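/- Maps of the torus $\mathbb{T}^d=\mathbb{R}^d/\mathbb{Z}^d$ are identified with their lifts to $\mathbb{R}^d$, and $|\cdot|$ is the supremum norm. Let $d=r+s$ with $r\ge 0$, $s\ge 1$, and consider the family $$F_{\Omega,\varepsilon}(x)=x+\Omega+\varepsilon f_\varepsilon(x),\qquad x\in\mathbb{T}^d,\ \Omega\in\mathbb{R}^d,\ 0\le\varepsilon<\varepsilon_1 .$$ **Resonance.** Let $\Omega_0\in\mathbb{R}^d$ be resonant with intrinsic frequency $\omega\in\mathbb{R}^r$: there are $\mathfrak{A}\in SL(d,\mathbb{Z})$ and $l\in\mathbb{Z}^d$ with $\mathfrak{A}\Omega_0=(\omega,0)+l$, and there are $\nu,\tau>0$ with $|k\cdot\omega-j|\ge\nu|k|^{-\tau}$ for all $k\in\mathbb{Z}^r\setminus\{0\}$ and $j\in\mathbb{Z}$. (So the resonance module $\{k\in\mathbb{Z}^d: k\cdot\Omega_0\in\mathbb{Z}\}$ has rank $s=d-r$.) **Averaging and normal form.** Put $H^0_\varepsilon=\mathrm{Id}$ and $G^0_\varepsilon(x)=x+\Omega_0$. For $j\ge1$ let $u_j$ be the coefficient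 of $\varepsilon^j$ in $(H^{j-1}_\varepsilon)^{-1}\circ F_{\Omega_0,\varepsilon}\circ H^{j-1}_\varepsilon-G^{j-1}_\varepsilon$ (equivalently, in $F_{\Omega_0,\varepsilon}\circ H^{j-1}_\varepsilon-H^{j-1}_\varepsilon\circ G^{j-1}_\varepsilon$), let $g_j(x)=\sum_{k\cdot\Omega_0\in\mathbb{Z}}\widehat u_j(k)e^{2\pi i k\cdot x}$ be its resonant part, let $$h^{j-1}(x)=\sum_{k\cdot\Omega_0\notin\mathbb{Z}}\frac{\widehat u_j(k)}{e^{2\pi i k\cdot\Omega_0}-1}\,e^{2\pi i k\cdot x},$$ and put $H^j_\varepsilon=H^{j-1}_\varepsilon+\varepsilon^jh^{j-1}$, $G^j_\varepsilon=G^{j-1}_\varepsilon+\varepsilon^jg_j$. Let $n\ge 1$ be the least $j\ge1$ with $g_j\not\equiv0$ (assumed to exist), let $m\ge1$, put $H_\varepsilon=H_\varepsilon^{n+m-1}$, and let $\eta(x_2,\varepsilon)\in\mathbb{R}^s$, $x_2\in\mathbb{R}^s$, be the second component in $\mathbb{R}^r\times\mathbb{R}^s$ of $\sum_{j=n}^{n+m-1}\varepsilon^{j-n}\mathfrak{A}\,g_j(\mathfrak{A}^{-1}(x_1,x_2))$,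 which does not depend on $x_1$. The map in resonant normal form is $$\Phi_{\Omega,\varepsilon}=(\Phi_1,\Phi_2)=\mathfrak{A}\circ H_\varepsilon^{-1}\circ F_{\Omega,\varepsilon}\circ H_\varepsilon\circ\mathfrak{A}^{-1}-l .$$ **Regularity.** Let $L\ge1$ and $q$ be integers with $q\ge(n+m-1)(d+\tau)$, and let $p$ be an integer, $\infty$, or $\omega$ (real analytic), with $L+2<p-q$ (no condition if $p\in\{\infty,\omega\}$). Assume that $f_\varepsilon(x)$ is $\mathbb{Z}^d$-periodic and $C^p$ in $x$ and $C^{n+m}$ in $\varepsilon\in[0,\varepsilon_1)$, that is, $\partial^b_\varepsilon f_\varepsilon$ exists and is $C^p$ in $x$ for $b\le n+m$, and $D^a_x\partial_\varepsilon^bf_\varepsilon(x)$ is jointly continuous for $b\le n+m$ and all finite $a\le p$. **Non-degeneracy and hyperbolicity.** Assume * (H1) there is $x_2^*$ with $\eta(x_2^*,0)=0$ and $D_1\eta(x_2^*,0)$ nonsingular; * (H2) there are constants $C_s,C_u>0$ such that, for all sufficiently small $\varepsilon>0$ and at the zero $x_2$ of $\eta(\cdot,\varepsilon)$ near $x_2^*$,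 the matrix $\Lambda=I+\varepsilon^nD_1\eta(x_2,\varepsilon)$ has no eigenvalue of modulus one, and there are a $\Lambda$-invariant splitting $\mathbb{R}^s=E^s\oplus E^u$ and norms on $E^s$ and $E^u$ (all allowed to depend on $\varepsilon$) in which $\|\Lambda|_{E^s}\|\le1-C_s\varepsilon^n$ and $\|(\Lambda|_{E^u})^{-1}\|\le1-C_u\varepsilon^n$. **Conclusion.** For every $C$ and every $\alpha\in(0,1)$ there is $\varepsilon_0\in(0,\varepsilon_1]$ such that for every $0<\varepsilon<\varepsilon_0$ the map $H_\varepsilon$ is invertible, and there are a point $x_2^*(\varepsilon)$ with $\eta(x_2^*(\varepsilon),\varepsilon)=0$ and $|x_2^*(\varepsilon)-x_2^*|\le\varepsilon^\alpha$, and a splitting $\mathbb{R}^s=E^s\oplus E^u$ as in (H2) for $\Lambda=I+\varepsilon^nD_1\eta(x_2^*(\varepsilon),\varepsilon)$, with the following property. For every $\Omega$ with $|\Omega-\Omega_0|\le C\varepsilon^{n+1}$ there is a $C^{L-1}$ map $w:\mathbb{T}^r\to\mathbb{R}^s$ with $|w(x_1)-x_2^*(\varepsilon)|\le\varepsilon^\alpha$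 for all $x_1$, such that: * $\mathcal{P}(x_1)=\Phi_1(x_1,w(x_1))$ is a bijection of $\mathbb{R}^r$, and $w$ is a fixed point of the graph-transform operator $\mathscr{F}$, whose components in $E^s$ and $E^u$ are, with $\pi^s,\pi^u$ the projections of the splitting and $v=\mathcal{P}^{-1}(x_1)$, $$\mathscr{F}^s[w](x_1)=\pi^s\Phi_2(v,w(v)),\qquad \mathscr{F}^u[w](x_1)=(\Lambda|_{E^u})^{-1}\pi^u\big[w(\mathcal{P}(x_1))-\big(\Phi_2(x_1,w(x_1))-\Lambda w(x_1)\big)\big];$$ * the image $\{H_\varepsilon(\mathfrak{A}^{-1}(x_1,w(x_1))):x_1\in\mathbb{T}^r\}$ of the graph of $w$ is an embedded $r$-dimensional torus in $\mathbb{T}^d$ of class $C^{L-1}$ (immersed if $L\ge2$) which $F_{\Omega,\varepsilon}$ maps onto itself. -/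

import Mathlib

open Set Filter Topology

noncomputable section

namespace PhaseLocking

/-! Maps of `𝕋ᵈ = ℝᵈ / ℤᵈ` are handled through their lifts to `ℝᵈ = (Fin d → ℝ)`, which carries the
supremum norm. -/

/-- The real vector with the given integer entries. -/
def intVec {d : ℕ} (k : Fin d → ℤ) : Fin d → ℝ := fun i => (k i : ℝ)

/-- The pairing `k · x` of an integer vector with a real one. -/
def pairing {d : ℕ} (k : Fin d → ℤ) (x : Fin d → ℝ) : ℝ := ∑ i, (k i : ℝ) * x i

/-- `u` is `ℤᵈ`-periodic, that is, `u` is a function on `𝕋ᵈ`. -/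
def Periodic {d : ℕ} {E : Type*} (u : (Fin d → ℝ) → E) : Prop :=
  ∀ (x : Fin d → ℝ) (k : Fin d → ℤ), u (x + intVec k) = u x

/-- The projection `ℝᵈ → 𝕋ᵈ`. -/
def toTorus {d : ℕ} (x : Fin d → ℝ) : UnitAddTorus (Fin d) := fun i => (x i : UnitAddCircle)

/-- The Diophantine condition of type `(ν, τ)`: `|k · ω - n| ≥ ν |k|^(-τ)` for all integer vectors
`k ≠ 0` and all integers `n`. -/
def Diophantine {r : ℕ} (ν τ : ℝ) (ω : Fin r → ℝ) : Prop :=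
  ∀ k : Fin r → ℤ, k ≠ 0 → ∀ n : ℤ, ν * ‖k‖ ^ (-τ) ≤ |pairing k ω - (n : ℝ)|

/-- `k` lies in the resonance module `{k ∈ ℤᵈ : k · Ω ∈ ℤ}` of `Ω`. -/
def InResonanceModule {d : ℕ} (Ω : Fin d → ℝ) (k : Fin d → ℤ) : Prop :=
  ∃ n : ℤ, pairing k Ω = (n : ℝ)

/-- The linear action of `SL(d, ℤ)` on `ℝᵈ`. -/
def slAct {d : ℕ} (A : Matrix.SpecialLinearGroup (Fin d) ℤ) (x : Fin d → ℝ) : Fin d → ℝ :=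
  ((A : Matrix (Fin d) (Fin d) ℤ).map (Int.cast : ℤ → ℝ)).mulVec x

/-- The family `F_{Ω,ε}(x) = x + Ω + ε f_ε(x)` (lifted to `ℝᵈ`). -/
def family {d : ℕ} (f : ℝ → (Fin d → ℝ) → (Fin d → ℝ)) (Ω : Fin d → ℝ) (ε : ℝ)
    (x : Fin d → ℝ) : Fin d → ℝ :=
  x + Ω + ε • f ε x

/-- `f_ε(x)` is of class `C^p` in `x` (`p` finite, `∞`, or `ω` for real analytic) and `C^k` in
`ε ∈ [0, ε₁)`: the derivatives `∂_ε^b f_ε` with `b ≤ k` exist, they are `C^p` in `x`, and all the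
mixed derivatives `D_x^a ∂_ε^b f_ε(x)` with `b ≤ k` and finite `a ≤ p` are jointly continuous. -/
def MixedRegularity {d : ℕ} (p : WithTop ℕ∞) (k : ℕ) (ε₁ : ℝ)
    (f : ℝ → (Fin d → ℝ) → (Fin d → ℝ)) : Prop :=
  (∀ x, ContDiffOn ℝ (k : WithTop ℕ∞) (fun ε => f ε x) (Ico 0 ε₁)) ∧
  ∀ b : ℕ, b ≤ k →
    (∀ ε ∈ Ico (0 : ℝ) ε₁,
      ContDiff ℝ p (fun x => iteratedDerivWithin b (fun t => f t x) (Ico 0 ε₁) ε)) ∧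
    ∀ a : ℕ, (a : WithTop ℕ∞) ≤ p →
      ContinuousOn
        (fun z : ℝ × (Fin d → ℝ) =>
          iteratedFDeriv ℝ a (fun x => iteratedDerivWithin b (fun t => f t x) (Ico 0 ε₁) z.1) z.2)
        (Ico (0 : ℝ) ε₁ ×ˢ univ)

section Averaging

/-- The number `exp(2πi t)`. -/
def expChar (t : ℝ) : ℂ := Complex.exp (2 * Real.pi * Complex.I * t)

/-- The `k`-th Fourier coefficient of the `i`-th component of a periodic `u : ℝᵈ → ℝᵈ`. -/
def fourierCoefficient {d : ℕ} (u : (Fin d → ℝ) → (Fin d → ℝ)) (k : Fin d → ℤ) (i : Fin d) : ℂ :=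
  ∫ x in Icc (0 : Fin d → ℝ) 1, expChar (-pairing k x) * (u x i : ℂ)

open Classical in
/-- The resonant part of `u`: its Fourier series restricted to the resonance module of `Ω`. -/
def resonantPart {d : ℕ} (Ω : Fin d → ℝ) (u : (Fin d → ℝ) → (Fin d → ℝ)) (x : Fin d → ℝ) :
    Fin d → ℝ :=
  fun i => (∑' k : Fin d → ℤ,
    if InResonanceModule Ω k then fourierCoefficient u k i * expChar (pairing k x) else 0).re

open Classical in
/-- The solution `h` of the cohomology equation `h(x + Ω) - h(x) = u(x) - resonantPart Ω u x` whose
own resonant Fourier coefficients vanish. -/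
def cohomologySolution {d : ℕ} (Ω : Fin d → ℝ) (u : (Fin d → ℝ) → (Fin d → ℝ)) (x : Fin d → ℝ) :
    Fin d → ℝ :=
  fun i => (∑' k : Fin d → ℤ,
    if InResonanceModule Ω k then 0
    else fourierCoefficient u k i / (expChar (pairing k Ω) - 1) * expChar (pairing k x)).re

/-- The coefficient of `ε^j` in `F_{Ω₀,ε} ∘ H_ε - H_ε ∘ G_ε`, where `HG = (H, G)` and the
coefficients of lower order vanish. For `H_ε = Id + O(ε)` this is also the coefficient of `ε^j` in
`H_ε⁻¹ ∘ F_{Ω₀,ε} ∘ H_ε - G_ε`. -/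
def orderCoefficient {d : ℕ} (f : ℝ → (Fin d → ℝ) → (Fin d → ℝ)) (Ω₀ : Fin d → ℝ) (j : ℕ)
    (HG : (ℝ → (Fin d → ℝ) → (Fin d → ℝ)) × (ℝ → (Fin d → ℝ) → (Fin d → ℝ)))
    (x : Fin d → ℝ) : Fin d → ℝ :=
  limUnder (𝓝[>] (0 : ℝ))
    (fun ε => (ε ^ j)⁻¹ • (family f Ω₀ ε (HG.1 ε x) - HG.1 ε (HG.2 ε x)))

/-- The averaging procedure. After `N` steps it yields the pair `(H_ε, G_ε)` with
`H_ε = Id + ε h⁰ + ⋯ + ε^N h^(N-1)` and `G_ε(x) = x + Ω₀ + ε g₁ + ⋯ + ε^N g_N`. In step `j`, with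
`u` the coefficient of `ε^j` in `H_ε⁻¹ ∘ F_{Ω₀,ε} ∘ H_ε - G_ε` for the pair obtained so far, `h^(j-1)`
solves the cohomology equation for `u` up to its resonant part and `g_j` is that resonant part. -/
def averaging {d : ℕ} (f : ℝ → (Fin d → ℝ) → (Fin d → ℝ)) (Ω₀ : Fin d → ℝ) :
    ℕ → (ℝ → (Fin d → ℝ) → (Fin d → ℝ)) × (ℝ → (Fin d → ℝ) → (Fin d → ℝ))
  | 0 => (fun _ x => x, fun _ x => x + Ω₀)
  | j + 1 =>
    let HG := averaging f Ω₀ j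
    let u := orderCoefficient f Ω₀ (j + 1) HG
    (fun ε x => HG.1 ε x + ε ^ (j + 1) • cohomologySolution Ω₀ u x,
      fun ε x => HG.2 ε x + ε ^ (j + 1) • resonantPart Ω₀ u x)

/-- The conjugacy `H_ε^N = Id + ε h⁰ + ⋯ + ε^N h^(N-1)`. -/
def conjugacy {d : ℕ} (f : ℝ → (Fin d → ℝ) → (Fin d → ℝ)) (Ω₀ : Fin d → ℝ) (N : ℕ) :
    ℝ → (Fin d → ℝ) → (Fin d → ℝ) :=
  (averaging f Ω₀ N).1

/-- The averaged term `g_j` of order `ε^j` (for `j ≥ 1`). -/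
def averagedTerm {d : ℕ} (f : ℝ → (Fin d → ℝ) → (Fin d → ℝ)) (Ω₀ : Fin d → ℝ) :
    ℕ → (Fin d → ℝ) → (Fin d → ℝ)
  | 0 => 0
  | j + 1 => resonantPart Ω₀ (orderCoefficient f Ω₀ (j + 1) (averaging f Ω₀ j))

/-- `n` is the order of the first averaged term that does not vanish identically. -/
def IsLeadingOrder {d : ℕ} (f : ℝ → (Fin d → ℝ) → (Fin d → ℝ)) (Ω₀ : Fin d → ℝ) (n : ℕ) : Prop :=
  1 ≤ n ∧ (∀ j, 1 ≤ j → j < n → averagedTerm f Ω₀ j = 0) ∧ averagedTerm f Ω₀ n ≠ 0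

end Averaging

section NormalForm

/-- The first component of a point of `ℝʳ × ℝˢ`. -/
def fstPart {r s : ℕ} (y : Fin (r + s) → ℝ) : Fin r → ℝ := fun i => y (Fin.castAdd s i)

/-- The second component of a point of `ℝʳ × ℝˢ`. -/
def sndPart {r s : ℕ} (y : Fin (r + s) → ℝ) : Fin s → ℝ := fun i => y (Fin.natAdd r i)

/-- The function `η(x₂, ε)` of the resonant normal form: the second component of
`∑_{n ≤ j ≤ n+m-1} ε^(j-n) A g_j(A⁻¹(x₁, x₂))`, a sum which does not depend on `x₁`. -/
def eta {r s : ℕ} (f : ℝ → (Fin (r + s) → ℝ) → (Fin (r + s) → ℝ)) (Ω₀ : Fin (r + s) → ℝ)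
    (A : Matrix.SpecialLinearGroup (Fin (r + s)) ℤ) (n m : ℕ) (x₂ : Fin s → ℝ) (ε : ℝ) :
    Fin s → ℝ :=
  sndPart (∑ k ∈ Finset.range m,
    ε ^ k • slAct A (averagedTerm f Ω₀ (n + k) (slAct A⁻¹ (Fin.append (0 : Fin r → ℝ) x₂))))

/-- The derivative `D₁η(x₂, ε)`. -/
def etaDeriv {r s : ℕ} (f : ℝ → (Fin (r + s) → ℝ) → (Fin (r + s) → ℝ)) (Ω₀ : Fin (r + s) → ℝ)
    (A : Matrix.SpecialLinearGroup (Fin (r + s)) ℤ) (n m : ℕ) (x₂ : Fin s → ℝ) (ε : ℝ) :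
    (Fin s → ℝ) →L[ℝ] (Fin s → ℝ) :=
  fderiv ℝ (fun x => eta f Ω₀ A n m x ε) x₂

/-- The map in resonant normal form: `A ∘ H_ε⁻¹ ∘ F_{Ω,ε} ∘ H_ε ∘ A⁻¹`, where the lift to
`ℝʳ × ℝˢ` is chosen by removing the integer vector `l` of `A Ω₀ = (ω, 0) + l`. -/
def normalFormMap {d : ℕ} (f : ℝ → (Fin d → ℝ) → (Fin d → ℝ)) (Ω₀ : Fin d → ℝ)
    (A : Matrix.SpecialLinearGroup (Fin d) ℤ) (l : Fin d → ℤ) (N : ℕ) (Ω : Fin d → ℝ) (ε : ℝ)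
    (y : Fin d → ℝ) : Fin d → ℝ :=
  slAct A (Function.invFun (conjugacy f Ω₀ N ε)
    (family f Ω ε (conjugacy f Ω₀ N ε (slAct A⁻¹ y)))) - intVec l

end NormalForm

section GraphTransform

variable {r s : ℕ}

/-- No (complex) eigenvalue of `Λ` lies on the unit circle. -/
def SpectrumOffUnitCircle (Λ : (Fin s → ℝ) →L[ℝ] (Fin s → ℝ)) : Prop :=
  ∀ z ∈ spectrum ℂ
    ((LinearMap.toMatrix' (Λ : (Fin s → ℝ) →ₗ[ℝ] (Fin s → ℝ))).map (algebraMap ℝ ℂ)), ‖z‖ ≠ 1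

/-- `P` is the projection onto `Eˢ = range P` along `Eᵘ = ker P` for a `Λ`-invariant splitting
`ℝˢ = Eˢ ⊕ Eᵘ` such that, in suitable norms on `Eˢ` and on `Eᵘ`, `‖Λ|Eˢ‖ ≤ a` and `Λ|Eᵘ` is
invertible with `‖(Λ|Eᵘ)⁻¹‖ ≤ b`. A norm on a subspace is given by a seminorm on the whole space
that is definite on the subspace. -/
def AdaptedSplitting (Λ P : (Fin s → ℝ) →L[ℝ] (Fin s → ℝ)) (a b : ℝ) : Prop :=
  P.comp P = P ∧ P.comp Λ = Λ.comp P ∧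
  (∃ N : Seminorm ℝ (Fin s → ℝ), (∀ v, P v = v → N v = 0 → v = 0) ∧
    ∀ v, P v = v → N (Λ v) ≤ a * N v) ∧
  (∃ N : Seminorm ℝ (Fin s → ℝ), (∀ v, P v = 0 → N v = 0 → v = 0) ∧
    ∀ v, P v = 0 → N v ≤ b * N (Λ v))

/-- The map `𝒫(x₁) = Φ₁(x₁, w(x₁))` of a map `Φ = (Φ₁, Φ₂)` of `ℝʳ × ℝˢ`. -/
def baseMap (Φ : (Fin (r + s) → ℝ) → (Fin (r + s) → ℝ)) (w : (Fin r → ℝ) → (Fin s → ℝ))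
    (x₁ : Fin r → ℝ) : Fin r → ℝ :=
  fstPart (Φ (Fin.append x₁ (w x₁)))

/-- The map `x₁ ↦ Φ₂(x₁, w(x₁))` of a map `Φ = (Φ₁, Φ₂)` of `ℝʳ × ℝˢ`. -/
def fibreMap (Φ : (Fin (r + s) → ℝ) → (Fin (r + s) → ℝ)) (w : (Fin r → ℝ) → (Fin s → ℝ))
    (x₁ : Fin r → ℝ) : Fin s → ℝ :=
  sndPart (Φ (Fin.append x₁ (w x₁)))

/-- The graph-transform operator `𝓕 = (𝓕ˢ, 𝓕ᵘ)` of `Φ`, for the splitting given by `P`: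
`𝓕ˢ[w](x₁) = Pˢ Φ₂(v, w(v))` with `v = 𝒫⁻¹(x₁)`, and
`𝓕ᵘ[w](x₁) = (Λᵘ)⁻¹ Pᵘ [w(𝒫(x₁)) - (Φ₂(x₁, w(x₁)) - Λ w(x₁))]`, with `Pˢ = P`, `Pᵘ = 1 - P`
and `(Λᵘ)⁻¹ Pᵘ = Pᵘ Λ⁻¹`. -/
def graphTransform (Φ : (Fin (r + s) → ℝ) → (Fin (r + s) → ℝ))
    (Λ P : (Fin s → ℝ) →L[ℝ] (Fin s → ℝ)) (w : (Fin r → ℝ) → (Fin s → ℝ)) (x₁ : Fin r → ℝ) :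
    Fin s → ℝ :=
  P (fibreMap Φ w (Function.invFun (baseMap Φ w) x₁)) +
    (1 - P) (Λ.inverse (w (baseMap Φ w x₁) - (fibreMap Φ w x₁ - Λ (w x₁))))

end GraphTransform

/-- `K : ℝʳ → ℝᵈ` parametrizes an embedded `r`-dimensional torus of class `C^k` in `𝕋ᵈ` that is
invariant under the map of `𝕋ᵈ` with lift `F`: `K` descends to an injective map `𝕋ʳ → 𝕋ᵈ` of class
`C^k`, an immersion if `k ≥ 1`, and the map of `𝕋ᵈ` sends its image onto itself. -/
def IsInvariantTorus {r d : ℕ} (k : ℕ) (F : (Fin d → ℝ) → (Fin d → ℝ))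
    (K : (Fin r → ℝ) → (Fin d → ℝ)) : Prop :=
  ContDiff ℝ (k : WithTop ℕ∞) K ∧
  (∀ θ θ' : Fin r → ℝ, toTorus (K θ) = toTorus (K θ') ↔ toTorus θ = toTorus θ') ∧
  (1 ≤ k → ∀ θ, Function.Injective (fderiv ℝ K θ)) ∧
  (fun x => toTorus (F x)) '' {x | toTorus x ∈ range (fun θ => toTorus (K θ))} =
    range (fun θ => toTorus (K θ))

end PhaseLocking

end

/-! In suitable coordinates the theorem concerns a perturbed skew map. After averaging, the map on
`ℝʳ × ℝˢ` is `(x₁ + ω + εⁿ (θ(x₂) + O(ε)), x₂ + εⁿ (η(x₂) + O(ε)))`: the averaged terms of order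
below `n` vanish, resonant terms do not involve `x₁`, and the detuning `Ω - Ω₀` is `O(ε^(n+1))`.
Without the remainders a zero of `η(·, ε)` is an invariant torus, and hyperbolicity makes it
persist. Displacement and hyperbolic rate are both of order `εⁿ`, so only relative sizes count: the
remainder is of relative size `ε`, which is small against the admitted deviation `ε^α`.

Normal form (`averaging_regularity`, `exists_normalForm`). Regularity is counted in the classes `WA
s` of functions with Fourier coefficients absolutely summable against `(1 + |k|)^s`. They are
algebras in which a derivative costs one unit of weight and a solution of the cohomology equation
costs `τ`; the passage from `C^p` costs slightly more than `d`, but only once. The error `F ∘ H - H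
∘ G` has an expansion in powers of `ε` (`Expands`), and each averaging step cancels its leading
coefficient (`AveragingStep.succ`).

Hyperbolicity (`exists_uniform_hypDich`). The adapted norms may depend on `ε`, so estimates in the
fixed norm with uniform constants have to be found. Rates of order `εⁿ` keep the eigenvalues of
`D₁η` uniformly away from the imaginary axis, and this gap passes to the limit `ε = 0`. The limit
has a Lyapunov form, obtained by a separation argument (`exists_lyapunov`). The same form serves all
small `ε` and controls both the rates and the projections.

Invariant graph (`GraphData.exists_invariant`). The equation `w ∘ 𝒫 = Φ₂(·, w)` is solved by
iteration. With the base map and the nonlinear terms frozen at the previous iterate, the next one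
solves `z ∘ p = Λ z + g`, whose bounded solution is an explicit series (`HypDich.exists_solution`).
The iterates stay in a ball of `C^L` and contract in the sup norm; interpolation then makes the
limit `C^(L-1)`. An invariant graph is a fixed point of the graph transform, and its image under `H
∘ A⁻¹` is the torus. -/

noncomputable section

namespace PhaseLocking

/-! ### Calculus of maps with uniformly bounded derivatives. -/

section BoundedCalculus

variable {X E F G : Type} [NormedAddCommGroup X] [NormedSpace ℝ X]
  [NormedAddCommGroup E] [NormedSpace ℝ E] [NormedAddCommGroup F] [NormedSpace ℝ F]
  [NormedAddCommGroup G] [NormedSpace ℝ G]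

/-- `g` is of class `C^k` and its derivatives of order at most `k` are bounded by `K`. -/
structure BC (k : ℕ) (K : ℝ) (g : X → E) : Prop where
  contDiff : ContDiff ℝ k g
  bound : ∀ j ≤ k, ∀ x, ‖iteratedFDeriv ℝ j g x‖ ≤ K

/-- `g` is of class `C^k` and its derivatives of positive order at most `k` are bounded by `K`. -/
structure DB (k : ℕ) (K : ℝ) (g : X → E) : Prop where
  contDiff : ContDiff ℝ k g
  bound : ∀ j, 1 ≤ j → j ≤ k → ∀ x, ‖iteratedFDeriv ℝ j g x‖ ≤ K

variable {k : ℕ} {K K' : ℝ} {g : X → E}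

theorem BC.norm_le (h : BC k K g) (x : X) : ‖g x‖ ≤ K := by
  simpa using h.bound 0 (Nat.zero_le _) x

theorem BC.nonneg (h : BC k K g) : 0 ≤ K := (norm_nonneg _).trans (h.norm_le 0)

theorem BC.mono (h : BC k K g) (hK : K ≤ K') : BC k K' g :=
  ⟨h.contDiff, fun j hj x => (h.bound j hj x).trans hK⟩

theorem DB.mono (h : DB k K g) (hK : K ≤ K') : DB k K' g :=
  ⟨h.contDiff, fun j h1 hj x => (h.bound j h1 hj x).trans hK⟩

theorem BC.of_le {j : ℕ} (h : BC k K g) (hj : j ≤ k) : BC j K g :=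
  ⟨h.contDiff.of_le (by exact_mod_cast hj), fun i hi x => h.bound i (hi.trans hj) x⟩

theorem DB.of_le {j : ℕ} (h : DB k K g) (hj : j ≤ k) : DB j K g :=
  ⟨h.contDiff.of_le (by exact_mod_cast hj), fun i h1 hi x => h.bound i h1 (hi.trans hj) x⟩

theorem BC.db (h : BC k K g) : DB k K g := ⟨h.contDiff, fun j _ hj x => h.bound j hj x⟩

theorem BC.of_db (h : DB k K g) (h0 : ∀ x, ‖g x‖ ≤ K) : BC k K g := by
  refine ⟨h.contDiff, fun j hj x => ?_⟩
  rcases Nat.eq_zero_or_pos j with rfl | h1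
  · simpa using h0 x
  · exact h.bound j h1 hj x

theorem bc_zero_iff : BC 0 K g ↔ Continuous g ∧ ∀ x, ‖g x‖ ≤ K := by
  refine ⟨fun h => ⟨h.contDiff.continuous, h.norm_le⟩, fun h => ⟨?_, fun j hj x => ?_⟩⟩
  · exact_mod_cast contDiff_zero.2 h.1
  · obtain rfl : j = 0 := by omega
    simpa using h.2 x

theorem db_zero_iff : DB 0 K g ↔ Continuous g := by
  refine ⟨fun h => h.contDiff.continuous, fun h => ⟨?_, fun j h1 hj x => by omega⟩⟩
  exact_mod_cast contDiff_zero.2 h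

theorem db_succ_iff : DB (k + 1) K g ↔ Differentiable ℝ g ∧ BC k K (fderiv ℝ g) := by
  constructor
  · intro h
    have h' := h.contDiff
    push_cast at h'
    rw [contDiff_succ_iff_fderiv] at h'
    refine ⟨h'.1, h'.2.2, fun j hj x => ?_⟩
    rw [norm_iteratedFDeriv_fderiv]
    exact h.bound (j + 1) (by omega) (by omega) x
  · rintro ⟨h1, h2⟩
    refine ⟨?_, fun j hj1 hj x => ?_⟩
    · push_cast
      rw [contDiff_succ_iff_fderiv]
      exact ⟨h1, by simp, h2.contDiff⟩
    · obtain ⟨i, rfl⟩ : ∃ i, j = i + 1 := ⟨j - 1, by omega⟩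
      rw [← norm_iteratedFDeriv_fderiv]
      exact h2.bound i (by omega) x

theorem bc_succ_iff :
    BC (k + 1) K g ↔ Differentiable ℝ g ∧ (∀ x, ‖g x‖ ≤ K) ∧ BC k K (fderiv ℝ g) :=
  ⟨fun h => ⟨(db_succ_iff.1 h.db).1, h.norm_le, (db_succ_iff.1 h.db).2⟩,
    fun h => BC.of_db (db_succ_iff.2 ⟨h.1, h.2.2⟩) h.2.1⟩

theorem BC.const (c : E) : BC k ‖c‖ (fun _ : X => c) := by
  refine ⟨contDiff_const, fun j hj x => ?_⟩
  rcases Nat.eq_zero_or_pos j with rfl | h1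
  · simp
  · rw [iteratedFDeriv_const_of_ne (by omega)]
    simp

theorem DB.const {K : ℝ} (hK : 0 ≤ K) (c : E) : DB k K (fun _ : X => c) := by
  refine ⟨contDiff_const, fun j h1 hj x => ?_⟩
  rw [iteratedFDeriv_const_of_ne (by omega)]
  simpa using hK

theorem BC.zero {K : ℝ} (hK : 0 ≤ K) : BC k K (fun _ : X => (0 : E)) :=
  (BC.const (0 : E)).mono (by simpa using hK)

theorem DB.clm (L : X →L[ℝ] E) : DB k ‖L‖ (fun x => L x) := by
  cases k with
  | zero => exact db_zero_iff.2 L.continuous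
  | succ k =>
    refine db_succ_iff.2 ⟨L.differentiable, ?_⟩
    have : fderiv ℝ (fun x => L x) = fun _ => L := by ext1 x; exact L.fderiv
    rw [this]
    exact BC.const L

theorem DB.id : DB k 1 (fun x : X => x) :=
  (DB.clm (ContinuousLinearMap.id ℝ X)).mono ContinuousLinearMap.norm_id_le

theorem DB.add {f : X → E} (hf : DB k K f) (hg : DB k K' g) :
    DB k (K + K') (fun x => f x + g x) := by
  refine ⟨hf.contDiff.add hg.contDiff, fun j h1 hj x => ?_⟩
  rw [fun_iteratedFDeriv_add (hf.contDiff.of_le (by exact_mod_cast hj))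
    (hg.contDiff.of_le (by exact_mod_cast hj))]
  exact (norm_add_le _ _).trans (add_le_add (hf.bound j h1 hj x) (hg.bound j h1 hj x))

theorem BC.add {f : X → E} (hf : BC k K f) (hg : BC k K' g) :
    BC k (K + K') (fun x => f x + g x) :=
  BC.of_db (hf.db.add hg.db)
    fun x => (norm_add_le _ _).trans (add_le_add (hf.norm_le x) (hg.norm_le x))

theorem DB.clm_comp (L : E →L[ℝ] F) (hg : DB k K g) : DB k (‖L‖ * K) (fun x => L (g x)) := by
  refine ⟨L.contDiff.comp hg.contDiff, fun j h1 hj x => ?_⟩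
  refine (L.norm_iteratedFDeriv_comp_left hg.contDiff.contDiffAt (by exact_mod_cast hj)).trans ?_
  exact mul_le_mul_of_nonneg_left (hg.bound j h1 hj x) (norm_nonneg _)

theorem BC.clm_comp (L : E →L[ℝ] F) (hg : BC k K g) : BC k (‖L‖ * K) (fun x => L (g x)) :=
  BC.of_db (hg.db.clm_comp L) fun x => (L.le_opNorm _).trans
    (mul_le_mul_of_nonneg_left (hg.norm_le x) (norm_nonneg _))

theorem DB.smul (c : ℝ) (hg : DB k K g) : DB k (|c| * K) (fun x => c • g x) := by
  refine ⟨hg.contDiff.const_smul c, fun j h1 hj x => ?_⟩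
  rw [iteratedFDeriv_const_smul_apply' (hg.contDiff.of_le (by exact_mod_cast hj)).contDiffAt,
    norm_smul, Real.norm_eq_abs]
  exact mul_le_mul_of_nonneg_left (hg.bound j h1 hj x) (abs_nonneg _)

theorem BC.smul (c : ℝ) (hg : BC k K g) : BC k (|c| * K) (fun x => c • g x) :=
  BC.of_db (hg.db.smul c) fun x => by
    rw [norm_smul, Real.norm_eq_abs]
    exact mul_le_mul_of_nonneg_left (hg.norm_le x) (abs_nonneg _)

theorem DB.neg (hg : DB k K g) : DB k K (fun x => -g x) := by
  simpa using hg.smul (-1)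

theorem BC.neg (hg : BC k K g) : BC k K (fun x => -g x) := by
  simpa using hg.smul (-1)

theorem DB.sub {f : X → E} (hf : DB k K f) (hg : DB k K' g) :
    DB k (K + K') (fun x => f x - g x) := by
  simpa [sub_eq_add_neg] using hf.add hg.neg

theorem BC.sub {f : X → E} (hf : BC k K f) (hg : BC k K' g) :
    BC k (K + K') (fun x => f x - g x) := by
  simpa [sub_eq_add_neg] using hf.add hg.neg

theorem BC.sum {ι : Type*} (s : Finset ι) {f : ι → X → E} {K : ι → ℝ}
    (hf : ∀ i ∈ s, BC k (K i) (f i)) : BC k (∑ i ∈ s, K i) (fun x => ∑ i ∈ s, f i x) := by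
  classical
  induction s using Finset.induction_on with
  | empty => simpa using BC.zero (X := X) (E := E) (k := k) le_rfl
  | insert a s ha ih =>
    simp only [Finset.sum_insert ha]
    exact (hf a (by simp)).add (ih fun i hi => hf i (by simp [hi]))

/-- Leibniz' rule; the binomial coefficients of order `j` add up to `2 ^ j`. -/
theorem BC.bilin (B : E →L[ℝ] F →L[ℝ] G) (hB : ‖B‖ ≤ 1) {f : X → E} {g : X → F}
    (hf : BC k K f) (hg : BC k K' g) : BC k (2 ^ k * (K * K')) (fun x => B (f x) (g x)) := by
  refine ⟨B.isBoundedBilinearMap.contDiff.comp (hf.contDiff.prodMk hg.contDiff),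
    fun j hj x => ?_⟩
  refine (B.norm_iteratedFDeriv_le_of_bilinear_of_le_one hf.contDiff hg.contDiff x
    (by exact_mod_cast hj) hB).trans ?_
  calc _ ≤ ∑ i ∈ Finset.range (j + 1), (j.choose i : ℝ) * (K * K') := by
        refine Finset.sum_le_sum fun i hi => ?_
        have hi' : i ≤ j := by simpa [Nat.lt_succ_iff] using hi
        rw [mul_assoc]
        refine mul_le_mul_of_nonneg_left ?_ (by positivity)
        exact mul_le_mul (hf.bound i (hi'.trans hj) x) (hg.bound (j - i) (by omega) x)
          (norm_nonneg _) hf.nonneg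
    _ = 2 ^ j * (K * K') := by
        rw [← Finset.sum_mul]
        congr 1
        exact_mod_cast Nat.sum_range_choose j
    _ ≤ 2 ^ k * (K * K') := by
        refine mul_le_mul_of_nonneg_right ?_ (mul_nonneg hf.nonneg hg.nonneg)
        exact pow_le_pow_right₀ (by norm_num) hj

theorem BC.clm_mul {f : X → F →L[ℝ] G} {g : X → E →L[ℝ] F} (hf : BC k K f) (hg : BC k K' g) :
    BC k (2 ^ k * (K * K')) (fun x => (f x).comp (g x)) :=
  BC.bilin (ContinuousLinearMap.compL ℝ E F G) (ContinuousLinearMap.norm_compL_le ℝ E F G) hf hg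

theorem BC.mul {f g : X → ℝ} (hf : BC k K f) (hg : BC k K' g) :
    BC k (2 ^ k * (K * K')) (fun x => f x * g x) :=
  BC.bilin (ContinuousLinearMap.mul ℝ ℝ) (ContinuousLinearMap.opNorm_mul_le ℝ ℝ) hf hg

theorem DB.lipschitz (h : DB k K g) (hk : 1 ≤ k) (x y : X) : ‖g x - g y‖ ≤ K * ‖x - y‖ := by
  obtain ⟨j, rfl⟩ : ∃ j, k = j + 1 := ⟨k - 1, by omega⟩
  obtain ⟨h1, h2⟩ := db_succ_iff.1 h
  exact Convex.norm_image_sub_le_of_norm_fderiv_le (fun z _ => h1 z) (fun z _ => h2.norm_le z)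
    convex_univ (mem_univ y) (mem_univ x)

/-- The constant in the bound for the derivatives of a composition. -/
def compConst (D : ℝ) : ℕ → ℝ
  | 0 => 1
  | k + 1 => 1 + 2 ^ k * (compConst D k * D)

theorem one_le_compConst {D : ℝ} (hD : 0 ≤ D) (k : ℕ) : 1 ≤ compConst D k := by
  induction k with
  | zero => exact le_rfl
  | succ k ih =>
    have : 0 ≤ (2 : ℝ) ^ k * (compConst D k * D) := by positivity
    simp only [compConst]; linarith

theorem DB.nonneg [Nonempty X] {D : ℝ} {u : X → E} (h : DB (k + 1) D u) : 0 ≤ D :=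
  (norm_nonneg _).trans (h.bound 1 le_rfl (by omega) (Classical.arbitrary X))

/-- The inductive step common to `BC.comp` and `DB.comp`: the chain rule writes the derivative of
the composition as a product of two bounded maps. Only the derivatives of `f` have to be bounded,
not `f` itself. -/
theorem DB.comp_of_bc {D : ℝ} {f : E → F} {u : X → E} (hf : DB (k + 1) K f) (hu : DB (k + 1) D u)
    (h : BC k (compConst D k * K) (fun x => fderiv ℝ f (u x))) :
    DB (k + 1) (compConst D (k + 1) * K) (fun x => f (u x)) := by
  obtain ⟨hf1, hf2⟩ := db_succ_iff.1 hf
  obtain ⟨hu1, hu2⟩ := db_succ_iff.1 hu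
  refine db_succ_iff.2 ⟨hf1.comp hu1, ?_⟩
  have : fderiv ℝ (fun x => f (u x)) = fun x => (fderiv ℝ f (u x)).comp (fderiv ℝ u x) := by
    ext1 x; exact fderiv_comp x (hf1 _) (hu1 x)
  rw [this]
  refine (h.clm_mul hu2).mono ?_
  have := hf2.nonneg
  simp only [compConst]
  nlinarith

/-- Induction on `k` with varying target space, since the derivative of `f` takes operator values.
-/
theorem BC.comp {D : ℝ} {f : E → F} {u : X → E} (hf : BC k K f) (hu : DB k D u) :
    BC k (compConst D k * K) (fun x => f (u x)) := by
  induction k generalizing F with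
  | zero =>
    rw [bc_zero_iff] at hf ⊢
    rw [db_zero_iff] at hu
    exact ⟨hf.1.comp hu, fun x => by simpa [compConst] using hf.2 (u x)⟩
  | succ k ih =>
    have hD := hu.nonneg
    have h1 := (bc_succ_iff.1 hf).2.2
    refine BC.of_db (hf.db.comp_of_bc hu (ih h1 (hu.of_le (Nat.le_succ k)))) fun x => ?_
    exact (hf.norm_le _).trans (le_mul_of_one_le_left hf.nonneg (one_le_compConst hD _))

theorem DB.comp {D : ℝ} {f : E → F} {u : X → E} (hf : DB k K f) (hu : DB k D u) :
    DB k (compConst D k * K) (fun x => f (u x)) := by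
  cases k with
  | zero => exact db_zero_iff.2 ((db_zero_iff.1 hf).comp (db_zero_iff.1 hu))
  | succ k =>
    exact hf.comp_of_bc hu (BC.comp (db_succ_iff.1 hf).2 (hu.of_le (Nat.le_succ k)))

/-- The constant in the bound for a composition with a perturbation of the identity. -/
def nearConst : ℕ → ℝ
  | 0 => 0
  | k + 1 => nearConst k + 2 ^ k * (1 + nearConst k)

theorem nearConst_nonneg (k : ℕ) : 0 ≤ nearConst k := by
  induction k with
  | zero => exact le_rfl
  | succ k ih => simp only [nearConst]; positivity

theorem nearConst_mono : Monotone nearConst := by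
  refine monotone_nat_of_le_succ fun k => ?_
  have := nearConst_nonneg k
  simp only [nearConst]
  exact le_add_of_nonneg_right (by positivity)

/-- The factor `1 + O(κ)`, instead of the `compConst` of a general composition, is the point: in
`BC.comp_iterate` it is raised to arbitrary powers and must not outgrow a contraction of rate `1 -
μ`. -/
theorem DB.comp_near_of_bc {κ : ℝ} {f : X → F} {θ : X → X} (hκ0 : 0 ≤ κ) (hκ : κ ≤ 1)
    (hf : DB (k + 1) K f) (hθ : DB (k + 1) κ θ)
    (h : BC k (K * (1 + nearConst k * κ)) (fun x => fderiv ℝ f (x + θ x))) :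
    DB (k + 1) (K * (1 + nearConst (k + 1) * κ)) (fun x => f (x + θ x)) := by
  obtain ⟨hf1, hf2⟩ := db_succ_iff.1 hf
  obtain ⟨hu1, hu2⟩ := db_succ_iff.1 hθ
  have hd : Differentiable ℝ (fun x => x + θ x) := differentiable_id.add hu1
  refine db_succ_iff.2 ⟨hf1.comp hd, ?_⟩
  have : fderiv ℝ (fun x => f (x + θ x)) = fun x => fderiv ℝ f (x + θ x) +
      (fderiv ℝ f (x + θ x)).comp (fderiv ℝ θ x) := by
    ext1 x
    have h1 := (hf1 (x + θ x)).hasFDerivAt.comp x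
      ((hasFDerivAt_id x).add (hu1 x).hasFDerivAt)
    have h2 := h1.fderiv
    rw [ContinuousLinearMap.comp_add, ContinuousLinearMap.comp_id] at h2
    exact h2
  rw [this]
  refine (h.add (h.clm_mul hu2)).mono ?_
  have hK := hf2.nonneg
  have hc := nearConst_nonneg k
  simp only [nearConst]
  have h2 : (0:ℝ) < 2 ^ k := by positivity
  have : nearConst k * κ ≤ nearConst k := mul_le_of_le_one_right hc hκ
  have : (2:ℝ) ^ k * (K * (nearConst k * κ) * κ) ≤ 2 ^ k * (K * nearConst k * κ) := by
    gcongr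
  nlinarith

theorem BC.comp_near {κ : ℝ} {f : X → F} {θ : X → X} (hκ0 : 0 ≤ κ) (hκ : κ ≤ 1)
    (hf : BC k K f) (hθ : DB k κ θ) : BC k (K * (1 + nearConst k * κ)) (fun x => f (x + θ x)) := by
  induction k generalizing F with
  | zero =>
    rw [bc_zero_iff] at hf ⊢
    rw [db_zero_iff] at hθ
    exact ⟨hf.1.comp (continuous_id.add hθ), fun x => by simpa [nearConst] using hf.2 (x + θ x)⟩
  | succ k ih =>
    have h1 := (bc_succ_iff.1 hf).2.2
    refine BC.of_db (hf.db.comp_near_of_bc hκ0 hκ hθ (ih h1 (hθ.of_le (Nat.le_succ k))))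
      fun x => (hf.norm_le _).trans (le_mul_of_one_le_right hf.nonneg ?_)
    have := nearConst_nonneg (k + 1)
    have : 0 ≤ nearConst (k + 1) * κ := by positivity
    linarith

/-- If `u = a - a ∘ u` with `a` small, then `u` is bounded by twice the bound of `a`. -/
theorem BC.absorb {a u : X → X →L[ℝ] X} {κ : ℝ} (ha : BC k κ a) (hu : ContDiff ℝ k u)
    (h : ∀ x, u x = a x - (a x).comp (u x)) (hκ : 2 ^ (k + 1) * κ ≤ 1) : BC k (2 * κ) u := by
  refine ⟨hu, fun j => ?_⟩
  have hκ0 := ha.nonneg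
  induction j using Nat.strong_induction_on with
  | _ j ih =>
    intro hj x
    set B := ContinuousLinearMap.compL ℝ X X X
    have hju : ContDiff ℝ j u := hu.of_le (by exact_mod_cast hj)
    have hja : ContDiff ℝ j a := ha.contDiff.of_le (by exact_mod_cast hj)
    have hB : ContDiff ℝ j (fun y => B (a y) (u y)) :=
      B.isBoundedBilinearMap.contDiff.comp (hja.prodMk hju)
    have e : u = fun y => a y - B (a y) (u y) := funext h
    have h1 : iteratedFDeriv ℝ j u x =
        iteratedFDeriv ℝ j a x - iteratedFDeriv ℝ j (fun y => B (a y) (u y)) x := by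
      conv_lhs => rw [e]
      exact congrFun (fun_iteratedFDeriv_sub hja hB) x
    have h2 : ‖iteratedFDeriv ℝ j (fun y => B (a y) (u y)) x‖ ≤
        ∑ i ∈ Finset.range (j + 1), (j.choose i : ℝ) * ‖iteratedFDeriv ℝ i a x‖ *
          ‖iteratedFDeriv ℝ (j - i) u x‖ :=
      B.norm_iteratedFDeriv_le_of_bilinear_of_le_one hja hju x le_rfl
        (ContinuousLinearMap.norm_compL_le ℝ X X X)
    set U := ‖iteratedFDeriv ℝ j u x‖
    -- The term with `i = 0` contains the unknown top derivative `U` and is kept apart; in all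
    -- others the derivative of `u` is of lower order and bounded by `2 * κ` by induction.
    have h3 : ∑ i ∈ Finset.range (j + 1), (j.choose i : ℝ) * ‖iteratedFDeriv ℝ i a x‖ *
          ‖iteratedFDeriv ℝ (j - i) u x‖ ≤ (2 ^ j - 1) * (κ * (2 * κ)) + κ * U := by
      rw [Finset.sum_range_succ']
      have h4 : ∑ i ∈ Finset.range j, ((j.choose (i + 1) : ℕ) : ℝ) = 2 ^ j - 1 := by
        have := Nat.sum_range_choose j
        rw [Finset.sum_range_succ'] at this
        have h5 : ((∑ i ∈ Finset.range j, j.choose (i + 1) + j.choose 0 : ℕ) : ℝ) = 2 ^ j := by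
          exact_mod_cast this
        push_cast at h5
        simp at h5
        linarith
      rw [← h4, Finset.sum_mul]
      refine add_le_add (Finset.sum_le_sum fun i hi => ?_) ?_
      · have : i < j := by simpa using hi
        rw [mul_assoc]
        refine mul_le_mul_of_nonneg_left ?_ (by positivity)
        exact mul_le_mul (ha.bound _ (by omega) x) (ih _ (by omega) (by omega) x)
          (norm_nonneg _) hκ0
      · simp only [Nat.choose_zero_right, Nat.cast_one, one_mul, Nat.sub_zero]
        exact mul_le_mul_of_nonneg_right (ha.bound 0 (by omega) x) (norm_nonneg _)
    have h5 : U ≤ κ + ((2 ^ j - 1) * (κ * (2 * κ)) + κ * U) := by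
      have : U = ‖iteratedFDeriv ℝ j a x - iteratedFDeriv ℝ j (fun y => B (a y) (u y)) x‖ := by
        rw [← h1]
      exact this.trans_le ((norm_sub_le _ _).trans (add_le_add (ha.bound j hj x) (h2.trans h3)))
    have h6 : (2:ℝ) ^ j ≤ 2 ^ k := pow_le_pow_right₀ (by norm_num) hj
    have h7 : (2:ℝ) ^ j * κ * 2 ≤ 1 := by
      rw [pow_succ] at hκ
      nlinarith
    have h8 : κ ≤ 1 / 2 := by
      have : (1:ℝ) ≤ 2 ^ j := one_le_pow₀ (by norm_num)
      nlinarith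
    -- By `h7`, `κ + (2 ^ j - 1) * (2 * κ ^ 2) ≤ 2 * κ * (1 - κ)`, so the bound `2 * κ` reproduces
    -- itself.
    have h9 : (1 - κ) * U ≤ (1 - κ) * (2 * κ) := by nlinarith
    exact le_of_mul_le_mul_left h9 (by linarith)

end BoundedCalculus

end PhaseLocking

end

noncomputable section

namespace PhaseLocking

/-! ### Perturbations of the identity, integration in a parameter, uniform limits. -/

section NearIdentity

variable {X E F : Type} [NormedAddCommGroup X] [NormedSpace ℝ X]
  [NormedAddCommGroup E] [NormedSpace ℝ E] [NormedAddCommGroup F] [NormedSpace ℝ F]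

variable {k : ℕ} {K κ : ℝ}

/-- A Lipschitz perturbation of the identity is a homeomorphism. -/
theorem exists_homeomorph_add [CompleteSpace X] {π : X → X} (hκ0 : 0 ≤ κ) (hκ : κ < 1)
    (hπ : ∀ x y, ‖π x - π y‖ ≤ κ * ‖x - y‖) : ∃ e : X ≃ₜ X, ∀ x, e x = x + π x := by
  have h : ApproximatesLinearOn (fun x => x + π x)
      ((ContinuousLinearEquiv.refl ℝ X : X ≃L[ℝ] X) : X →L[ℝ] X) univ ⟨κ, hκ0⟩ := by
    intro x _ y _
    have : x + π x - (y + π y) - (x - y) = π x - π y := by abel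
    change _ ≤ κ * _
    simpa [this] using hπ x y
  refine ⟨h.toHomeomorph _ ?_, fun x => rfl⟩
  rcases subsingleton_or_nontrivial X with hX | hX
  · exact Or.inl hX
  · right
    have h1 : ‖((ContinuousLinearEquiv.refl ℝ X).symm : X →L[ℝ] X)‖₊ = 1 := by
      ext
      simp
    rw [h1, inv_one]
    exact_mod_cast hκ

/-- The inverse of a `C^k` perturbation of the identity is a `C^k` perturbation of the identity of
the same size. -/
theorem exists_inverse_near [CompleteSpace X] {π : X → X} (hk : 1 ≤ k) (hκ0 : 0 ≤ κ)
    (hκ : 2 ^ (k + 1) * ((1 + nearConst k) * κ) ≤ 1) (hπ : DB k κ π) :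
    ∃ ψ : X → X, (∀ x, (x - ψ x) + π (x - ψ x) = x) ∧ (∀ x, (x + π x) - ψ (x + π x) = x) ∧
      DB k (2 * (1 + nearConst k) * κ) ψ := by
  have hc := nearConst_nonneg k
  have hκ1 : (1 + nearConst k) * κ ≤ 1 / 4 := by
    have : (2:ℝ) ^ 2 ≤ 2 ^ (k + 1) := pow_le_pow_right₀ (by norm_num) (by omega)
    have h0 : 0 ≤ (1 + nearConst k) * κ := by positivity
    nlinarith
  have hκ2 : κ ≤ 1 / 4 := by nlinarith
  obtain ⟨e, he⟩ := exists_homeomorph_add hκ0 (by linarith) (hπ.lipschitz hk)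
  have hπd : Differentiable ℝ π := hπ.contDiff.differentiable (by simp; omega)
  have hπn : ∀ x, ‖fderiv ℝ π x‖ ≤ κ := fun x => by
    have := hπ.bound 1 le_rfl hk x
    rwa [norm_iteratedFDeriv_one] at this
  -- Neumann series: `fderiv π` has norm below one, so the derivative of `e` is invertible
  -- everywhere.
  have hes : ContDiff ℝ k e.symm := by
    have hsmall : ∀ x, ‖-fderiv ℝ π x‖ < 1 := fun x => by
      rw [norm_neg]; exact (hπn x).trans_lt (by linarith)
    refine e.contDiff_symm
      (f₀' := fun x => ContinuousLinearEquiv.unitsEquiv ℝ X (Units.oneSub _ (hsmall x))) ?_ ?_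
    · intro x
      have h1 : ((ContinuousLinearEquiv.unitsEquiv ℝ X (Units.oneSub _ (hsmall x)) : X ≃L[ℝ] X)
          : X →L[ℝ] X) = ContinuousLinearMap.id ℝ X + fderiv ℝ π x := by
        ext v
        simp [sub_eq_add_neg, Units.oneSub]
      rw [h1]
      have : (e : X → X) = fun x => x + π x := funext he
      rw [this]
      exact (hasFDerivAt_id x).add (hπd x).hasFDerivAt
    · have : (e : X → X) = fun x => x + π x := funext he
      rw [this]
      exact contDiff_id.add hπ.contDiff
  -- The inverse of `e` is `x - ψ x`, and `ψ` satisfies `ψ = π ∘ (id - ψ)`.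
  set ψ : X → X := fun x => π (e.symm x) with hψ
  have hsy : ∀ x, e.symm x = x + -ψ x := fun x => by
    have := he (e.symm x)
    rw [e.apply_symm_apply] at this
    simp only [hψ]
    nth_rewrite 2 [this]
    abel
  have hψc : ContDiff ℝ k ψ := hπ.contDiff.comp hes
  refine ⟨ψ, fun x => ?_, fun x => ?_, ?_⟩
  · rw [sub_eq_add_neg, ← hsy, ← he, e.apply_symm_apply]
  · rw [sub_eq_add_neg, ← hsy, ← he, e.symm_apply_apply]
  -- Differentiating `ψ = π ∘ (id - ψ)` gives `Dψ = a - a Dψ` with `a = Dπ ∘ (id - ψ)`, the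
  -- situation of `BC.absorb`. The bound for `ψ` at order `j` controls `a` at order `j`, hence `ψ`
  -- at order `j + 1`.
  · have key : ∀ j ≤ k, DB j (2 * (1 + nearConst k) * κ) ψ := by
      intro j
      induction j with
      | zero => exact fun _ => db_zero_iff.2 hψc.continuous
      | succ j ih =>
        intro hj
        have hψd : Differentiable ℝ ψ := hψc.differentiable (by simp; omega)
        refine db_succ_iff.2 ⟨hψd, ?_⟩
        have h1 := (db_succ_iff.1 (hπ.of_le hj)).2
        -- The crude bound 1 for the derivatives of `ψ` is enough here and keeps the constant from
        -- growing with `j`.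
        have h2 := BC.comp_near (κ := 1) zero_le_one le_rfl h1
          ((ih (by omega)).neg.mono (by nlinarith))
        have h3 : BC j ((1 + nearConst k) * κ) (fun x => fderiv ℝ π (x + -ψ x)) := by
          refine h2.mono ?_
          have := nearConst_mono (show j ≤ k by omega)
          nlinarith
        have h4 := h3.absorb (u := fderiv ℝ ψ) ?_ ?_ ?_
        · exact h4.mono (by linarith)
        · have : ContDiff ℝ (j + 1 : ℕ) ψ := hψc.of_le (by exact_mod_cast hj)
          push_cast at this
          exact (contDiff_succ_iff_fderiv.1 this).2.2
        · intro x
          have hd : HasFDerivAt (fun y => y + -ψ y)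
              (ContinuousLinearMap.id ℝ X + -fderiv ℝ ψ x) x :=
            (hasFDerivAt_id x).add (hψd x).hasFDerivAt.neg
          have h5 : HasFDerivAt (fun y => π (y + -ψ y)) ((fderiv ℝ π (x + -ψ x)).comp
              (ContinuousLinearMap.id ℝ X + -fderiv ℝ ψ x)) x :=
            (hπd (x + -ψ x)).hasFDerivAt.comp x hd
          have h6 : (fun y => π (y + -ψ y)) = ψ := by
            ext1 y; rw [← hsy]
          rw [h6] at h5
          have h7 := h5.fderiv
          rw [ContinuousLinearMap.comp_add, ContinuousLinearMap.comp_id,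
            ContinuousLinearMap.comp_neg, ← sub_eq_add_neg] at h7
          exact h7
        · refine le_trans ?_ hκ
          refine mul_le_mul_of_nonneg_right ?_ (by positivity)
          exact pow_le_pow_right₀ (by norm_num) (by omega)
    exact key k le_rfl

/-- The constant in the bound for the difference of a function at two nearby maps. -/
def diffConst (D : ℝ) : ℕ → ℝ
  | 0 => 1
  | k + 1 => 1 + 2 ^ k * (diffConst D k * D) + 2 ^ k * compConst (D + 1) k

theorem diffConst_nonneg {D : ℝ} (hD : 0 ≤ D) (k : ℕ) : 0 ≤ diffConst D k := by
  induction k with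
  | zero => exact zero_le_one
  | succ k ih =>
    have := one_le_compConst (D := D + 1) (by linarith) k
    simp only [diffConst]; positivity

/-- The derivative of the difference is `(Dh(a + b) - Dh(a)) Da + Dh(a + b) Db`, so induction
applies to `Dh`. The base case is the mean value inequality, which uses one more derivative of `h`
than the result has. It will compare `H⁻¹(H G + E)` with `G` for a small error `E`. -/
theorem BC.comp_sub_comp {D β : ℝ} {h : E → F} {a b : X → E} (hD : 0 ≤ D) (hh : DB (k + 1) K h)
    (ha : DB k D a) (hb : BC k β b) (hβ : β ≤ 1) :
    BC k (diffConst D k * K * β) (fun x => h (a x + b x) - h (a x)) := by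
  have hβ0 := hb.nonneg
  induction k generalizing F with
  | zero =>
    have hK := hh.nonneg
    refine bc_zero_iff.2 ⟨?_, fun x => ?_⟩
    · have hc := hh.contDiff.continuous
      have ha' := ha.contDiff.continuous
      have hb' := hb.contDiff.continuous
      fun_prop
    · have := hh.lipschitz le_rfl (a x + b x) (a x)
      simp only [diffConst, one_mul]
      refine this.trans ?_
      rw [add_sub_cancel_left]
      exact mul_le_mul_of_nonneg_left (hb.norm_le x) hK
  | succ k ih =>
    have hK := hh.nonneg
    obtain ⟨hh1, hh2⟩ := db_succ_iff.1 hh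
    obtain ⟨ha1, ha2⟩ := db_succ_iff.1 ha
    obtain ⟨hb1, hb0, hb2⟩ := bc_succ_iff.1 hb
    have i0 : ∀ x, ‖h (a x + b x) - h (a x)‖ ≤ K * β := fun x => by
      have := hh.lipschitz (by omega) (a x + b x) (a x)
      rw [add_sub_cancel_left] at this
      exact this.trans (mul_le_mul_of_nonneg_left (hb.norm_le x) hK)
    have i1 := ih hh2.db (ha.of_le (Nat.le_succ k)) (hb.of_le (Nat.le_succ k))
    have i2 : BC k (compConst (D + 1) k * K) (fun x => fderiv ℝ h (a x + b x)) :=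
      (hh2.of_le (Nat.le_succ k)).comp
        (((ha.of_le (Nat.le_succ k)).add (hb.of_le (Nat.le_succ k)).db).mono (by linarith))
    have hdc := diffConst_nonneg hD k
    have hcc := one_le_compConst (D := D + 1) (by linarith) k
    have e : fderiv ℝ (fun x => h (a x + b x) - h (a x)) = fun x =>
        (fderiv ℝ h (a x + b x) - fderiv ℝ h (a x)).comp (fderiv ℝ a x) +
        (fderiv ℝ h (a x + b x)).comp (fderiv ℝ b x) := by
      ext1 x
      have h1 : HasFDerivAt (fun x => a x + b x) (fderiv ℝ a x + fderiv ℝ b x) x :=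
        (ha1 x).hasFDerivAt.add (hb1 x).hasFDerivAt
      have h2 : HasFDerivAt (fun x => h (a x + b x)) _ x :=
        (hh1 (a x + b x)).hasFDerivAt.comp x h1
      have h3 : HasFDerivAt (fun x => h (a x)) _ x :=
        (hh1 (a x)).hasFDerivAt.comp x (ha1 x).hasFDerivAt
      have h4 : fderiv ℝ (fun x => h (a x + b x) - h (a x)) x = _ := (h2.sub h3).fderiv
      rw [h4, ContinuousLinearMap.comp_add, ContinuousLinearMap.sub_comp]
      abel
    refine bc_succ_iff.2 ⟨?_, fun x => ?_, ?_⟩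
    · exact (hh1.comp (ha1.add hb1)).sub (hh1.comp ha1)
    · refine (i0 x).trans ?_
      refine mul_le_mul_of_nonneg_right (le_mul_of_one_le_left hK ?_) hβ0
      simp only [diffConst]
      have : 0 ≤ (2:ℝ) ^ k * (diffConst D k * D) := by positivity
      have : 0 ≤ (2:ℝ) ^ k * compConst (D + 1) k := by positivity
      linarith
    · rw [e]
      refine ((i1.clm_mul ha2).add (i2.clm_mul hb2)).mono ?_
      simp only [diffConst]
      have : 0 ≤ K * β := by positivity
      nlinarith

/-- A family of maps whose derivative in the parameter is bounded in `C^k` is itself bounded in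
`C^k`. -/
theorem BC.of_hasDerivWithinAt {V ρ : ℝ → X → E} {b B : ℝ} (hb : 0 ≤ b)
    (hV : ContDiff ℝ k (V b)) (hV0 : ∀ x, V 0 x = 0) (hVc : ∀ x, ContinuousOn (V · x) (Icc 0 b))
    (hd : ∀ x, ∀ t ∈ Ico 0 b, HasDerivWithinAt (V · x) (ρ t x) (Ici t) t)
    (hρ : ∀ t ∈ Ico 0 b, BC k B (ρ t)) : BC k (B * b) (V b) := by
  refine ⟨hV, fun a ha => ?_⟩
  -- Spatial derivatives are not assumed to commute with the derivative in `t`. To pass from order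
  -- `a` to `a + 1`, the claim at order `a` is applied to the increment of `V` by a vector `h`,
  -- which bounds the Lipschitz constant of the `a`-th derivative.
  have key : ∀ a : ℕ, ∀ (V ρ : ℝ → X → E) (B : ℝ), ContDiff ℝ a (V b) → (∀ x, V 0 x = 0) →
      (∀ x, ContinuousOn (V · x) (Icc 0 b)) →
      (∀ x, ∀ t ∈ Ico 0 b, HasDerivWithinAt (V · x) (ρ t x) (Ici t) t) →
      (∀ t ∈ Ico 0 b, ContDiff ℝ a (ρ t)) →
      (∀ t ∈ Ico 0 b, ∀ x, ‖iteratedFDeriv ℝ a (ρ t) x‖ ≤ B) →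
      ∀ x, ‖iteratedFDeriv ℝ a (V b) x‖ ≤ B * b := by
    intro a
    induction a with
    | zero =>
      intro V ρ B hV hV0 hVc hd hρc hρ x
      simp only [norm_iteratedFDeriv_zero] at hρ ⊢
      have := norm_image_sub_le_of_norm_deriv_right_le_segment (hVc x) (hd x)
        (fun t ht => hρ t ht x) b ⟨hb, le_rfl⟩
      simpa [hV0] using this
    | succ a ih =>
      intro V ρ B hV hV0 hVc hd hρc hρ x
      have hBb : 0 ≤ B * b := by
        rcases hb.eq_or_lt with rfl | h
        · simp
        · exact mul_nonneg ((norm_nonneg _).trans (hρ 0 ⟨le_rfl, h⟩ 0)) hb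
      have hVa : ContDiff ℝ a (V b) := hV.of_le (by exact_mod_cast Nat.le_succ a)
      have hlip : ∀ h : X, ‖iteratedFDeriv ℝ a (V b) (x + h) - iteratedFDeriv ℝ a (V b) x‖ ≤
          B * b * ‖h‖ := by
        intro h
        have hsh : ContDiff ℝ a (fun y => V b (y + h)) := hVa.comp (contDiff_id.add contDiff_const)
        have e1 : iteratedFDeriv ℝ a (fun y => V b (y + h) - V b y) x =
            iteratedFDeriv ℝ a (V b) (x + h) - iteratedFDeriv ℝ a (V b) x := by
          rw [congrFun (fun_iteratedFDeriv_sub hsh hVa) x, iteratedFDeriv_comp_add_right]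
        rw [← e1]
        have := ih (fun t y => V t (y + h) - V t y) (fun t y => ρ t (y + h) - ρ t y) (B * ‖h‖)
          (hsh.sub hVa) (by simp [hV0]) (fun y => (hVc _).sub (hVc _))
          (fun y t ht => (hd _ t ht).sub (hd _ t ht)) ?_ ?_ x
        · calc _ ≤ _ := this
            _ = _ := by ring
        · intro t ht
          have h0 : ContDiff ℝ a (ρ t) := (hρc t ht).of_le (by exact_mod_cast Nat.le_succ a)
          exact (h0.comp (contDiff_id.add contDiff_const)).sub h0
        · intro t ht y
          have h0 : ContDiff ℝ a (ρ t) := (hρc t ht).of_le (by exact_mod_cast Nat.le_succ a)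
          have h1 : ContDiff ℝ a (fun y => ρ t (y + h)) :=
            h0.comp (contDiff_id.add contDiff_const)
          rw [congrFun (fun_iteratedFDeriv_sub h1 h0) y, iteratedFDeriv_comp_add_right]
          have hdiff : Differentiable ℝ (iteratedFDeriv ℝ a (ρ t)) :=
            (hρc t ht).differentiable_iteratedFDeriv (by exact_mod_cast Nat.lt_succ_self a)
          have := Convex.norm_image_sub_le_of_norm_fderiv_le (fun z _ => hdiff z)
            (fun z _ => by rw [norm_fderiv_iteratedFDeriv]; exact hρ t ht z)
            convex_univ (mem_univ y) (mem_univ (y + h))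
          simpa using this
      have hdiff : Differentiable ℝ (iteratedFDeriv ℝ a (V b)) :=
        hV.differentiable_iteratedFDeriv (by exact_mod_cast Nat.lt_succ_self a)
      rw [← norm_fderiv_iteratedFDeriv]
      refine (hdiff x).hasFDerivAt.le_of_lip' hBb ?_
      refine Eventually.of_forall fun y => ?_
      have := hlip (y - x)
      rwa [add_sub_cancel] at this
  exact key a V ρ B (hV.of_le (by exact_mod_cast ha)) hV0 hVc hd
    (fun t ht => (hρ t ht).contDiff.of_le (by exact_mod_cast ha))
    fun t ht x => (hρ t ht).bound a ha x

/-- Interpolation between a function and its second derivative. -/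
theorem norm_fderiv_le_interpolate {v : X → E} {a K t : ℝ} (ht : 0 < t) (hv : BC 2 K v)
    (ha : ∀ x, ‖v x‖ ≤ a) (x : X) : ‖fderiv ℝ v x‖ ≤ 2 * a / t + K * t := by
  have hK := hv.nonneg
  have ha0 : 0 ≤ a := (norm_nonneg _).trans (ha 0)
  obtain ⟨h1, h2⟩ := db_succ_iff.1 hv.db
  have hr : 0 ≤ 2 * a / t + K * t := by positivity
  have hone : ∀ w : X, ‖w‖ = t → ‖fderiv ℝ v x w‖ ≤ 2 * a + K * t * t := by
    intro w hw
    -- Taylor's formula on the ball of radius `t`, where the derivative varies by at most `K * t`.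
    have h3 : ‖v (x + w) - v x - fderiv ℝ v x (x + w - x)‖ ≤ K * t * ‖x + w - x‖ := by
      refine Convex.norm_image_sub_le_of_norm_hasFDerivWithin_le' (s := Metric.closedBall x t)
        (f' := fderiv ℝ v) (fun y _ => (h1 y).hasFDerivAt.hasFDerivWithinAt) (fun y hy => ?_)
        (convex_closedBall x t) (Metric.mem_closedBall_self ht.le) (by simp [hw])
      refine (h2.db.lipschitz le_rfl y x).trans ?_
      rw [Metric.mem_closedBall, dist_eq_norm] at hy
      gcongr
    rw [add_sub_cancel_left, hw] at h3
    have h4 : fderiv ℝ v x w = v (x + w) - v x - (v (x + w) - v x - fderiv ℝ v x w) := by abel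
    rw [h4]
    refine (norm_sub_le _ _).trans (add_le_add ((norm_sub_le _ _).trans ?_) h3)
    linarith [ha (x + w), ha x]
  refine ContinuousLinearMap.opNorm_le_bound _ hr fun w => ?_
  rcases eq_or_ne w 0 with rfl | hw
  · simp
  · have hw' : 0 < ‖w‖ := norm_pos_iff.2 hw
    have h5 := hone ((t / ‖w‖) • w) (by
      rw [norm_smul, Real.norm_of_nonneg (by positivity)]; field_simp)
    rw [map_smul, norm_smul, Real.norm_of_nonneg (by positivity)] at h5
    have h6 : (2 * a / t + K * t) * ‖w‖ = (2 * a + K * t * t) * (‖w‖ / t) := by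
      field_simp
    rw [h6]
    calc ‖fderiv ℝ v x w‖ = t / ‖w‖ * ‖fderiv ℝ v x w‖ * (‖w‖ / t) := by field_simp
      _ ≤ _ := by gcongr

/-- A uniform limit of maps bounded in `C^(k+1)` is of class `C^k`. -/
theorem contDiff_of_tendstoUniformly [CompleteSpace E] {y : ℕ → X → E} {f : X → E}
    (hy : ∀ n, BC (k + 1) K (y n)) (hf : TendstoUniformly y f atTop) : ContDiff ℝ k f := by
  induction k generalizing E with
  | zero =>
    exact_mod_cast contDiff_zero.2
      (hf.continuous (Eventually.of_forall fun n => (hy n).contDiff.continuous).frequently)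
  | succ k ih =>
    have hK := (hy 0).nonneg
    have hdy : ∀ n, BC (k + 1) K (fderiv ℝ (y n)) := fun n => (bc_succ_iff.1 (hy n)).2.2
    -- Only the functions are known to converge. Interpolation with the uniform bound on second
    -- derivatives makes the first derivatives Cauchy in the sup norm.
    have hc : UniformCauchySeqOn (fun n => fderiv ℝ (y n)) atTop univ := by
      rw [Metric.uniformCauchySeqOn_iff]
      intro ε hε
      -- The step `t` keeps the second-derivative term below `ε / 2`; the accuracy `a` then makes `2
      -- * a / t` equal to `ε / 4`.
      set t := ε / (4 * (K + 1)) with ht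
      have ht0 : 0 < t := by positivity
      set a := ε * t / 8 with ha
      have ha0 : 0 < a := by positivity
      obtain ⟨N, hN⟩ := Metric.uniformCauchySeqOn_iff.1
        (tendstoUniformlyOn_univ.2 hf).uniformCauchySeqOn a ha0
      refine ⟨N, fun m hm n hn x _ => ?_⟩
      have h1 : BC 2 (K + K) (fun x => y m x - y n x) :=
        ((hy m).of_le (by omega)).sub ((hy n).of_le (by omega))
      have h2 := norm_fderiv_le_interpolate ht0 h1
        (fun x => by rw [← dist_eq_norm]; exact (hN m hm n hn x (mem_univ x)).le) x
      rw [fderiv_fun_sub ((bc_succ_iff.1 (hy m)).1 x) ((bc_succ_iff.1 (hy n)).1 x)] at h2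
      rw [dist_eq_norm]
      refine h2.trans_lt ?_
      have e1 : 2 * a / t = ε / 4 := by rw [ha]; field_simp; ring
      have e2 : (K + K) * t ≤ ε / 2 := by
        rw [ht]
        rw [mul_div_assoc', div_le_iff₀ (by positivity)]
        nlinarith
      linarith
    obtain ⟨g, hg⟩ : ∃ g : X → X →L[ℝ] E, ∀ x, Tendsto (fun n => fderiv ℝ (y n) x) atTop
        (𝓝 (g x)) := by
      choose g hg using fun x => cauchySeq_tendsto_of_complete (hc.cauchySeq (mem_univ x))
      exact ⟨g, hg⟩
    have hgu : TendstoUniformly (fun n => fderiv ℝ (y n)) g atTop :=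
      tendstoUniformlyOn_univ.1 (hc.tendstoUniformlyOn_of_tendsto fun x _ => hg x)
    have hd : ∀ x, HasFDerivAt f (g x) x := fun x =>
      hasFDerivAt_of_tendstoUniformly hgu
        (fun n x => ((bc_succ_iff.1 (hy n)).1 x).hasFDerivAt)
        (fun x => hf.tendsto_at x) x
    have hfg : fderiv ℝ f = g := funext fun x => (hd x).fderiv
    push_cast
    rw [contDiff_succ_iff_fderiv]
    refine ⟨fun x => (hd x).differentiableAt, by simp, ?_⟩
    rw [hfg]
    exact ih hdy hgu

end NearIdentity

end PhaseLocking

end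

noncomputable section

namespace PhaseLocking

/-! ### Hyperbolic linear maps and the equation `z ∘ p = Λ z + g`. -/

section Dichotomy

variable {X Y E : Type} [NormedAddCommGroup X] [NormedSpace ℝ X]
  [NormedAddCommGroup Y] [NormedSpace ℝ Y] [NormedAddCommGroup E] [NormedSpace ℝ E]

/-- The linear map `Λ` with inverse `Λi` contracts the range of `P` and expands the kernel of `P`
with rate `1 - μ`. -/
structure HypDich (Λ Λi P : Y →L[ℝ] Y) (K μ : ℝ) : Prop where
  mul_inv : Λ * Λi = 1
  inv_mul : Λi * Λ = 1
  comm : P * Λ = Λ * P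
  stable : ∀ j : ℕ, ‖Λ ^ j * P‖ ≤ K * (1 - μ) ^ j
  unstable : ∀ j : ℕ, ‖Λi ^ j * (1 - P)‖ ≤ K * (1 - μ) ^ j

variable {k : ℕ} {K μ κ γ : ℝ} {Λ Λi P : Y →L[ℝ] Y}

theorem HypDich.comm_inv (h : HypDich Λ Λi P K μ) : P * Λi = Λi * P := by
  calc P * Λi = (Λi * Λ) * (P * Λi) := by rw [h.inv_mul, one_mul]
    _ = Λi * (Λ * P) * Λi := by simp only [mul_assoc]
    _ = Λi * (P * Λ) * Λi := by rw [h.comm]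
    _ = Λi * P * (Λ * Λi) := by simp only [mul_assoc]
    _ = Λi * P := by rw [h.mul_inv, mul_one]

theorem HypDich.nonneg (h : HypDich Λ Λi P K μ) : 0 ≤ K :=
  (norm_nonneg _).trans (by simpa using h.stable 0)

theorem BC.tsum [CompleteSpace E] {f : ℕ → X → E} {v : ℕ → ℝ} (hv : Summable v)
    (hf : ∀ i, BC k (v i) (f i)) : BC k (∑' i, v i) (fun x => ∑' i, f i x) := by
  have h1 : ∀ i, ContDiff ℝ ((k : ℕ∞) : WithTop ℕ∞) (f i) := fun i => (hf i).contDiff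
  have h2 : ∀ (j i : ℕ) (x : X), (j : ℕ∞) ≤ k → ‖iteratedFDeriv ℝ j (f i) x‖ ≤ v i :=
    fun j i x hj => (hf i).bound j (by exact_mod_cast hj) x
  refine ⟨contDiff_tsum (v := fun _ => v) h1 (fun _ _ => hv) h2, fun j hj x => ?_⟩
  rw [iteratedFDeriv_tsum_apply (v := fun _ => v) h1 (fun _ _ => hv) h2 (by exact_mod_cast hj)]
  exact tsum_of_norm_bounded hv.hasSum fun i => (hf i).bound j hj x

theorem BC.comp_iterate {f : X → E} {θ : X → X} (hκ0 : 0 ≤ κ) (hκ : κ ≤ 1)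
    (hf : BC k γ f) (hθ : DB k κ θ) (j : ℕ) :
    BC k (γ * (1 + nearConst k * κ) ^ j) (fun x => f ((fun y => y + θ y)^[j] x)) := by
  induction j with
  | zero => simpa using hf
  | succ j ih =>
    have := ih.comp_near hκ0 hκ hθ
    simp only [Function.iterate_succ_apply]
    refine this.mono (le_of_eq (by ring))

/-- Bounded solutions of `z ∘ p = Λ z + g` for a hyperbolic `Λ`. -/
theorem HypDich.norm_le {ι : Type} (h : HypDich Λ Λi P K μ) (hμ0 : 0 < μ) (hμ1 : μ ≤ 1)
    {p q : ι → ι} (hpq : ∀ x, p (q x) = x) {z g : ι → Y} {M : ℝ} (hz : ∀ x, ‖z x‖ ≤ M)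
    (hg : ∀ x, ‖g x‖ ≤ γ) (he : ∀ x, z (p x) = Λ (z x) + g x) (x : ι) :
    ‖z x‖ ≤ 2 * K * γ / μ := by
  have hK := h.nonneg
  have hγ : 0 ≤ γ := (norm_nonneg _).trans (hg x)
  have hsum : ∀ j : ℕ, ∑ i ∈ Finset.range j, (1 - μ) ^ i ≤ 1 / μ := by
    intro j
    have := mul_neg_geom_sum (1 - μ) j
    rw [le_div_iff₀ hμ0]
    have h1 : 0 ≤ (1 - μ) ^ j := by apply pow_nonneg; linarith
    have h2 : 1 - (1 - μ) = μ := by ring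
    rw [h2] at this
    linarith
  -- The boundary term of the iterated equation carries `(1 - μ) ^ j` and disappears in the limit,
  -- whatever the a priori bound `M`.
  have hlim : ∀ a b : ℝ, (∀ j : ℕ, a ≤ K * (1 - μ) ^ j * M + b) → a ≤ b := by
    intro a b hab
    have h1 : Tendsto (fun j : ℕ => K * (1 - μ) ^ j * M + b) atTop (𝓝 (K * 0 * M + b)) :=
      (((tendsto_pow_atTop_nhds_zero_of_lt_one (by linarith) (by linarith)).const_mul K).mul_const
        M).add_const b
    have := ge_of_tendsto' h1 hab
    simpa using this
  have hs : ‖P (z x)‖ ≤ K * γ / μ := by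
    refine hlim _ _ fun j => ?_
    -- On the range of `P` the equation is iterated along a backward orbit of `p`, supplied by the
    -- right inverse `q`.
    have e : ∀ j : ℕ, P (z x) = (Λ ^ j * P) (z (q^[j] x)) +
        ∑ i ∈ Finset.range j, (Λ ^ i * P) (g (q^[i + 1] x)) := by
      intro j
      induction j with
      | zero => simp
      | succ j ih =>
        rw [Finset.sum_range_succ, ih]
        have h1 : z (q^[j] x) = Λ (z (q^[j + 1] x)) + g (q^[j + 1] x) := by
          rw [← he, Function.iterate_succ_apply', hpq]
        have h2 : Λ ^ (j + 1) * P = Λ ^ j * P * Λ := by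
          rw [mul_assoc, h.comm, ← mul_assoc, pow_succ]
        rw [h1, map_add, h2]
        simp only [ContinuousLinearMap.mul_def, ContinuousLinearMap.comp_apply]
        abel
    rw [e j]
    refine (norm_add_le _ _).trans (add_le_add ?_ ?_)
    · exact ((Λ ^ j * P).le_opNorm _).trans
        (mul_le_mul (h.stable j) (hz _) (norm_nonneg _) ((norm_nonneg _).trans (h.stable j)))
    · calc _ ≤ ∑ i ∈ Finset.range j, K * (1 - μ) ^ i * γ :=
          norm_sum_le_of_le _ fun i _ => ((Λ ^ i * P).le_opNorm _).trans
            (mul_le_mul (h.stable i) (hg _) (norm_nonneg _) ((norm_nonneg _).trans (h.stable i)))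
        _ = K * γ * ∑ i ∈ Finset.range j, (1 - μ) ^ i := by
          rw [Finset.mul_sum]; exact Finset.sum_congr rfl fun i _ => by ring
        _ ≤ K * γ * (1 / μ) := mul_le_mul_of_nonneg_left (hsum j) (by positivity)
        _ = _ := by ring
  have hu : ‖(1 - P) (z x)‖ ≤ K * γ / μ := by
    refine hlim _ _ fun j => ?_
    have hcm : (1 - P) * Λi = Λi * (1 - P) := by
      rw [sub_mul, mul_sub, h.comm_inv, one_mul, mul_one]
    -- On the kernel of `P` the equation is solved for `z` by means of `Λi` and iterated along the
    -- forward orbit.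
    have e : ∀ j : ℕ, (1 - P) (z x) = (Λi ^ j * (1 - P)) (z (p^[j] x)) -
        ∑ i ∈ Finset.range j, (Λi ^ (i + 1) * (1 - P)) (g (p^[i] x)) := by
      intro j
      induction j with
      | zero => simp
      | succ j ih =>
        rw [Finset.sum_range_succ, ih]
        have h1 : z (p^[j] x) = Λi (z (p^[j + 1] x)) - Λi (g (p^[j] x)) := by
          rw [Function.iterate_succ_apply', he, map_add]
          have : Λi (Λ (z (p^[j] x))) = z (p^[j] x) := by
            exact congrArg (fun T : Y →L[ℝ] Y => T (z (p^[j] x))) h.inv_mul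
          rw [this]; abel
        have h2 : Λi ^ (j + 1) * (1 - P) = Λi ^ j * (1 - P) * Λi := by
          rw [mul_assoc, hcm, ← mul_assoc, pow_succ]
        rw [h1, map_sub, h2]
        simp only [ContinuousLinearMap.mul_def, ContinuousLinearMap.comp_apply]
        abel
    rw [e j]
    refine (norm_sub_le _ _).trans (add_le_add ?_ ?_)
    · exact ((Λi ^ j * (1 - P)).le_opNorm _).trans
        (mul_le_mul (h.unstable j) (hz _) (norm_nonneg _) ((norm_nonneg _).trans (h.unstable j)))
    · calc _ ≤ ∑ i ∈ Finset.range j, K * (1 - μ) ^ i * γ :=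
          norm_sum_le_of_le _ fun i _ => by
            refine ((Λi ^ (i + 1) * (1 - P)).le_opNorm _).trans ?_
            refine (mul_le_mul (h.unstable (i + 1)) (hg _) (norm_nonneg _)
              ((norm_nonneg _).trans (h.unstable _))).trans ?_
            refine mul_le_mul_of_nonneg_right (mul_le_mul_of_nonneg_left ?_ hK) hγ
            exact pow_le_pow_of_le_one (by linarith) (by linarith) (Nat.le_succ i)
        _ = K * γ * ∑ i ∈ Finset.range j, (1 - μ) ^ i := by
          rw [Finset.mul_sum]; exact Finset.sum_congr rfl fun i _ => by ring
        _ ≤ K * γ * (1 / μ) := mul_le_mul_of_nonneg_left (hsum j) (by positivity)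
        _ = _ := by ring
  have e : z x = P (z x) + (1 - P) (z x) := by simp
  rw [e]
  refine (norm_add_le _ _).trans ((add_le_add hs hu).trans (le_of_eq (by ring)))

/-- The equation `z ∘ p = Λ z + g` for a hyperbolic `Λ` and a map `p` near the identity has a
solution of the class of `g`. -/
theorem HypDich.exists_solution [CompleteSpace Y] (h : HypDich Λ Λi P K μ) (hμ0 : 0 < μ)
    (hμ1 : μ ≤ 1) {π ψ : X → X} (hκ0 : 0 ≤ κ) (hκ : κ ≤ 1) (hκμ : nearConst k * κ ≤ μ / 2)
    (hπ : DB k κ π) (hψ : DB k κ ψ) (hqp : ∀ x, (x + π x) - ψ (x + π x) = x) {g : X → Y}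
    (hg : BC k γ g) :
    ∃ z : X → Y, BC k (8 * K * γ / μ) z ∧ ∀ x, z (x + π x) = Λ (z x) + g x := by
  have hK := h.nonneg
  have hγ := hg.nonneg
  have hnc := nearConst_nonneg k
  set p : X → X := fun x => x + π x with hp
  set q : X → X := fun x => x + -ψ x with hq
  have hqp' : ∀ x, q (p x) = x := fun x => by simpa [hp, hq, sub_eq_add_neg] using hqp x
  set ρ := 1 + nearConst k * κ with hρ
  have hρ1 : 1 ≤ ρ := by
    have : 0 ≤ nearConst k * κ := by positivity
    linarith
  have hρ2 : ρ ≤ 2 := by linarith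
  set σ := 1 - μ / 2 with hσ
  -- Composition with the `j`-th iterate of `p` or `q` inflates `C^k` norms by `ρ ^ j`; the
  -- hypothesis `hκμ` leaves half of the contraction rate.
  have hρσ : (1 - μ) * ρ ≤ σ := by nlinarith
  have hμ' : 0 ≤ 1 - μ := by linarith
  have hgeo : ∀ j : ℕ, (1 - μ) ^ j * ρ ^ j ≤ σ ^ j := fun j => by
    rw [← mul_pow]; exact pow_le_pow_left₀ (by positivity) hρσ j
  have hσ0 : 0 ≤ σ := by rw [hσ]; linarith
  have hσ1 : σ < 1 := by rw [hσ]; linarith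
  have hsm : Summable fun j : ℕ => 2 * K * γ * σ ^ j :=
    (summable_geometric_of_lt_one hσ0 hσ1).mul_left _
  have hts : ∑' j : ℕ, 2 * K * γ * σ ^ j = 4 * K * γ / μ := by
    rw [tsum_mul_left, tsum_geometric_of_lt_one hσ0 hσ1, hσ]
    rw [show 1 - (1 - μ / 2) = μ / 2 by ring]
    field_simp
    ring
  have hs : ∀ j : ℕ, BC k (2 * K * γ * σ ^ j) (fun x => (Λ ^ j * P) (g (q^[j + 1] x))) := by
    intro j
    refine ((hg.comp_iterate hκ0 hκ hψ.neg (j + 1)).clm_comp (Λ ^ j * P)).mono ?_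
    calc ‖Λ ^ j * P‖ * (γ * ρ ^ (j + 1)) ≤ K * (1 - μ) ^ j * (γ * ρ ^ (j + 1)) :=
          mul_le_mul_of_nonneg_right (h.stable j) (by positivity)
      _ = K * γ * ρ * ((1 - μ) ^ j * ρ ^ j) := by ring
      _ ≤ K * γ * 2 * σ ^ j := by
          refine mul_le_mul (mul_le_mul_of_nonneg_left hρ2 (by positivity)) (hgeo j)
            (by positivity) (by positivity)
      _ = _ := by ring
  have hu : ∀ j : ℕ, BC k (2 * K * γ * σ ^ j)
      (fun x => (Λi ^ (j + 1) * (1 - P)) (g (p^[j] x))) := by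
    intro j
    refine ((hg.comp_iterate hκ0 hκ hπ j).clm_comp (Λi ^ (j + 1) * (1 - P))).mono ?_
    calc ‖Λi ^ (j + 1) * (1 - P)‖ * (γ * ρ ^ j) ≤ K * (1 - μ) ^ (j + 1) * (γ * ρ ^ j) :=
          mul_le_mul_of_nonneg_right (h.unstable _) (by positivity)
      _ = K * γ * (1 - μ) * ((1 - μ) ^ j * ρ ^ j) := by ring
      _ ≤ K * γ * 2 * σ ^ j := by
          refine mul_le_mul (mul_le_mul_of_nonneg_left (by linarith) (by positivity)) (hgeo j)
            (by positivity) (by positivity)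
      _ = _ := by ring
  have hss : ∀ x, Summable fun j : ℕ => (Λ ^ j * P) (g (q^[j + 1] x)) := fun x =>
    Summable.of_norm_bounded hsm fun j => (hs j).norm_le x
  have hus : ∀ x, Summable fun j : ℕ => (Λi ^ (j + 1) * (1 - P)) (g (p^[j] x)) := fun x =>
    Summable.of_norm_bounded hsm fun j => (hu j).norm_le x
  -- The stable part sums over the past of the orbit, the unstable part over its present and future.
  refine ⟨fun x => (∑' j : ℕ, (Λ ^ j * P) (g (q^[j + 1] x))) -
    ∑' j : ℕ, (Λi ^ (j + 1) * (1 - P)) (g (p^[j] x)), ?_, fun x => ?_⟩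
  · have := (BC.tsum hsm hs).sub (BC.tsum hsm hu)
    refine this.mono ?_
    rw [hts]
    exact le_of_eq (by ring)
  · have e1 : (∑' j : ℕ, (Λ ^ j * P) (g (q^[j + 1] (p x)))) =
        P (g x) + Λ (∑' j : ℕ, (Λ ^ j * P) (g (q^[j + 1] x))) := by
      have h1 : ∀ j : ℕ, q^[j + 1] (p x) = q^[j] x := fun j => by
        rw [Function.iterate_succ_apply, hqp']
      have h2 : Summable fun j : ℕ => (Λ ^ j * P) (g (q^[j] x)) := by
        have := hss (p x)
        simpa only [h1] using this
      simp only [h1]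
      rw [h2.tsum_eq_zero_add, Λ.map_tsum (hss x)]
      simp only [pow_zero, one_mul, Function.iterate_zero, id]
      congr 1
      refine tsum_congr fun j => ?_
      rw [pow_succ', mul_assoc]
      rfl
    have e2 : (∑' j : ℕ, (Λi ^ (j + 1) * (1 - P)) (g (p^[j] (p x)))) =
        Λ (∑' j : ℕ, (Λi ^ (j + 1) * (1 - P)) (g (p^[j] x))) - (1 - P) (g x) := by
      have h3 : ∀ j : ℕ, Λ ((Λi ^ (j + 1) * (1 - P)) (g (p^[j] x))) =
          (Λi ^ j * (1 - P)) (g (p^[j] x)) := fun j => by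
        have : Λ * (Λi ^ (j + 1) * (1 - P)) = Λi ^ j * (1 - P) := by
          rw [pow_succ', ← mul_assoc, ← mul_assoc, h.mul_inv, one_mul]
        rw [← this]; rfl
      have h4 : Summable fun j : ℕ => (Λi ^ j * (1 - P)) (g (p^[j] x)) := by
        have := (hus x).mapL Λ
        simpa only [h3] using this
      rw [Λ.map_tsum (hus x)]
      simp only [h3]
      rw [h4.tsum_eq_zero_add]
      simp only [Function.iterate_succ_apply, pow_zero, one_mul, Function.iterate_zero, id]
      abel
    change _ - _ = Λ (_ - _) + g x
    have e3 : (1 - P) (g x) = g x - P (g x) := rfl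
    rw [e1, e2, map_sub, e3]
    abel

end Dichotomy

end PhaseLocking

end

noncomputable section

namespace PhaseLocking

/-! ### The invariance equation of a perturbed skew map. -/

section InvariantGraph

variable {X Y E : Type} [NormedAddCommGroup X] [NormedSpace ℝ X]
  [NormedAddCommGroup Y] [NormedSpace ℝ Y] [NormedAddCommGroup E] [NormedSpace ℝ E]

/-- In the chain rule every term contains a derivative of `y`, so the derivatives of the composition
are `O(δ)` as soon as those of `f` are bounded. -/
theorem DB.comp_small {k : ℕ} {K δ : ℝ} {f : Y → E} {y : X → Y} (hf : DB k K f) (hy : DB k δ y)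
    (hδ : δ ≤ 1) (hK : 0 ≤ K) (hδ0 : 0 ≤ δ) :
    DB k (2 ^ k * compConst 1 k * K * δ) (fun x => f (y x)) := by
  cases k with
  | zero => exact db_zero_iff.2 ((db_zero_iff.1 hf).comp (db_zero_iff.1 hy))
  | succ k =>
    obtain ⟨hf1, hf2⟩ := db_succ_iff.1 hf
    obtain ⟨hu1, hu2⟩ := db_succ_iff.1 hy
    refine db_succ_iff.2 ⟨hf1.comp hu1, ?_⟩
    have : fderiv ℝ (fun x => f (y x)) = fun x => (fderiv ℝ f (y x)).comp (fderiv ℝ y x) := by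
      ext1 x; exact fderiv_comp x (hf1 _) (hu1 x)
    rw [this]
    refine ((hf2.comp ((hy.of_le (Nat.le_succ k)).mono hδ)).clm_mul hu2).mono ?_
    have h1 := one_le_compConst (D := 1) zero_le_one k
    have h2 : compConst 1 k ≤ compConst 1 (k + 1) := by
      simp only [compConst]
      have : (1:ℝ) ≤ 2 ^ k := one_le_pow₀ (by norm_num)
      nlinarith
    have h3 : (2:ℝ) ^ k ≤ 2 ^ (k + 1) := pow_le_pow_right₀ (by norm_num) (Nat.le_succ k)
    calc (2:ℝ) ^ k * (compConst 1 k * K * δ) = 2 ^ k * compConst 1 k * (K * δ) := by ring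
      _ ≤ 2 ^ (k + 1) * compConst 1 (k + 1) * (K * δ) := by gcongr
      _ = _ := by ring

theorem DB.graph {k : ℕ} {δ : ℝ} {y : X → Y} (hy : DB k δ y) (hδ : δ ≤ 1) :
    DB k 2 (fun x => (x, y x)) := by
  have h1 : DB k 1 (fun x : X => ContinuousLinearMap.inl ℝ X Y x) :=
    (DB.clm _).mono (ContinuousLinearMap.norm_inl_le_one ℝ X Y)
  have h2 : DB k 1 (fun x : X => ContinuousLinearMap.inr ℝ X Y (y x)) := by
    cases k with
    | zero => exact db_zero_iff.2 ((ContinuousLinearMap.inr ℝ X Y).continuous.comp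
        (db_zero_iff.1 hy))
    | succ k =>
      refine (hy.clm_comp _).mono ?_
      have := mul_le_mul (ContinuousLinearMap.norm_inr_le_one ℝ X Y) hδ hy.nonneg zero_le_one
      linarith
  have h3 := h1.add h2
  simp only [ContinuousLinearMap.inl_apply, ContinuousLinearMap.inr_apply, Prod.mk_add_mk,
    add_zero, zero_add] at h3
  exact h3.mono (by norm_num)

/-- The assumptions on the perturbation of a skew map of `X × Y` near the invariant set `y = 0`. -/
structure GraphData (k : ℕ) (K κ : ℝ) (φ : Y → X) (T : Y → Y) (R₁ : X × Y → X)
    (R₂ : X × Y → Y) : Prop where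
  base : DB (k + 1) K φ
  diff : Differentiable ℝ T
  zero : T 0 = 0
  fderiv_zero : fderiv ℝ T 0 = 0
  fibre : BC (k + 1) K (fderiv ℝ T)
  rem₁ : BC (k + 1) κ R₁
  rem₂ : BC (k + 1) κ R₂

variable {k : ℕ} {K κ δ : ℝ} {φ : Y → X} {T : Y → Y} {R₁ : X × Y → X} {R₂ : X × Y → Y}

theorem GraphData.norm_fderiv_le (h : GraphData k K κ φ T R₁ R₂) (v : Y) :
    ‖fderiv ℝ T v‖ ≤ K * ‖v‖ := by
  have := h.fibre.db.lipschitz (by omega) v 0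
  simpa [h.fderiv_zero] using this

theorem GraphData.lipschitz (h : GraphData k K κ φ T R₁ R₂) {u v : Y} (hu : ‖u‖ ≤ δ)
    (hv : ‖v‖ ≤ δ) : ‖T u - T v‖ ≤ K * δ * ‖u - v‖ := by
  have hK := h.fibre.nonneg
  refine Convex.norm_image_sub_le_of_norm_fderiv_le (s := Metric.closedBall 0 δ)
    (fun z _ => h.diff z) (fun z hz => (h.norm_fderiv_le z).trans ?_)
    (convex_closedBall 0 δ) (by simpa using hv) (by simpa using hu)
  exact mul_le_mul_of_nonneg_left (by simpa using hz) hK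

/-- The constant in the estimates of the data of the invariance equation. -/
def graphConst (k : ℕ) (K : ℝ) : ℝ :=
  2 ^ (k + 1) * compConst 1 (k + 1) * (1 + K) * (2 ^ (k + 1) * (1 + compConst 2 (k + 1)))

theorem graphConst_ge (k : ℕ) (hK : 0 ≤ K) : 2 ^ (k + 1) * compConst 1 (k + 1) * K ≤ graphConst k K ∧
    2 ^ (k + 1) * (2 ^ k * compConst 1 k * K) ≤ graphConst k K ∧ K ≤ graphConst k K ∧
    compConst 2 (k + 1) ≤ graphConst k K := by
  have h1 := one_le_compConst (D := 1) zero_le_one k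
  have h1' := one_le_compConst (D := 1) zero_le_one (k + 1)
  have h2 := one_le_compConst (D := 2) zero_le_two (k + 1)
  have h3 : (1:ℝ) ≤ 2 ^ (k + 1) := one_le_pow₀ (by norm_num)
  have h6 : (2:ℝ) ^ k ≤ 2 ^ (k + 1) := pow_le_pow_right₀ (by norm_num) (Nat.le_succ k)
  have h5 : compConst 1 k ≤ compConst 1 (k + 1) := by
      simp only [compConst]
      have : (1:ℝ) ≤ 2 ^ k := one_le_pow₀ (by norm_num)
      nlinarith
  have hA : (1:ℝ) ≤ 2 ^ (k + 1) * compConst 1 (k + 1) := one_le_mul_of_one_le_of_one_le h3 h1'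
  have hB : 1 + compConst 2 (k + 1) ≤ 2 ^ (k + 1) * (1 + compConst 2 (k + 1)) :=
    le_mul_of_one_le_left (by linarith) h3
  have hB' : (2:ℝ) ^ (k + 1) ≤ 2 ^ (k + 1) * (1 + compConst 2 (k + 1)) :=
    le_mul_of_one_le_right (by positivity) (by linarith)
  set A : ℝ := 2 ^ (k + 1) * compConst 1 (k + 1)
  set B : ℝ := 2 ^ (k + 1) * (1 + compConst 2 (k + 1))
  have hg : graphConst k K = A * (1 + K) * B := rfl
  have hAK : A * K ≤ A * (1 + K) := by nlinarith
  have hB1 : 1 ≤ B := h3.trans hB'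
  have hA1 : 0 ≤ A * (1 + K) := by positivity
  rw [hg]
  refine ⟨?_, ?_, ?_, ?_⟩
  · exact hAK.trans (le_mul_of_one_le_right hA1 hB1)
  · have : (2:ℝ) ^ k * compConst 1 k * K ≤ A * (1 + K) := by
      refine le_trans ?_ hAK
      exact mul_le_mul_of_nonneg_right (mul_le_mul h6 h5 (by linarith) (by positivity)) hK
    calc _ ≤ B * (A * (1 + K)) := mul_le_mul hB' this (by positivity) (by linarith)
      _ = _ := by ring
  · have : K ≤ A * (1 + K) := by nlinarith
    exact this.trans (le_mul_of_one_le_right hA1 hB1)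
  · have : 1 ≤ A * (1 + K) := by nlinarith
    calc compConst 2 (k + 1) ≤ B := by linarith
      _ ≤ _ := le_mul_of_one_le_left (by linarith) this

/-- The translation `ω` is not small, but it is constant and disappears from the derivatives; hence
`DB` and not `BC`. -/
theorem GraphData.base_bound (h : GraphData k K κ φ T R₁ R₂) {y : X → Y} (hy : BC (k + 1) δ y)
    (hδ : δ ≤ 1) {e : ℝ} (he : 0 ≤ e) (ω : X) :
    DB (k + 1) (e * (graphConst k K * (δ + κ)))
      (fun x => ω + e • (φ (y x) + R₁ (x, y x))) := by
  have hK := h.fibre.nonneg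
  have hκ := h.rem₁.nonneg
  have hδ0 := hy.nonneg
  obtain ⟨g1, g2, g3, g4⟩ := graphConst_ge k hK
  have h1 := h.base.comp_small hy.db hδ hK hδ0
  have h2 := h.rem₁.comp (hy.db.graph hδ)
  have h3 := (DB.const le_rfl ω).add (((h1.add h2.db).smul e))
  refine h3.mono ?_
  rw [zero_add, abs_of_nonneg he]
  refine mul_le_mul_of_nonneg_left ?_ he
  nlinarith

/-- `T` vanishes to second order at zero: both factors of `D(T ∘ y) = DT(y) Dy` are `O(δ)`. The
resulting `δ ^ 2 + κ` is what allows the iteration to map a ball of radius `δ` into itself. -/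
theorem GraphData.fibre_bound (h : GraphData k K κ φ T R₁ R₂) {y : X → Y} (hy : BC (k + 1) δ y)
    (hδ : δ ≤ 1) {e : ℝ} (he : 0 ≤ e) :
    BC (k + 1) (e * (2 * graphConst k K * (δ ^ 2 + κ))) (fun x => e • (T (y x) + R₂ (x, y x))) := by
  have hK := h.fibre.nonneg
  have hκ := h.rem₂.nonneg
  have hδ0 := hy.nonneg
  obtain ⟨g1, g2, g3, g4⟩ := graphConst_ge k hK
  have hy0 : ∀ x, ‖y x‖ ≤ δ := hy.norm_le
  obtain ⟨hy1, hy2⟩ := db_succ_iff.1 hy.db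
  have h1 : BC k (2 ^ k * compConst 1 k * K * δ) (fun x => fderiv ℝ T (y x)) := by
    refine BC.of_db ((h.fibre.of_le (Nat.le_succ k)).db.comp_small
      (hy.db.of_le (Nat.le_succ k)) hδ hK hδ0) fun x => ?_
    refine (h.norm_fderiv_le _).trans ?_
    have : (1:ℝ) ≤ 2 ^ k * compConst 1 k := one_le_mul_of_one_le_of_one_le
      (one_le_pow₀ (by norm_num)) (one_le_compConst zero_le_one k)
    calc K * ‖y x‖ ≤ K * δ := mul_le_mul_of_nonneg_left (hy0 x) hK
      _ ≤ (2 ^ k * compConst 1 k) * (K * δ) := le_mul_of_one_le_left (by positivity) this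
      _ = _ := by ring
  have hT : BC (k + 1) (graphConst k K * δ ^ 2) (fun x => T (y x)) := by
    refine bc_succ_iff.2 ⟨h.diff.comp hy1, fun x => ?_, ?_⟩
    · have := h.lipschitz (hy0 x) (v := 0) (by simpa using hδ0)
      rw [h.zero, sub_zero, sub_zero] at this
      refine this.trans ?_
      calc K * δ * ‖y x‖ ≤ K * δ * δ := mul_le_mul_of_nonneg_left (hy0 x) (by positivity)
        _ ≤ _ := by nlinarith [sq_nonneg δ]
    · have : fderiv ℝ (fun x => T (y x)) = fun x => (fderiv ℝ T (y x)).comp (fderiv ℝ y x) := by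
        ext1 x; exact fderiv_comp x (h.diff _) (hy1 x)
      rw [this]
      refine (h1.clm_mul hy2).mono ?_
      calc (2:ℝ) ^ k * (2 ^ k * compConst 1 k * K * δ * δ)
          = 2 ^ k * (2 ^ k * compConst 1 k * K) * δ ^ 2 := by ring
        _ ≤ graphConst k K * δ ^ 2 := by
          refine mul_le_mul_of_nonneg_right (le_trans ?_ g2) (sq_nonneg δ)
          have := one_le_compConst (D := 1) zero_le_one k
          refine mul_le_mul_of_nonneg_right ?_ (by positivity)
          exact pow_le_pow_right₀ (by norm_num) (Nat.le_succ k)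
  have h2 := h.rem₂.comp (hy.db.graph hδ)
  refine ((hT.add h2).smul e).mono ?_
  rw [abs_of_nonneg he]
  refine mul_le_mul_of_nonneg_left ?_ he
  have : compConst 2 (k + 1) * κ ≤ graphConst k K * κ := mul_le_mul_of_nonneg_right g4 hκ
  have hg0 : 0 ≤ graphConst k K := hK.trans g3
  nlinarith [mul_nonneg hg0 hκ, mul_nonneg hg0 (sq_nonneg δ)]

theorem GraphData.base_sub (h : GraphData k K κ φ T R₁ R₂) (x : X) (u v : Y) :
    ‖(φ u + R₁ (x, u)) - (φ v + R₁ (x, v))‖ ≤ (K + κ) * ‖u - v‖ := by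
  have h1 := h.base.lipschitz (by omega) u v
  have h2 := h.rem₁.db.lipschitz (by omega) (x, u) (x, v)
  rw [Prod.mk_sub_mk, sub_self, Prod.norm_mk, norm_zero, max_eq_right (norm_nonneg _)] at h2
  rw [add_sub_add_comm, add_mul]
  exact (norm_add_le _ _).trans (add_le_add h1 h2)

theorem GraphData.fibre_sub (h : GraphData k K κ φ T R₁ R₂) (x : X) {u v : Y} (hu : ‖u‖ ≤ δ)
    (hv : ‖v‖ ≤ δ) :
    ‖(T u + R₂ (x, u)) - (T v + R₂ (x, v))‖ ≤ (K * δ + κ) * ‖u - v‖ := by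
  have h1 := h.lipschitz hu hv
  have h2 := h.rem₂.db.lipschitz (by omega) (x, u) (x, v)
  rw [Prod.mk_sub_mk, sub_self, Prod.norm_mk, norm_zero, max_eq_right (norm_nonneg _)] at h2
  rw [add_sub_add_comm, add_mul]
  exact (norm_add_le _ _).trans (add_le_add h1 h2)

variable [CompleteSpace X] [CompleteSpace Y]

/-- One step of the iteration for the invariance equation. -/
theorem GraphData.exists_step {Λ Λi P : Y →L[ℝ] Y} {K' c e : ℝ}
    (h : GraphData k K κ φ T R₁ R₂) (hc : 0 < c) (he : 0 < e) (hce : c * e ≤ 1) (he1 : e ≤ 1)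
    (hΛ : HypDich Λ Λi P K' (c * e)) (hδ : δ ≤ 1)
    (h1 : 2 ^ (k + 2) * ((1 + nearConst (k + 1)) * (graphConst k K * (δ + κ))) ≤ 1)
    (h2 : nearConst (k + 1) * (2 * (1 + nearConst (k + 1)) * (graphConst k K * (δ + κ))) ≤ c / 2)
    (h3 : 8 * K' / c * (2 * graphConst k K * (δ ^ 2 + κ)) ≤ δ) (ω : X) {y : X → Y}
    (hy : BC (k + 1) δ y) :
    ∃ z : X → Y, BC (k + 1) δ z ∧
      (∃ q : X → X, ∀ x, q x + (ω + e • (φ (y (q x)) + R₁ (q x, y (q x)))) = x) ∧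
      ∀ x, z (x + (ω + e • (φ (y x) + R₁ (x, y x)))) = Λ (z x) + e • (T (y x) + R₂ (x, y x)) := by
  have hK := h.fibre.nonneg
  have hκ := h.rem₂.nonneg
  have hδ0 := hy.nonneg
  have hn := nearConst_nonneg (k + 1)
  have hg0 : 0 ≤ graphConst k K := hK.trans (graphConst_ge k hK).2.2.1
  have hπ := h.base_bound hy hδ he.le ω
  set s := graphConst k K * (δ + κ) with hs
  have hs0 : 0 ≤ s := by positivity
  have hsm : 2 ^ (k + 1 + 1) * ((1 + nearConst (k + 1)) * (e * s)) ≤ 1 := by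
    refine le_trans ?_ h1
    refine mul_le_mul_of_nonneg_left (mul_le_mul_of_nonneg_left ?_ (by linarith)) (by positivity)
    nlinarith
  -- The base map is frozen at the given `y` and inverted.
  obtain ⟨ψ, hψ1, hψ2, hψ3⟩ := exists_inverse_near (by omega) (by positivity) hsm hπ
  have hpow : (2:ℝ) ^ 1 ≤ 2 ^ (k + 1 + 1) := pow_le_pow_right₀ (by norm_num) (by omega)
  have hκ1 : 2 * (1 + nearConst (k + 1)) * (e * s) ≤ 1 := by
    refine le_trans ?_ hsm
    rw [mul_assoc]
    refine mul_le_mul_of_nonneg_right (by linarith) (by positivity)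
  -- Solving the linear equation divides by the rate `c * e`, while the right-hand side carries a
  -- factor `e`; the estimate is therefore uniform in `e`.
  obtain ⟨z, hz1, hz2⟩ := hΛ.exists_solution (by positivity) hce (by positivity) hκ1 (by
      calc nearConst (k + 1) * (2 * (1 + nearConst (k + 1)) * (e * s))
          = e * (nearConst (k + 1) * (2 * (1 + nearConst (k + 1)) * s)) := by ring
        _ ≤ e * (c / 2) := mul_le_mul_of_nonneg_left h2 he.le
        _ = _ := by ring)
    (hπ.mono (by
      have : 0 ≤ e * s := by positivity
      nlinarith)) hψ3 hψ2 (h.fibre_bound hy hδ he.le)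
  refine ⟨z, hz1.mono (le_trans (le_of_eq ?_) h3), ⟨fun x => x - ψ x, hψ1⟩, hz2⟩
  field_simp

/-- A perturbed hyperbolic skew map has an invariant graph. -/
theorem GraphData.exists_invariant {Λ Λi P : Y →L[ℝ] Y} {K' c e : ℝ}
    (h : GraphData k K κ φ T R₁ R₂) (hc : 0 < c) (he : 0 < e) (hce : c * e ≤ 1) (he1 : e ≤ 1)
    (hΛ : HypDich Λ Λi P K' (c * e)) (hδ0 : 0 ≤ δ) (hδ : δ ≤ 1)
    (h1 : 2 ^ (k + 2) * ((1 + nearConst (k + 1)) * (graphConst k K * (δ + κ))) ≤ 1)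
    (h2 : nearConst (k + 1) * (2 * (1 + nearConst (k + 1)) * (graphConst k K * (δ + κ))) ≤ c / 2)
    (h3 : 8 * K' / c * (2 * graphConst k K * (δ ^ 2 + κ)) ≤ δ)
    (h4 : 2 * K' / c * (K * δ + κ + δ * (K + κ)) ≤ 1 / 2)
    (h5 : K * δ + 2 * κ < 1) (ω : X) :
    ∃ y : X → Y, ContDiff ℝ k y ∧ (∀ x, ‖y x‖ ≤ δ) ∧
      (∀ t : X, (∀ x v, R₁ (x + t, v) = R₁ (x, v)) → (∀ x v, R₂ (x + t, v) = R₂ (x, v)) →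
        ∀ x, y (x + t) = y x) ∧
      Function.Bijective (fun x => x + (ω + e • (φ (y x) + R₁ (x, y x)))) ∧
      ∀ x, y (x + (ω + e • (φ (y x) + R₁ (x, y x)))) =
        Λ (y x) + e • (T (y x) + R₂ (x, y x)) := by
  have hK := h.fibre.nonneg
  have hκ := h.rem₂.nonneg
  have hK' := hΛ.nonneg
  -- `S` is the iteration: it returns a solution of the linear equation with base map and nonlinear
  -- terms frozen at `y`.
  choose! S hS1 hS2 hS3 using fun (y : X → Y) (hy : BC (k + 1) δ y) =>
    h.exists_step hc he hce he1 hΛ hδ h1 h2 h3 ω hy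
  set π : (X → Y) → X → X := fun y x => ω + e • (φ (y x) + R₁ (x, y x)) with hπ
  set Y' : ℕ → X → Y := fun n => S^[n] (fun _ => 0) with hY'
  have hsucc : ∀ n, Y' (n + 1) = S (Y' n) := fun n => Function.iterate_succ_apply' S n _
  have hB : ∀ n, BC (k + 1) δ (Y' n) := by
    intro n
    induction n with
    | zero => exact BC.zero hδ0
    | succ n ih => rw [hsucc]; exact hS1 _ ih
  have heq : ∀ n x, Y' (n + 1) (x + π (Y' n) x) =
      Λ (Y' (n + 1) x) + e • (T (Y' n x) + R₂ (x, Y' n x)) := fun n x => by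
    rw [hsucc]; exact hS3 _ (hB n) x
  have hce0 : 0 < c * e := by positivity
  -- contraction
  have hcontr : ∀ n d, (∀ x, ‖Y' (n + 1) x - Y' n x‖ ≤ d) →
      ∀ x, ‖Y' (n + 2) x - Y' (n + 1) x‖ ≤ d / 2 := by
    intro n d hd x
    have hd0 : 0 ≤ d := (norm_nonneg _).trans (hd x)
    obtain ⟨q, hq⟩ := hS2 _ (hB (n + 1))
    -- Consecutive iterates satisfy equations over different base maps. The difference is written
    -- over that of `Y' (n + 1)`; the resulting shift in the argument of `Y' (n + 1)` goes into `g`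
    -- and is estimated by its Lipschitz constant `δ`.
    have key := hΛ.norm_le (p := fun x => x + π (Y' (n + 1)) x) (q := q) hce0 hce hq
      (z := fun x => Y' (n + 2) x - Y' (n + 1) x) (M := δ + δ)
      (g := fun x => (e • (T (Y' (n + 1) x) + R₂ (x, Y' (n + 1) x)) -
          e • (T (Y' n x) + R₂ (x, Y' n x))) -
        (Y' (n + 1) (x + π (Y' (n + 1)) x) - Y' (n + 1) (x + π (Y' n) x)))
      (γ := e * ((K * δ + κ + δ * (K + κ)) * d)) ?_ ?_ ?_ x
    · refine key.trans ?_
      calc 2 * K' * (e * ((K * δ + κ + δ * (K + κ)) * d)) / (c * e)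
          = (2 * K' / c * (K * δ + κ + δ * (K + κ))) * d := by field_simp
        _ ≤ 1 / 2 * d := mul_le_mul_of_nonneg_right h4 hd0
        _ = d / 2 := by ring
    · intro x
      exact (norm_sub_le _ _).trans (add_le_add ((hB _).norm_le x) ((hB _).norm_le x))
    · intro x
      refine (norm_sub_le _ _).trans ?_
      have e1 : ‖e • (T (Y' (n + 1) x) + R₂ (x, Y' (n + 1) x)) -
          e • (T (Y' n x) + R₂ (x, Y' n x))‖ ≤ e * ((K * δ + κ) * d) := by
        rw [← smul_sub, norm_smul, Real.norm_of_nonneg he.le]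
        refine mul_le_mul_of_nonneg_left ?_ he.le
        refine (h.fibre_sub x ((hB _).norm_le x) ((hB _).norm_le x)).trans ?_
        exact mul_le_mul_of_nonneg_left (hd x) (by positivity)
      have e2 : ‖Y' (n + 1) (x + π (Y' (n + 1)) x) - Y' (n + 1) (x + π (Y' n) x)‖ ≤
          δ * (e * ((K + κ) * d)) := by
        refine ((hB (n + 1)).db.lipschitz (by omega) _ _).trans ?_
        refine mul_le_mul_of_nonneg_left ?_ hδ0
        rw [add_sub_add_left_eq_sub, hπ]
        simp only
        rw [add_sub_add_left_eq_sub, ← smul_sub, norm_smul, Real.norm_of_nonneg he.le]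
        refine mul_le_mul_of_nonneg_left ?_ he.le
        refine (h.base_sub x _ _).trans ?_
        exact mul_le_mul_of_nonneg_left (hd x) (by positivity)
      refine (add_le_add e1 e2).trans (le_of_eq (by ring))
    · intro x
      have a1 := heq (n + 1) x
      have a2 := heq n x
      simp only [map_sub]
      rw [a1, a2]
      abel
  have hgeo : ∀ n x, ‖Y' (n + 1) x - Y' n x‖ ≤ 2 * δ * (1 / 2) ^ n := by
    intro n
    induction n with
    | zero =>
      intro x
      refine (norm_sub_le _ _).trans ?_
      have := (hB (0 + 1)).norm_le x
      have := (hB 0).norm_le x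
      simp only [pow_zero]
      linarith
    | succ n ih =>
      intro x
      refine (hcontr n _ ih x).trans (le_of_eq ?_)
      rw [pow_succ]; ring
  have hdist : ∀ x n, dist (Y' n x) (Y' (n + 1) x) ≤ 2 * δ * (1 / 2) ^ n := fun x n => by
    rw [dist_comm, dist_eq_norm]; exact hgeo n x
  choose y hy using fun x => cauchySeq_tendsto_of_complete
    (cauchySeq_of_le_geometric (1 / 2) (2 * δ) (by norm_num) (hdist x))
  have hyd : ∀ n x, dist (Y' n x) (y x) ≤ 2 * δ * (1 / 2) ^ n / (1 - 1 / 2) := fun n x =>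
    dist_le_of_le_geometric_of_tendsto (1 / 2) (2 * δ) (by norm_num) (hdist x) (hy x) n
  have hunif : TendstoUniformly Y' y atTop := by
    rw [Metric.tendstoUniformly_iff]
    intro ε hε
    have hlim : Tendsto (fun n : ℕ => 2 * δ * (1 / 2 : ℝ) ^ n / (1 - 1 / 2)) atTop
        (𝓝 (2 * δ * 0 / (1 - 1 / 2))) :=
      ((tendsto_pow_atTop_nhds_zero_of_lt_one (by norm_num) (by norm_num)).const_mul _).div_const _
    rw [mul_zero, zero_div] at hlim
    filter_upwards [hlim.eventually_lt_const hε] with n hn x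
    rw [dist_comm]
    exact (hyd n x).trans_lt hn
  -- The contraction holds only in the sup norm; the uniform `C^(k+1)` bound turns it into a `C^k`
  -- limit.
  have hyc : ContDiff ℝ k y := contDiff_of_tendstoUniformly hB hunif
  have hyn : ∀ x, ‖y x‖ ≤ δ := fun x =>
    le_of_tendsto (hy x).norm (Eventually.of_forall fun n => (hB n).norm_le x)
  have hyl : ∀ x x', ‖y x - y x'‖ ≤ δ * ‖x - x'‖ := fun x x' =>
    le_of_tendsto ((hy x).sub (hy x')).norm
      (Eventually.of_forall fun n => (hB n).db.lipschitz (by omega) x x')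
  have hπy : ∀ x, Tendsto (fun n => x + π (Y' n) x) atTop (𝓝 (x + π y x)) := by
    intro x
    have c1 := (h.base.contDiff.continuous.tendsto (y x)).comp (hy x)
    have c2 := (h.rem₁.contDiff.continuous.tendsto (x, y x)).comp
      ((tendsto_const_nhds (x := x)).prodMk_nhds (hy x))
    exact (((c1.add c2).const_smul e).const_add ω).const_add x
  refine ⟨y, hyc, hyn, ?_, ?_, ?_⟩
  · intro t ht1 ht2 x
    have hper : ∀ n x, Y' n (x + t) = Y' n x := by
      intro n
      induction n with
      | zero => intro x; rfl
      | succ n ih =>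
        intro x
        obtain ⟨q, hq⟩ := hS2 _ (hB n)
        have hπt : ∀ x, π (Y' n) (x + t) = π (Y' n) x := fun x => by
          simp only [hπ, ih, ht1]
        -- The translate by a common period solves the same linear equation, and bounded solutions
        -- are unique.
        have key := hΛ.norm_le (p := fun x => x + π (Y' n) x) (q := q) hce0 hce hq
          (z := fun x => Y' (n + 1) (x + t) - Y' (n + 1) x) (M := δ + δ)
          (g := fun _ => 0) (γ := 0) ?_ (by simp) ?_ x
        · rw [mul_zero, zero_div] at key
          exact sub_eq_zero.1 (norm_le_zero_iff.1 key)
        · intro x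
          exact (norm_sub_le _ _).trans (add_le_add ((hB _).norm_le _) ((hB _).norm_le x))
        · intro x
          have a1 := heq n (x + t)
          have a2 := heq n x
          rw [hπt, ih, ht2, add_right_comm] at a1
          rw [a1, a2, map_sub]
          abel
    refine tendsto_nhds_unique (hy (x + t)) ?_
    simpa only [hper] using hy x
  -- For `k = 0` the limit is only Lipschitz, so bijectivity is taken from a Lipschitz estimate and
  -- not from derivatives.
  · obtain ⟨E, hE⟩ := exists_homeomorph_add (X := X) (κ := K * δ + 2 * κ) (π := π y)
      (by positivity) h5 (fun x x' => by
        have d1 := h.base.lipschitz (by omega) (y x) (y x')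
        have d2 := h.rem₁.db.lipschitz (by omega) (x, y x) (x', y x')
        rw [Prod.mk_sub_mk, Prod.norm_mk] at d2
        have d3 : max ‖x - x'‖ ‖y x - y x'‖ ≤ ‖x - x'‖ :=
          max_le le_rfl ((hyl x x').trans (mul_le_of_le_one_left (norm_nonneg _) hδ))
        have d4 := hyl x x'
        change ‖(ω + e • (φ (y x) + R₁ (x, y x))) - (ω + e • (φ (y x') + R₁ (x', y x')))‖ ≤ _
        rw [add_sub_add_left_eq_sub, ← smul_sub, norm_smul, Real.norm_of_nonneg he.le,
          add_sub_add_comm]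
        refine (mul_le_of_le_one_left (norm_nonneg _) he1).trans ?_
        refine (norm_add_le _ _).trans ?_
        have d5 : K * ‖y x - y x'‖ ≤ K * (δ * ‖x - x'‖) := mul_le_mul_of_nonneg_left d4 hK
        have d6 : κ * max ‖x - x'‖ ‖y x - y x'‖ ≤ κ * ‖x - x'‖ :=
          mul_le_mul_of_nonneg_left d3 hκ
        have : 0 ≤ κ * ‖x - x'‖ := by positivity
        linarith)
    have : (fun x => x + π y x) = E := funext fun x => (hE x).symm
    change Function.Bijective (fun x => x + π y x)
    rw [this]
    exact E.bijective
  · intro x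
    -- The iterates are evaluated at moving points, so pointwise convergence would not suffice.
    have hunif' : TendstoUniformly (fun n => Y' (n + 1)) y atTop := fun u hu =>
      (tendsto_add_atTop_nat 1).eventually (hunif u hu)
    have l1 : Tendsto (fun n => Y' (n + 1) (x + π (Y' n) x)) atTop (𝓝 (y (x + π y x))) :=
      hunif'.tendsto_comp hyc.continuous.continuousAt (hπy x)
    have l2 : Tendsto (fun n => Λ (Y' (n + 1) x) + e • (T (Y' n x) + R₂ (x, Y' n x))) atTop
        (𝓝 (Λ (y x) + e • (T (y x) + R₂ (x, y x)))) := by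
      have c1 := (h.diff.continuous.tendsto (y x)).comp (hy x)
      have c2 := (h.rem₂.contDiff.continuous.tendsto (x, y x)).comp
        ((tendsto_const_nhds (x := x)).prodMk_nhds (hy x))
      exact ((Λ.continuous.tendsto (y x)).comp ((tendsto_add_atTop_iff_nat 1).2 (hy x))).add
        ((c1.add c2).const_smul e)
    simp only [heq] at l1
    exact tendsto_nhds_unique l1 l2

end InvariantGraph

end PhaseLocking

end

noncomputable section

namespace PhaseLocking

/-! ### Absolutely summable trigonometric series with weights. -/

section FourierSeries

variable {d : ℕ}

theorem expChar_add (s t : ℝ) : expChar (s + t) = expChar s * expChar t := by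
  simp only [expChar, ← Complex.exp_add]
  congr 1
  push_cast
  ring

theorem expChar_zero : expChar 0 = 1 := by simp [expChar]

theorem expChar_intCast (n : ℤ) : expChar n = 1 := by
  rw [expChar, ← Complex.exp_int_mul_two_pi_mul_I n]
  congr 1
  push_cast
  ring

theorem norm_expChar (t : ℝ) : ‖expChar t‖ = 1 := by
  have : 2 * (Real.pi : ℂ) * Complex.I * t = ((2 * Real.pi * t : ℝ) : ℂ) * Complex.I := by
    push_cast; ring
  rw [expChar, this, Complex.norm_exp_ofReal_mul_I]

theorem expChar_neg (t : ℝ) : expChar (-t) = starRingEnd ℂ (expChar t) := by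
  rw [expChar, expChar, ← Complex.exp_conj]
  congr 1
  simp only [map_mul, Complex.conj_ofReal, Complex.conj_I, map_ofNat]
  push_cast
  ring

theorem hasDerivAt_expChar (t : ℝ) :
    HasDerivAt expChar (2 * Real.pi * Complex.I * expChar t) t := by
  have h1 : HasDerivAt (fun s : ℝ => 2 * (Real.pi : ℂ) * Complex.I * (s : ℂ))
      (2 * Real.pi * Complex.I * 1) t :=
    (Complex.ofRealCLM.hasDerivAt (x := t)).const_mul _
  have h2 := h1.cexp
  refine h2.congr_deriv ?_
  simp only [expChar]
  ring

theorem continuous_expChar : Continuous expChar :=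
  continuous_iff_continuousAt.2 fun t => (hasDerivAt_expChar t).continuousAt

theorem pairing_add (k : Fin d → ℤ) (x y : Fin d → ℝ) :
    pairing k (x + y) = pairing k x + pairing k y := by
  simp only [pairing, Pi.add_apply, mul_add, Finset.sum_add_distrib]

theorem pairing_add_left (k l : Fin d → ℤ) (x : Fin d → ℝ) :
    pairing (k + l) x = pairing k x + pairing l x := by
  simp only [pairing, Pi.add_apply, Int.cast_add, add_mul, Finset.sum_add_distrib]

theorem pairing_neg_left (k : Fin d → ℤ) (x : Fin d → ℝ) : pairing (-k) x = -pairing k x := by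
  simp only [pairing, Pi.neg_apply, Int.cast_neg, neg_mul, Finset.sum_neg_distrib]

theorem pairing_intVec (k m : Fin d → ℤ) : pairing k (intVec m) = ((∑ i, k i * m i : ℤ) : ℝ) := by
  simp [pairing, intVec]

/-- The pairing with an integer vector as a continuous linear map. -/
def pairingCLM (k : Fin d → ℤ) : (Fin d → ℝ) →L[ℝ] ℝ :=
  ∑ i, (k i : ℝ) • ContinuousLinearMap.proj i

theorem pairingCLM_apply (k : Fin d → ℤ) (x : Fin d → ℝ) : pairingCLM k x = pairing k x := by
  simp [pairingCLM, pairing]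

theorem continuous_pairing (k : Fin d → ℤ) : Continuous (pairing k) := by
  have : pairing k = fun x => pairingCLM k x := funext fun x => (pairingCLM_apply k x).symm
  rw [this]; exact (pairingCLM k).continuous

theorem abs_le_norm_int (k : Fin d → ℤ) (i : Fin d) : |(k i : ℝ)| ≤ ‖k‖ := by
  have := norm_le_pi_norm k i
  rwa [Int.norm_eq_abs] at this

theorem norm_pairingCLM_le (k : Fin d → ℤ) : ‖pairingCLM k‖ ≤ d * ‖k‖ := by
  refine ContinuousLinearMap.opNorm_le_bound _ (by positivity) fun x => ?_
  rw [pairingCLM_apply, pairing]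
  calc ‖∑ i, (k i : ℝ) * x i‖ ≤ ∑ _i : Fin d, ‖k‖ * ‖x‖ := by
        refine norm_sum_le_of_le _ fun i _ => ?_
        rw [norm_mul]
        exact mul_le_mul (abs_le_norm_int k i) (norm_le_pi_norm x i) (norm_nonneg _) (norm_nonneg _)
    _ = _ := by simp; ring

/-- The partial derivative `∂ᵢu`. -/
def pd {E : Type} [NormedAddCommGroup E] [NormedSpace ℝ E] (i : Fin d) (u : (Fin d → ℝ) → E) :
    (Fin d → ℝ) → E :=
  fun x => fderiv ℝ u x (Pi.single i 1)

/-- `U` is the sum of a trigonometric series whose coefficients are absolutely summable with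
weight `(1 + |k|)^s`. -/
def WAC (s : ℝ) (U : (Fin d → ℝ) → ℂ) : Prop :=
  ∃ (ι : Type) (c : ι → ℂ) (κ : ι → Fin d → ℤ), Summable (fun i => (1 + ‖κ i‖) ^ s * ‖c i‖) ∧
    ∀ x, HasSum (fun i => c i * expChar (pairing (κ i) x)) (U x)

/-- The real-valued functions whose Fourier coefficients are absolutely summable with weight
`(1 + |k|)^s`. -/
def WA (s : ℝ) (u : (Fin d → ℝ) → ℝ) : Prop := WAC s (fun x => (u x : ℂ))

theorem one_le_weight {s : ℝ} (hs : 0 ≤ s) (k : Fin d → ℤ) : 1 ≤ (1 + ‖k‖) ^ s :=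
  Real.one_le_rpow (by linarith [norm_nonneg k]) hs

variable {s : ℝ} {U V : (Fin d → ℝ) → ℂ} {u v : (Fin d → ℝ) → ℝ}

theorem summable_of_weight (hs : 0 ≤ s) {ι : Type} {c : ι → ℂ} {κ : ι → Fin d → ℤ}
    (h : Summable (fun i => (1 + ‖κ i‖) ^ s * ‖c i‖)) : Summable fun i => ‖c i‖ :=
  Summable.of_nonneg_of_le (fun _ => norm_nonneg _)
    (fun _ => le_mul_of_one_le_left (norm_nonneg _) (one_le_weight hs _)) h

theorem WAC.mono {s' : ℝ} (h : WAC s U) (hs : s' ≤ s) : WAC s' U := by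
  obtain ⟨ι, c, κ, h1, h2⟩ := h
  refine ⟨ι, c, κ, Summable.of_nonneg_of_le (fun _ => by positivity) (fun i => ?_) h1, h2⟩
  refine mul_le_mul_of_nonneg_right ?_ (norm_nonneg _)
  exact Real.rpow_le_rpow_of_exponent_le (by linarith [norm_nonneg (κ i)]) hs

theorem WAC.add (hU : WAC s U) (hV : WAC s V) : WAC s (fun x => U x + V x) := by
  obtain ⟨ι, c, κ, h1, h2⟩ := hU
  obtain ⟨ι', c', κ', h1', h2'⟩ := hV
  refine ⟨ι ⊕ ι', Sum.elim c c', Sum.elim κ κ', ?_, fun x => ?_⟩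
  · exact Summable.sum (f := fun i => (1 + ‖Sum.elim κ κ' i‖) ^ s * ‖Sum.elim c c' i‖) h1 h1'
  · exact HasSum.sum (f := fun i => Sum.elim c c' i * expChar (pairing (Sum.elim κ κ' i) x))
      (h2 x) (h2' x)

theorem WAC.const_mul (a : ℂ) (hU : WAC s U) : WAC s (fun x => a * U x) := by
  obtain ⟨ι, c, κ, h1, h2⟩ := hU
  refine ⟨ι, fun i => a * c i, κ, ?_, fun x => ?_⟩
  · refine (h1.mul_left ‖a‖).congr fun i => ?_
    rw [norm_mul]; ring
  · refine ((h2 x).mul_left a).congr_fun fun i => ?_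
    ring

theorem WAC.conj (hU : WAC s U) : WAC s (fun x => starRingEnd ℂ (U x)) := by
  obtain ⟨ι, c, κ, h1, h2⟩ := hU
  refine ⟨ι, fun i => starRingEnd ℂ (c i), fun i => -κ i, ?_, fun x => ?_⟩
  · simpa using h1
  · have := (Complex.hasSum_conj' (f := fun i => c i * expChar (pairing (κ i) x))).2 (h2 x)
    refine this.congr_fun fun i => ?_
    rw [pairing_neg_left, expChar_neg, map_mul]

/-- Equal frequencies need not be collected, so the product is indexed by pairs. The weight is
submultiplicative because `1 + ‖k + l‖ ≤ (1 + ‖k‖) (1 + ‖l‖)`. -/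
theorem WAC.mul (hs : 0 ≤ s) (hU : WAC s U) (hV : WAC s V) : WAC s (fun x => U x * V x) := by
  obtain ⟨ι, c, κ, h1, h2⟩ := hU
  obtain ⟨ι', c', κ', h1', h2'⟩ := hV
  have hp : Summable fun i : ι × ι' => ((1 + ‖κ i.1‖) ^ s * ‖c i.1‖) *
      ((1 + ‖κ' i.2‖) ^ s * ‖c' i.2‖) :=
    h1.mul_of_nonneg h1' (fun i => by positivity) (fun i => by positivity)
  refine ⟨ι × ι', fun i => c i.1 * c' i.2, fun i => κ i.1 + κ' i.2, ?_, fun x => ?_⟩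
  · refine Summable.of_nonneg_of_le (fun i => by positivity) (fun i => ?_) hp
    rw [norm_mul]
    have : (1 + ‖κ i.1 + κ' i.2‖) ^ s ≤ (1 + ‖κ i.1‖) ^ s * (1 + ‖κ' i.2‖) ^ s := by
      rw [← Real.mul_rpow (by positivity) (by positivity)]
      refine Real.rpow_le_rpow (by positivity) ?_ hs
      have h3 := norm_add_le (κ i.1) (κ' i.2)
      have h4 : 0 ≤ ‖κ i.1‖ * ‖κ' i.2‖ := by positivity
      nlinarith
    calc _ ≤ (1 + ‖κ i.1‖) ^ s * (1 + ‖κ' i.2‖) ^ s * (‖c i.1‖ * ‖c' i.2‖) :=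
          mul_le_mul_of_nonneg_right this (by positivity)
      _ = _ := by ring
  · have hn1 : Summable fun i => ‖c i * expChar (pairing (κ i) x)‖ := by
      simpa [norm_expChar] using summable_of_weight hs h1
    have hn2 : Summable fun i => ‖c' i * expChar (pairing (κ' i) x)‖ := by
      simpa [norm_expChar] using summable_of_weight hs h1'
    have hs' := summable_mul_of_summable_norm hn1 hn2
    refine ((h2 x).mul (h2' x) hs').congr_fun fun i => ?_
    rw [pairing_add_left, expChar_add]; ring

theorem WAC.const (c : ℂ) : WAC s (fun _ : Fin d → ℝ => c) := by
  refine ⟨Unit, fun _ => c, fun _ => 0, ?_, fun x => ?_⟩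
  · exact (hasSum_fintype _).summable
  · convert hasSum_fintype (fun _ : Unit => c * expChar (pairing (0 : Fin d → ℤ) x))
    simp [pairing, expChar_zero]

theorem WAC.translate (a : Fin d → ℝ) (hU : WAC s U) : WAC s (fun x => U (x + a)) := by
  obtain ⟨ι, c, κ, h1, h2⟩ := hU
  refine ⟨ι, fun i => c i * expChar (pairing (κ i) a), κ, ?_, fun x => ?_⟩
  · simpa [norm_expChar] using h1
  · refine (h2 (x + a)).congr_fun fun i => ?_
    rw [pairing_add, expChar_add]; ring

theorem WAC.periodic (hU : WAC s U) : Periodic U := by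
  obtain ⟨ι, c, κ, h1, h2⟩ := hU
  intro x m
  refine ((h2 (x + intVec m)).unique ((h2 x).congr_fun fun i => ?_))
  rw [pairing_add, expChar_add, pairing_intVec, expChar_intCast, mul_one]

/-- The real part is half the sum with the conjugate, whose frequencies are reversed. -/
theorem WAC.re (hU : WAC s U) : WA s (fun x => (U x).re) := by
  have := (hU.add hU.conj).const_mul (1 / 2)
  refine Eq.mp (congrArg (WAC s) (funext fun x => ?_)) this
  rw [Complex.add_conj]
  push_cast
  ring

theorem WAC.continuous (hs : 0 ≤ s) (hU : WAC s U) :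
    Continuous U ∧ ∃ K, ∀ x, ‖U x‖ ≤ K := by
  obtain ⟨ι, c, κ, h1, h2⟩ := hU
  have h3 := summable_of_weight hs h1
  have h4 : ∀ i x, ‖c i * expChar (pairing (κ i) x)‖ ≤ ‖c i‖ := fun i x => by
    rw [norm_mul, norm_expChar, mul_one]
  have hU : U = fun x => ∑' i, c i * expChar (pairing (κ i) x) :=
    funext fun x => (h2 x).tsum_eq.symm
  refine ⟨?_, ∑' i, ‖c i‖, fun x => ?_⟩
  · rw [hU]
    exact continuous_tsum (fun i => continuous_const.mul
      (continuous_expChar.comp (continuous_pairing _))) h3 h4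
  · rw [hU]
    exact tsum_of_norm_bounded h3.hasSum fun i => h4 i x

theorem hasFDerivAt_expChar_pairing (k : Fin d → ℤ) (x : Fin d → ℝ) :
    HasFDerivAt (fun x => expChar (pairing k x))
      ((pairingCLM k).smulRight (2 * Real.pi * Complex.I * expChar (pairing k x))) x := by
  have h1 : HasFDerivAt (pairing k) (pairingCLM k) x := by
    have : pairing k = fun x => pairingCLM k x := funext fun x => (pairingCLM_apply k x).symm
    rw [this]; exact (pairingCLM k).hasFDerivAt
  have h2 := (hasDerivAt_expChar (pairing k x)).hasFDerivAt.comp x h1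
  refine h2.congr_fderiv ?_
  ext v
  simp

/-- Termwise differentiation: the factor `κ i j` brought down by a derivative is dominated by `1 +
‖κ i‖`, one unit of the weight. -/
theorem WAC.pd (hs : 0 ≤ s) (hU : WAC (s + 1) U) :
    Differentiable ℝ U ∧ ∀ j, WAC s (pd j U) := by
  obtain ⟨ι, c, κ, h1, h2⟩ := hU
  have hw : ∀ i, (1 + ‖κ i‖) ^ (s + 1) = (1 + ‖κ i‖) ^ s * (1 + ‖κ i‖) := fun i => by
    rw [Real.rpow_add_one (by positivity)]
  have hw1 : ∀ i, 1 ≤ (1 + ‖κ i‖) ^ s := fun i => one_le_weight hs _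
  have hsum : Summable fun i => 2 * Real.pi * d * ((1 + ‖κ i‖) ^ (s + 1) * ‖c i‖) :=
    h1.mul_left _
  set f' : ι → (Fin d → ℝ) → (Fin d → ℝ) →L[ℝ] ℂ := fun i x => (pairingCLM (κ i)).smulRight
    (c i * (2 * Real.pi * Complex.I * expChar (pairing (κ i) x))) with hf'
  have hf'n : ∀ i x, ‖f' i x‖ ≤ 2 * Real.pi * d * ((1 + ‖κ i‖) ^ (s + 1) * ‖c i‖) := by
    intro i x
    rw [hf', ContinuousLinearMap.norm_smulRight_apply]
    simp only [norm_mul, norm_expChar, Complex.norm_I, Complex.norm_real, RCLike.norm_ofNat,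
      Real.norm_of_nonneg Real.pi_pos.le, mul_one]
    have h3 := norm_pairingCLM_le (κ i)
    have h4 : ‖κ i‖ ≤ (1 + ‖κ i‖) ^ (s + 1) := by
      rw [hw]
      have := hw1 i
      nlinarith [norm_nonneg (κ i)]
    have hpi := Real.pi_pos
    calc ‖pairingCLM (κ i)‖ * (‖c i‖ * (2 * Real.pi))
        ≤ d * ((1 + ‖κ i‖) ^ (s + 1)) * (‖c i‖ * (2 * Real.pi)) := by
          refine mul_le_mul_of_nonneg_right (h3.trans ?_) (by positivity)
          exact mul_le_mul_of_nonneg_left h4 (by positivity)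
      _ = _ := by ring
  have hUe : U = fun x => ∑' i, c i * expChar (pairing (κ i) x) :=
    funext fun x => (h2 x).tsum_eq.symm
  have hd : ∀ x, HasFDerivAt U (∑' i, f' i x) x := by
    intro x
    have hterm : ∀ i x, HasFDerivAt (fun x => c i * expChar (pairing (κ i) x)) (f' i x) x := ?_
    · rw [hUe]
      exact hasFDerivAt_tsum hsum hterm hf'n (h2 0).summable x
    intro i x
    have := (hasFDerivAt_expChar_pairing (κ i) x).const_mul (c i)
    refine this.congr_fderiv ?_
    ext v
    simp only [hf', _root_.smul_apply, ContinuousLinearMap.smulRight_apply,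
      smul_eq_mul, Complex.real_smul]
    ring
  refine ⟨fun x => (hd x).differentiableAt, fun j => ?_⟩
  refine ⟨ι, fun i => 2 * Real.pi * Complex.I * (κ i j) * c i, κ, ?_, fun x => ?_⟩
  · refine Summable.of_nonneg_of_le (fun i => by positivity) (fun i => ?_)
      (h1.mul_left (2 * Real.pi))
    simp only [norm_mul, Complex.norm_I, Complex.norm_real, RCLike.norm_ofNat,
      Real.norm_of_nonneg Real.pi_pos.le, mul_one, Complex.norm_intCast]
    rw [hw]
    have h3 : |(κ i j : ℝ)| ≤ 1 + ‖κ i‖ := (abs_le_norm_int _ j).trans (by linarith)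
    have h4 := hw1 i
    have hpi := Real.pi_pos
    calc (1 + ‖κ i‖) ^ s * (2 * Real.pi * |(κ i j : ℝ)| * ‖c i‖)
        = 2 * Real.pi * ((1 + ‖κ i‖) ^ s * |(κ i j : ℝ)| * ‖c i‖) := by ring
      _ ≤ _ := by gcongr
  · have hsf : Summable fun i => f' i x := Summable.of_norm_bounded hsum fun i => hf'n i x
    have h5 := hsf.hasSum.mapL (ContinuousLinearMap.apply ℝ ℂ (Pi.single j (1:ℝ)))
    simp only [ContinuousLinearMap.apply_apply] at h5
    have h6 : PhaseLocking.pd j U x = (∑' i, f' i x) (Pi.single j 1) := by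
      rw [PhaseLocking.pd, (hd x).fderiv]
    rw [h6]
    refine h5.congr_fun fun i => ?_
    simp only [hf', ContinuousLinearMap.smulRight_apply, pairingCLM_apply, pairing]
    have : ∑ m, (κ i m : ℝ) * (Pi.single j (1:ℝ) : Fin d → ℝ) m = κ i j := by
      rw [Finset.sum_eq_single j]
      · simp
      · intro b _ hb; simp [hb]
      · simp
    rw [this, Complex.real_smul]
    push_cast
    ring

end FourierSeries

end PhaseLocking

end

noncomputable section

namespace PhaseLocking

/-! ### Fourier coefficients of periodic functions and their decay. -/

section FourierCoefficients

open MeasureTheory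

variable {d : ℕ} {s : ℝ} {U V : (Fin d → ℝ) → ℂ}

theorem toTorus_eq_iff {x y : Fin d → ℝ} : toTorus x = toTorus y ↔ ∃ m, x = y + intVec m := by
  constructor
  · intro h
    have h1 : ∀ i, ∃ m : ℤ, x i = y i + m := fun i => by
      have h2 : ((x i : ℝ) : UnitAddCircle) = ((y i : ℝ) : UnitAddCircle) := congrFun h i
      rw [← sub_eq_zero, ← AddCircle.coe_sub, AddCircle.coe_eq_zero_iff] at h2
      obtain ⟨m, hm⟩ := h2
      exact ⟨m, by rw [zsmul_eq_mul, mul_one] at hm; linarith⟩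
    choose m hm using h1
    exact ⟨m, funext hm⟩
  · rintro ⟨m, rfl⟩
    funext i
    simp [toTorus, intVec]

theorem isQuotientMap_toTorus : IsQuotientMap (toTorus (d := d)) := by
  have : IsOpenQuotientMap (Pi.map fun (_ : Fin d) (t : ℝ) => (t : UnitAddCircle)) :=
    IsOpenQuotientMap.piMap fun _ => QuotientAddGroup.isOpenQuotientMap_mk
  exact this.isQuotientMap

/-- The `k`-th Fourier coefficient of a periodic complex-valued function. -/
def fc (U : (Fin d → ℝ) → ℂ) (k : Fin d → ℤ) : ℂ :=
  ∫ x in Icc (0 : Fin d → ℝ) 1, expChar (-pairing k x) * U x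

theorem expChar_pairing (k : Fin d → ℤ) (x : Fin d → ℝ) :
    expChar (pairing k x) = UnitAddTorus.mFourier k (toTorus x) := by
  have h : ∀ s : Finset (Fin d), expChar (∑ i ∈ s, (k i : ℝ) * x i) =
      ∏ i ∈ s, fourier (k i) (toTorus x i) := by
    intro s
    classical
    induction s using Finset.induction_on with
    | empty => simp [expChar_zero]
    | insert a s ha ih =>
      rw [Finset.sum_insert ha, Finset.prod_insert ha, expChar_add, ih]
      congr 1
      simp only [toTorus, fourier_coe_apply, expChar]
      congr 1
      push_cast
      ring
  exact h Finset.univ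

theorem exists_torus_map (hU : Periodic U) (hc : Continuous U) :
    ∃ f : C(UnitAddTorus (Fin d), ℂ), ∀ x, f (toTorus x) = U x := by
  have hf : Function.FactorsThrough U (toTorus (d := d)) := fun x y h => by
    obtain ⟨m, rfl⟩ := toTorus_eq_iff.1 h
    exact hU y m
  let q : C(Fin d → ℝ, UnitAddTorus (Fin d)) := ⟨toTorus, isQuotientMap_toTorus.continuous⟩
  have hq : IsQuotientMap q := isQuotientMap_toTorus
  refine ⟨hq.lift ⟨U, hc⟩ hf, fun x => ?_⟩
  exact congrFun (congrArg DFunLike.coe (hq.lift_comp ⟨U, hc⟩ hf)) x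

/-- The corner `a` of the period cube is left free, since `fc_translate` has to move the cube. -/
theorem mFourierCoeff_eq_fc {f : C(UnitAddTorus (Fin d), ℂ)} (hf : ∀ x, f (toTorus x) = U x)
    (k : Fin d → ℤ) (a : Fin d → ℝ) : UnitAddTorus.mFourierCoeff f k =
      ∫ x in Icc a (a + 1), expChar (-pairing k x) * U x := by
  rw [UnitAddTorus.mFourierCoeff_eq_integral f k a]
  have h1 : {x : Fin d → ℝ | ∀ i, x i ∈ Ioc (a i) (a i + 1)} =
      Set.pi univ fun i => Ioc (a i) ((a + 1) i) := by
    ext x; simp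
  have h2 : (Set.pi univ fun i => Ioc (a i) ((a + 1) i)) =ᵐ[volume] Icc a (a + 1) :=
    Measure.univ_pi_Ioc_ae_eq_Icc
  rw [h1, setIntegral_congr_set h2]
  refine setIntegral_congr_fun measurableSet_Icc fun x _ => ?_
  change UnitAddTorus.mFourier (-k) (toTorus x) • f (toTorus x) = _
  rw [hf, ← expChar_pairing, pairing_neg_left, smul_eq_mul]

theorem mFourierCoeff_eq_fc_zero {f : C(UnitAddTorus (Fin d), ℂ)} (hf : ∀ x, f (toTorus x) = U x)
    (k : Fin d → ℤ) : UnitAddTorus.mFourierCoeff f k = fc U k := by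
  have := mFourierCoeff_eq_fc hf k 0
  rwa [zero_add] at this

/-- A change of variables moves the unit cube to the cube with corner `t`, and the Fourier
coefficient can be computed on either. -/
theorem fc_translate (hU : Periodic U) (hc : Continuous U) (k : Fin d → ℤ) (t : Fin d → ℝ) :
    fc (fun x => U (x + t)) k = expChar (pairing k t) * fc U k := by
  obtain ⟨f, hf⟩ := exists_torus_map hU hc
  have h1 := mFourierCoeff_eq_fc hf k t
  rw [mFourierCoeff_eq_fc_zero hf] at h1
  rw [h1, fc]
  have h2 := (measurePreserving_add_right (volume : Measure (Fin d → ℝ)) t).setIntegral_preimage_emb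
    (MeasurableEquiv.addRight t).measurableEmbedding
    (fun y => expChar (-pairing k y) * U y) (Icc t (t + 1))
  have h3 : (fun x : Fin d → ℝ => x + t) ⁻¹' Icc t (t + 1) = Icc 0 1 := by
    rw [Set.preimage_add_const_Icc]; simp
  rw [h3] at h2
  rw [← h2, ← integral_const_mul]
  refine setIntegral_congr_fun measurableSet_Icc fun x _ => ?_
  rw [pairing_add, neg_add, expChar_add]
  have : expChar (pairing k t) * expChar (-pairing k t) = 1 := by
    rw [← expChar_add]; simp [expChar_zero]
  calc _ = (expChar (pairing k t) * expChar (-pairing k t)) *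
      (expChar (-pairing k x) * U (x + t)) := by rw [this, one_mul]
    _ = _ := by ring

theorem norm_fc_le {M : ℝ} (hM : ∀ x, ‖U x‖ ≤ M) (k : Fin d → ℤ) : ‖fc U k‖ ≤ M := by
  have h1 : (volume (Icc (0 : Fin d → ℝ) 1)) = 1 := by
    rw [Real.volume_Icc_pi]; simp
  have := norm_setIntegral_le_of_norm_le_const (μ := volume) (s := Icc (0 : Fin d → ℝ) 1)
    (f := fun x => expChar (-pairing k x) * U x) (C := M) (by rw [h1]; simp)
    (fun x _ => by rw [norm_mul, norm_expChar, one_mul]; exact hM x)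
  rw [measureReal_def, h1] at this
  simpa [fc] using this

theorem bounded_of_periodic {E : Type} [NormedAddCommGroup E] {u : (Fin d → ℝ) → E}
    (hu : Periodic u) (hc : Continuous u) : ∃ M, ∀ x, ‖u x‖ ≤ M := by
  obtain ⟨M, hM⟩ := (isCompact_Icc (a := (0 : Fin d → ℝ)) (b := 1)).exists_bound_of_continuousOn
    hc.continuousOn
  refine ⟨M, fun x => ?_⟩
  have h := hu x (fun i => -⌊x i⌋)
  rw [← h]
  refine hM _ ⟨fun i => ?_, fun i => ?_⟩
  · simp only [Pi.zero_apply, Pi.add_apply, intVec, Int.cast_neg]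
    linarith [Int.floor_le (x i)]
  · simp only [Pi.one_apply, Pi.add_apply, intVec, Int.cast_neg]
    linarith [Int.lt_floor_add_one (x i)]

theorem Periodic.pd {E : Type} [NormedAddCommGroup E] [NormedSpace ℝ E] {u : (Fin d → ℝ) → E}
    (hu : Periodic u) (i : Fin d) : Periodic (pd i u) := by
  intro x m
  have : (fun y => u (y + intVec m)) = u := funext fun y => hu y m
  rw [PhaseLocking.pd, PhaseLocking.pd, ← fderiv_comp_add_right, this]

theorem hasDerivAt_add_single (hdiff : Differentiable ℝ U) (i : Fin d) (x : Fin d → ℝ) (t : ℝ) :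
    HasDerivAt (fun t : ℝ => U (x + Pi.single i t)) (pd i U (x + Pi.single i t)) t := by
  have h1 : HasDerivAt (fun t : ℝ => x + Pi.single i t) (Pi.single i 1) t := by
    have h2 : HasDerivAt (fun t : ℝ => t • (Pi.single i (1:ℝ) : Fin d → ℝ))
        ((1:ℝ) • Pi.single i 1) t := (hasDerivAt_id t).smul_const _
    have h3 : (fun t : ℝ => x + Pi.single i t) =
        fun t : ℝ => x + t • (Pi.single i (1:ℝ) : Fin d → ℝ) := by
      ext t j
      by_cases h : j = i
      · subst h; simp
      · simp [h]
    rw [h3]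
    simpa using h2.const_add x
  exact (hdiff _).hasFDerivAt.comp_hasDerivAt t h1

theorem hasDerivAt_setIntegral_cube {G G' : ℝ → (Fin d → ℝ) → ℂ} {M : ℝ}
    (hG : ∀ t, Continuous (G t)) (hG' : ∀ t, Continuous (G' t)) (hM : ∀ t x, ‖G' t x‖ ≤ M)
    (hd : ∀ x t, HasDerivAt (fun t => G t x) (G' t x) t) :
    HasDerivAt (fun t => ∫ x in Icc (0 : Fin d → ℝ) 1, G t x)
      (∫ x in Icc (0 : Fin d → ℝ) 1, G' 0 x) 0 := by
  have hfin : IsFiniteMeasure (volume.restrict (Icc (0 : Fin d → ℝ) 1)) :=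
    ⟨by rw [Measure.restrict_apply_univ]; exact isCompact_Icc.measure_lt_top⟩
  exact (hasDerivAt_integral_of_dominated_loc_of_deriv_le
    (s := univ) (bound := fun _ => M) univ_mem
    (Eventually.of_forall fun t => (hG t).aestronglyMeasurable)
    ((hG 0).continuousOn.integrableOn_compact isCompact_Icc)
    (hG' 0).aestronglyMeasurable
    (Eventually.of_forall fun x t _ => hM t x)
    (integrable_const M)
    (Eventually.of_forall fun x t _ => hd x t)).2

theorem hasDerivAt_fc_translate (hU : Periodic U) (hc : ContDiff ℝ 1 U) (k : Fin d → ℤ)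
    (i : Fin d) : HasDerivAt (fun t : ℝ => fc (fun x => U (x + Pi.single i t)) k)
      (fc (pd i U) k) 0 := by
  have hdiff : Differentiable ℝ U := hc.differentiable (by simp)
  have hpc : Continuous (pd i U) :=
    (hc.continuous_fderiv (by simp)).clm_apply continuous_const
  obtain ⟨M, hM⟩ := bounded_of_periodic (hU.pd i) hpc
  have hce : Continuous fun x => expChar (-pairing k x) :=
    continuous_expChar.comp (continuous_pairing k).neg
  have hF : ∀ {V : (Fin d → ℝ) → ℂ}, Continuous V → ∀ t : ℝ, Continuous fun x : Fin d → ℝ =>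
      expChar (-pairing k x) * V (x + Pi.single i t) := fun hV t =>
    hce.mul (hV.comp (continuous_id.add continuous_const))
  have h2 := hasDerivAt_setIntegral_cube (M := M)
    (G := fun (t : ℝ) x => expChar (-pairing k x) * U (x + Pi.single i t))
    (hF hc.continuous) (hF hpc)
    (fun t x => by rw [norm_mul, norm_expChar, one_mul]; exact hM _)
    (fun x t => (hasDerivAt_add_single hdiff i x t).const_mul _)
  simp only [Pi.single_zero, add_zero] at h2
  exact h2

/-- In place of an integration by parts, the identity of `fc_translate` along the `i`-th axis is
differentiated in the translation parameter at zero. -/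
theorem fc_pd (hU : Periodic U) (hc : ContDiff ℝ 1 U) (k : Fin d → ℤ) (i : Fin d) :
    fc (pd i U) k = 2 * Real.pi * Complex.I * k i * fc U k := by
  have h1 : (fun t : ℝ => fc (fun x => U (x + Pi.single i t)) k) =
      fun t : ℝ => expChar ((k i : ℝ) * t) * fc U k := by
    ext t
    have h2 := fc_translate hU hc.continuous k (Pi.single i t)
    have h3 : pairing k (Pi.single i t) = (k i : ℝ) * t := by
      rw [pairing, Finset.sum_eq_single i]
      · simp
      · intro b _ hb; simp [hb]
      · simp
    rw [h3] at h2
    exact h2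
  have h4 := hasDerivAt_fc_translate hU hc k i
  rw [h1] at h4
  have h6 : HasDerivAt (fun t : ℝ => (k i : ℝ) * t) (k i : ℝ) 0 := by
    simpa using (hasDerivAt_id (0:ℝ)).const_mul (k i : ℝ)
  have h7 := h4.unique (((hasDerivAt_expChar _).scomp (0:ℝ) h6).mul_const _)
  rw [h7, mul_zero, expChar_zero, Complex.real_smul]
  push_cast
  ring

/-- Repeated use of `fc_pd` in one coordinate; the factors `2π ≥ 1` are discarded. -/
theorem fc_decay {p : ℕ} (hU : Periodic U) (hc : ContDiff ℝ p U) :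
    ∃ C, ∀ k, ∀ i, |(k i : ℝ)| ^ p * ‖fc U k‖ ≤ C := by
  induction p generalizing U with
  | zero =>
    obtain ⟨M, hM⟩ := bounded_of_periodic hU hc.continuous
    exact ⟨M, fun k i => by simpa using norm_fc_le hM k⟩
  | succ p ih =>
    have hpd : ∀ i, ContDiff ℝ p (pd i U) := fun i =>
      (hc.fderiv_right (m := p) (by push_cast; exact le_rfl)).clm_apply contDiff_const
    choose C hC using fun i => ih (hU.pd i) (hpd i)
    refine ⟨∑ i, |C i|, fun k i => ?_⟩
    have h1 := fc_pd hU (hc.of_le (by push_cast; exact le_add_self)) k i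
    have h2 : ‖fc (pd i U) k‖ = 2 * Real.pi * |(k i : ℝ)| * ‖fc U k‖ := by
      rw [h1]
      simp [abs_of_pos Real.pi_pos]
    have h3 := hC i k i
    rw [h2] at h3
    have h4 : C i ≤ ∑ i, |C i| := (le_abs_self _).trans
      (Finset.single_le_sum (f := fun i => |C i|) (fun _ _ => abs_nonneg _) (Finset.mem_univ i))
    refine le_trans ?_ (h3.trans h4)
    have hpi : 1 ≤ 2 * Real.pi := by linarith [Real.pi_gt_three]
    calc |(k i : ℝ)| ^ (p + 1) * ‖fc U k‖ = 1 * (|(k i : ℝ)| ^ p * (|(k i : ℝ)| * ‖fc U k‖)) := by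
          ring
      _ ≤ (2 * Real.pi) * (|(k i : ℝ)| ^ p * (|(k i : ℝ)| * ‖fc U k‖)) :=
          mul_le_mul_of_nonneg_right hpi (by positivity)
      _ = _ := by ring

theorem norm_intVec (k : Fin d → ℤ) : ‖intVec k‖ = ‖k‖ := by
  simp only [Pi.norm_def, intVec]
  congr 2

/-- Comparison with the sum of `‖k‖ ^ (-a)` over the lattice `ℤᵈ` in `ℝᵈ`, which converges for
exponents above the rank `d`. The point `k = 0` is a finite exception to the comparison. -/
theorem summable_weight_neg {a : ℝ} (ha : (d : ℝ) < a) :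
    Summable fun k : Fin d → ℤ => (1 + ‖k‖) ^ (-a) := by
  set L := Submodule.span ℤ (Set.range (Pi.basisFun ℝ (Fin d))) with hL
  have hrank : Module.finrank ℤ L = d := by
    rw [ZLattice.rank ℝ L]; simp
  have h1 : Summable fun z : L => ‖z‖ ^ (-a) := by
    refine ZLattice.summable_norm_rpow L (-a) ?_
    rw [hrank]; linarith
  have hmem : ∀ k : Fin d → ℤ, intVec k ∈ L := by
    intro k
    have : intVec k = ∑ i, k i • (Pi.basisFun ℝ (Fin d)) i := by
      ext j
      simp [intVec, Finset.sum_apply, Pi.single_apply]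
    rw [this]
    exact Submodule.sum_mem _ fun i _ => Submodule.smul_mem _ _
      (Submodule.subset_span (mem_range_self i))
  have hinj : Function.Injective fun k : Fin d → ℤ => (⟨intVec k, hmem k⟩ : L) := by
    intro k l hkl
    ext i
    have := congrFun (congrArg Subtype.val hkl) i
    simpa [intVec] using this
  have h2 := h1.comp_injective hinj
  have h3 : ∀ᶠ k : Fin d → ℤ in cofinite,
      ‖(1 + ‖k‖) ^ (-a)‖ ≤ ‖k‖ ^ (-a) := by
    have : ∀ᶠ k : Fin d → ℤ in cofinite, k ≠ 0 := by
      simp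
    filter_upwards [this] with k hk
    rw [Real.norm_of_nonneg (by positivity)]
    have hk' : 0 < ‖k‖ := norm_pos_iff.2 hk
    exact Real.rpow_le_rpow_of_nonpos hk' (by linarith)
      (by have : (0:ℝ) ≤ d := Nat.cast_nonneg d
          linarith)
  refine Summable.of_norm_bounded_eventually (g := fun k => ‖k‖ ^ (-a)) ?_ h3
  refine h2.congr fun k => ?_
  simp only [Function.comp]
  rw [Submodule.coe_norm, norm_intVec]

theorem hasSum_fc (hU : Periodic U) (hc : Continuous U) (h : Summable fun k => ‖fc U k‖)
    (x : Fin d → ℝ) : HasSum (fun k => fc U k * expChar (pairing k x)) (U x) := by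
  obtain ⟨f, hf⟩ := exists_torus_map hU hc
  have h1 : UnitAddTorus.mFourierCoeff f = fc U := funext (mFourierCoeff_eq_fc_zero hf)
  have h2 := UnitAddTorus.hasSum_mFourier_series_apply_of_summable (f := f)
    (by rw [h1]; exact h.of_norm) (toTorus x)
  rw [hf, h1] at h2
  refine h2.congr_fun fun k => ?_
  rw [expChar_pairing, smul_eq_mul]

/-- Smooth periodic functions have weighted absolutely summable Fourier coefficients. -/
theorem WAC.of_contDiff {p : ℕ} (hU : Periodic U) (hc : ContDiff ℝ p U) (hs : 0 ≤ s)
    (hsp : s + d < p) : WAC s U := by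
  obtain ⟨C, hC⟩ := fc_decay hU hc
  obtain ⟨M, hM⟩ := bounded_of_periodic hU hc.continuous
  have hM0 : 0 ≤ M := (norm_nonneg _).trans (hM 0)
  have hb : ∀ k, ‖fc U k‖ ≤ (M + 2 ^ p * |C|) * (1 + ‖k‖) ^ (-(p:ℝ)) := by
    intro k
    rw [Real.rpow_neg (by positivity), Real.rpow_natCast, ← div_eq_mul_inv,
      le_div_iff₀ (by positivity)]
    rcases eq_or_ne k 0 with rfl | hk
    · simp only [norm_zero, add_zero, one_pow, mul_one]
      exact (norm_fc_le hM 0).trans (le_add_of_nonneg_right (by positivity))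
    · have hne : Nonempty (Fin d) := by
        by_contra h
        rw [not_nonempty_iff] at h
        exact hk (Subsingleton.elim _ _)
      -- A coordinate realising the maximum norm turns the coordinatewise decay into decay in `‖k‖`.
      obtain ⟨i, hi⟩ : ∃ i, ‖k‖ = |(k i : ℝ)| := by
        obtain ⟨i, -, hi⟩ := Finset.exists_max_image Finset.univ (fun i => ‖k i‖)
          Finset.univ_nonempty
        refine ⟨i, le_antisymm ?_ (abs_le_norm_int k i)⟩
        rw [← Int.norm_eq_abs]
        exact (pi_norm_le_iff_of_nonneg (norm_nonneg _)).2 fun j => hi j (Finset.mem_univ j)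
      have h1 : 1 ≤ ‖k‖ := by
        rw [hi]
        have : k i ≠ 0 := by
          intro h0
          rw [h0] at hi
          simp at hi
          exact hk hi
        exact_mod_cast Int.one_le_abs this
      have h2 := hC k i
      rw [← hi] at h2
      calc ‖fc U k‖ * (1 + ‖k‖) ^ p ≤ ‖fc U k‖ * (2 * ‖k‖) ^ p := by gcongr; linarith
        _ = 2 ^ p * (‖k‖ ^ p * ‖fc U k‖) := by rw [mul_pow]; ring
        _ ≤ 2 ^ p * |C| := by gcongr; exact h2.trans (le_abs_self C)
        _ ≤ _ := le_add_of_nonneg_left hM0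
  have hsum : Summable fun k : Fin d → ℤ => (1 + ‖k‖) ^ s * ‖fc U k‖ := by
    refine Summable.of_nonneg_of_le (fun k => by positivity) (fun k => ?_)
      ((summable_weight_neg (d := d) (a := p - s) (by linarith)).mul_left (M + 2 ^ p * |C|))
    calc (1 + ‖k‖) ^ s * ‖fc U k‖
        ≤ (1 + ‖k‖) ^ s * ((M + 2 ^ p * |C|) * (1 + ‖k‖) ^ (-(p:ℝ))) := by gcongr; exact hb k
      _ = (M + 2 ^ p * |C|) * ((1 + ‖k‖) ^ s * (1 + ‖k‖) ^ (-(p:ℝ))) := by ring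
      _ = _ := by
        rw [← Real.rpow_add (by positivity)]
        congr 2
        ring
  exact ⟨Fin d → ℤ, fc U, fun k => k, hsum, hasSum_fc hU hc.continuous
    (summable_of_weight hs hsum)⟩

end FourierCoefficients

end PhaseLocking

end

noncomputable section

namespace PhaseLocking

/-! ### The weighted classes of real functions and their bounded derivatives. -/

section WeightedAlgebra

variable {d : ℕ} {s : ℝ} {u v : (Fin d → ℝ) → ℝ}

theorem WA.mono {s' : ℝ} (h : WA s u) (hs : s' ≤ s) : WA s' u := WAC.mono h hs

theorem WA.add (hu : WA s u) (hv : WA s v) : WA s (fun x => u x + v x) := by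
  have := WAC.add hu hv
  simpa [WA] using this

theorem WA.const_mul (a : ℝ) (hu : WA s u) : WA s (fun x => a * u x) := by
  have := WAC.const_mul (a : ℂ) hu
  simpa [WA] using this

theorem WA.mul (hs : 0 ≤ s) (hu : WA s u) (hv : WA s v) : WA s (fun x => u x * v x) := by
  have := WAC.mul hs hu hv
  simpa [WA] using this

theorem WA.const (c : ℝ) : WA s (fun _ : Fin d → ℝ => c) := WAC.const (c : ℂ)

theorem WA.translate (a : Fin d → ℝ) (hu : WA s u) : WA s (fun x => u (x + a)) :=
  WAC.translate a hu

theorem WA.periodic (hu : WA s u) : Periodic u := fun x m => by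
  have := WAC.periodic hu x m
  exact_mod_cast this

theorem WA.continuous (hs : 0 ≤ s) (hu : WA s u) : Continuous u ∧ ∃ K, ∀ x, ‖u x‖ ≤ K := by
  obtain ⟨h1, K, hK⟩ := WAC.continuous hs hu
  refine ⟨by simpa [Function.comp_def] using Complex.continuous_re.comp h1, K, fun x => ?_⟩
  simpa using hK x

theorem WA.pd (hs : 0 ≤ s) (hu : WA (s + 1) u) : Differentiable ℝ u ∧ ∀ j, WA s (pd j u) := by
  obtain ⟨h1, h2⟩ := WAC.pd hs hu
  have h3 : ∀ x, HasFDerivAt u (Complex.reCLM.comp (fderiv ℝ (fun x => (u x : ℂ)) x)) x := fun x =>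
    Complex.reCLM.hasFDerivAt.comp x (h1 x).hasFDerivAt
  have hd : Differentiable ℝ u := fun x => (h3 x).differentiableAt
  refine ⟨hd, fun j => ?_⟩
  refine Eq.mp (congrArg (WAC s) (funext fun x => ?_)) (h2 j)
  have h4 : HasFDerivAt (fun x => (u x : ℂ)) (Complex.ofRealCLM.comp (fderiv ℝ u x)) x :=
    Complex.ofRealCLM.hasFDerivAt.comp x (hd x).hasFDerivAt
  rw [PhaseLocking.pd, h4.fderiv]
  rfl

theorem fderiv_eq_sum_pd {E : Type} [NormedAddCommGroup E] [NormedSpace ℝ E]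
    (u : (Fin d → ℝ) → E) (x : Fin d → ℝ) :
    fderiv ℝ u x = ∑ j, (ContinuousLinearMap.proj (R := ℝ) (φ := fun _ : Fin d => ℝ) j).smulRight
      (pd j u x) := by
  refine ContinuousLinearMap.ext fun y => ?_
  have hy : y = ∑ j, y j • (Pi.single j (1:ℝ) : Fin d → ℝ) := by
    ext j; simp [Finset.sum_apply, Pi.single_apply]
  conv_lhs => rw [hy, map_sum]
  simp [pd]

/-- Partial derivatives lower the weight by one, so weight `s` pays for `k ≤ s` bounded derivatives;
the total derivative is reassembled from the partial ones. -/
theorem WA.bc {k : ℕ} (hk : (k : ℝ) ≤ s) (hu : WA s u) : ∃ K, BC k K u := by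
  induction k generalizing s u with
  | zero =>
    obtain ⟨h1, K, hK⟩ := hu.continuous (by simpa using hk)
    exact ⟨K, bc_zero_iff.2 ⟨h1, hK⟩⟩
  | succ k ih =>
    push_cast at hk
    have hk0 : (0:ℝ) ≤ k := Nat.cast_nonneg k
    obtain ⟨-, K₀, hK₀⟩ := hu.continuous (by linarith)
    obtain ⟨h1, h2⟩ := WA.pd (s := s - 1) (u := u) (by linarith) (by simpa using hu)
    choose K hK using fun j => ih (by linarith) (h2 j)
    have hB : BC k _ (fun x => ∑ j : Fin d,
        (ContinuousLinearMap.smulRightL ℝ (Fin d → ℝ) ℝ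
          (ContinuousLinearMap.proj (R := ℝ) (φ := fun _ : Fin d => ℝ) j)) (PhaseLocking.pd j u x)) :=
      BC.sum Finset.univ fun j _ => (hK j).clm_comp _
    have hB' : BC k _ (fderiv ℝ u) :=
      Eq.mp (congrArg (BC k _) (funext fun x => (fderiv_eq_sum_pd u x).symm)) hB
    exact ⟨_, bc_succ_iff.2 ⟨h1, fun x => (hK₀ x).trans (le_max_left K₀ _),
      hB'.mono (le_max_right K₀ _)⟩⟩

end WeightedAlgebra

/-! ### Identification of the coefficients of a series with Fourier coefficients. -/

section CanonicalCoefficients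

open MeasureTheory

variable {d : ℕ} {s : ℝ} {U : (Fin d → ℝ) → ℂ}

/-- For `m ≠ k`, translation by half a period in a coordinate with `m i ≠ k i` changes the sign of
the character but not its integral. -/
theorem fc_expChar_pairing (m k : Fin d → ℤ) :
    fc (fun x => expChar (pairing m x)) k = if m = k then 1 else 0 := by
  have h0 : ∀ x, expChar (-pairing k x) * expChar (pairing m x) =
      expChar (-pairing 0 x) * expChar (pairing (m - k) x) := fun x => by
    rw [← expChar_add, ← expChar_add, sub_eq_add_neg, pairing_add_left, pairing_neg_left]
    congr 1
    simp [pairing]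
    ring
  have h1 : fc (fun x => expChar (pairing m x)) k =
      fc (fun x => expChar (pairing (m - k) x)) 0 := by
    simp only [fc, h0]
  rw [h1]
  split_ifs with h
  · subst h
    have : (volume (Icc (0 : Fin d → ℝ) 1)) = 1 := by
      rw [Real.volume_Icc_pi]; simp
    simp [fc, pairing, expChar_zero, measureReal_def, this]
  · set l := m - k with hl
    have hl0 : l ≠ 0 := sub_ne_zero.2 h
    obtain ⟨i, hi⟩ := Function.ne_iff.1 hl0
    have hi' : (l i : ℝ) ≠ 0 := by exact_mod_cast hi
    have hper : Periodic fun x : Fin d → ℝ => expChar (pairing l x) := fun x n => by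
      beta_reduce
      rw [pairing_add, expChar_add, pairing_intVec, expChar_intCast, mul_one]
    have h2 := fc_translate hper (continuous_expChar.comp (continuous_pairing l)) 0
      (Pi.single i (1 / (2 * l i)))
    have h3 : pairing l (Pi.single i (1 / (2 * (l i : ℝ)))) = 1 / 2 := by
      rw [pairing, Finset.sum_eq_single i]
      · simp; field_simp
      · intro b _ hb; simp [hb]
      · simp
    have h4 : expChar (1 / 2) = -1 := by
      rw [expChar, ← Complex.exp_pi_mul_I]
      congr 1
      push_cast
      ring
    have h5 : fc (fun x => expChar (pairing l (x + Pi.single i (1 / (2 * (l i : ℝ)))))) 0 =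
        -fc (fun x => expChar (pairing l x)) 0 := by
      simp only [pairing_add, expChar_add, h3, h4, fc]
      rw [← integral_neg]
      congr 1
      ext x
      ring
    rw [h5] at h2
    have h6 : pairing (0 : Fin d → ℤ) (Pi.single i (1 / (2 * (l i : ℝ)))) = 0 := by simp [pairing]
    rw [h6, expChar_zero, one_mul] at h2
    exact self_eq_neg.1 h2.symm

/-- Terms of equal frequency are added up; by the triangle inequality the weighted sum does not
grow. -/
theorem WAC.exists_canonical (hs : 0 ≤ s) (hU : WAC s U) : ∃ C : (Fin d → ℤ) → ℂ,
    Summable (fun k => (1 + ‖k‖) ^ s * ‖C k‖) ∧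
      ∀ x, HasSum (fun k => C k * expChar (pairing k x)) (U x) := by
  obtain ⟨ι, c, κ, h1, h2⟩ := hU
  have h3 := summable_of_weight hs h1
  refine ⟨fun k => ∑' i : {i // κ i = k}, c i.1, ?_, fun x => ?_⟩
  · have h7 : Summable fun p : Σ k, {i // κ i = k} => (1 + ‖κ p.2.1‖) ^ s * ‖c p.2.1‖ :=
      ((Equiv.sigmaFiberEquiv κ).summable_iff
        (f := fun i => (1 + ‖κ i‖) ^ s * ‖c i‖)).2 h1
    refine Summable.of_nonneg_of_le (fun k => by positivity) (fun k => ?_) h7.sigma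
    have h9 : Summable fun i : {i // κ i = k} => ‖c i.1‖ := h3.subtype _
    calc (1 + ‖k‖) ^ s * ‖∑' i : {i // κ i = k}, c i.1‖
        ≤ (1 + ‖k‖) ^ s * ∑' i : {i // κ i = k}, ‖c i.1‖ := by
          gcongr
          exact norm_tsum_le_tsum_norm h9
      _ = ∑' i : {i // κ i = k}, (1 + ‖k‖) ^ s * ‖c i.1‖ := (tsum_mul_left).symm
      _ = _ := tsum_congr fun i => by rw [i.2]
  · have h8 : HasSum (fun p : Σ k, {i // κ i = k} => c p.2.1 * expChar (pairing (κ p.2.1) x))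
        (U x) := ((Equiv.sigmaFiberEquiv κ).hasSum_iff
        (f := fun i => c i * expChar (pairing (κ i) x))).2 (h2 x)
    refine h8.sigma fun k => ?_
    have h9 : Summable fun i : {i // κ i = k} => c i.1 := h3.of_norm.subtype _
    refine (h9.hasSum.mul_right (expChar (pairing k x))).congr_fun fun i => ?_
    rw [i.2]

/-- The Fourier coefficients of a function in the weighted class are summable with the weight. -/
theorem WAC.summable_fc (hs : 0 ≤ s) (hU : WAC s U) :
    Summable (fun k => (1 + ‖k‖) ^ s * ‖fc U k‖) := by
  obtain ⟨c, h1, h2⟩ := hU.exists_canonical hs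
  have h3 : Summable fun k => ‖c k‖ := summable_of_weight (κ := fun k => k) hs h1
  refine h1.congr fun k => ?_
  have hcont : ∀ i, Continuous fun x => expChar (-pairing k x) * (c i * expChar (pairing i x)) :=
    fun i => (continuous_expChar.comp (continuous_pairing k).neg).mul
      (continuous_const.mul (continuous_expChar.comp (continuous_pairing _)))
  have hnorm : ∀ i x, ‖expChar (-pairing k x) * (c i * expChar (pairing i x))‖ = ‖c i‖ :=
    fun i x => by rw [norm_mul, norm_mul, norm_expChar, norm_expChar, one_mul, mul_one]
  have hvol : (volume (Icc (0 : Fin d → ℝ) 1)) = 1 := by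
    rw [Real.volume_Icc_pi]; simp
  -- Termwise integration against `expChar (-pairing k x)` leaves only the coefficient with index
  -- `k`.
  have h4 := hasSum_integral_of_summable_integral_norm
    (μ := volume.restrict (Icc (0 : Fin d → ℝ) 1))
    (F := fun i x => expChar (-pairing k x) * (c i * expChar (pairing i x)))
    (fun i => (hcont i).continuousOn.integrableOn_compact isCompact_Icc)
    (h3.congr fun i => by simp only [hnorm]; simp [measureReal_def, hvol])
  have h5 : (∫ x in Icc (0 : Fin d → ℝ) 1,
      ∑' i, expChar (-pairing k x) * (c i * expChar (pairing i x))) = fc U k := by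
    refine setIntegral_congr_fun measurableSet_Icc fun x _ => ?_
    exact ((h2 x).mul_left _).tsum_eq
  rw [h5] at h4
  have h6 : ∀ i, (∫ x in Icc (0 : Fin d → ℝ) 1, expChar (-pairing k x) *
      (c i * expChar (pairing i x))) = if i = k then c i else 0 := fun i => by
    have : (∫ x in Icc (0 : Fin d → ℝ) 1, expChar (-pairing k x) *
        (c i * expChar (pairing i x))) = c i * fc (fun x => expChar (pairing i x)) k := by
      rw [fc, ← integral_const_mul]
      congr 1
      ext x
      ring
    rw [this, fc_expChar_pairing]
    split_ifs <;> simp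
  simp only [h6] at h4
  rw [← h4.unique (hasSum_ite_eq k (c k) |>.congr_fun fun i => ?_)]
  split_ifs with h
  · rw [h]
  · rfl

theorem WAC.hasSum_fc (hs : 0 ≤ s) (hU : WAC s U) (x : Fin d → ℝ) :
    HasSum (fun k => fc U k * expChar (pairing k x)) (U x) :=
  PhaseLocking.hasSum_fc hU.periodic (hU.continuous hs).1
    (summable_of_weight hs (hU.summable_fc hs)) x

theorem WA.of_contDiff {p : ℕ} {u : (Fin d → ℝ) → ℝ} (hu : Periodic u) (hc : ContDiff ℝ p u)
    (hs : 0 ≤ s) (hsp : s + d < p) : WA s u :=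
  WAC.of_contDiff (fun x k => by rw [hu x k]) (Complex.ofRealCLM.contDiff.comp hc) hs hsp

end CanonicalCoefficients

end PhaseLocking

end

noncomputable section

namespace PhaseLocking

/-! ### The cohomology equation in the weighted classes. -/

section CohomologyEquation

variable {d : ℕ} {s τ : ℝ} {Ω : Fin d → ℝ}

/-- The small divisors of `Ω` are bounded below with exponent `τ`. -/
def SmallDivisors (τ : ℝ) (Ω : Fin d → ℝ) : Prop :=
  ∃ c > 0, ∀ k, ¬InResonanceModule Ω k → c * (1 + ‖k‖) ^ (-τ) ≤ ‖expChar (pairing k Ω) - 1‖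

open Classical in
theorem WA.resonantPart_series (hs : 0 ≤ s) {u : (Fin d → ℝ) → Fin d → ℝ} {i : Fin d}
    (hu : WA s fun x => u x i) : Summable fun k => (1 + ‖k‖) ^ s *
      ‖if InResonanceModule Ω k then fourierCoefficient u k i else 0‖ := by
  refine Summable.of_nonneg_of_le (fun k => by positivity) (fun k => ?_) (WAC.summable_fc hs hu)
  gcongr
  split_ifs
  · exact le_rfl
  · simp

-- Division by a small divisor enlarges a coefficient by at most `c⁻¹ (1 + ‖k‖) ^ τ`, so the loss is
-- the weight `τ` and nothing more. This economy is the reason for weighted series in place of `C^k`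
-- norms.
open Classical in
theorem WA.cohomologySolution_series (hs : 0 ≤ s) (hΩ : SmallDivisors τ Ω)
    {u : (Fin d → ℝ) → Fin d → ℝ} {i : Fin d} (hu : WA s fun x => u x i) :
    Summable fun k => (1 + ‖k‖) ^ (s - τ) * ‖if InResonanceModule Ω k then 0
      else fourierCoefficient u k i / (expChar (pairing k Ω) - 1)‖ := by
  obtain ⟨c, hc, h⟩ := hΩ
  refine Summable.of_nonneg_of_le (fun k => by positivity) (fun k => ?_)
    ((WAC.summable_fc hs hu).mul_left c⁻¹)
  split_ifs with hk
  · simp only [norm_zero, mul_zero]; positivity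
  · have h1 := h k hk
    have h2 : 0 < c * (1 + ‖k‖) ^ (-τ) := by positivity
    have h3 : fourierCoefficient u k i = fc (fun x => (u x i : ℂ)) k := rfl
    rw [norm_div, ← h3]
    calc (1 + ‖k‖) ^ (s - τ) * (‖fourierCoefficient u k i‖ / ‖expChar (pairing k Ω) - 1‖)
        ≤ (1 + ‖k‖) ^ (s - τ) * (‖fourierCoefficient u k i‖ / (c * (1 + ‖k‖) ^ (-τ))) := by
          gcongr
      _ = _ := by
          rw [sub_eq_add_neg, Real.rpow_add (by positivity)]
          field_simp

open Classical in
theorem hasSum_of_summable_weight (hs : 0 ≤ s) {c : (Fin d → ℤ) → ℂ}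
    (h : Summable fun k => (1 + ‖k‖) ^ s * ‖c k‖) (x : Fin d → ℝ) :
    HasSum (fun k => c k * expChar (pairing k x)) (∑' k, c k * expChar (pairing k x)) := by
  refine Summable.hasSum (Summable.of_norm ?_)
  simpa [norm_expChar] using summable_of_weight (κ := fun k => k) hs h

theorem WA.of_series (hs : 0 ≤ s) {c : (Fin d → ℤ) → ℂ}
    (h : Summable fun k => (1 + ‖k‖) ^ s * ‖c k‖) :
    WA s fun x => (∑' k, c k * expChar (pairing k x)).re :=
  WAC.re ⟨_, c, fun k => k, h, hasSum_of_summable_weight hs h⟩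

open Classical in
theorem resonantPart_apply (u : (Fin d → ℝ) → Fin d → ℝ) (x : Fin d → ℝ) (i : Fin d) :
    resonantPart Ω u x i = (∑' k, (if InResonanceModule Ω k then fourierCoefficient u k i else 0) *
      expChar (pairing k x)).re := by
  simp only [resonantPart, ite_mul, zero_mul]

open Classical in
theorem cohomologySolution_apply (u : (Fin d → ℝ) → Fin d → ℝ) (x : Fin d → ℝ) (i : Fin d) :
    cohomologySolution Ω u x i = (∑' k, (if InResonanceModule Ω k then 0
      else fourierCoefficient u k i / (expChar (pairing k Ω) - 1)) * expChar (pairing k x)).re := by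
  simp only [cohomologySolution, ite_mul, zero_mul]

theorem WA.resonantPart (hs : 0 ≤ s) {u : (Fin d → ℝ) → Fin d → ℝ} {i : Fin d}
    (hu : WA s fun x => u x i) : WA s fun x => resonantPart Ω u x i := by
  simp only [resonantPart_apply]
  exact WA.of_series hs (WA.resonantPart_series hs hu)

theorem WA.cohomologySolution (hs : 0 ≤ s) (hτ : τ ≤ s) (hΩ : SmallDivisors τ Ω)
    {u : (Fin d → ℝ) → Fin d → ℝ} {i : Fin d} (hu : WA s fun x => u x i) :
    WA (s - τ) fun x => cohomologySolution Ω u x i := by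
  simp only [cohomologySolution_apply]
  exact WA.of_series (by linarith) (WA.cohomologySolution_series hs hΩ hu)

/-- The cohomology equation. -/
theorem cohomologySolution_add_sub (hs : 0 ≤ s) (hτ : τ ≤ s) (hΩ : SmallDivisors τ Ω)
    {u : (Fin d → ℝ) → Fin d → ℝ} {i : Fin d} (hu : WA s fun x => u x i) (x : Fin d → ℝ) :
    cohomologySolution Ω u (x + Ω) i - cohomologySolution Ω u x i =
      u x i - PhaseLocking.resonantPart Ω u x i := by
  classical
  have hc := hasSum_of_summable_weight (by linarith : 0 ≤ s - τ)
    (WA.cohomologySolution_series hs hΩ hu)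
  have hr := hasSum_of_summable_weight hs (WA.resonantPart_series (Ω := Ω) hs hu) x
  have hf : HasSum (fun k => fourierCoefficient u k i * expChar (pairing k x)) (u x i : ℂ) :=
    WAC.hasSum_fc hs hu x
  -- At nonresonant frequencies the divisor cancels against the factor `expChar (pairing k Ω) - 1`
  -- produced by the translation; at resonant ones both sides vanish.
  have h1 := ((hc (x + Ω)).sub (hc x)).congr_fun
    (g := fun k => fourierCoefficient u k i * expChar (pairing k x) -
      (if InResonanceModule Ω k then fourierCoefficient u k i else 0) * expChar (pairing k x))
    fun k => by
      by_cases hk : InResonanceModule Ω k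
      · simp [hk]
      · have hne : expChar (pairing k Ω) - 1 ≠ 0 := by
          obtain ⟨c, hc, h⟩ := hΩ
          have := h k hk
          rw [← norm_pos_iff]
          exact lt_of_lt_of_le (by positivity) this
        simp only [hk, if_false, zero_mul, sub_zero]
        rw [pairing_add, expChar_add]
        field_simp
  have h2 := h1.unique (hf.sub hr)
  have h3 := congrArg Complex.re h2
  simp only [Complex.sub_re, Complex.ofReal_re] at h3
  rw [cohomologySolution_apply, cohomologySolution_apply, resonantPart_apply]
  exact h3

end CohomologyEquation

/-! ### The action of `SL(d, ℤ)`. -/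

section SpecialLinear

variable {d : ℕ} (A : Matrix.SpecialLinearGroup (Fin d) ℤ)

theorem slAct_add (x y : Fin d → ℝ) : slAct A (x + y) = slAct A x + slAct A y :=
  Matrix.mulVec_add _ _ _

theorem slAct_smul (c : ℝ) (x : Fin d → ℝ) : slAct A (c • x) = c • slAct A x :=
  Matrix.mulVec_smul _ _ _

/-- The action of `SL(d, ℤ)` by continuous linear maps. -/
def slActL : (Fin d → ℝ) →L[ℝ] (Fin d → ℝ) :=
  LinearMap.toContinuousLinearMap
    { toFun := slAct A, map_add' := slAct_add A, map_smul' := slAct_smul A }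

theorem slActL_apply (x : Fin d → ℝ) : slActL A x = slAct A x := rfl

theorem slAct_slAct (B : Matrix.SpecialLinearGroup (Fin d) ℤ) (x : Fin d → ℝ) :
    slAct A (slAct B x) = slAct (A * B) x := by
  simp only [slAct, Matrix.mulVec_mulVec, Matrix.SpecialLinearGroup.coe_mul]
  congr 1
  exact (Matrix.map_mul (f := Int.castRingHom ℝ)).symm

theorem slAct_one (x : Fin d → ℝ) : slAct (1 : Matrix.SpecialLinearGroup (Fin d) ℤ) x = x := by
  simp [slAct]

theorem slAct_inv_slAct (x : Fin d → ℝ) : slAct A⁻¹ (slAct A x) = x := by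
  rw [slAct_slAct, inv_mul_cancel, slAct_one]

theorem slAct_slAct_inv (x : Fin d → ℝ) : slAct A (slAct A⁻¹ x) = x := by
  rw [slAct_slAct, mul_inv_cancel, slAct_one]

theorem pairing_slAct (k : Fin d → ℤ) (x : Fin d → ℝ) :
    pairing k (slAct A x) = pairing (Matrix.vecMul k (A : Matrix (Fin d) (Fin d) ℤ)) x := by
  have h := Matrix.dotProduct_mulVec (fun i => (k i : ℝ))
    ((A : Matrix (Fin d) (Fin d) ℤ).map (Int.cast : ℤ → ℝ)) x
  simp only [pairing, slAct]
  refine h.trans ?_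
  simp [dotProduct, Matrix.vecMul]

theorem slAct_intVec (m : Fin d → ℤ) :
    slAct A (intVec m) = intVec (Matrix.mulVec (A : Matrix (Fin d) (Fin d) ℤ) m) := by
  ext i
  simp [slAct, intVec, Matrix.mulVec, dotProduct]

end SpecialLinear

/-! ### The resonance module and the small divisors in adapted coordinates. -/

section Resonance

variable {r s : ℕ} {Ω₀ : Fin (r + s) → ℝ} {A : Matrix.SpecialLinearGroup (Fin (r + s)) ℤ}
  {ω : Fin r → ℝ} {l : Fin (r + s) → ℤ} {ν τ : ℝ}

/-- The integer vector `k'` with `k · A⁻¹ (x₁, 0) = k' · x₁`. -/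
def fstFreq (A : Matrix.SpecialLinearGroup (Fin (r + s)) ℤ) (k : Fin (r + s) → ℤ) : Fin r → ℤ :=
  fun j => Matrix.vecMul k ((A⁻¹ : Matrix.SpecialLinearGroup (Fin (r + s)) ℤ) :
    Matrix (Fin (r + s)) (Fin (r + s)) ℤ) (Fin.castAdd s j)

theorem pairing_append (k : Fin (r + s) → ℤ) (x : Fin r → ℝ) (y : Fin s → ℝ) :
    pairing k (Fin.append x y) = pairing (fun j => k (Fin.castAdd s j)) x +
      pairing (fun j => k (Fin.natAdd r j)) y := by
  simp [pairing, Fin.sum_univ_add]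

/-- `k · Ω₀ = (k A⁻¹) · (A Ω₀)`, and modulo integers only the component `ω` of `A Ω₀` contributes.
-/
theorem pairing_resonant (hΩ₀ : slAct A Ω₀ = Fin.append ω (0 : Fin s → ℝ) + intVec l)
    (k : Fin (r + s) → ℤ) : ∃ n : ℤ, pairing k Ω₀ = pairing (fstFreq A k) ω + n := by
  have h1 : pairing k Ω₀ = pairing (Matrix.vecMul k
      ((A⁻¹ : Matrix.SpecialLinearGroup (Fin (r + s)) ℤ) : Matrix (Fin (r + s)) (Fin (r + s)) ℤ))
      (slAct A Ω₀) := by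
    rw [← pairing_slAct, slAct_inv_slAct]
  rw [h1, hΩ₀, pairing_add, pairing_append, pairing_intVec]
  refine ⟨∑ i, Matrix.vecMul k ((A⁻¹ : Matrix.SpecialLinearGroup (Fin (r + s)) ℤ) :
    Matrix (Fin (r + s)) (Fin (r + s)) ℤ) i * l i, ?_⟩
  congr 1
  simp [pairing, fstFreq]

/-- By `pairing_resonant` the question is whether `fstFreq A k · ω` is an integer, which the
Diophantine condition excludes for nonzero `fstFreq A k`. -/
theorem inResonanceModule_iff (hΩ₀ : slAct A Ω₀ = Fin.append ω (0 : Fin s → ℝ) + intVec l)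
    (hν : 0 < ν) (hω : Diophantine ν τ ω) (k : Fin (r + s) → ℤ) :
    InResonanceModule Ω₀ k ↔ fstFreq A k = 0 := by
  obtain ⟨n, hn⟩ := pairing_resonant hΩ₀ k
  constructor
  · rintro ⟨j, hj⟩
    by_contra h
    have h1 := hω _ h (j - n)
    have h2 : 0 < ‖fstFreq A k‖ := norm_pos_iff.2 h
    have h3 : pairing (fstFreq A k) ω - ((j - n : ℤ) : ℝ) = 0 := by
      push_cast
      linarith
    rw [h3, abs_zero] at h1
    have : 0 < ν * ‖fstFreq A k‖ ^ (-τ) := by positivity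
    linarith
  · intro h
    refine ⟨n, ?_⟩
    rw [hn, h]
    simp [pairing]

/-- `|e^{2πit} - 1| = 2 |sin πt|`, combined with Jordan's inequality. -/
theorem four_mul_abs_le_norm_expChar_sub_one {t : ℝ} (ht : |t| ≤ 1 / 2) :
    4 * |t| ≤ ‖expChar t - 1‖ := by
  have h1 : expChar t = Complex.exp (Complex.I * ((2 * Real.pi * t : ℝ) : ℂ)) := by
    rw [expChar]; congr 1; push_cast; ring
  have hpi := Real.pi_pos
  have h2 : |2 * Real.pi * t / 2| ≤ Real.pi / 2 := by
    rw [show 2 * Real.pi * t / 2 = Real.pi * t by ring, abs_mul, abs_of_pos hpi]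
    nlinarith
  have h3 := Real.mul_abs_le_abs_sin h2
  rw [h1, Complex.norm_exp_I_mul_ofReal_sub_one, norm_mul]
  have h4 : 2 / Real.pi * |2 * Real.pi * t / 2| = 2 * |t| := by
    rw [show 2 * Real.pi * t / 2 = Real.pi * t by ring, abs_mul, abs_of_pos hpi]
    field_simp
  rw [h4] at h3
  simp only [Real.norm_eq_abs, Nat.abs_ofNat]
  linarith

/-- The distance of `k · Ω₀` to the integers is that of `fstFreq A k · ω`, and `‖fstFreq A k‖` is at
most a multiple of `1 + ‖k‖`; so the exponent `τ` survives the change of coordinates. -/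
theorem smallDivisors_of_diophantine
    (hΩ₀ : slAct A Ω₀ = Fin.append ω (0 : Fin s → ℝ) + intVec l)
    (hν : 0 < ν) (hτ : 0 < τ) (hω : Diophantine ν τ ω) : SmallDivisors τ Ω₀ := by
  obtain ⟨a, ha, hak⟩ : ∃ a > 0, ∀ k : Fin (r + s) → ℤ, ‖fstFreq A k‖ ≤ a * (1 + ‖k‖) := by
    set B : Matrix (Fin (r + s)) (Fin (r + s)) ℤ :=
      ((A⁻¹ : Matrix.SpecialLinearGroup (Fin (r + s)) ℤ) : Matrix (Fin (r + s)) (Fin (r + s)) ℤ)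
      with hB
    refine ⟨1 + ∑ i, ∑ j, ‖B i j‖, by positivity, fun k => ?_⟩
    refine (pi_norm_le_iff_of_nonneg (by positivity)).2 fun j => ?_
    have h1 : fstFreq A k j = ∑ i, k i * B i (Fin.castAdd s j) := rfl
    rw [h1]
    have h2 : ∑ i, ‖B i (Fin.castAdd s j)‖ ≤ ∑ i, ∑ j, ‖B i j‖ := Finset.sum_le_sum fun i _ =>
      Finset.single_le_sum (f := fun j => ‖B i j‖) (fun _ _ => norm_nonneg _) (Finset.mem_univ _)
    calc ‖∑ i, k i * B i (Fin.castAdd s j)‖ ≤ ∑ i, ‖k‖ * ‖B i (Fin.castAdd s j)‖ := by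
          refine norm_sum_le_of_le _ fun i _ => (norm_mul_le _ _).trans ?_
          exact mul_le_mul_of_nonneg_right (norm_le_pi_norm k i) (norm_nonneg _)
      _ = ‖k‖ * ∑ i, ‖B i (Fin.castAdd s j)‖ := (Finset.mul_sum _ _ _).symm
      _ ≤ (1 + ‖k‖) * (1 + ∑ i, ∑ j, ‖B i j‖) := by
          have := norm_nonneg k
          gcongr
          · linarith
          · linarith
      _ = _ := mul_comm _ _
  refine ⟨4 * (ν * a ^ (-τ)), by positivity, fun k hk => ?_⟩
  rw [inResonanceModule_iff hΩ₀ hν hω] at hk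
  obtain ⟨n, hn⟩ := pairing_resonant hΩ₀ k
  set t := pairing (fstFreq A k) ω with ht
  have h1 := hω _ hk (round t)
  rw [← ht] at h1
  have h2 : expChar (pairing k Ω₀) = expChar (t - round t) := by
    have h3 : pairing k Ω₀ = (t - round t) + ((round t + n : ℤ) : ℝ) := by
      rw [hn]; push_cast; ring
    rw [h3, expChar_add, expChar_intCast, mul_one]
  rw [h2]
  refine le_trans ?_ (four_mul_abs_le_norm_expChar_sub_one (abs_sub_round t))
  have h4 : 0 < ‖fstFreq A k‖ := norm_pos_iff.2 hk
  have h5 : (a * (1 + ‖k‖)) ^ (-τ) ≤ ‖fstFreq A k‖ ^ (-τ) :=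
    Real.rpow_le_rpow_of_nonpos h4 (hak k) (by linarith)
  rw [Real.mul_rpow ha.le (by positivity)] at h5
  calc 4 * (ν * a ^ (-τ)) * (1 + ‖k‖) ^ (-τ) = 4 * (ν * (a ^ (-τ) * (1 + ‖k‖) ^ (-τ))) := by ring
    _ ≤ 4 * (ν * ‖fstFreq A k‖ ^ (-τ)) := by gcongr
    _ ≤ _ := by linarith

/-- In the coordinates given by `A`, a resonant part does not depend on the first component. -/
theorem resonantPart_slAct_inv (hΩ₀ : slAct A Ω₀ = Fin.append ω (0 : Fin s → ℝ) + intVec l)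
    (hν : 0 < ν) (hω : Diophantine ν τ ω) (u : (Fin (r + s) → ℝ) → Fin (r + s) → ℝ)
    (x₁ : Fin r → ℝ) (x₂ : Fin s → ℝ) :
    resonantPart Ω₀ u (slAct A⁻¹ (Fin.append x₁ x₂)) =
      resonantPart Ω₀ u (slAct A⁻¹ (Fin.append 0 x₂)) := by
  ext i
  simp only [resonantPart]
  congr 2
  ext k
  split_ifs with hk
  · rw [inResonanceModule_iff hΩ₀ hν hω] at hk
    rw [pairing_slAct, pairing_slAct, pairing_append, pairing_append]
    have h1 : (fun j => Matrix.vecMul k ((A⁻¹ : Matrix.SpecialLinearGroup (Fin (r + s)) ℤ) :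
      Matrix (Fin (r + s)) (Fin (r + s)) ℤ) (Fin.castAdd s j)) = 0 := hk
    rw [h1]
    simp [pairing]
  · rfl

end Resonance

end PhaseLocking

end

noncomputable section

namespace PhaseLocking

/-! ### Asymptotic expansions in `ε`. -/

section Expansions

variable {d k : ℕ} {s : ℝ}

/-- `v_ε(x) = c₀(x) + ε c₁(x) + ⋯ + ε^(M-1) c_(M-1)(x) + O(ε^M)` for small `ε ≥ 0`, where the
coefficients are of class `WA s` and the remainder is measured in `C^k`. -/
def Expands (k : ℕ) (s : ℝ) : ℕ → (ℝ → (Fin d → ℝ) → ℝ) → Prop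
  | 0, v => ∃ b > 0, ∃ K, ∀ ε ∈ Ico (0:ℝ) b, BC k K (v ε)
  | M + 1, v => ∃ c v', WA s c ∧ Expands k s M v' ∧
      ∃ b > 0, ∀ ε ∈ Ico (0:ℝ) b, ∀ x, v ε x = c x + ε * v' ε x

variable {M : ℕ} {v w : ℝ → (Fin d → ℝ) → ℝ} {c : (Fin d → ℝ) → ℝ}

theorem Expands.congr (hv : Expands k s M v) {b : ℝ} (hb : 0 < b)
    (h : ∀ ε ∈ Ico (0:ℝ) b, ∀ x, w ε x = v ε x) : Expands k s M w := by
  cases M with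
  | zero =>
    obtain ⟨b', hb', K, hK⟩ := hv
    refine ⟨min b b', lt_min hb hb', K, fun ε hε => ?_⟩
    rw [show w ε = v ε from funext (h ε ⟨hε.1, hε.2.trans_le (min_le_left _ _)⟩)]
    exact hK ε ⟨hε.1, hε.2.trans_le (min_le_right _ _)⟩
  | succ M =>
    obtain ⟨c, v', hc, hv', b', hb', hK⟩ := hv
    refine ⟨c, v', hc, hv', min b b', lt_min hb hb', fun ε hε x => ?_⟩
    rw [h ε ⟨hε.1, hε.2.trans_le (min_le_left _ _)⟩,
      hK ε ⟨hε.1, hε.2.trans_le (min_le_right _ _)⟩]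

theorem Expands.zero : Expands k s M (fun _ (_ : Fin d → ℝ) => (0:ℝ)) := by
  induction M with
  | zero => exact ⟨1, one_pos, 0, fun _ _ => BC.zero le_rfl⟩
  | succ M ih => exact ⟨_, _, WA.const 0, ih, 1, one_pos, fun ε _ x => by simp⟩

theorem WA.expands (hs : k ≤ s) (hc : WA s c) : Expands k s M (fun _ => c) := by
  cases M with
  | zero =>
    obtain ⟨K, hK⟩ := hc.bc hs
    exact ⟨1, one_pos, K, fun _ _ => hK⟩
  | succ M => exact ⟨c, _, hc, Expands.zero, 1, one_pos, fun ε _ x => by simp⟩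

theorem Expands.add (hv : Expands k s M v) (hw : Expands k s M w) :
    Expands k s M (fun ε x => v ε x + w ε x) := by
  induction M generalizing v w with
  | zero =>
    obtain ⟨b, hb, K, hK⟩ := hv
    obtain ⟨b', hb', K', hK'⟩ := hw
    exact ⟨min b b', lt_min hb hb', K + K', fun ε hε =>
      (hK ε ⟨hε.1, hε.2.trans_le (min_le_left _ _)⟩).add
        (hK' ε ⟨hε.1, hε.2.trans_le (min_le_right _ _)⟩)⟩
  | succ M ih =>
    obtain ⟨c, v', hc, hv', b, hb, h⟩ := hv
    obtain ⟨c', w', hc', hw', b', hb', h'⟩ := hw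
    refine ⟨_, _, hc.add hc', ih hv' hw', min b b', lt_min hb hb', fun ε hε x => ?_⟩
    beta_reduce
    rw [h ε ⟨hε.1, hε.2.trans_le (min_le_left _ _)⟩,
      h' ε ⟨hε.1, hε.2.trans_le (min_le_right _ _)⟩]
    ring

theorem Expands.const_mul (a : ℝ) (hv : Expands k s M v) :
    Expands k s M (fun ε x => a * v ε x) := by
  induction M generalizing v with
  | zero =>
    obtain ⟨b, hb, K, hK⟩ := hv
    exact ⟨b, hb, _, fun ε hε => (hK ε hε).smul a⟩
  | succ M ih =>
    obtain ⟨c, v', hc, hv', b, hb, h⟩ := hv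
    refine ⟨_, _, hc.const_mul a, ih hv', b, hb, fun ε hε x => ?_⟩
    beta_reduce
    rw [h ε hε]
    ring

theorem Expands.sub (hv : Expands k s M v) (hw : Expands k s M w) :
    Expands k s M (fun ε x => v ε x - w ε x) := by
  simpa [sub_eq_add_neg] using hv.add (hw.const_mul (-1))

theorem Expands.sum {ι : Type*} (t : Finset ι) {v : ι → ℝ → (Fin d → ℝ) → ℝ}
    (h : ∀ i ∈ t, Expands k s M (v i)) : Expands k s M (fun ε x => ∑ i ∈ t, v i ε x) := by
  classical
  induction t using Finset.induction_on with
  | empty => simpa using Expands.zero (d := d) (k := k) (s := s) (M := M)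
  | insert a t ha ih =>
    simp only [Finset.sum_insert ha]
    exact (h a (Finset.mem_insert_self a t)).add
      (ih fun i hi => h i (Finset.mem_insert_of_mem hi))

theorem Expands.id_mul (hv : Expands k s M v) : Expands k s (M + 1) (fun ε x => ε * v ε x) :=
  ⟨_, v, WA.const 0, hv, 1, one_pos, fun ε _ x => by simp⟩

theorem Expands.pow_mul (i : ℕ) (hv : Expands k s M v) :
    Expands k s (M + i) (fun ε x => ε ^ i * v ε x) := by
  induction i with
  | zero => simpa using hv
  | succ i ih =>
    have := ih.id_mul
    simp only [← mul_assoc, ← pow_succ'] at this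
    exact this

/-- The last coefficient is absorbed in the remainder and must therefore be bounded in `C^k`; hence
`k ≤ s`. -/
theorem Expands.lower (hs : k ≤ s) (hv : Expands k s (M + 1) v) : Expands k s M v := by
  induction M generalizing v with
  | zero =>
    obtain ⟨c, v', hc, ⟨b', hb', K', hK'⟩, b, hb, h⟩ := hv
    obtain ⟨K, hK⟩ := hc.bc hs
    refine ⟨min 1 (min b b'), by positivity, K + K', fun ε hε => ?_⟩
    have h1 : ε < 1 := hε.2.trans_le (min_le_left _ _)
    have h2 : ε < b := hε.2.trans_le ((min_le_right _ _).trans (min_le_left _ _))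
    have h3 : ε < b' := hε.2.trans_le ((min_le_right _ _).trans (min_le_right _ _))
    rw [show v ε = fun x => c x + ε * v' ε x from funext (h ε ⟨hε.1, h2⟩)]
    have h4 := hK' ε ⟨hε.1, h3⟩
    refine hK.add ((h4.smul ε).mono ?_)
    rw [abs_of_nonneg hε.1]
    exact mul_le_of_le_one_left h4.nonneg h1.le
  | succ M ih =>
    obtain ⟨c, v', hc, hv', b, hb, h⟩ := hv
    exact ⟨c, v', hc, ih hv', b, hb, h⟩

theorem Expands.mono (hs : k ≤ s) {M' : ℕ} (h : M' ≤ M) (hv : Expands k s M v) :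
    Expands k s M' v := by
  induction M with
  | zero => obtain rfl : M' = 0 := by omega
            exact hv
  | succ M ih =>
    rcases Nat.lt_or_ge M' (M + 1) with h1 | h1
    · exact ih (by omega) (hv.lower hs)
    · obtain rfl : M' = M + 1 := by omega
      exact hv

theorem Expands.mul (hs : k ≤ s) (hv : Expands k s M v) (hw : Expands k s M w) :
    Expands k s M (fun ε x => v ε x * w ε x) := by
  have hs0 : 0 ≤ s := (Nat.cast_nonneg k).trans hs
  induction M generalizing v w with
  | zero =>
    obtain ⟨b, hb, K, hK⟩ := hv
    obtain ⟨b', hb', K', hK'⟩ := hw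
    exact ⟨min b b', lt_min hb hb', _, fun ε hε =>
      (hK ε ⟨hε.1, hε.2.trans_le (min_le_left _ _)⟩).mul
        (hK' ε ⟨hε.1, hε.2.trans_le (min_le_right _ _)⟩)⟩
  | succ M ih =>
    have hw0 := hw.lower hs
    obtain ⟨c, v', hc, hv', b, hb, h⟩ := hv
    obtain ⟨c', w', hc', hw', b', hb', h'⟩ := hw
    -- `v w = c c' + ε (c w' + v' w)`: in this asymmetric form `w` itself is needed only to order
    -- `M`.
    refine ⟨_, _, hc.mul hs0 hc', (ih (WA.expands hs hc) hw').add (ih hv' hw0), min b b',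
      lt_min hb hb', fun ε hε x => ?_⟩
    beta_reduce
    rw [h ε ⟨hε.1, hε.2.trans_le (min_le_left _ _)⟩]
    have := h' ε ⟨hε.1, hε.2.trans_le (min_le_right _ _)⟩ x
    linear_combination c x * this

/-- The recursive definition suits algebraic operations; the sum with a remainder `O(ε ^ M)` suits
integration in `ε`. -/
theorem expands_iff_sum : Expands k s M v ↔ ∃ c : ℕ → (Fin d → ℝ) → ℝ, (∀ i, WA s (c i)) ∧
    ∃ b > 0, ∃ K, ∀ ε ∈ Ico (0:ℝ) b,
      BC k (K * ε ^ M) (fun x => v ε x - ∑ i ∈ Finset.range M, ε ^ i * c i x) := by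
  induction M generalizing v with
  | zero =>
    simp only [Finset.range_zero, Finset.sum_empty, sub_zero, pow_zero, mul_one]
    exact ⟨fun h => ⟨fun _ _ => 0, fun _ => WA.const 0, h⟩, fun ⟨_, _, h⟩ => h⟩
  | succ M ih =>
    constructor
    · rintro ⟨c, v', hc, hv', b, hb, h⟩
      obtain ⟨c', hc', b', hb', K, hK⟩ := ih.1 hv'
      refine ⟨fun i => Nat.casesOn i c c', fun i => ?_, min b b', lt_min hb hb', K, fun ε hε => ?_⟩
      · cases i
        · exact hc
        · exact hc' _
      · have h1 := (hK ε ⟨hε.1, hε.2.trans_le (min_le_right _ _)⟩).smul ε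
        rw [abs_of_nonneg hε.1] at h1
        refine Eq.mp (congrArg₂ (BC k) (by ring) (funext fun x => ?_)) h1
        rw [h ε ⟨hε.1, hε.2.trans_le (min_le_left _ _)⟩, Finset.sum_range_succ']
        change _ = c x + ε * v' ε x -
          ((∑ i ∈ Finset.range M, ε ^ (i + 1) * c' i x) + ε ^ 0 * c x)
        simp only [smul_eq_mul, pow_succ', pow_zero, one_mul, mul_sub, Finset.mul_sum, mul_assoc]
        ring
    · rintro ⟨c, hc, b, hb, K, hK⟩
      -- At `ε = 0` the convention `0⁻¹ = 0` leaves only the polynomial, and the remainder bound `K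
      -- * 0 ^ (M + 1) = 0` forces `v 0 = c 0`.
      refine ⟨c 0, fun ε x => (∑ i ∈ Finset.range M, ε ^ i * c (i + 1) x) +
        ε⁻¹ * (v ε x - ∑ i ∈ Finset.range (M + 1), ε ^ i * c i x), hc 0, ih.2
        ⟨fun i => c (i + 1), fun i => hc _, b, hb, K, fun ε hε => ?_⟩, b, hb, fun ε hε x => ?_⟩
      · have h1 := (hK ε hε).smul ε⁻¹
        rcases hε.1.eq_or_lt with rfl | h0
        · have hK0 : 0 ≤ K * 0 ^ M := by
            rcases M with _ | M
            · simpa using (hK (b / 2) ⟨by positivity, by linarith⟩).nonneg.trans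
                (le_refl _) |> fun h => by
                  have : 0 < b / 2 := by positivity
                  have h2 : 0 ≤ K * (b / 2) := by simpa using h
                  exact nonneg_of_mul_nonneg_left h2 this
            · simp
          simpa using BC.zero (X := Fin d → ℝ) (E := ℝ) (k := k) hK0
        · rw [abs_of_nonneg (by positivity)] at h1
          refine Eq.mp (congrArg₂ (BC k) (by rw [pow_succ]; field_simp) (funext fun x => ?_)) h1
          simp
      · rcases hε.1.eq_or_lt with rfl | h0
        · have h1 := (hK 0 hε).norm_le x
          simp only [ne_eq, Nat.add_eq_zero_iff, one_ne_zero, and_false, not_false_eq_true,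
            zero_pow, mul_zero] at h1
          have h2 := norm_le_zero_iff.1 h1
          rw [Finset.sum_range_succ'] at h2
          simp at h2
          simp
          linarith
        · rw [mul_add, mul_inv_cancel_left₀ h0.ne', Finset.sum_range_succ', Finset.mul_sum]
          simp only [pow_succ', pow_zero, one_mul, mul_assoc]
          ring

/-- A function of order `ε^j` with an expansion is `ε^j` times a function with an expansion. -/
theorem Expands.factor (hs : k ≤ s) {j : ℕ} (hv : Expands k s (M + j) v)
    (h : ∀ x, (fun ε => v ε x) =O[𝓝[>] 0] fun ε => ε ^ j) :
    ∃ v', Expands k s M v' ∧ ∃ b > 0, ∀ ε ∈ Ico (0:ℝ) b, ∀ x, v ε x = ε ^ j * v' ε x := by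
  induction j generalizing v with
  | zero => exact ⟨v, hv, 1, one_pos, fun ε _ x => by simp⟩
  | succ j ih =>
    obtain ⟨c, v', hc, hv', b, hb, hcv⟩ := hv
    obtain ⟨b', hb', K, hK⟩ := hv'.mono hs (Nat.zero_le _)
    have hmem : ∀ {b : ℝ}, 0 < b → ∀ᶠ ε in 𝓝[>] (0:ℝ), ε ∈ Ico (0:ℝ) b := fun {b} hb => by
      filter_upwards [Ioo_mem_nhdsGT hb] with ε hε using ⟨hε.1.le, hε.2⟩
    have hid : Tendsto (fun ε : ℝ => ε) (𝓝[>] 0) (𝓝 0) := tendsto_nhdsWithin_of_tendsto_nhds tendsto_id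
    -- The leading coefficient is the limit of `v ε x`, which is zero since `v` is of positive order
    -- in `ε`.
    have hc0 : ∀ x, c x = 0 := by
      intro x
      have h1 : Tendsto (fun ε => v ε x) (𝓝[>] 0) (𝓝 0) :=
        (h x).trans_tendsto (by simpa using hid.pow (j + 1))
      have h2 : Tendsto (fun ε => ε * v' ε x) (𝓝[>] 0) (𝓝 0) := by
        refine hid.zero_mul_isBoundedUnder_le ⟨K, ?_⟩
        rw [eventually_map]
        filter_upwards [hmem hb'] with ε hε using (hK ε hε).norm_le x
      have h3 : Tendsto (fun ε => v ε x - ε * v' ε x) (𝓝[>] 0) (𝓝 (c x)) := by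
        refine tendsto_const_nhds.congr' ?_
        filter_upwards [hmem hb] with ε hε
        rw [hcv ε hε]; ring
      simpa using tendsto_nhds_unique h3 (h1.sub h2)
    have hcv' : ∀ ε ∈ Ico (0:ℝ) b, ∀ x, v ε x = ε * v' ε x := fun ε hε x => by
      rw [hcv ε hε, hc0, zero_add]
    obtain ⟨v'', hv'', b'', hb'', h''⟩ := ih hv' fun x => by
      obtain ⟨C, hC⟩ := (h x).bound
      refine Asymptotics.IsBigO.of_bound C ?_
      filter_upwards [hC, hmem hb, self_mem_nhdsWithin] with ε h1 h2 h3
      have h3 : 0 < ε := h3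
      rw [hcv' ε h2, pow_succ', norm_mul, norm_mul, mul_left_comm] at h1
      exact le_of_mul_le_mul_left h1 (norm_pos_iff.2 h3.ne')
    refine ⟨v'', hv'', min b b'', lt_min hb hb'', fun ε hε x => ?_⟩
    rw [hcv' ε ⟨hε.1, hε.2.trans_le (min_le_left _ _)⟩,
      h'' ε ⟨hε.1, hε.2.trans_le (min_le_right _ _)⟩]
    ring

/-- An expansion of the derivative in `ε` can be integrated. -/
theorem Expands.of_hasDerivWithinAt (hs : k ≤ s) {ρ : ℝ → (Fin d → ℝ) → ℝ} {b : ℝ} (hb : 0 < b)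
    (hv : ∀ ε ∈ Ico 0 b, ContDiff ℝ k (v ε)) (h0 : WA s (v 0))
    (hcont : ∀ x, ContinuousOn (fun ε => v ε x) (Ico 0 b))
    (hd : ∀ x, ∀ ε ∈ Ico 0 b, HasDerivWithinAt (fun ε => v ε x) (ρ ε x) (Ici ε) ε)
    (hρ : Expands k s M ρ) : Expands k s (M + 1) v := by
  obtain ⟨r, hr, b', hb', K, hK⟩ := expands_iff_sum.1 hρ
  have hrc : ∀ i, ContDiff ℝ k (r i) := fun i => by
    obtain ⟨K, hK⟩ := (hr i).bc hs
    exact hK.contDiff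
  have hv0c := hv 0 ⟨le_rfl, hb⟩
  -- The coefficients of the antiderivative: `v 0`, followed by `r i / (i + 1)`.
  refine expands_iff_sum.2 ⟨fun i => Nat.casesOn i (v 0) fun i x => (i + 1 : ℝ)⁻¹ * r i x,
    fun i => ?_, min b b', lt_min hb hb', K, fun ε hε => ?_⟩
  · cases i
    · exact h0
    · exact (hr _).const_mul _
  have hεb : ε < b := hε.2.trans_le (min_le_left _ _)
  have hεb' : ε < b' := hε.2.trans_le (min_le_right _ _)
  rcases hε.1.eq_or_lt with rfl | hε0
  · simp only [Finset.sum_range_succ']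
    simpa using BC.zero (X := Fin d → ℝ) (E := ℝ) (k := k) (le_refl (0:ℝ))
  have hKnn : 0 ≤ K := by
    have := (hK ε ⟨hε.1, hεb'⟩).nonneg
    exact nonneg_of_mul_nonneg_left this (by positivity)
  have key := BC.of_hasDerivWithinAt (k := k) (b := ε) (B := K * ε ^ M)
    (V := fun t x => v t x - ∑ i ∈ Finset.range (M + 1),
      t ^ i * (Nat.casesOn i (v 0) (fun i x => (i + 1 : ℝ)⁻¹ * r i x) : (Fin d → ℝ) → ℝ) x)
    (ρ := fun t x => ρ t x - ∑ i ∈ Finset.range M, t ^ i * r i x)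
  refine Eq.mp (congrArg₂ (BC k) (by ring) rfl) (key ?_ ?_ ?_ ?_ ?_ ?_)
  · exact hε.1
  · refine (hv ε ⟨hε.1, hεb⟩).sub (ContDiff.sum fun i _ => contDiff_const.mul ?_)
    cases i
    · exact hv0c
    · exact contDiff_const.mul (hrc _)
  · intro x
    simp [Finset.sum_range_succ']
  · intro x
    refine ((hcont x).mono fun t ht => ⟨ht.1, ht.2.trans_lt hεb⟩).sub (Continuous.continuousOn ?_)
    fun_prop
  · intro x t ht
    refine (hd x t ⟨ht.1, ht.2.trans hεb⟩).sub (HasDerivAt.hasDerivWithinAt ?_)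
    simp only [Finset.sum_range_succ', pow_zero, one_mul]
    have h1 : HasDerivAt (fun t : ℝ => ∑ i ∈ Finset.range M,
        t ^ (i + 1) * ((i + 1 : ℝ)⁻¹ * r i x))
        (∑ i ∈ Finset.range M, t ^ i * r i x) t := by
      refine HasDerivAt.fun_sum fun i _ => ?_
      have h2 := (hasDerivAt_pow (i + 1) t).mul_const ((i + 1 : ℝ)⁻¹ * r i x)
      refine h2.congr_deriv ?_
      have : (i + 1 : ℝ) ≠ 0 := by positivity
      push_cast
      field_simp
    exact h1.add_const _
  · intro t ht
    refine (hK t ⟨ht.1, ht.2.trans hεb'⟩).mono ?_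
    have := ht.1
    gcongr
    exact ht.2.le

end Expansions

end PhaseLocking

end

noncomputable section

namespace PhaseLocking

/-! ### Composition with families polynomial in `ε`. -/

section PolynomialFamilies

theorem BC.pi {X : Type} [NormedAddCommGroup X] [NormedSpace ℝ X] {d k : ℕ} {K : ℝ}
    {u : X → Fin d → ℝ} (h : ∀ i, BC k K fun x => u x i) : BC k (d * K) u := by
  have h1 := BC.sum Finset.univ fun i _ =>
    (h i).clm_comp (ContinuousLinearMap.single ℝ (fun _ : Fin d => ℝ) i)
  have h2 : ∀ i, ‖ContinuousLinearMap.single ℝ (fun _ : Fin d => ℝ) i‖ ≤ 1 := fun i =>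
    ContinuousLinearMap.opNorm_le_bound _ zero_le_one fun x => by
      simp [Pi.norm_single]
  have h3 : (fun x => ∑ i, ContinuousLinearMap.single ℝ (fun _ : Fin d => ℝ) i (u x i)) = u := by
    ext x j
    simp [Finset.sum_apply, Pi.single_apply]
  rw [h3] at h1
  refine h1.mono ?_
  calc _ ≤ ∑ _i : Fin d, K := Finset.sum_le_sum fun i _ =>
        mul_le_of_le_one_left (h i).nonneg (h2 i)
    _ = d * K := by simp

variable {d k : ℕ} {s : ℝ} {Ω : Fin d → ℝ} {γ : ℕ → (Fin d → ℝ) → Fin d → ℝ} {m : ℕ}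

theorem exists_bc_of_forall_wa (hs : k ≤ s) {u : (Fin d → ℝ) → Fin d → ℝ}
    (h : ∀ i, WA s fun x => u x i) : ∃ K, BC k K u := by
  choose K hK using fun i => (h i).bc hs
  exact ⟨_, BC.pi fun i => (hK i).mono
    ((le_abs_self _).trans (Finset.single_le_sum (f := fun i => |K i|) (fun _ _ => abs_nonneg _)
      (Finset.mem_univ i)))⟩

/-- The map `x + Ω + ε γ₀(x) + ⋯ + ε^m γ_(m-1)(x)`. -/
def polyMap (Ω : Fin d → ℝ) (γ : ℕ → (Fin d → ℝ) → Fin d → ℝ) (m : ℕ) (ε : ℝ) (x : Fin d → ℝ) :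
    Fin d → ℝ :=
  x + Ω + ∑ i ∈ Finset.range m, ε ^ (i + 1) • γ i x

theorem bc_polyMap_sub (hs : k ≤ s) (hγ : ∀ i < m, ∀ j, WA s fun x => γ i x j) :
    ∃ K, 0 ≤ K ∧ ∀ ε ∈ Icc (0:ℝ) 1,
      BC k (K * ε) (fun x => ∑ i ∈ Finset.range m, ε ^ (i + 1) • γ i x) := by
  have h1 : ∀ i, ∃ K, i < m → BC k K (γ i) := fun i => by
    by_cases hi : i < m
    · obtain ⟨K, hK⟩ := exists_bc_of_forall_wa hs (hγ i hi)
      exact ⟨K, fun _ => hK⟩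
    · exact ⟨0, fun h => absurd h hi⟩
  choose K hK using h1
  have hK0 : ∀ i ∈ Finset.range m, 0 ≤ K i := fun i hi => (hK i (Finset.mem_range.1 hi)).nonneg
  refine ⟨∑ i ∈ Finset.range m, K i, Finset.sum_nonneg hK0, fun ε hε => ?_⟩
  refine (BC.sum (Finset.range m) fun i hi =>
    (hK i (Finset.mem_range.1 hi)).smul (ε ^ (i + 1))).mono ?_
  rw [Finset.sum_mul]
  refine Finset.sum_le_sum fun i hi => ?_
  rw [abs_of_nonneg (pow_nonneg hε.1 _), mul_comm]
  refine mul_le_mul_of_nonneg_left ?_ (hK0 i hi)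
  rw [pow_succ]
  exact mul_le_of_le_one_left hε.1 (pow_le_one₀ hε.1 hε.2)

theorem db_polyMap (hs : k ≤ s) (hγ : ∀ i < m, ∀ j, WA s fun x => γ i x j) :
    ∃ D, ∀ ε ∈ Icc (0:ℝ) 1, DB k D (polyMap Ω γ m ε) := by
  obtain ⟨K, hK0, hK⟩ := bc_polyMap_sub hs hγ
  exact ⟨1 + 0 + K, fun ε hε => (DB.id.add (DB.const le_rfl Ω)).add
    ((hK ε hε).mono (mul_le_of_le_one_right hK0 hε.2)).db⟩

theorem hasDerivAt_polyMap (ε : ℝ) (x : Fin d → ℝ) :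
    HasDerivAt (fun ε => polyMap Ω γ m ε x)
      (∑ i ∈ Finset.range m, ((i + 1 : ℝ) * ε ^ i) • γ i x) ε := by
  refine HasDerivAt.const_add _ (HasDerivAt.fun_sum fun i _ => ?_)
  have := (hasDerivAt_pow (i + 1) ε).smul_const (γ i x)
  simpa using this

theorem polyMap_zero (x : Fin d → ℝ) : polyMap Ω γ m 0 x = x + Ω := by
  simp [polyMap]

/-- Composition of a fixed function with a polynomial family. -/
theorem WA.expands_comp_polyMap (hs : (k : ℝ) + 1 ≤ s) (hγ : ∀ i < m, ∀ j, WA s fun x => γ i x j)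
    {M : ℕ} {s' : ℝ} {h : (Fin d → ℝ) → ℝ} (hh : WA s' h) (hs' : s + M ≤ s' + 1) :
    Expands k s M (fun ε x => h (polyMap Ω γ m ε x)) := by
  have hk0 : (0:ℝ) ≤ k := Nat.cast_nonneg k
  have hks : (k : ℝ) ≤ s := by linarith
  obtain ⟨D, hD⟩ := db_polyMap (Ω := Ω) hks hγ
  induction M generalizing s' h with
  | zero =>
    obtain ⟨K, hK⟩ := hh.bc (k := k) (by push_cast at hs'; linarith)
    exact ⟨1, one_pos, _, fun ε hε => hK.comp (hD ε ⟨hε.1, hε.2.le⟩)⟩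
  | succ M ih =>
    push_cast at hs'
    have hM0 : (0:ℝ) ≤ M := Nat.cast_nonneg M
    have hks' : (k : ℝ) ≤ s' := by linarith
    obtain ⟨hdiff, hpd⟩ := WA.pd (s := s' - 1) (u := h) (by linarith) (by simpa using hh)
    obtain ⟨K, hK⟩ := hh.bc hks'
    have hcomp : ∀ x, Continuous fun ε : ℝ => polyMap Ω γ m ε x := fun x =>
      continuous_iff_continuousAt.2 fun ε => (hasDerivAt_polyMap ε x).continuousAt
    -- Differentiation in `ε` replaces `h` by its partial derivatives, so each further order of the
    -- expansion uses up one unit of the weight of `h`; this is the budget `s + M ≤ s' + 1`.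
    refine Expands.of_hasDerivWithinAt (b := 1) hks
      (ρ := fun ε x => ∑ j, PhaseLocking.pd j h (polyMap Ω γ m ε x) *
        ∑ i ∈ Finset.range m, (i + 1 : ℝ) * (ε ^ i * γ i x j)) one_pos ?_ ?_ ?_ ?_ ?_
    · exact fun ε hε => (hK.comp (hD ε ⟨hε.1, hε.2.le⟩)).contDiff
    · simp only [polyMap_zero]
      exact (hh.translate Ω).mono (by linarith)
    · exact fun x => (hdiff.continuous.comp (hcomp x)).continuousOn
    · intro x ε _
      have h1 := (hdiff (polyMap Ω γ m ε x)).hasFDerivAt.comp_hasDerivAt ε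
        (hasDerivAt_polyMap (Ω := Ω) (γ := γ) (m := m) ε x)
      refine (h1.congr_deriv ?_).hasDerivWithinAt
      rw [fderiv_eq_sum_pd]
      simp only [sum_apply, ContinuousLinearMap.smulRight_apply,
        ContinuousLinearMap.proj_apply, Finset.sum_apply, Pi.smul_apply, smul_eq_mul]
      refine Finset.sum_congr rfl fun j _ => ?_
      rw [mul_comm]
      congr 1
      exact Finset.sum_congr rfl fun i _ => by ring
    · refine Expands.sum _ fun j _ => (ih (hpd j) (by linarith)).mul hks
        (Expands.sum _ fun i hi => Expands.const_mul _ ?_)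
      exact ((WA.expands hks (hγ i (Finset.mem_range.1 hi) j)).pow_mul i).mono hks
        (Nat.le_add_right M i)

/-- Composition of an expansion with a polynomial family. -/
theorem Expands.comp_polyMap (hs : (k : ℝ) + 1 ≤ s) (hγ : ∀ i < m, ∀ j, WA s fun x => γ i x j)
    {M : ℕ} {s' : ℝ} {v : ℝ → (Fin d → ℝ) → ℝ} (hv : Expands k s' M v) (hs' : s + M ≤ s' + 1) :
    Expands k s M (fun ε x => v ε (polyMap Ω γ m ε x)) := by
  have hks : (k : ℝ) ≤ s := by linarith
  obtain ⟨D, hD⟩ := db_polyMap (Ω := Ω) hks hγ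
  induction M generalizing v with
  | zero =>
    obtain ⟨b, hb, K, hK⟩ := hv
    exact ⟨min b 1, lt_min hb one_pos, _, fun ε hε => (hK ε ⟨hε.1, hε.2.trans_le
      (min_le_left _ _)⟩).comp (hD ε ⟨hε.1, hε.2.le.trans (min_le_right _ _)⟩)⟩
  | succ M ih =>
    push_cast at hs'
    obtain ⟨c, v', hc, hv', b, hb, h⟩ := hv
    exact ((hc.expands_comp_polyMap hs hγ (M := M + 1) (by push_cast; linarith)).add
      (ih hv' (by linarith)).id_mul).congr hb fun ε hε x => h ε hε _

end PolynomialFamilies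

/-! ### Taylor expansion of the given family in `ε`. -/

section Taylor

/-- Taylor's formula in a parameter, with the remainder measured in `C^k`. -/
theorem BC.taylor {X E : Type} [NormedAddCommGroup X] [NormedSpace ℝ X] [NormedAddCommGroup E]
    [NormedSpace ℝ E] {k N : ℕ} {K b : ℝ} {φ : ℕ → ℝ → X → E}
    (hφ : ∀ i ≤ N, ∀ t ∈ Ico 0 b, BC k K (φ i t))
    (hc : ∀ i < N, ∀ x, ContinuousOn (fun t => φ i t x) (Ico 0 b))
    (hd : ∀ i < N, ∀ x, ∀ t ∈ Ico 0 b,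
      HasDerivWithinAt (fun t => φ i t x) (φ (i + 1) t x) (Ici t) t) {ε : ℝ} (hε : ε ∈ Ico 0 b) :
    BC k (K * ε ^ N) (fun x => φ 0 ε x -
      ∑ i ∈ Finset.range N, ε ^ i • ((i.factorial : ℝ)⁻¹ • φ i 0 x)) := by
  induction N generalizing φ ε with
  | zero => simpa using hφ 0 le_rfl ε hε
  | succ N ih =>
    have hb : 0 < b := hε.1.trans_lt hε.2
    have hK : 0 ≤ K := (hφ 0 (Nat.zero_le _) 0 ⟨le_rfl, hb⟩).nonneg
    -- The derivative in `t` of the remainder of order `N + 1` is the remainder of order `N` of the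
    -- shifted family.
    have ih' := fun {t : ℝ} (ht : t ∈ Ico 0 b) => ih (φ := fun i => φ (i + 1))
      (fun i hi => hφ (i + 1) (by omega)) (fun i hi => hc (i + 1) (by omega))
      (fun i hi => hd (i + 1) (by omega)) ht
    have key := BC.of_hasDerivWithinAt (k := k) (b := ε) (B := K * ε ^ N)
      (V := fun t x => φ 0 t x -
        ∑ i ∈ Finset.range (N + 1), t ^ i • ((i.factorial : ℝ)⁻¹ • φ i 0 x))
      (ρ := fun t x => φ 1 t x -
        ∑ i ∈ Finset.range N, t ^ i • ((i.factorial : ℝ)⁻¹ • φ (i + 1) 0 x)) hε.1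
    rw [pow_succ, ← mul_assoc]
    refine key ?_ ?_ ?_ ?_ ?_
    · exact (hφ 0 (Nat.zero_le _) ε hε).contDiff.sub (ContDiff.sum fun i hi =>
        ((hφ i (by have := Finset.mem_range.1 hi; omega) 0 ⟨le_rfl, hb⟩).contDiff.const_smul
          _).const_smul _)
    · intro x
      simp [Finset.sum_range_succ']
    · intro x
      refine ((hc 0 (by omega) x).mono fun t ht => ⟨ht.1, ht.2.trans_lt hε.2⟩).sub
        (Continuous.continuousOn ?_)
      fun_prop
    · intro x t ht
      refine (hd 0 (by omega) x t ⟨ht.1, ht.2.trans hε.2⟩).sub (HasDerivAt.hasDerivWithinAt ?_)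
      simp only [Finset.sum_range_succ', pow_zero, one_smul]
      refine HasDerivAt.add_const _ (HasDerivAt.fun_sum fun i _ => ?_)
      refine ((hasDerivAt_pow (i + 1) t).smul_const _).congr_deriv ?_
      rw [smul_smul, smul_smul, Nat.factorial_succ]
      congr 1
      have : (i + 1 : ℝ) ≠ 0 := by positivity
      have : (i.factorial : ℝ) ≠ 0 := by positivity
      push_cast
      field_simp
    · intro t ht
      refine (ih' ⟨ht.1, ht.2.trans hε.2⟩).mono ?_
      have := ht.1
      gcongr
      exact ht.2.le

variable {d : ℕ} {p : WithTop ℕ∞} {k N : ℕ} {ε₁ : ℝ} {f : ℝ → (Fin d → ℝ) → Fin d → ℝ}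

theorem Periodic.iteratedDerivWithin (hper : ∀ ε ∈ Ico (0:ℝ) ε₁, Periodic (f ε)) (b : ℕ) {ε : ℝ}
    (hε : ε ∈ Ico 0 ε₁) :
    Periodic fun x => iteratedDerivWithin b (fun t => f t x) (Ico 0 ε₁) ε := fun x m =>
  iteratedDerivWithin_congr (fun t ht => hper t ht x m) hε

theorem Periodic.iteratedFDeriv {E : Type} [NormedAddCommGroup E] [NormedSpace ℝ E]
    {u : (Fin d → ℝ) → E} (hu : Periodic u) (a : ℕ) : Periodic (iteratedFDeriv ℝ a u) := by
  intro x m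
  rw [← iteratedFDeriv_comp_add_right]
  congr 1
  exact funext fun y => hu y m

/-- Compactness of `[0, ε₁ / 2]` times the period cube; halving the interval keeps it away from the
open end `ε₁`. -/
theorem exists_bc_of_mixedRegularity (hε₁ : 0 < ε₁) (hper : ∀ ε ∈ Ico (0:ℝ) ε₁, Periodic (f ε))
    (hf : MixedRegularity p N ε₁ f) (hk : (k : WithTop ℕ∞) ≤ p) :
    ∃ K, ∀ b ≤ N, ∀ ε ∈ Ico 0 (ε₁ / 2),
      BC k K (fun x => iteratedDerivWithin b (fun t => f t x) (Ico 0 ε₁) ε) := by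
  have hsub : Icc 0 (ε₁ / 2) ⊆ Ico 0 ε₁ := fun t ht => ⟨ht.1, by linarith [ht.2]⟩
  have h1 : ∀ b a : ℕ, ∃ K, b ≤ N → a ≤ k → ∀ ε ∈ Ico 0 (ε₁ / 2), ∀ x, ‖iteratedFDeriv ℝ a
      (fun x => iteratedDerivWithin b (fun t => f t x) (Ico 0 ε₁) ε) x‖ ≤ K := by
    intro b a
    by_cases hb : b ≤ N
    swap
    · exact ⟨0, fun h => absurd h hb⟩
    by_cases ha : a ≤ k
    swap
    · exact ⟨0, fun _ h => absurd h ha⟩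
    have hc := (hf.2 b hb).2 a (le_trans (by exact_mod_cast ha) hk)
    obtain ⟨K, hK⟩ := ((isCompact_Icc (a := (0:ℝ)) (b := ε₁ / 2)).prod
      (isCompact_Icc (a := (0 : Fin d → ℝ)) (b := 1))).exists_bound_of_continuousOn
      (hc.mono (prod_mono hsub (subset_univ _)))
    refine ⟨K, fun _ _ ε hε x => ?_⟩
    have hp := Periodic.iteratedFDeriv (Periodic.iteratedDerivWithin hper b
      (hsub ⟨hε.1, hε.2.le⟩)) a x (fun i => -⌊x i⌋)
    rw [← hp]
    refine hK (ε, x + intVec fun i => -⌊x i⌋) ⟨⟨hε.1, hε.2.le⟩, fun i => ?_, fun i => ?_⟩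
    · simp only [Pi.zero_apply, Pi.add_apply, intVec, Int.cast_neg]
      linarith [Int.floor_le (x i)]
    · simp only [Pi.one_apply, Pi.add_apply, intVec, Int.cast_neg]
      linarith [Int.lt_floor_add_one (x i)]
  choose K hK using h1
  refine ⟨∑ b ∈ Finset.range (N + 1), ∑ a ∈ Finset.range (k + 1), |K b a|, fun b hb ε hε =>
    ⟨((hf.2 b hb).1 ε (hsub ⟨hε.1, hε.2.le⟩)).of_le hk, fun a ha x => ?_⟩⟩
  refine (hK b a hb ha ε hε x).trans ((le_abs_self _).trans ?_)
  refine le_trans (Finset.single_le_sum (f := fun a => |K b a|) (fun _ _ => abs_nonneg _)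
    (Finset.mem_range.2 (by omega : a < k + 1))) ?_
  exact Finset.single_le_sum (f := fun b => ∑ a ∈ Finset.range (k + 1), |K b a|)
    (fun _ _ => Finset.sum_nonneg fun _ _ => abs_nonneg _)
    (Finset.mem_range.2 (by omega : b < N + 1))

/-- The expansion of the family in powers of `ε`. -/
theorem expands_of_mixedRegularity {S : ℝ} {p₀ : ℕ} (hε₁ : 0 < ε₁)
    (hper : ∀ ε ∈ Ico (0:ℝ) ε₁, Periodic (f ε)) (hf : MixedRegularity p N ε₁ f)
    (hp₀ : (p₀ : WithTop ℕ∞) ≤ p) (hS : 0 ≤ S) (hSp : S + d < p₀) (hk : k ≤ p₀) (i : Fin d) :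
    Expands k S N (fun ε x => f ε x i) := by
  obtain ⟨K, hK⟩ := exists_bc_of_mixedRegularity hε₁ hper hf
    (le_trans (by exact_mod_cast hk) hp₀ : (k : WithTop ℕ∞) ≤ p)
  have h0 : (0:ℝ) ∈ Ico 0 ε₁ := ⟨le_rfl, hε₁⟩
  have hsub : Ico 0 (ε₁ / 2) ⊆ Ico 0 ε₁ := fun t ht => ⟨ht.1, by linarith [ht.2]⟩
  set φ : ℕ → ℝ → (Fin d → ℝ) → Fin d → ℝ := fun b ε x =>
    iteratedDerivWithin b (fun t => f t x) (Ico 0 ε₁) ε with hφ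
  have hud : UniqueDiffOn ℝ (Ico 0 ε₁) := uniqueDiffOn_Ico 0 ε₁
  have hdiff : ∀ b < N, ∀ x, DifferentiableOn ℝ (fun t => φ b t x) (Ico 0 ε₁) := fun b hb x =>
    (hf.1 x).differentiableOn_iteratedDerivWithin (by exact_mod_cast hb) hud
  have key := fun {ε : ℝ} (hε : ε ∈ Ico 0 (ε₁ / 2)) => BC.taylor (φ := φ) hK
    (fun b hb x => (hdiff b hb x).continuousOn.mono hsub) (fun b hb x t ht => by
      have h1 := (hdiff b hb x t (hsub ht)).hasDerivWithinAt
      have h2 : φ (b + 1) t x = derivWithin (fun t => φ b t x) (Ico 0 ε₁) t := by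
        simp only [hφ, iteratedDerivWithin_succ]
      rw [h2]
      refine h1.mono_of_mem_nhdsWithin ?_
      filter_upwards [Ico_mem_nhdsGE (hsub ht).2] with y hy using ⟨ht.1.trans hy.1, hy.2⟩) hε
  -- `expands_iff_sum` asks for coefficients of every order; those beyond `N` do not enter the sum
  -- and are set to zero.
  refine expands_iff_sum.2 ⟨fun b x => if b ≤ N then ((b.factorial : ℝ)⁻¹ • φ b 0 x) i else 0,
    fun b => ?_, ε₁ / 2, by positivity, K, fun ε hε => ?_⟩
  · by_cases hb : b ≤ N
    · simp only [hb, if_true, Pi.smul_apply, smul_eq_mul]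
      refine WA.const_mul _ (WA.of_contDiff (p := p₀) (fun x m => ?_) ?_ hS hSp)
      · exact congrFun (Periodic.iteratedDerivWithin hper b h0 x m) i
      · exact contDiff_pi.1 (((hf.2 b hb).1 0 h0).of_le hp₀) i
    · simp only [hb, if_false]
      exact WA.const 0
  · have h1 := (key hε).clm_comp (ContinuousLinearMap.proj (R := ℝ) (φ := fun _ : Fin d => ℝ) i)
    have h2 : ‖ContinuousLinearMap.proj (R := ℝ) (φ := fun _ : Fin d => ℝ) i‖ ≤ 1 :=
      ContinuousLinearMap.opNorm_le_bound _ zero_le_one fun x => by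
        simpa using norm_le_pi_norm x i
    refine Eq.mp (congrArg (BC k _) (funext fun x => ?_))
      (h1.mono (mul_le_of_le_one_left (key hε).nonneg h2))
    simp only [hφ, ContinuousLinearMap.proj_apply, Pi.sub_apply, iteratedDerivWithin_zero,
      Finset.sum_apply, Pi.smul_apply, smul_eq_mul]
    congr 1
    refine Finset.sum_congr rfl fun b hb => ?_
    rw [if_pos (Finset.mem_range.1 hb).le]

end Taylor

end PhaseLocking

end

noncomputable section

namespace PhaseLocking

/-! ### The averaging procedure: regularity and order of the error. -/

section AveragingProcedure

variable {d : ℕ} (f : ℝ → (Fin d → ℝ) → Fin d → ℝ) (Ω₀ : Fin d → ℝ)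

/-- The function `u` of the step `j + 1` of the averaging procedure. -/
def stepCoefficient (j : ℕ) : (Fin d → ℝ) → Fin d → ℝ :=
  orderCoefficient f Ω₀ (j + 1) (averaging f Ω₀ j)

/-- The term `h^j` of the conjugacy. -/
def conjugacyTerm (j : ℕ) : (Fin d → ℝ) → Fin d → ℝ :=
  cohomologySolution Ω₀ (stepCoefficient f Ω₀ j)

/-- The error after `j` steps of the averaging procedure. -/
def averagingError (j : ℕ) (ε : ℝ) (x : Fin d → ℝ) : Fin d → ℝ :=
  family f Ω₀ ε ((averaging f Ω₀ j).1 ε x) - (averaging f Ω₀ j).1 ε ((averaging f Ω₀ j).2 ε x)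

theorem averaging_eq (j : ℕ) : averaging f Ω₀ j = (polyMap 0 (conjugacyTerm f Ω₀) j,
    polyMap Ω₀ (fun i => averagedTerm f Ω₀ (i + 1)) j) := by
  induction j with
  | zero => ext ε x i <;> simp [averaging, polyMap]
  | succ j ih =>
    have h1 : averaging f Ω₀ (j + 1) =
      (fun ε x => (averaging f Ω₀ j).1 ε x + ε ^ (j + 1) • conjugacyTerm f Ω₀ j x,
      fun ε x => (averaging f Ω₀ j).2 ε x + ε ^ (j + 1) • averagedTerm f Ω₀ (j + 1) x) := rfl
    rw [h1, ih]
    ext ε x i <;> simp [polyMap, Finset.sum_range_succ, add_assoc]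

theorem conjugacy_eq (j : ℕ) : conjugacy f Ω₀ j = polyMap 0 (conjugacyTerm f Ω₀) j := by
  rw [conjugacy, averaging_eq]

theorem averagingError_eq (j : ℕ) (ε : ℝ) (x : Fin d → ℝ) : averagingError f Ω₀ j ε x =
    family f Ω₀ ε (polyMap 0 (conjugacyTerm f Ω₀) j ε x) - polyMap 0 (conjugacyTerm f Ω₀) j ε
      (polyMap Ω₀ (fun i => averagedTerm f Ω₀ (i + 1)) j ε x) := by
  rw [averagingError, averaging_eq]

theorem averagingError_apply (j : ℕ) (ε : ℝ) (x : Fin d → ℝ) (i : Fin d) :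
    averagingError f Ω₀ j ε x i = ε * f ε (polyMap 0 (conjugacyTerm f Ω₀) j ε x) i +
      ∑ a ∈ Finset.range j, ε ^ (a + 1) * conjugacyTerm f Ω₀ a x i -
      ∑ a ∈ Finset.range j, ε ^ (a + 1) * averagedTerm f Ω₀ (a + 1) x i -
      ∑ a ∈ Finset.range j, ε ^ (a + 1) * conjugacyTerm f Ω₀ a
        (polyMap Ω₀ (fun i => averagedTerm f Ω₀ (i + 1)) j ε x) i := by
  rw [averagingError_eq]
  set G := polyMap Ω₀ (fun i => averagedTerm f Ω₀ (i + 1)) j ε x with hG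
  have h1 : G i = x i + Ω₀ i +
      ∑ a ∈ Finset.range j, ε ^ (a + 1) * averagedTerm f Ω₀ (a + 1) x i := by
    simp [hG, polyMap, Finset.sum_apply]
  have h2 : ∀ y, polyMap 0 (conjugacyTerm f Ω₀) j ε y i =
      y i + ∑ a ∈ Finset.range j, ε ^ (a + 1) * conjugacyTerm f Ω₀ a y i := fun y => by
    simp [polyMap, Finset.sum_apply]
  simp only [family, Pi.sub_apply, Pi.add_apply, Pi.smul_apply, smul_eq_mul]
  rw [h2, h2, h1]
  ring

variable {f Ω₀} {k N : ℕ} {S τ : ℝ}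

/-- The regularity and the order of the error in the averaging procedure. -/
structure AveragingStep (f : ℝ → (Fin d → ℝ) → Fin d → ℝ) (Ω₀ : Fin d → ℝ) (S τ : ℝ)
    (j : ℕ) : Prop where
  averagedTerm : ∀ i < j, ∀ a, WA (S - i * (τ + 1)) fun x => averagedTerm f Ω₀ (i + 1) x a
  conjugacyTerm : ∀ i < j, ∀ a, WA (S - (i + 1) * (τ + 1) + 1) fun x => conjugacyTerm f Ω₀ i x a
  error : ∃ b > 0, ∃ C, ∀ ε ∈ Ioo (0:ℝ) b, ∀ x, ‖averagingError f Ω₀ j ε x‖ ≤ C * ε ^ (j + 1)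

/-- `f` enters with a factor `ε` and the term `h^a` with `ε ^ (a + 1)`, so `f` need only be expanded
to order `M` and `h^a` to order `M - a`. That later terms need fewer orders compensates for their
lower regularity `S - (a + 1) (τ + 1) + 1`. -/
theorem AveragingStep.expands {j M : ℕ} (h : AveragingStep f Ω₀ S τ j) (hτ : 0 < τ)
    (hf : ∀ i, Expands k S N fun ε x => f ε x i) (hS : k + 1 ≤ S - j * (τ + 1)) (hMj : M ≤ j + 1)
    (hMN : M ≤ N) (i : Fin d) :
    Expands k (S - j * (τ + 1)) (M + 1) fun ε x => averagingError f Ω₀ j ε x i := by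
  have hmul : ∀ a < j, ((a : ℝ) + 1) * (τ + 1) ≤ j * (τ + 1) := fun a ha => by
    have : (a + 1 : ℝ) ≤ j := by exact_mod_cast ha
    gcongr
  have hτj : 0 ≤ j * τ := by positivity
  have hk : (k : ℝ) ≤ S - j * (τ + 1) := by linarith
  have hkS : (k : ℝ) ≤ S := by nlinarith
  have hh : ∀ a < j, ∀ i, WA (S - j * (τ + 1)) fun x => PhaseLocking.conjugacyTerm f Ω₀ a x i :=
    fun a ha i => (h.conjugacyTerm a ha i).mono (by linarith [hmul a ha])
  have hg : ∀ a < j, ∀ i,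
      WA (S - j * (τ + 1)) fun x => PhaseLocking.averagedTerm f Ω₀ (a + 1) x i :=
    fun a ha i => (h.averagedTerm a ha i).mono (by linarith [hmul a ha])
  have hMj' : (M : ℝ) ≤ j + 1 := by exact_mod_cast hMj
  have e1 := (((hf i).mono hkS hMN).comp_polyMap (Ω := 0) hS hh (by nlinarith)).id_mul
  have hpow : ∀ {a : ℕ} {v : ℝ → (Fin d → ℝ) → ℝ}, Expands k (S - j * (τ + 1)) (M - a) v →
      Expands k (S - j * (τ + 1)) (M + 1) fun ε x => ε ^ (a + 1) * v ε x := fun {a v} hv =>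
    (hv.pow_mul (a + 1)).mono hk (by omega)
  have e2 := Expands.sum (Finset.range j) fun a ha =>
    hpow (a := a) (WA.expands hk (hh a (Finset.mem_range.1 ha) i))
  have e3 := Expands.sum (Finset.range j) fun a ha =>
    hpow (a := a) (WA.expands hk (hg a (Finset.mem_range.1 ha) i))
  have e4 := Expands.sum (Finset.range j) fun a ha =>
    hpow (a := a) (WA.expands_comp_polyMap (Ω := Ω₀) hS hg
      (h.conjugacyTerm a (Finset.mem_range.1 ha) i) (M := M - a) (by
        have ha' := Finset.mem_range.1 ha
        have h1 := hmul a ha'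
        rcases le_or_gt M a with h2 | h2
        · rw [Nat.sub_eq_zero_of_le h2, Nat.cast_zero]
          linarith
        · rw [Nat.cast_sub h2.le]
          have h3 : (a + 1 : ℝ) ≤ j := by exact_mod_cast ha'
          have h4 : 0 ≤ (j - (a + 1 : ℝ)) * τ := mul_nonneg (by linarith) hτ.le
          nlinarith))
  exact (((e1.add e2).sub e3).sub e4).congr one_pos fun ε _ x => averagingError_apply f Ω₀ j ε x i

/-- A common domain and constant for finitely many bounds. -/
theorem exists_common_bound {P : Fin d → ℝ → ℝ → Prop}
    (hP : ∀ i ε K K', 0 ≤ ε → K ≤ K' → P i ε K → P i ε K')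
    (h : ∀ i, ∃ b > 0, ∃ K, ∀ ε ∈ Ico (0:ℝ) b, P i ε K) :
    ∃ b > 0, ∃ K, 0 ≤ K ∧ ∀ ε ∈ Ico (0:ℝ) b, ∀ i, P i ε K := by
  choose b hb K hK using h
  obtain ⟨b', hb', hbb⟩ : ∃ b' > 0, ∀ i, b' ≤ b i := by
    rcases isEmpty_or_nonempty (Fin d) with h | h
    · exact ⟨1, one_pos, fun i => h.elim i⟩
    · obtain ⟨i, hi⟩ := Finite.exists_min b
      exact ⟨b i, hb i, hi⟩
  refine ⟨b', hb', ∑ i, |K i|, Finset.sum_nonneg fun _ _ => abs_nonneg _, fun ε hε i =>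
    hP i ε (K i) _ hε.1 ((le_abs_self _).trans (Finset.single_le_sum (f := fun i => |K i|)
      (fun _ _ => abs_nonneg _) (Finset.mem_univ i))) (hK i ε ⟨hε.1, hε.2.trans_le (hbb i)⟩)⟩

theorem AveragingStep.zero (hf : ∀ i, Expands k S N fun ε x => f ε x i) (hS : k ≤ S) :
    AveragingStep f Ω₀ S τ 0 := by
  refine ⟨fun i hi => absurd hi (Nat.not_lt_zero i), fun i hi => absurd hi (Nat.not_lt_zero i), ?_⟩
  obtain ⟨b, hb, K, hK0, hK⟩ := exists_common_bound (P := fun i ε K => BC k K fun x => f ε x i)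
    (fun i ε K K' _ h h' => h'.mono h) fun i => (hf i).mono hS (Nat.zero_le N)
  refine ⟨b, hb, K, fun ε hε x => ?_⟩
  refine (pi_norm_le_iff_of_nonneg (by have := hε.1; positivity)).2 fun i => ?_
  rw [averagingError_apply]
  simp only [Finset.range_zero, Finset.sum_empty, add_zero, sub_zero, zero_add, pow_one]
  rw [norm_mul, Real.norm_of_nonneg hε.1.le, mul_comm]
  exact mul_le_mul_of_nonneg_right ((hK ε ⟨hε.1.le, hε.2⟩ i).norm_le _) hε.1.le

/-- The order `j + 1` of the error is known only in the sup norm; the expansion transfers it to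
`C^k`. The case `M = 1` yields the leading coefficient in a step, the case `M = 0` the final error
at `j = N`, where no further order of `f` is available. -/
theorem AveragingStep.exists_factor {j M : ℕ} (h : AveragingStep f Ω₀ S τ j) (hτ : 0 < τ)
    (hf : ∀ i, Expands k S N fun ε x => f ε x i) (hS : k + 1 ≤ S - j * (τ + 1)) (hM : M ≤ 1)
    (hMN : M + j ≤ N) (i : Fin d) : ∃ v', Expands k (S - j * (τ + 1)) M v' ∧
      ∃ b > 0, ∀ ε ∈ Ico (0:ℝ) b, ∀ x, averagingError f Ω₀ j ε x i = ε ^ (j + 1) * v' ε x := by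
  refine Expands.factor (by linarith) (h.expands hτ hf hS (M := M + j) (by omega) hMN i) fun x => ?_
  obtain ⟨b, hb, C, hC⟩ := h.error
  refine Asymptotics.IsBigO.of_bound C ?_
  filter_upwards [Ioo_mem_nhdsGT hb] with ε hε
  rw [Real.norm_of_nonneg (pow_nonneg hε.1.le _)]
  exact (norm_le_pi_norm _ i).trans (hC ε hε x)

/-- The function `u` of a step: its regularity and its role as leading coefficient. -/
theorem AveragingStep.stepCoefficient {j : ℕ} (h : AveragingStep f Ω₀ S τ j) (hτ : 0 < τ)
    (hf : ∀ i, Expands k S N fun ε x => f ε x i) (hS : k + 1 ≤ S - j * (τ + 1)) (hj : j < N) :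
    (∀ i, WA (S - j * (τ + 1)) fun x => stepCoefficient f Ω₀ j x i) ∧
      ∃ b > 0, ∃ K, 0 ≤ K ∧ ∀ ε ∈ Ico (0:ℝ) b, ∀ x,
        ‖averagingError f Ω₀ j ε x - ε ^ (j + 1) • stepCoefficient f Ω₀ j x‖ ≤ K * ε ^ (j + 2) := by
  have h1 : ∀ i, ∃ c : (Fin d → ℝ) → ℝ, WA (S - j * (τ + 1)) c ∧ ∃ b > 0, ∃ K, ∀ ε ∈ Ico (0:ℝ) b,
      ∀ x, |averagingError f Ω₀ j ε x i - ε ^ (j + 1) * c x| ≤ K * ε ^ (j + 2) := by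
    intro i
    obtain ⟨v', ⟨c, v'', hc, ⟨b'', hb'', K, hK⟩, b', hb', hcv⟩, b, hb, hv⟩ :=
      h.exists_factor hτ hf hS le_rfl (by omega) i
    refine ⟨c, hc, min b (min b' b''), by positivity, K, fun ε hε x => ?_⟩
    have e1 : ε < b := hε.2.trans_le (min_le_left _ _)
    have e2 : ε < b' := hε.2.trans_le ((min_le_right _ _).trans (min_le_left _ _))
    have e3 : ε < b'' := hε.2.trans_le ((min_le_right _ _).trans (min_le_right _ _))
    rw [hv ε ⟨hε.1, e1⟩, hcv ε ⟨hε.1, e2⟩]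
    have e4 : ε ^ (j + 1) * (c x + ε * v'' ε x) - ε ^ (j + 1) * c x = v'' ε x * ε ^ (j + 2) := by
      ring
    rw [e4, abs_mul, abs_of_nonneg (pow_nonneg hε.1 _)]
    exact mul_le_mul_of_nonneg_right ((hK ε ⟨hε.1, e3⟩).norm_le x) (pow_nonneg hε.1 _)
  choose c hc hcb using h1
  obtain ⟨b, hb, K, hK0, hK⟩ := exists_common_bound (P := fun i ε K => ∀ x,
    |averagingError f Ω₀ j ε x i - ε ^ (j + 1) * c i x| ≤ K * ε ^ (j + 2))
    (fun i ε K K' hε hKK h x => (h x).trans (by gcongr)) hcb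
  -- The step coefficient is a `limUnder`, which is meaningful only once convergence is proved; the
  -- estimate `hK` supplies it, with limit `c`.
  have hu : ∀ i x, PhaseLocking.stepCoefficient f Ω₀ j x i = c i x := by
    have hid : Tendsto (fun ε : ℝ => ε) (𝓝[>] 0) (𝓝 0) :=
      tendsto_nhdsWithin_of_tendsto_nhds tendsto_id
    have h2 : ∀ x, Tendsto (fun ε : ℝ => (ε ^ (j + 1))⁻¹ • averagingError f Ω₀ j ε x) (𝓝[>] 0)
        (𝓝 fun i => c i x) := by
      intro x
      refine tendsto_pi_nhds.2 fun i => ?_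
      rw [tendsto_iff_norm_sub_tendsto_zero]
      refine squeeze_zero' (Eventually.of_forall fun _ => norm_nonneg _) ?_
        (by simpa using hid.const_mul K)
      filter_upwards [Ioo_mem_nhdsGT hb] with ε hε
      have h3 := hK ε ⟨hε.1.le, hε.2⟩ i x
      have hε0 := hε.1
      have h4 : ((ε ^ (j + 1))⁻¹ • averagingError f Ω₀ j ε x) i - c i x =
          (ε ^ (j + 1))⁻¹ * (averagingError f Ω₀ j ε x i - ε ^ (j + 1) * c i x) := by
        simp only [Pi.smul_apply, smul_eq_mul]
        field_simp
      rw [h4, norm_mul, norm_inv, Real.norm_of_nonneg (pow_nonneg hε0.le _),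
        inv_mul_le_iff₀ (by positivity)]
      exact h3.trans (le_of_eq (by ring))
    exact fun i x => congrFun (h2 x).limUnder_eq i
  refine ⟨fun i => by simpa only [hu] using hc i, b, hb, K, hK0, fun ε hε x => ?_⟩
  refine (pi_norm_le_iff_of_nonneg (by have := hε.1; positivity)).2 fun i => ?_
  simpa [hu] using hK ε hε i x

/-- At order `ε ^ (j + 1)` the new error is `u - g - (c(x + Ω₀) - c(x))`, zero by the cohomology
equation. What remains are differences of `f`, of the earlier conjugacy terms and of the new one at
nearby points, each with an additional factor `ε`. -/
theorem AveragingStep.succ {j : ℕ} (h : AveragingStep f Ω₀ S τ j) (hτ : 0 < τ)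
    (hΩ₀ : SmallDivisors τ Ω₀) (hf : ∀ i, Expands k S N fun ε x => f ε x i) (hk : 1 ≤ k)
    (hS : k + 1 ≤ S - (j + 1) * (τ + 1)) (hj : j < N) : AveragingStep f Ω₀ S τ (j + 1) := by
  have hk1 : (1:ℝ) ≤ k := by exact_mod_cast hk
  obtain ⟨hu, b₁, hb₁, K₁, hK₁0, hK₁⟩ := h.stepCoefficient hτ hf (by linarith) hj
  have hg := fun i => WA.resonantPart (Ω := Ω₀) (by linarith) (hu i)
  have hh := fun i => WA.cohomologySolution (by linarith) (by linarith) hΩ₀ (hu i)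
  have hcoh : ∀ x i, PhaseLocking.conjugacyTerm f Ω₀ j (x + Ω₀) i -
      PhaseLocking.conjugacyTerm f Ω₀ j x i = PhaseLocking.stepCoefficient f Ω₀ j x i -
      PhaseLocking.averagedTerm f Ω₀ (j + 1) x i := fun x i =>
    cohomologySolution_add_sub (by linarith) (by linarith) hΩ₀ (hu i) x
  have hA : ∀ i < j + 1, ∀ a, WA (S - i * (τ + 1))
      fun x => PhaseLocking.averagedTerm f Ω₀ (i + 1) x a := fun i hi a => by
    rcases Nat.lt_succ_iff_lt_or_eq.1 hi with hi | rfl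
    · exact h.averagedTerm i hi a
    · exact hg a
  have hC : ∀ i < j + 1, ∀ a, WA (S - (i + 1) * (τ + 1) + 1)
      fun x => PhaseLocking.conjugacyTerm f Ω₀ i x a := fun i hi a => by
    rcases Nat.lt_succ_iff_lt_or_eq.1 hi with hi | rfl
    · exact h.conjugacyTerm i hi a
    · exact (hh a).mono (by linarith)
  refine ⟨hA, hC, ?_⟩
  have hmul : ∀ a < j + 1, ((a : ℝ) + 1) * (τ + 1) ≤ (j + 1) * (τ + 1) := fun a ha => by
    have : (a + 1 : ℝ) ≤ j + 1 := by exact_mod_cast ha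
    gcongr
  obtain ⟨K₂, hK₂0, hK₂⟩ := bc_polyMap_sub (k := k) (m := j) (s := k)
    (γ := PhaseLocking.conjugacyTerm f Ω₀) le_rfl
    fun i hi a => (hC i (by omega) a).mono (by linarith [hmul i (by omega)])
  obtain ⟨K₃, hK₃0, hK₃⟩ := bc_polyMap_sub (k := k) (m := j + 1) (s := k)
    (γ := fun i => PhaseLocking.averagedTerm f Ω₀ (i + 1)) le_rfl
    fun i hi a => (hA i hi a).mono (by linarith [hmul i hi])
  obtain ⟨K₄, hK₄⟩ := exists_bc_of_forall_wa (k := k) (s := k) le_rfl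
    fun a => (hC j (Nat.lt_succ_self j) a).mono (by linarith)
  obtain ⟨K₅, hK₅⟩ := exists_bc_of_forall_wa (k := k) (s := k) le_rfl
    fun a => (hA j (Nat.lt_succ_self j) a).mono (by linarith)
  obtain ⟨b₆, hb₆, K₆, hK₆0, hK₆⟩ := exists_common_bound (P := fun i ε K => BC k K fun x => f ε x i)
    (fun i ε K K' _ h h' => h'.mono h) fun i => (hf i).mono (by nlinarith) (Nat.zero_le N)
  refine ⟨min 1 (min b₁ b₆), by positivity, K₁ + d * K₆ * K₄ + K₂ * K₅ + K₄ * K₃,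
    fun ε hε x => ?_⟩
  have hε0 : 0 < ε := hε.1
  have hε1 : ε < 1 := hε.2.trans_le (min_le_left _ _)
  have e1 : ε < b₁ := hε.2.trans_le ((min_le_right _ _).trans (min_le_left _ _))
  have e6 : ε < b₆ := hε.2.trans_le ((min_le_right _ _).trans (min_le_right _ _))
  set c := PhaseLocking.conjugacyTerm f Ω₀ j with hc
  set g := PhaseLocking.averagedTerm f Ω₀ (j + 1) with hgdef
  set H := polyMap 0 (PhaseLocking.conjugacyTerm f Ω₀) j ε with hH
  set R : (Fin d → ℝ) → Fin d → ℝ :=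
    fun x => ∑ i ∈ Finset.range j, ε ^ (i + 1) • PhaseLocking.conjugacyTerm f Ω₀ i x with hR
  set G := polyMap Ω₀ (fun i => PhaseLocking.averagedTerm f Ω₀ (i + 1)) j ε x with hG
  have hHR : ∀ y, H y = y + R y := fun y => by simp [hH, hR, polyMap]
  have hH' : ∀ y, polyMap 0 (PhaseLocking.conjugacyTerm f Ω₀) (j + 1) ε y =
      H y + ε ^ (j + 1) • c y := fun y => by
    simp only [hH, polyMap, Finset.sum_range_succ, add_assoc, hc]
  have hG' : polyMap Ω₀ (fun i => PhaseLocking.averagedTerm f Ω₀ (i + 1)) (j + 1) ε x =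
      G + ε ^ (j + 1) • g x := by
    simp only [hG, polyMap, Finset.sum_range_succ, add_assoc, hgdef]
  have hcoh' : c (x + Ω₀) - c x = PhaseLocking.stepCoefficient f Ω₀ j x - g x :=
    funext fun i => hcoh x i
  -- The first bracket is the error minus its leading term; the cohomology equation has already been
  -- used to cancel the rest of that order.
  have hE : averagingError f Ω₀ (j + 1) ε x =
      (averagingError f Ω₀ j ε x - ε ^ (j + 1) • PhaseLocking.stepCoefficient f Ω₀ j x) +
      ε • (f ε (H x + ε ^ (j + 1) • c x) - f ε (H x)) -
      (R (G + ε ^ (j + 1) • g x) - R G) -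
      ε ^ (j + 1) • (c (G + ε ^ (j + 1) • g x) - c (x + Ω₀)) := by
    have hu' : PhaseLocking.stepCoefficient f Ω₀ j x = c (x + Ω₀) - c x + g x := by
      rw [hcoh']; abel
    rw [averagingError_eq, averagingError_eq, hu', hH', hG', hH', family, family, ← hH, ← hG,
      hHR (G + ε ^ (j + 1) • g x), hHR G]
    simp only [smul_sub, smul_add]
    abel
  have hfd : BC k (d * K₆) (f ε) := BC.pi (hK₆ ε ⟨hε0.le, e6⟩)
  have hp : 0 ≤ ε ^ (j + 1) := pow_nonneg hε0.le _
  have b2 : ‖ε • (f ε (H x + ε ^ (j + 1) • c x) - f ε (H x))‖ ≤ d * K₆ * K₄ * ε ^ (j + 2) := by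
    have := hfd.db.lipschitz hk (H x + ε ^ (j + 1) • c x) (H x)
    rw [add_sub_cancel_left, norm_smul, Real.norm_of_nonneg hp] at this
    rw [norm_smul, Real.norm_of_nonneg hε0.le]
    calc _ ≤ ε * (d * K₆ * (ε ^ (j + 1) * K₄)) := by
          have := hK₄.norm_le x
          have h6 := hfd.nonneg
          refine mul_le_mul_of_nonneg_left (le_trans ‹_› ?_) hε0.le
          gcongr
      _ = _ := by ring
  have b3 : ‖R (G + ε ^ (j + 1) • g x) - R G‖ ≤ K₂ * K₅ * ε ^ (j + 2) := by
    have := (hK₂ ε ⟨hε0.le, hε1.le⟩).db.lipschitz hk (G + ε ^ (j + 1) • g x) G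
    rw [add_sub_cancel_left, norm_smul, Real.norm_of_nonneg hp] at this
    refine this.trans ?_
    calc _ ≤ K₂ * ε * (ε ^ (j + 1) * K₅) := by
          have := hK₅.norm_le x
          gcongr
      _ = _ := by ring
  have b4 : ‖ε ^ (j + 1) • (c (G + ε ^ (j + 1) • g x) - c (x + Ω₀))‖ ≤
      K₄ * K₃ * ε ^ (j + 2) := by
    have h1 := hK₄.db.lipschitz hk (G + ε ^ (j + 1) • g x) (x + Ω₀)
    have h2 := (hK₃ ε ⟨hε0.le, hε1.le⟩).norm_le x
    have h3 : G + ε ^ (j + 1) • g x - (x + Ω₀) = ∑ i ∈ Finset.range (j + 1),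
        ε ^ (i + 1) • PhaseLocking.averagedTerm f Ω₀ (i + 1) x := by
      rw [← hG', polyMap, add_sub_cancel_left]
    rw [h3] at h1
    rw [norm_smul, Real.norm_of_nonneg hp]
    calc _ ≤ ε ^ (j + 1) * (K₄ * (K₃ * ε)) := by
          have := hK₄.nonneg
          refine mul_le_mul_of_nonneg_left (h1.trans ?_) hp
          gcongr
      _ = _ := by ring
  rw [hE]
  refine (norm_sub_le _ _).trans ?_
  refine (add_le_add ((norm_sub_le _ _).trans (add_le_add (norm_add_le _ _) le_rfl)) le_rfl).trans ?_
  have b1 := hK₁ ε ⟨hε0.le, e1⟩ x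
  calc _ ≤ K₁ * ε ^ (j + 2) + d * K₆ * K₄ * ε ^ (j + 2) + K₂ * K₅ * ε ^ (j + 2) +
      K₄ * K₃ * ε ^ (j + 2) := by gcongr
    _ = _ := by ring

/-- The averaging procedure can be carried out up to order `N`. -/
theorem averagingStep (hτ : 0 < τ) (hΩ₀ : SmallDivisors τ Ω₀)
    (hf : ∀ i, Expands k S N fun ε x => f ε x i) (hk : 1 ≤ k) (hS : k + 1 ≤ S - N * (τ + 1))
    {j : ℕ} (hj : j ≤ N) : AveragingStep f Ω₀ S τ j := by
  have hmono : ∀ i ≤ N, (i : ℝ) * (τ + 1) ≤ N * (τ + 1) := fun i hi => by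
    have : (i : ℝ) ≤ N := by exact_mod_cast hi
    gcongr
  induction j with
  | zero => exact AveragingStep.zero hf (by have := hmono 0 hj; simp at this; linarith)
  | succ j ih =>
    have := hmono (j + 1) hj
    push_cast at this
    exact (ih (by omega)).succ hτ hΩ₀ hf hk (by linarith) hj

/-- The error after all steps, with its derivatives. -/
theorem bc_averagingError (hτ : 0 < τ) (hΩ₀ : SmallDivisors τ Ω₀)
    (hf : ∀ i, Expands k S N fun ε x => f ε x i) (hk : 1 ≤ k) (hS : k + 1 ≤ S - N * (τ + 1)) :
    ∃ b > 0, ∃ K, 0 ≤ K ∧ ∀ ε ∈ Ico (0:ℝ) b,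
      BC k (K * ε ^ (N + 1)) (averagingError f Ω₀ N ε) := by
  obtain ⟨b, hb, K, hK0, hK⟩ := exists_common_bound (d := d)
    (P := fun i ε K => BC k (K * ε ^ (N + 1)) fun x => averagingError f Ω₀ N ε x i)
    (fun i ε K K' hε h h' => h'.mono (by gcongr)) fun i => by
      obtain ⟨v', ⟨b', hb', K, hK⟩, b, hb, hv⟩ := (averagingStep hτ hΩ₀ hf hk hS
        le_rfl).exists_factor hτ hf hS (Nat.zero_le 1) (by omega) i
      refine ⟨min b b', lt_min hb hb', K, fun ε hε => ?_⟩
      have h1 := (hK ε ⟨hε.1, hε.2.trans_le (min_le_right _ _)⟩).smul (ε ^ (N + 1))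
      rw [abs_of_nonneg (pow_nonneg hε.1 _), mul_comm] at h1
      exact Eq.mp (congrArg (BC k _) (funext fun x =>
        (hv ε ⟨hε.1, hε.2.trans_le (min_le_left _ _)⟩ x).symm)) h1
  refine ⟨b, hb, d * K, by positivity, fun ε hε => (BC.pi (hK ε hε)).mono (le_of_eq (by ring))⟩

end AveragingProcedure

end PhaseLocking

end

noncomputable section

namespace PhaseLocking

/-! ### Smallness conditions and periodicity. -/

section Smallness

theorem eventually_mul_le (K : ℝ) {c : ℝ} (hc : 0 < c) : ∀ᶠ ε in 𝓝[>] (0:ℝ), K * ε ≤ c := by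
  have h : Tendsto (fun ε : ℝ => K * ε) (𝓝[>] 0) (𝓝 (K * 0)) :=
    (tendsto_nhdsWithin_of_tendsto_nhds tendsto_id).const_mul K
  rw [mul_zero] at h
  exact (h.eventually_lt_const hc).mono fun ε h => h.le

theorem eventually_mem_Ioo {b : ℝ} (hb : 0 < b) : ∀ᶠ ε in 𝓝[>] (0:ℝ), ε ∈ Ioo 0 b :=
  Ioo_mem_nhdsGT hb

end Smallness

section PeriodicMaps

variable {d : ℕ} {Ω : Fin d → ℝ} {γ : ℕ → (Fin d → ℝ) → Fin d → ℝ} {m : ℕ}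

theorem polyMap_add_intVec (hγ : ∀ i < m, Periodic (γ i)) (ε : ℝ) (x : Fin d → ℝ) (n : Fin d → ℤ) :
    polyMap Ω γ m ε (x + intVec n) = polyMap Ω γ m ε x + intVec n := by
  have h : ∑ i ∈ Finset.range m, ε ^ (i + 1) • γ i (x + intVec n) =
      ∑ i ∈ Finset.range m, ε ^ (i + 1) • γ i x :=
    Finset.sum_congr rfl fun i hi => by rw [hγ i (Finset.mem_range.1 hi)]
  rw [polyMap, polyMap, h]
  abel

theorem periodic_of_forall_wa {s : ℝ} {u : (Fin d → ℝ) → Fin d → ℝ}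
    (h : ∀ i, WA s fun x => u x i) : Periodic u := fun x m => funext fun i => (h i).periodic x m

theorem family_add_intVec {f : ℝ → (Fin d → ℝ) → Fin d → ℝ} {ε : ℝ} (hf : Periodic (f ε))
    (x : Fin d → ℝ) (n : Fin d → ℤ) : family f Ω ε (x + intVec n) = family f Ω ε x + intVec n := by
  rw [family, family, hf]
  abel

end PeriodicMaps

/-! ### The conjugated map as the averaged map plus a remainder. -/

section NormalFormExpansion

variable {d : ℕ} {f : ℝ → (Fin d → ℝ) → Fin d → ℝ} {Ω₀ : Fin d → ℝ} {k n N : ℕ} {ε₁ : ℝ}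

/-- Up to a small periodic remainder, the conjugated map is the averaged one. -/
theorem exists_conjugated_remainder (hε₁ : 0 < ε₁) (hper : ∀ ε ∈ Ico (0:ℝ) ε₁, Periodic (f ε))
    (hg : ∀ i < N, ∀ a, WA (k + 2) fun x => averagedTerm f Ω₀ (i + 1) x a)
    (hh : ∀ i < N, ∀ a, WA (k + 2) fun x => conjugacyTerm f Ω₀ i x a)
    (herr : ∃ b > 0, ∃ K, 0 ≤ K ∧ ∀ ε ∈ Ico (0:ℝ) b,
      BC k (K * ε ^ (N + 1)) (averagingError f Ω₀ N ε)) (hn : n ≤ N) (C : ℝ) :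
    ∃ C', 0 ≤ C' ∧ ∀ᶠ ε in 𝓝[>] (0:ℝ), Function.Bijective (conjugacy f Ω₀ N ε) ∧
      Differentiable ℝ (conjugacy f Ω₀ N ε) ∧
      Differentiable ℝ (Function.invFun (conjugacy f Ω₀ N ε)) ∧
      ContDiff ℝ k (conjugacy f Ω₀ N ε) ∧
      (∀ x m, conjugacy f Ω₀ N ε (x + intVec m) = conjugacy f Ω₀ N ε x + intVec m) ∧
      ∀ Ω, ‖Ω - Ω₀‖ ≤ C * ε ^ (n + 1) → ∃ Z, BC k (C' * ε ^ (n + 1)) Z ∧ Periodic Z ∧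
        ∀ x, Function.invFun (conjugacy f Ω₀ N ε) (family f Ω ε (conjugacy f Ω₀ N ε x)) =
          polyMap Ω₀ (fun i => averagedTerm f Ω₀ (i + 1)) N ε x + Z x := by
  obtain ⟨b, hb, K, hK0, hK⟩ := herr
  -- One derivative more than the remainder will have, because `BC.comp_sub_comp` loses one.
  obtain ⟨K₂, hK₂0, hK₂⟩ := bc_polyMap_sub (k := k + 1) (m := N)
    (γ := conjugacyTerm f Ω₀) (by push_cast; linarith) hh
  obtain ⟨D, hD⟩ := db_polyMap (k := k) (m := N) (Ω := Ω₀)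
    (γ := fun i => averagedTerm f Ω₀ (i + 1)) (by linarith) hg
  have hc := nearConst_nonneg (k + 1)
  set D' := |compConst D k * 2| with hD'
  refine ⟨diffConst D' k * 2 * (K + |C|), mul_nonneg (mul_nonneg (diffConst_nonneg (abs_nonneg _) _)
    zero_le_two) (by positivity), ?_⟩
  filter_upwards [eventually_mem_Ioo hb, eventually_mem_Ioo one_pos, eventually_mem_Ioo hε₁,
    eventually_mul_le K₂ (c := 1 / (2 ^ (k + 1 + 1) * (1 + nearConst (k + 1)))) (by positivity),
    eventually_mul_le (2 * (1 + nearConst (k + 1)) * K₂) one_pos, eventually_mul_le K₂ one_pos,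
    eventually_mul_le (K + |C|) one_pos] with ε hεb hε1 hεε₁ hs₁ hs₂ hs₃ hs₄
  have hε0 := hε1.1
  have hR := hK₂ ε ⟨hε0.le, hε1.2.le⟩
  set H := conjugacy f Ω₀ N ε with hH
  have hHeq : ∀ x, H x = x + ∑ i ∈ Finset.range N, ε ^ (i + 1) • conjugacyTerm f Ω₀ i x := fun x => by
    rw [hH, conjugacy_eq, polyMap, add_zero]
  obtain ⟨ψ, hψ1, hψ2, hψ⟩ := exists_inverse_near (k := k + 1) (by omega) (by positivity) (by
    rw [le_div_iff₀ (by positivity)] at hs₁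
    calc _ = K₂ * ε * (2 ^ (k + 1 + 1) * (1 + nearConst (k + 1))) := by ring
      _ ≤ 1 := hs₁) hR.db
  have hright : ∀ x, H (x - ψ x) = x := fun x => by rw [hHeq]; exact hψ1 x
  have hleft : ∀ x, H x - ψ (H x) = x := fun x => by
    have := hψ2 x
    rwa [← hHeq] at this
  have hinj : Function.Injective H := fun x y hxy => by rw [← hleft x, ← hleft y, hxy]
  have hinv : Function.invFun H = fun x => x - ψ x := by
    ext1 x
    exact hinj (by rw [Function.invFun_eq ⟨_, hright x⟩, hright])
  have hbij : Function.Bijective H := ⟨hinj, fun x => ⟨_, hright x⟩⟩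
  have hψ1' : DB (k + 1) 1 ψ := hψ.mono (by linarith)
  have hHinv : DB (k + 1) 2 (Function.invFun H) := by
    rw [hinv]
    exact (DB.id.sub hψ1').mono (by norm_num)
  have hHD : DB (k + 1) 2 H := by
    rw [show H = _ from funext hHeq]
    exact (DB.id.add (hR.db.mono hs₃)).mono (by norm_num)
  have hHper : ∀ x m, H (x + intVec m) = H x + intVec m := fun x m => by
    rw [hH, conjugacy_eq]
    exact polyMap_add_intVec (fun i hi => periodic_of_forall_wa (hh i hi)) ε x m
  have hHinvper : ∀ x m, Function.invFun H (x + intVec m) = Function.invFun H x + intVec m :=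
    fun x m => hinj (by
      rw [hHper, Function.rightInverse_invFun hbij.2, Function.rightInverse_invFun hbij.2])
  refine ⟨hbij, (db_succ_iff.1 hHD).1, (db_succ_iff.1 hHinv).1,
    hHD.contDiff.of_le (by exact_mod_cast Nat.le_succ k), hHper, fun Ω hΩ => ?_⟩
  set G := polyMap Ω₀ (fun i => averagedTerm f Ω₀ (i + 1)) N ε with hG
  have hGper : ∀ x m, G (x + intVec m) = G x + intVec m :=
    polyMap_add_intVec (fun i hi => periodic_of_forall_wa (hg i hi)) ε
  -- Replacing `Ω₀` by `Ω` only adds a constant, which joins the averaging error; both are `O(ε ^ (n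
  -- + 1))` because `n ≤ N`.
  have hfam : ∀ x, family f Ω ε (H x) = H (G x) + (averagingError f Ω₀ N ε x + (Ω - Ω₀)) :=
    fun x => by
      rw [averagingError_eq, ← conjugacy_eq, ← hH, ← hG, family, family]
      abel
  have hE : BC k ((K + |C|) * ε ^ (n + 1)) (fun x => averagingError f Ω₀ N ε x + (Ω - Ω₀)) := by
    refine ((hK ε ⟨hε0.le, hεb.2⟩).add (BC.const (Ω - Ω₀))).mono ?_
    rw [add_mul]
    refine add_le_add ?_ (hΩ.trans ?_)
    · exact mul_le_mul_of_nonneg_left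
        (pow_le_pow_of_le_one hε0.le hε1.2.le (by omega)) hK0
    · exact mul_le_mul_of_nonneg_right (le_abs_self C) (by positivity)
  have hEper : Periodic (fun x => averagingError f Ω₀ N ε x + (Ω - Ω₀)) := fun x m => by
    beta_reduce
    rw [averagingError_eq, averagingError_eq, ← conjugacy_eq, ← hH, ← hG, hGper, hHper, hHper,
      family_add_intVec (hper ε ⟨hε0.le, hεε₁.2⟩)]
    abel
  have hsmall : (K + |C|) * ε ^ (n + 1) ≤ 1 := by
    refine le_trans (mul_le_mul_of_nonneg_left ?_ (by positivity)) hs₄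
    rw [pow_succ]
    exact mul_le_of_le_one_left hε0.le (pow_le_one₀ hε0.le hε1.2.le)
  have hHG : DB k D' (fun x => H (G x)) :=
    ((hHD.of_le (Nat.le_succ k)).comp (hD ε ⟨hε0.le, hε1.2.le⟩)).mono (le_abs_self _)
  -- The remainder is `H⁻¹(H G + E) - H⁻¹(H G)`.
  refine ⟨_, (BC.comp_sub_comp (abs_nonneg _) hHinv hHG hE hsmall).mono (le_of_eq (by ring)),
    fun x m => ?_, fun x => ?_⟩
  · have := hEper x m
    beta_reduce at this ⊢
    rw [this, hGper, hHper, hHinvper, add_right_comm, hHinvper]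
    abel
  · rw [hfam, Function.leftInverse_invFun hinj (G x)]
    abel

end NormalFormExpansion

/-! ### The resonant normal form on `ℝʳ × ℝˢ`. -/

section Coordinates

variable {r s : ℕ}

/-- The first component as a continuous linear map. -/
def fstL : (Fin (r + s) → ℝ) →L[ℝ] (Fin r → ℝ) :=
  ContinuousLinearMap.pi fun i => ContinuousLinearMap.proj (Fin.castAdd s i)

/-- The second component as a continuous linear map. -/
def sndL : (Fin (r + s) → ℝ) →L[ℝ] (Fin s → ℝ) :=
  ContinuousLinearMap.pi fun i => ContinuousLinearMap.proj (Fin.natAdd r i)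

theorem append_add (x x' : Fin r → ℝ) (y y' : Fin s → ℝ) :
    Fin.append (x + x') (y + y') = Fin.append x y + Fin.append x' y' := by
  ext i
  refine Fin.addCases (fun i => ?_) (fun i => ?_) i <;> simp

theorem append_smul (c : ℝ) (x : Fin r → ℝ) (y : Fin s → ℝ) :
    Fin.append (c • x) (c • y) = c • Fin.append x y := by
  ext i
  refine Fin.addCases (fun i => ?_) (fun i => ?_) i <;> simp

/-- The identification of `ℝʳ × ℝˢ` with `ℝʳ⁺ˢ` as a continuous linear map. -/
def appendL : (Fin r → ℝ) × (Fin s → ℝ) →L[ℝ] (Fin (r + s) → ℝ) :=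
  LinearMap.toContinuousLinearMap
    { toFun := fun z => Fin.append z.1 z.2
      map_add' := fun z w => append_add z.1 w.1 z.2 w.2
      map_smul' := fun c z => append_smul c z.1 z.2 }

theorem append_fstPart_sndPart (y : Fin (r + s) → ℝ) : Fin.append (fstPart y) (sndPart y) = y := by
  ext i
  refine Fin.addCases (fun i => ?_) (fun i => ?_) i <;> simp [fstPart, sndPart]

theorem fstPart_append (x : Fin r → ℝ) (y : Fin s → ℝ) : fstPart (Fin.append x y) = x := by
  ext i; simp [fstPart]

theorem sndPart_append (x : Fin r → ℝ) (y : Fin s → ℝ) : sndPart (Fin.append x y) = y := by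
  ext i; simp [sndPart]

theorem append_intVec (x : Fin r → ℤ) : Fin.append (intVec x) (0 : Fin s → ℝ) =
    intVec (Fin.append x (0 : Fin s → ℤ)) := by
  ext i
  refine Fin.addCases (fun i => ?_) (fun i => ?_) i <;> simp [intVec]

variable {f : ℝ → (Fin (r + s) → ℝ) → Fin (r + s) → ℝ} {Ω₀ : Fin (r + s) → ℝ}
  {A : Matrix.SpecialLinearGroup (Fin (r + s)) ℤ} {ω : Fin r → ℝ} {l : Fin (r + s) → ℤ}
  {ν τ : ℝ} {n m : ℕ}

/-- The averaged vector field `∑ ε^(j-n) A g_j(A⁻¹(0, x₂))`. -/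
def averagedField (f : ℝ → (Fin (r + s) → ℝ) → Fin (r + s) → ℝ) (Ω₀ : Fin (r + s) → ℝ)
    (A : Matrix.SpecialLinearGroup (Fin (r + s)) ℤ) (n m : ℕ) (x₂ : Fin s → ℝ) (ε : ℝ) :
    Fin (r + s) → ℝ :=
  ∑ k ∈ Finset.range m,
    ε ^ k • slAct A (averagedTerm f Ω₀ (n + k) (slAct A⁻¹ (Fin.append (0 : Fin r → ℝ) x₂)))

theorem averagedTerm_slAct_inv (hΩ₀ : slAct A Ω₀ = Fin.append ω (0 : Fin s → ℝ) + intVec l)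
    (hν : 0 < ν) (hω : Diophantine ν τ ω) (j : ℕ) (x₁ : Fin r → ℝ) (x₂ : Fin s → ℝ) :
    averagedTerm f Ω₀ j (slAct A⁻¹ (Fin.append x₁ x₂)) =
      averagedTerm f Ω₀ j (slAct A⁻¹ (Fin.append 0 x₂)) := by
  cases j with
  | zero => rfl
  | succ j => exact resonantPart_slAct_inv hΩ₀ hν hω _ x₁ x₂

theorem slAct_sum {ι : Type*} (t : Finset ι) (v : ι → Fin (r + s) → ℝ) :
    slAct A (∑ i ∈ t, v i) = ∑ i ∈ t, slAct A (v i) := map_sum (slActL A) v t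

/-- The averaged map in the coordinates given by `A`. -/
theorem slAct_polyMap (hΩ₀ : slAct A Ω₀ = Fin.append ω (0 : Fin s → ℝ) + intVec l)
    (hν : 0 < ν) (hω : Diophantine ν τ ω) (hn : IsLeadingOrder f Ω₀ n) (hm : 1 ≤ m) (ε : ℝ)
    (x₁ : Fin r → ℝ) (x₂ : Fin s → ℝ) :
    slAct A (polyMap Ω₀ (fun i => averagedTerm f Ω₀ (i + 1)) (n + m - 1) ε
      (slAct A⁻¹ (Fin.append x₁ x₂))) - intVec l =
      Fin.append x₁ x₂ + Fin.append ω 0 + ε ^ n • averagedField f Ω₀ A n m x₂ ε := by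
  obtain ⟨hn1, hn2, -⟩ := hn
  -- The summand with index `i` is `g_(i+1)`; the first `n - 1` vanish and `m` remain.
  have h1 : n + m - 1 = (n - 1) + m := by omega
  rw [polyMap, slAct_add, slAct_add, slAct_slAct_inv, hΩ₀, h1, Finset.sum_range_add,
    Finset.sum_eq_zero, zero_add, averagedField, slAct_sum, Finset.smul_sum]
  · have h2 : ∀ i, slAct A (ε ^ (n - 1 + i + 1) • averagedTerm f Ω₀ (n - 1 + i + 1)
        (slAct A⁻¹ (Fin.append x₁ x₂))) = ε ^ n • ε ^ i • slAct A (averagedTerm f Ω₀ (n + i)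
          (slAct A⁻¹ (Fin.append 0 x₂))) := fun i => by
      have h3 : n - 1 + i + 1 = n + i := by omega
      rw [h3, slAct_smul, averagedTerm_slAct_inv hΩ₀ hν hω, smul_smul, pow_add]
    simp only [h2]
    abel
  · intro i hi
    rw [Finset.mem_range] at hi
    rw [hn2 (i + 1) (by omega) (by omega)]
    simp

/-- The first component of the averaged vector field. -/
def theta (f : ℝ → (Fin (r + s) → ℝ) → Fin (r + s) → ℝ) (Ω₀ : Fin (r + s) → ℝ)
    (A : Matrix.SpecialLinearGroup (Fin (r + s)) ℤ) (n m : ℕ) (x₂ : Fin s → ℝ) (ε : ℝ) :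
    Fin r → ℝ :=
  fstPart (averagedField f Ω₀ A n m x₂ ε)

theorem eta_eq (x₂ : Fin s → ℝ) (ε : ℝ) :
    eta f Ω₀ A n m x₂ ε = sndPart (averagedField f Ω₀ A n m x₂ ε) := rfl

variable {k : ℕ} {ε₁ : ℝ}

/-- The map in resonant normal form. -/
theorem exists_normalForm (hΩ₀ : slAct A Ω₀ = Fin.append ω (0 : Fin s → ℝ) + intVec l)
    (hν : 0 < ν) (hω : Diophantine ν τ ω) (hn : IsLeadingOrder f Ω₀ n) (hm : 1 ≤ m)
    (hε₁ : 0 < ε₁) (hper : ∀ ε ∈ Ico (0:ℝ) ε₁, Periodic (f ε))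
    (hg : ∀ i < n + m - 1, ∀ a, WA (k + 2) fun x => averagedTerm f Ω₀ (i + 1) x a)
    (hh : ∀ i < n + m - 1, ∀ a, WA (k + 2) fun x => conjugacyTerm f Ω₀ i x a)
    (herr : ∃ b > 0, ∃ K, 0 ≤ K ∧ ∀ ε ∈ Ico (0:ℝ) b,
      BC k (K * ε ^ (n + m - 1 + 1)) (averagingError f Ω₀ (n + m - 1) ε)) (C : ℝ) :
    ∃ C', 0 ≤ C' ∧ ∀ᶠ ε in 𝓝[>] (0:ℝ), Function.Bijective (conjugacy f Ω₀ (n + m - 1) ε) ∧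
      Differentiable ℝ (conjugacy f Ω₀ (n + m - 1) ε) ∧
      Differentiable ℝ (Function.invFun (conjugacy f Ω₀ (n + m - 1) ε)) ∧
      ContDiff ℝ k (conjugacy f Ω₀ (n + m - 1) ε) ∧
      (∀ x a, conjugacy f Ω₀ (n + m - 1) ε (x + intVec a) =
        conjugacy f Ω₀ (n + m - 1) ε x + intVec a) ∧
      ∀ Ω, ‖Ω - Ω₀‖ ≤ C * ε ^ (n + 1) → ∃ (R₁ : (Fin r → ℝ) × (Fin s → ℝ) → Fin r → ℝ)
        (R₂ : (Fin r → ℝ) × (Fin s → ℝ) → Fin s → ℝ), BC k (C' * ε) R₁ ∧ BC k (C' * ε) R₂ ∧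
        (∀ x v a, R₁ (x + intVec a, v) = R₁ (x, v)) ∧
        (∀ x v a, R₂ (x + intVec a, v) = R₂ (x, v)) ∧
        ∀ x₁ x₂, normalFormMap f Ω₀ A l (n + m - 1) Ω ε (Fin.append x₁ x₂) =
          Fin.append (x₁ + (ω + ε ^ n • (theta f Ω₀ A n m x₂ ε + R₁ (x₁, x₂))))
            (x₂ + ε ^ n • (eta f Ω₀ A n m x₂ ε + R₂ (x₁, x₂))) := by
  obtain ⟨C', hC', h⟩ := exists_conjugated_remainder (n := n) hε₁ hper hg hh herr
    (by omega) C
  set L := (slActL A⁻¹).comp (appendL (r := r) (s := s)) with hL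
  set c₁ := ‖fstL.comp (slActL A)‖ * compConst ‖L‖ k
  set c₂ := ‖sndL.comp (slActL A)‖ * compConst ‖L‖ k
  have hc1 : 0 ≤ c₁ := mul_nonneg (norm_nonneg _)
    (zero_le_one.trans (one_le_compConst (norm_nonneg _) _))
  have hc2 : 0 ≤ c₂ := mul_nonneg (norm_nonneg _)
    (zero_le_one.trans (one_le_compConst (norm_nonneg _) _))
  refine ⟨(c₁ + c₂) * C', by positivity, ?_⟩
  filter_upwards [h, self_mem_nhdsWithin] with ε ⟨h1, h2, h3, h3a, h4, h5⟩ hε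
  have hε0 : 0 < ε := hε
  refine ⟨h1, h2, h3, h3a, h4, fun Ω hΩ => ?_⟩
  obtain ⟨Z, hZ, hZp, hZe⟩ := h5 Ω hΩ
  have hZL : BC k (compConst ‖L‖ k * (C' * ε ^ (n + 1))) (fun z => Z (L z)) := hZ.comp (DB.clm L)
  have hLper : ∀ x v a, L (x + intVec a, v) = L (x, v) + intVec (Matrix.mulVec
      ((A⁻¹ : Matrix.SpecialLinearGroup (Fin (r + s)) ℤ) : Matrix (Fin (r + s)) (Fin (r + s)) ℤ)
      (Fin.append a 0)) := fun x v a => by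
    rw [← slAct_intVec, ← append_intVec, ← slActL_apply]
    have : ((x + intVec a, v) : (Fin r → ℝ) × (Fin s → ℝ)) = (x, v) + (intVec a, 0) := by simp
    rw [this, map_add]
    rfl
  have hpow : ε ^ (n + 1) = ε ^ n * ε := pow_succ ε n
  have hpn : 0 < ε ^ n := pow_pos hε0 n
  -- Division by `ε ^ n` puts the remainder `O(ε ^ (n + 1))` on the scale of the averaged field and
  -- leaves `O(ε)`.
  refine ⟨fun z => (ε ^ n)⁻¹ • (fstL.comp (slActL A)) (Z (L z)),
    fun z => (ε ^ n)⁻¹ • (sndL.comp (slActL A)) (Z (L z)), ?_, ?_, ?_, ?_, ?_⟩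
  · refine ((hZL.clm_comp (fstL.comp (slActL A))).smul (ε ^ n)⁻¹).mono ?_
    rw [abs_of_nonneg (by positivity)]
    calc _ = ‖fstL.comp (slActL A)‖ * compConst ‖L‖ k * C' * ε := by rw [hpow]; field_simp
      _ ≤ (c₁ + c₂) * C' * ε := by gcongr; exact le_add_of_nonneg_right hc2
  · refine ((hZL.clm_comp (sndL.comp (slActL A))).smul (ε ^ n)⁻¹).mono ?_
    rw [abs_of_nonneg (by positivity)]
    calc _ = ‖sndL.comp (slActL A)‖ * compConst ‖L‖ k * C' * ε := by rw [hpow]; field_simp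
      _ ≤ (c₁ + c₂) * C' * ε := by gcongr; exact le_add_of_nonneg_left hc1
  · intro x v a
    beta_reduce
    rw [hLper, hZp]
  · intro x v a
    beta_reduce
    rw [hLper, hZp]
  · intro x₁ x₂
    rw [normalFormMap, hZe, slAct_add, add_sub_right_comm, slAct_polyMap hΩ₀ hν hω hn hm]
    have hZ' : slAct A (Z (slAct A⁻¹ (Fin.append x₁ x₂))) = ε ^ n •
        Fin.append ((ε ^ n)⁻¹ • (fstL.comp (slActL A)) (Z (L (x₁, x₂))))
          ((ε ^ n)⁻¹ • (sndL.comp (slActL A)) (Z (L (x₁, x₂)))) := by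
      rw [append_smul, smul_smul, mul_inv_cancel₀ hpn.ne', one_smul]
      exact (append_fstPart_sndPart _).symm
    rw [hZ', ← append_fstPart_sndPart (averagedField f Ω₀ A n m x₂ ε), ← eta_eq, ← append_smul,
      ← append_smul, ← append_add, ← append_add, ← append_add]
    change Fin.append (x₁ + ω + ε ^ n • theta f Ω₀ A n m x₂ ε + _) _ = _
    congr 1
    · rw [smul_add]; abel
    · rw [smul_add]; abel

end Coordinates

end PhaseLocking

end

noncomputable section

namespace PhaseLocking

/-! ### Existence of a Lyapunov form. -/

section LyapunovForm

open Matrix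
open scoped ComplexOrder

variable {s : ℕ}

/-- A nonzero positive semidefinite `X` with `B X + X Bᵀ = 0` yields an imaginary eigenvalue. -/
theorem exists_imaginary_eigenvalue {B X : Matrix (Fin s) (Fin s) ℂ} (hX : X.PosSemidef)
    (hX0 : X ≠ 0) (h : B * X + X * Bᴴ = 0) : ∃ z ∈ spectrum ℂ B, z.re = 0 := by
  have hBX : B * X = -(X * Bᴴ) := eq_neg_of_add_eq_zero_left h
  -- `B X = -X Bᴴ` makes the range of `X` invariant under `B`.
  set V := LinearMap.range X.mulVecLin with hV
  have hinv : ∀ v ∈ V, B.mulVecLin v ∈ V := by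
    rintro _ ⟨u, rfl⟩
    refine ⟨-(Bᴴ *ᵥ u), ?_⟩
    simp only [mulVecLin_apply, mulVec_mulVec, mulVec_neg, hBX, neg_mulVec]
  have hVn : Nontrivial V := by
    rw [Submodule.nontrivial_iff_ne_bot]
    intro hbot
    refine hX0 (Matrix.ext_of_mulVec_single fun i => ?_)
    have : X.mulVecLin (Pi.single i 1) ∈ V := ⟨_, rfl⟩
    rw [hbot, Submodule.mem_bot, mulVecLin_apply] at this
    rw [this, zero_mulVec]
  obtain ⟨μ, hμ⟩ := Module.End.exists_eigenvalue (B.mulVecLin.restrict hinv)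
  obtain ⟨⟨w, hw⟩, hw1⟩ := hμ.exists_hasEigenvector
  have hw0 : w ≠ 0 := fun h0 => hw1.2 (Subtype.ext h0)
  have hBw : B *ᵥ w = μ • w := congrArg Subtype.val hw1.apply_eq_smul
  obtain ⟨u, rfl⟩ := hw
  simp only [mulVecLin_apply] at hBw hw0
  refine ⟨μ, ?_, ?_⟩
  · rw [Matrix.mem_spectrum_iff_isRoot_charpoly, Polynomial.IsRoot, Matrix.eval_charpoly,
      ← Matrix.exists_mulVec_eq_zero_iff]
    exact ⟨_, hw0, by
      rw [sub_mulVec, hBw, Matrix.scalar_apply, ← Matrix.smul_one_eq_diagonal, smul_mulVec,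
        one_mulVec, sub_self]⟩
  -- For an eigenvector `X u` the number `u* B X u = μ u* X u` is purely imaginary, while `u* X u`
  -- is real and nonzero.
  · set t := star u ⬝ᵥ (X *ᵥ u) with ht
    have ht0 : t ≠ 0 := fun h0 => hw0 ((hX.dotProduct_mulVec_zero_iff u).1 h0)
    have htr : star t = t := by
      have := hX.dotProduct_mulVec_nonneg u
      rw [← ht] at this
      exact (IsSelfAdjoint.of_nonneg this).star_eq
    have h1 : star u ⬝ᵥ (B *ᵥ (X *ᵥ u)) = μ * t := by
      rw [hBw, dotProduct_smul, smul_eq_mul]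
    have h2 : star (star u ⬝ᵥ (B *ᵥ (X *ᵥ u))) = -(star u ⬝ᵥ (B *ᵥ (X *ᵥ u))) := by
      have e1 : star (star u ⬝ᵥ (B *ᵥ (X *ᵥ u))) = star u ⬝ᵥ ((X * Bᴴ) *ᵥ u) := by
        rw [mulVec_mulVec, star_dotProduct, star_star, star_mulVec, conjTranspose_mul,
          hX.isHermitian.eq, dotProduct_mulVec]
      rw [e1, mulVec_mulVec, hBX, neg_mulVec, dotProduct_neg, neg_neg]
    rw [h1, star_mul', htr, ← neg_mul] at h2
    have h3 := mul_right_cancel₀ ht0 h2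
    have h4 := congrArg Complex.re h3
    simp at h4
    linarith

/-- Duality in place of a solution of the Lyapunov equation. By `exists_imaginary_eigenvalue`, the
map `X ↦ B X + X Bᵀ` does not vanish on the compact convex set of positive semidefinite `X` in the
unit ball with trace at least one. A functional separating zero from the image, evaluated on
matrices `v vᵀ`, is the required quadratic form. -/
theorem exists_lyapunov (B : Matrix (Fin s) (Fin s) ℝ)
    (hB : ∀ z ∈ spectrum ℂ (B.map (algebraMap ℝ ℂ)), z.re ≠ 0) :
    ∃ S : Matrix (Fin s) (Fin s) ℝ, S.IsSymm ∧ ∃ a > 0, ∀ v, a * ‖v‖ ^ 2 ≤ v ⬝ᵥ (S *ᵥ (B *ᵥ v)) := by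
  let T : (Fin s → Fin s → ℝ) →ₗ[ℝ] (Fin s → Fin s → ℝ) :=
    { toFun := fun X => B * Matrix.of X + Matrix.of X * Bᵀ
      map_add' := fun X Y => by
        change B * (Matrix.of X + Matrix.of Y) + (Matrix.of X + Matrix.of Y) * Bᵀ = _
        rw [mul_add, add_mul]
        exact add_add_add_comm _ _ _ _
      map_smul' := fun c X => by
        change B * (c • Matrix.of X) + (c • Matrix.of X) * Bᵀ = _
        rw [mul_smul_comm, smul_mul_assoc, ← smul_add]
        rfl }
  -- The trace condition keeps zero out of `K`, yet `v vᵀ` belongs to `K` for every `v` of sup norm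
  -- one.
  set K : Set (Fin s → Fin s → ℝ) := {X | ((Matrix.of X).map (algebraMap ℝ ℂ)).PosSemidef ∧
    1 ≤ ∑ i, X i i} ∩ Metric.closedBall 0 1 with hK
  have hKconv : Convex ℝ K := by
    refine Convex.inter ?_ (convex_closedBall _ _)
    rintro X ⟨hX1, hX2⟩ Y ⟨hY1, hY2⟩ a b ha hb hab
    refine ⟨?_, ?_⟩
    · have : (Matrix.of (a • X + b • Y)).map (algebraMap ℝ ℂ) =
          (a : ℂ) • (Matrix.of X).map (algebraMap ℝ ℂ) +
          (b : ℂ) • (Matrix.of Y).map (algebraMap ℝ ℂ) := by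
        ext i j; simp
      rw [this]
      exact (hX1.smul (by exact_mod_cast ha)).add (hY1.smul (by exact_mod_cast hb))
    · simp only [Pi.add_apply, Pi.smul_apply, smul_eq_mul, Finset.sum_add_distrib,
        ← Finset.mul_sum]
      nlinarith
  have hKclosed : IsClosed {X : Fin s → Fin s → ℝ |
      ((Matrix.of X).map (algebraMap ℝ ℂ)).PosSemidef ∧ 1 ≤ ∑ i, X i i} := by
    have hc : Continuous fun X : Fin s → Fin s → ℝ => (Matrix.of X).map (algebraMap ℝ ℂ) := by
      refine continuous_matrix fun i j => ?_
      exact Complex.continuous_ofReal.comp ((continuous_apply j).comp (continuous_apply i))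
    have h1 : IsClosed ({X : Fin s → Fin s → ℝ | ((Matrix.of X).map (algebraMap ℝ ℂ)).IsHermitian} ∩
        ⋂ x : Fin s → ℂ, {X : Fin s → Fin s → ℝ |
          0 ≤ star x ⬝ᵥ ((Matrix.of X).map (algebraMap ℝ ℂ) *ᵥ x)}) := by
      refine IsClosed.inter (isClosed_eq hc.matrix_conjTranspose hc) (isClosed_iInter fun x => ?_)
      exact isClosed_le continuous_const
        (continuous_const.dotProduct (hc.matrix_mulVec continuous_const))
    have h2 : IsClosed {X : Fin s → Fin s → ℝ |
        ((Matrix.of X).map (algebraMap ℝ ℂ)).PosSemidef} := by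
      refine Eq.mp (congrArg IsClosed (Set.ext fun X => ?_)) h1
      simp only [mem_inter_iff, mem_iInter, Set.mem_ofPred_eq]
      exact posSemidef_iff_dotProduct_mulVec.symm
    exact IsClosed.inter h2 (isClosed_le continuous_const
      (continuous_finsetSum _ fun i _ => (continuous_apply i).comp (continuous_apply i)))
  have hKcomp : IsCompact K := (isCompact_closedBall _ _).inter_left hKclosed
  have hTc : Continuous T := T.continuous_of_finiteDimensional
  have h0 : (0 : Fin s → Fin s → ℝ) ∉ T '' K := by
    rintro ⟨X, ⟨⟨hX1, hX2⟩, -⟩, hX⟩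
    have hX' : B * Matrix.of X + Matrix.of X * Bᵀ = 0 := hX
    obtain ⟨z, hz, hz0⟩ := exists_imaginary_eigenvalue (B := B.map (algebraMap ℝ ℂ)) hX1 (by
      intro h
      have : ∀ i, X i i = 0 := fun i => by
        have := congrFun (congrFun h i) i
        simpa using this
      simp [this] at hX2
      linarith) (by
      have h1 := congrArg (fun M : Matrix (Fin s) (Fin s) ℝ => M.map (algebraMap ℝ ℂ)) hX'
      have h2 : (B.map (algebraMap ℝ ℂ))ᴴ = Bᵀ.map (algebraMap ℝ ℂ) := by
        ext i j; simp [conjTranspose_apply]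
      rw [h2, ← Matrix.map_mul, ← Matrix.map_mul, ← Matrix.map_add _ (map_add _)]
      exact h1.trans (by ext; simp))
    exact hB z hz hz0
  obtain ⟨f, u, hu, hf⟩ := geometric_hahn_banach_point_closed (hKconv.linear_image T)
    (hKcomp.image hTc).isClosed h0
  rw [map_zero] at hu
  set F : Matrix (Fin s) (Fin s) ℝ := Matrix.of fun i j => f (Pi.single i (Pi.single j 1)) with hF
  have hfF : ∀ X, f X = ∑ i, ∑ j, X i j * F i j := fun X => by
    have hX : X = ∑ i, ∑ j, X i j • (Pi.single i (Pi.single j 1) : Fin s → Fin s → ℝ) := by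
      ext a b
      simp [Finset.sum_apply, Pi.single_apply, Finset.sum_ite_eq, ite_apply]
    conv_lhs => rw [hX]
    simp [map_sum, hF]
  have hvv : ∀ v : Fin s → ℝ, f (T fun i j => v i * v j) = v ⬝ᵥ ((F + Fᵀ) *ᵥ (B *ᵥ v)) := fun v => by
    have h1 : T (fun i j => v i * v j) = fun i j => (B *ᵥ v) i * v j + v i * (B *ᵥ v) j := by
      ext i j
      change (B * Matrix.of (fun i j => v i * v j) + Matrix.of (fun i j => v i * v j) * Bᵀ) i j = _
      simp only [Matrix.add_apply, Matrix.mul_apply, Matrix.of_apply, Matrix.transpose_apply,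
        mulVec, dotProduct, Finset.sum_mul, Finset.mul_sum]
      congr 1
      · exact Finset.sum_congr rfl fun _ _ => by ring
      · exact Finset.sum_congr rfl fun _ _ => by ring
    rw [h1, hfF]
    generalize B *ᵥ v = w
    simp only [add_mul, Finset.sum_add_distrib, add_mulVec, dotProduct_add]
    rw [add_comm]
    congr 1
    · simp only [dotProduct, mulVec, Finset.mul_sum]
      exact Finset.sum_congr rfl fun i _ => Finset.sum_congr rfl fun j _ => by ring
    · rw [Finset.sum_comm]
      simp only [dotProduct, mulVec, Finset.mul_sum, transpose_apply]
      exact Finset.sum_congr rfl fun i _ => Finset.sum_congr rfl fun j _ => by ring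
  refine ⟨F + Fᵀ, by rw [Matrix.IsSymm, transpose_add, transpose_transpose, add_comm], u, hu,
    fun v => ?_⟩
  have hunit : ∀ v : Fin s → ℝ, ‖v‖ = 1 → u ≤ v ⬝ᵥ ((F + Fᵀ) *ᵥ (B *ᵥ v)) := fun v hv => by
    rw [← hvv]
    have hle : ∀ i, |v i| ≤ 1 := fun i => by
      rw [← hv]; exact norm_le_pi_norm v i
    refine (hf _ ⟨_, ⟨⟨?_, ?_⟩, ?_⟩, rfl⟩).le
    · have := posSemidef_vecMulVec_self_star (fun i => (v i : ℂ))
      convert this using 1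
      ext i j
      simp [vecMulVec_apply]
    · obtain ⟨i, hi⟩ : ∃ i, |v i| = 1 := by
        by_contra! hne
        have : ‖v‖ < 1 := (pi_norm_lt_iff one_pos).2 fun i => lt_of_le_of_ne (hle i) (hne i)
        linarith
      have h1 : v i * v i = 1 := by rw [← abs_mul_abs_self, hi, one_mul]
      rw [← h1]
      exact Finset.single_le_sum (f := fun i => v i * v i) (fun i _ => mul_self_nonneg _)
        (Finset.mem_univ i)
    · rw [mem_closedBall_zero_iff]
      refine (pi_norm_le_iff_of_nonneg zero_le_one).2 fun i =>
        (pi_norm_le_iff_of_nonneg zero_le_one).2 fun j => ?_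
      rw [norm_mul]
      exact mul_le_one₀ (hle i) (norm_nonneg _) (hle j)
  rcases eq_or_ne v 0 with rfl | hv
  · simp
  · have hv0 : 0 < ‖v‖ := norm_pos_iff.2 hv
    have h1 := hunit (‖v‖⁻¹ • v) (by rw [norm_smul, norm_inv, norm_norm, inv_mul_cancel₀ hv0.ne'])
    simp only [mulVec_smul, dotProduct_smul, smul_dotProduct, smul_eq_mul] at h1
    calc u * ‖v‖ ^ 2 ≤ (‖v‖⁻¹ * (‖v‖⁻¹ * (v ⬝ᵥ ((F + Fᵀ) *ᵥ (B *ᵥ v))))) * ‖v‖ ^ 2 := by gcongr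
      _ = _ := by field_simp

end LyapunovForm

end PhaseLocking

end

noncomputable section

namespace PhaseLocking

/-! ### Decay in the fixed norm from adapted seminorms. -/

section Decay

variable {Y : Type} [NormedAddCommGroup Y] [NormedSpace ℝ Y] [FiniteDimensional ℝ Y]

theorem Seminorm.exists_le_norm (N : Seminorm ℝ Y) : ∃ C, 0 ≤ C ∧ ∀ v, N v ≤ C * ‖v‖ := by
  let b := Module.finBasis ℝ Y
  let φ := b.equivFunL
  refine ⟨‖φ.toContinuousLinearMap‖ * ∑ i, N (b i), by positivity, fun v => ?_⟩
  have hv : v = ∑ i, φ v i • b i := (b.sum_repr v).symm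
  calc N v = N (∑ i, φ v i • b i) := by rw [← hv]
    _ ≤ ∑ i, N (φ v i • b i) := by
        exact Finset.le_sum_of_subadditive N (map_zero N).le (map_add_le_add N) _ _
    _ ≤ ∑ i, (‖φ.toContinuousLinearMap‖ * ‖v‖) * N (b i) := Finset.sum_le_sum fun i _ => by
        rw [map_smul_eq_mul]
        refine mul_le_mul_of_nonneg_right ?_ (apply_nonneg N _)
        exact (norm_le_pi_norm (φ v) i).trans (φ.toContinuousLinearMap.le_opNorm v)
    _ = _ := by rw [← Finset.mul_sum]; ring

/-- A contraction of an adapted seminorm on an invariant subspace decays exponentially in norm. -/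
theorem exists_decay {T : Y →L[ℝ] Y} {V : Submodule ℝ Y} {N : Seminorm ℝ Y} {ρ : ℝ} (hρ : 0 ≤ ρ)
    (hT : ∀ v ∈ V, T v ∈ V) (hN : ∀ v ∈ V, N v = 0 → v = 0) (hNT : ∀ v ∈ V, N (T v) ≤ ρ * N v) :
    ∃ C, 0 ≤ C ∧ ∀ v ∈ V, ∀ j : ℕ, ‖(T ^ j) v‖ ≤ C * ρ ^ j * ‖v‖ := by
  obtain ⟨C₁, hC₁0, hC₁⟩ := Seminorm.exists_le_norm N
  have hNc : Continuous N := by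
    have : LipschitzWith ⟨C₁, hC₁0⟩ N := LipschitzWith.of_dist_le_mul fun x y => by
      rw [dist_eq_norm, dist_eq_norm]
      exact (abs_sub_map_le_sub N x y).trans (hC₁ _)
    exact this.continuous
  -- On the subspace the seminorm is definite, hence bounded below on the compact unit sphere.
  obtain ⟨δ, hδ, hδN⟩ : ∃ δ > 0, ∀ v ∈ V, δ * ‖v‖ ≤ N v := by
    have hS : IsCompact ((V : Set Y) ∩ Metric.sphere 0 1) :=
      (isCompact_sphere (0 : Y) 1).inter_left V.closed_of_finiteDimensional
    have hunit : ∃ δ > 0, ∀ v ∈ V, ‖v‖ = 1 → δ ≤ N v := by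
      rcases ((V : Set Y) ∩ Metric.sphere 0 1).eq_empty_or_nonempty with he | hne
      · refine ⟨1, one_pos, fun v hv h1 => ?_⟩
        have : v ∈ ((V : Set Y) ∩ Metric.sphere 0 1) := ⟨hv, by simpa using h1⟩
        rw [he] at this
        exact absurd this (notMem_empty v)
      · obtain ⟨v₀, ⟨hv₀, hv₁⟩, hmin⟩ := hS.exists_isMinOn hne hNc.continuousOn
        refine ⟨N v₀, lt_of_le_of_ne (apply_nonneg N _) fun h => ?_, fun v hv h1 =>
          hmin ⟨hv, by simpa using h1⟩⟩
        rw [hN v₀ hv₀ h.symm] at hv₁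
        simp at hv₁
    obtain ⟨δ, hδ, h⟩ := hunit
    refine ⟨δ, hδ, fun v hv => ?_⟩
    rcases eq_or_ne v 0 with rfl | hv0
    · simp
    · have hv1 : 0 < ‖v‖ := norm_pos_iff.2 hv0
      have := h (‖v‖⁻¹ • v) (V.smul_mem _ hv)
        (by rw [norm_smul, norm_inv, norm_norm, inv_mul_cancel₀ hv1.ne'])
      rw [map_smul_eq_mul, norm_inv, norm_norm, ← div_eq_inv_mul, le_div_iff₀ hv1] at this
      exact this
  refine ⟨C₁ / δ, by positivity, fun v hv j => ?_⟩
  have hiter : ∀ j : ℕ, (T ^ j) v ∈ V ∧ N ((T ^ j) v) ≤ ρ ^ j * N v := fun j => by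
    induction j with
    | zero => simpa using hv
    | succ j ih =>
      rw [pow_succ', mul_apply_eq_comp]
      refine ⟨hT _ ih.1, (hNT _ ih.1).trans ?_⟩
      rw [pow_succ', mul_assoc]
      exact mul_le_mul_of_nonneg_left ih.2 hρ
  have h1 := (hδN _ (hiter j).1).trans ((hiter j).2.trans
    (mul_le_mul_of_nonneg_left (hC₁ v) (pow_nonneg hρ j)))
  rw [mul_comm δ, ← le_div_iff₀ hδ] at h1
  exact h1.trans (le_of_eq (by ring))

end Decay

/-! ### Dichotomy constants that depend only on a Lyapunov form. -/

section LyapunovDichotomy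

variable {Y : Type} [NormedAddCommGroup Y]

/-- `p` is at least `κ ‖u‖²` always and at most `M ‖u‖²` at the start; taking roots costs the
constant `√(M / κ) ≤ K₀`. -/
theorem norm_le_of_comparison {u : ℕ → Y} {p : ℕ → ℝ} {κ M K₀ ρ : ℝ} (hκ : 0 < κ) (hK₀ : 0 ≤ K₀)
    (hρ : 0 ≤ ρ) (hM : M ≤ κ * K₀ ^ 2) (h1 : ∀ j, κ * ‖u j‖ ^ 2 ≤ p j)
    (h2 : p 0 ≤ M * ‖u 0‖ ^ 2) (h3 : ∀ j, p (j + 1) ≤ ρ ^ 2 * p j) (j : ℕ) :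
    ‖u j‖ ≤ K₀ * ρ ^ j * ‖u 0‖ := by
  have hp : p j ≤ (ρ ^ 2) ^ j * p 0 := by
    induction j with
    | zero => simp
    | succ j ih =>
      refine (h3 j).trans ?_
      rw [pow_succ' (ρ ^ 2), mul_assoc]
      exact mul_le_mul_of_nonneg_left ih (by positivity)
  refine abs_le_of_sq_le_sq' ?_ (by positivity) |>.2
  have h4 : p 0 ≤ κ * K₀ ^ 2 * ‖u 0‖ ^ 2 :=
    h2.trans (mul_le_mul_of_nonneg_right hM (by positivity))
  refine le_of_mul_le_mul_left (((h1 j).trans hp).trans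
    ((mul_le_mul_of_nonneg_left h4 (by positivity)).trans (le_of_eq ?_))) hκ
  ring

variable [NormedSpace ℝ Y]

set_option maxHeartbeats 600000 in
/-- Exponential dichotomy from a Lyapunov form: an invariant splitting into vectors with decaying
forward and backward orbits has constants that depend only on the form. -/
theorem hypDich_of_lyapunov {S : Y →L[ℝ] Y →L[ℝ] ℝ} (hS : ∀ v w, S v w = S w v)
    {a M b e κ K₀ : ℝ} (hM : 0 < M) (hb : 0 ≤ b)
    (hSM : ∀ v w, |S v w| ≤ M * ‖v‖ * ‖w‖)
    {B Λi P : Y →L[ℝ] Y} (hB : ‖B‖ ≤ b) (hSB : ∀ v, a * ‖v‖ ^ 2 ≤ S v (B v)) (he : 0 < e)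
    (he1 : M * b ^ 2 * e ≤ a) (he2 : b * e ≤ 1 / 2) (he3 : a * e ≤ M)
    (hκ : 0 < κ) (hκb : 4 * κ * b ≤ a) (hK₀ : 0 ≤ K₀) (hMK : M ≤ κ * K₀ ^ 2)
    (hinv : (1 + e • B) * Λi = 1) (hinv' : Λi * (1 + e • B) = 1)
    (hcomm : P * (1 + e • B) = (1 + e • B) * P)
    (hs : ∀ v, Tendsto (fun j : ℕ => ((1 + e • B) ^ j) (P v)) atTop (𝓝 0))
    (hu : ∀ v, Tendsto (fun j : ℕ => (Λi ^ j) ((1 - P) v)) atTop (𝓝 0)) :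
    HypDich (1 + e • B) Λi P (K₀ * (2 * M / κ)) (a / (4 * M) * e) := by
  set Λ := 1 + e • B with hΛ
  have ha : 0 ≤ a := le_trans (by positivity) hκb
  have hq (v) : |S v v| ≤ M * ‖v‖ ^ 2 := (hSM v v).trans (le_of_eq (by ring))
  have hΛv (v) : Λ v = v + e • B v := by simp [hΛ]
  have hBv (v) : ‖B v‖ ≤ b * ‖v‖ := (B.le_opNorm v).trans (by gcongr)
  -- The linear term contributes growth `2 * e * a`; by `he1` the term quadratic in `e` destroys at
  -- most half of it.
  have F1 (v) : S v v + e * a * ‖v‖ ^ 2 ≤ S (Λ v) (Λ v) := by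
    have h1 : S (Λ v) (Λ v) = S v v + 2 * e * S v (B v) + e ^ 2 * S (B v) (B v) := by
      rw [hΛv]
      simp only [map_add, map_smul, add_apply, smul_apply,
        smul_eq_mul, hS (B v) v]
      ring
    have h2 : -(M * b ^ 2 * ‖v‖ ^ 2) ≤ S (B v) (B v) := by
      have := (abs_le.1 (hq (B v))).1
      have h3 : ‖B v‖ ^ 2 ≤ (b * ‖v‖) ^ 2 := by gcongr; exact hBv v
      nlinarith
    have h3 : e * (M * b ^ 2 * e) * ‖v‖ ^ 2 ≤ e * a * ‖v‖ ^ 2 := by gcongr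
    have h4 := mul_le_mul_of_nonneg_left h2 (sq_nonneg e)
    have h5 := mul_le_mul_of_nonneg_left (hSB v) he.le
    rw [h1]
    nlinarith
  have heb : 0 ≤ b * e := by positivity
  have F2 (v) : (1 - 2 * (b * e)) * ‖v‖ ^ 2 ≤ ‖Λ v‖ ^ 2 ∧
      ‖Λ v‖ ^ 2 ≤ (1 + 3 * (b * e)) * ‖v‖ ^ 2 := by
    have h1 : ‖e • B v‖ ≤ b * e * ‖v‖ := by
      rw [norm_smul, Real.norm_of_nonneg he.le]
      nlinarith [hBv v]
    have h2 : (1 - b * e) * ‖v‖ ≤ ‖Λ v‖ := by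
      have := norm_sub_le_norm_add v (e • B v)
      rw [hΛv]; linarith
    have h3 : ‖Λ v‖ ≤ (1 + b * e) * ‖v‖ := by
      have := norm_add_le v (e • B v)
      rw [hΛv]; linarith
    constructor
    · have := pow_le_pow_left₀ (mul_nonneg (by linarith) (norm_nonneg v)) h2 2
      refine le_trans ?_ this
      rw [mul_pow]
      gcongr
      nlinarith
    · have := pow_le_pow_left₀ (norm_nonneg _) h3 2
      refine this.trans ?_
      rw [mul_pow]
      gcongr
      nlinarith
  have hκe : 4 * κ * (b * e) ≤ a * e := by nlinarith
  have hq0 {u : ℕ → Y} (h : Tendsto u atTop (𝓝 0)) (σ : ℝ) :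
      Tendsto (fun j => S (u j) (u j) + σ * ‖u j‖ ^ 2) atTop (𝓝 0) := by
    have hc : Continuous fun v : Y => S v v + σ * ‖v‖ ^ 2 :=
      (S.continuous.clm_apply continuous_id).add
        (continuous_const.mul (continuous_norm.pow 2))
    simpa [Function.comp_def] using (hc.tendsto 0).comp h
  set μ := a / (4 * M) * e with hμ
  have hμM : 4 * μ * M = a * e := by
    rw [hμ]; field_simp
  have hμ0 : 0 ≤ μ := by positivity
  have hμ1 : 4 * μ ≤ 1 := by
    by_contra h
    push Not at h
    nlinarith
  -- vectors with decaying forward orbit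
  have hstab {v : Y} (h : Tendsto (fun j : ℕ => (Λ ^ j) v) atTop (𝓝 0)) :
      S v v + κ * ‖v‖ ^ 2 ≤ 0 := by
    -- Adding `κ ‖·‖²` does not destroy the growth of `S` along orbits. The limit along a decaying
    -- orbit is zero, so the initial value is nonpositive.
    have hmono : Monotone fun j : ℕ => S ((Λ ^ j) v) ((Λ ^ j) v) + κ * ‖(Λ ^ j) v‖ ^ 2 :=
      monotone_nat_of_le_succ fun j => by
        rw [pow_succ' Λ j, mul_apply_eq_comp]
        have h1 := F1 ((Λ ^ j) v)
        have h2 := mul_le_mul_of_nonneg_left (F2 ((Λ ^ j) v)).1 hκ.le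
        have h3 := mul_le_mul_of_nonneg_right hκe (sq_nonneg ‖(Λ ^ j) v‖)
        have h4 : 0 ≤ κ * (b * e) * ‖(Λ ^ j) v‖ ^ 2 := by positivity
        nlinarith
    simpa using hmono.ge_of_tendsto (hq0 h κ) 0
  have hunst {v : Y} (h : Tendsto (fun j : ℕ => (Λi ^ j) v) atTop (𝓝 0)) :
      0 ≤ S v v + -κ * ‖v‖ ^ 2 := by
    have hanti : Antitone fun j : ℕ => S ((Λi ^ j) v) ((Λi ^ j) v) + -κ * ‖(Λi ^ j) v‖ ^ 2 :=
      antitone_nat_of_succ_le fun j => by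
        have h0 : (Λi ^ j) v = Λ ((Λi ^ (j + 1)) v) := by
          rw [pow_succ', ← mul_apply_eq_comp, ← mul_assoc, hinv, one_mul]
        have h1 := F1 ((Λi ^ (j + 1)) v)
        have h2 := mul_le_mul_of_nonneg_left (F2 ((Λi ^ (j + 1)) v)).2 hκ.le
        have h3 := mul_le_mul_of_nonneg_right hκe (sq_nonneg ‖(Λi ^ (j + 1)) v‖)
        have h4 : 0 ≤ κ * (b * e) * ‖(Λi ^ (j + 1)) v‖ ^ 2 := by positivity
        rw [h0]
        nlinarith
    simpa using hanti.le_of_tendsto (hq0 h (-κ)) 0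
  have htail {T : Y →L[ℝ] Y} {v : Y} (h : Tendsto (fun j : ℕ => (T ^ j) v) atTop (𝓝 0)) (i : ℕ) :
      Tendsto (fun j : ℕ => (T ^ j) ((T ^ i) v)) atTop (𝓝 0) := by
    have := (tendsto_add_atTop_iff_nat i).2 h
    simpa only [pow_add, mul_apply_eq_comp] using this
  have hdec {v : Y} (h : Tendsto (fun j : ℕ => (Λ ^ j) v) atTop (𝓝 0)) (j : ℕ) :
      ‖(Λ ^ j) v‖ ≤ K₀ * (1 - μ) ^ j * ‖v‖ := by
    have := norm_le_of_comparison (u := fun j => (Λ ^ j) v)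
      (p := fun j => -S ((Λ ^ j) v) ((Λ ^ j) v)) hκ hK₀ (by linarith : 0 ≤ 1 - μ) hMK
      (fun j => by linarith [hstab (htail h j)]) (by simpa using (abs_le.1 (hq v)).1 |> neg_le.1)
      (fun j => by
        rw [pow_succ' Λ j, mul_apply_eq_comp]
        have h1 := F1 ((Λ ^ j) v)
        have h2 := neg_le.1 (abs_le.1 (hq ((Λ ^ j) v))).1
        have h3 : 0 ≤ -S ((Λ ^ j) v) ((Λ ^ j) v) :=
          le_trans (by positivity) (by linarith [hstab (htail h j)] :
            κ * ‖(Λ ^ j) v‖ ^ 2 ≤ -S ((Λ ^ j) v) ((Λ ^ j) v))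
        have h4 := mul_le_mul_of_nonneg_left h2 (by positivity : 0 ≤ 4 * μ)
        have h5 : 4 * μ * (M * ‖(Λ ^ j) v‖ ^ 2) = e * a * ‖(Λ ^ j) v‖ ^ 2 := by
          rw [← mul_assoc, hμM]; ring
        nlinarith [mul_nonneg hμ0 h3, mul_nonneg (mul_nonneg hμ0 hμ0) h3]) j
    simpa using this
  have hdec' {v : Y} (h : Tendsto (fun j : ℕ => (Λi ^ j) v) atTop (𝓝 0)) (j : ℕ) :
      ‖(Λi ^ j) v‖ ≤ K₀ * (1 - μ) ^ j * ‖v‖ := by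
    have := norm_le_of_comparison (u := fun j => (Λi ^ j) v)
      (p := fun j => S ((Λi ^ j) v) ((Λi ^ j) v)) hκ hK₀ (by linarith : 0 ≤ 1 - μ) hMK
      (fun j => by linarith [hunst (htail h j)]) (by simpa using (abs_le.1 (hq v)).2)
      (fun j => by
        have h0 : (Λi ^ j) v = Λ ((Λi ^ (j + 1)) v) := by
          rw [pow_succ', ← mul_apply_eq_comp, ← mul_assoc, hinv, one_mul]
        rw [h0]
        set u := (Λi ^ (j + 1)) v with hu
        have h1 := F1 u
        have h2 := (abs_le.1 (hq u)).2
        have h3 : 0 ≤ S u u := le_trans (by positivity) (by linarith [hunst (htail h (j + 1))] :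
            κ * ‖u‖ ^ 2 ≤ S u u)
        have h4 := mul_le_mul_of_nonneg_left h2 (by positivity : 0 ≤ 4 * μ)
        have h5 : 4 * μ * (M * ‖u‖ ^ 2) = e * a * ‖u‖ ^ 2 := by
          rw [← mul_assoc, hμM]; ring
        have h6 : (1 + 4 * μ) * S u u ≤ S (Λ u) (Λ u) := by nlinarith
        have h7 : 1 ≤ (1 - μ) ^ 2 * (1 + 4 * μ) := by
          nlinarith [mul_nonneg hμ0 (sub_nonneg.2 hμ1), pow_nonneg hμ0 3]
        calc S u u = 1 * S u u := (one_mul _).symm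
          _ ≤ (1 - μ) ^ 2 * (1 + 4 * μ) * S u u := by gcongr
          _ = (1 - μ) ^ 2 * ((1 + 4 * μ) * S u u) := by ring
          _ ≤ _ := by gcongr) j
    simpa using this
  -- With stable part `x` and unstable part `y`, `S(y - x, x + y) = S(y, y) - S(x, x)` is at least
  -- `κ (‖x‖² + ‖y‖²)`; this bounds the projections without any information on the angle of the
  -- splitting.
  have hproj (v : Y) : ‖P v‖ + ‖(1 - P) v‖ ≤ 2 * M / κ * ‖v‖ := by
    have h1 := hstab (hs v)
    have h2 := hunst (hu v)
    have hv : v = P v + (1 - P) v := by simp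
    set x := P v
    set y := (1 - P) v
    have h3 : S (y - x) v = S y y - S x x := by
      rw [hv]
      simp only [map_add, map_sub, sub_apply, hS y x]
      ring
    have h4 : S (y - x) v ≤ M * (‖x‖ + ‖y‖) * ‖v‖ := by
      refine (le_abs_self _).trans ((hSM _ _).trans ?_)
      gcongr
      rw [add_comm]
      exact norm_sub_le _ _
    rw [div_mul_eq_mul_div, le_div_iff₀ hκ]
    have h5 : κ * (‖x‖ + ‖y‖) ^ 2 ≤ 2 * M * (‖x‖ + ‖y‖) * ‖v‖ := by
      have h7 : κ * ‖x‖ ^ 2 + κ * ‖y‖ ^ 2 ≤ M * (‖x‖ + ‖y‖) * ‖v‖ := by linarith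
      have h8 := mul_nonneg hκ.le (sq_nonneg (‖x‖ - ‖y‖))
      linarith [h7, h8, (by ring : κ * (‖x‖ + ‖y‖) ^ 2 =
        2 * (κ * ‖x‖ ^ 2 + κ * ‖y‖ ^ 2) - κ * (‖x‖ - ‖y‖) ^ 2)]
    have h6 : 0 ≤ ‖x‖ + ‖y‖ := by positivity
    rcases h6.eq_or_lt with h | h
    · rw [← h]; simp; positivity
    · refine le_of_mul_le_mul_left ?_ h
      linarith
  have hμ' : 0 ≤ 1 - μ := by linarith
  refine ⟨hinv, hinv', hcomm, fun j => ?_, fun j => ?_⟩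
  all_goals
    refine ContinuousLinearMap.opNorm_le_bound _ (by positivity) fun v => ?_
    rw [mul_apply_eq_comp]
  · calc _ ≤ K₀ * (1 - μ) ^ j * ‖P v‖ := hdec (hs v) j
      _ ≤ K₀ * (1 - μ) ^ j * (2 * M / κ * ‖v‖) := by
        gcongr
        linarith [hproj v, norm_nonneg ((1 - P) v)]
      _ = _ := by ring
  · calc _ ≤ K₀ * (1 - μ) ^ j * ‖(1 - P) v‖ := hdec' (hu v) j
      _ ≤ K₀ * (1 - μ) ^ j * (2 * M / κ * ‖v‖) := by
        gcongr
        linarith [hproj v, norm_nonneg (P v)]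
      _ = _ := by ring

end LyapunovDichotomy

end PhaseLocking

end

noncomputable section

namespace PhaseLocking

/-! ### The spectral gap forced by an adapted splitting. -/

section Spectrum

open Matrix

variable {s : ℕ}

/-- The complexification of a linear endomorphism of `ℝˢ`. -/
abbrev complexMatrix (T : (Fin s → ℝ) →L[ℝ] (Fin s → ℝ)) : Matrix (Fin s) (Fin s) ℂ :=
  (LinearMap.toMatrix' (T : (Fin s → ℝ) →ₗ[ℝ] (Fin s → ℝ))).map (algebraMap ℝ ℂ)

/-- `x + i y` is an eigenvector of `T` with eigenvalue `z`. -/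
structure IsComplexEigenvector (T : (Fin s → ℝ) →L[ℝ] (Fin s → ℝ)) (z : ℂ)
    (x y : Fin s → ℝ) : Prop where
  ne_zero : x ≠ 0 ∨ y ≠ 0
  re : T x = z.re • x - z.im • y
  im : T y = z.im • x + z.re • y

theorem exists_isComplexEigenvector {T : (Fin s → ℝ) →L[ℝ] (Fin s → ℝ)} {z : ℂ}
    (hz : z ∈ spectrum ℂ (complexMatrix T)) : ∃ x y, IsComplexEigenvector T z x y := by
  rw [Matrix.mem_spectrum_iff_isRoot_charpoly, Polynomial.IsRoot, Matrix.eval_charpoly,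
    ← Matrix.exists_mulVec_eq_zero_iff] at hz
  obtain ⟨v, hv0, hv⟩ := hz
  have hv' : complexMatrix T *ᵥ v = z • v := by
    rw [Matrix.sub_mulVec, sub_eq_zero] at hv
    rw [← hv, Matrix.scalar_apply, ← Matrix.smul_one_eq_diagonal, Matrix.smul_mulVec,
      Matrix.one_mulVec]
  have hT (u : Fin s → ℝ) (i : Fin s) :
      T u i = ∑ j, LinearMap.toMatrix' (T : (Fin s → ℝ) →ₗ[ℝ] (Fin s → ℝ)) i j * u j := by
    have := congrFun (LinearMap.toMatrix'_mulVec (T : (Fin s → ℝ) →ₗ[ℝ] (Fin s → ℝ)) u) i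
    exact this.symm
  have hi (i : Fin s) := congrFun hv' i
  simp only [Matrix.mulVec, dotProduct, Matrix.map_apply, Pi.smul_apply, smul_eq_mul,
    Complex.coe_algebraMap] at hi
  refine ⟨fun i => (v i).re, fun i => (v i).im, ?_, ?_, ?_⟩
  · by_contra h
    push Not at h
    refine hv0 (funext fun i => Complex.ext ?_ ?_)
    · exact congrFun h.1 i
    · exact congrFun h.2 i
  · ext i
    have := congrArg Complex.re (hi i)
    rw [hT]
    simp only [Complex.re_sum, Complex.mul_re, Complex.ofReal_re, Complex.ofReal_im, zero_mul,
      sub_zero] at this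
    rw [this]
    simp
  · ext i
    have := congrArg Complex.im (hi i)
    rw [hT]
    simp only [Complex.im_sum, Complex.mul_im, Complex.ofReal_re, Complex.ofReal_im, zero_mul,
      add_zero] at this
    rw [this]
    simp
    ring

theorem IsComplexEigenvector.pow {T : (Fin s → ℝ) →L[ℝ] (Fin s → ℝ)} {z : ℂ} {x y : Fin s → ℝ}
    (h : IsComplexEigenvector T z x y) (j : ℕ) :
    (T ^ j) x = (z ^ j).re • x - (z ^ j).im • y ∧ (T ^ j) y = (z ^ j).im • x + (z ^ j).re • y := by
  induction j with
  | zero => simp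
  | succ j ih =>
    simp only [pow_succ' T j, mul_apply_eq_comp, ih.1, ih.2, map_sub, map_add, map_smul, h.re, h.im,
      pow_succ' z j, Complex.mul_re, Complex.mul_im]
    constructor <;> module

theorem one_le_of_forall_le_mul_pow {c C t : ℝ} (hc : 0 < c) (ht : 0 ≤ t)
    (h : ∀ j : ℕ, c ≤ C * t ^ j) : 1 ≤ t := by
  by_contra ht1
  push Not at ht1
  have h1 : Tendsto (fun j : ℕ => C * t ^ j) atTop (𝓝 (C * 0)) :=
    (tendsto_pow_atTop_nhds_zero_of_lt_one ht ht1).const_mul C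
  have := ge_of_tendsto' h1 h
  linarith

/-- The decay of `T ^ j` becomes `‖z‖ ^ j ≤ const * ρ ^ j`, read off in a coordinate where the
eigenvector does not vanish. -/
theorem IsComplexEigenvector.norm_le {T : (Fin s → ℝ) →L[ℝ] (Fin s → ℝ)} {z : ℂ}
    {x y : Fin s → ℝ} (h : IsComplexEigenvector T z x y) {C ρ : ℝ} (hρ : 0 ≤ ρ)
    (hx : ∀ j : ℕ, ‖(T ^ j) x‖ ≤ C * ρ ^ j * ‖x‖) (hy : ∀ j : ℕ, ‖(T ^ j) y‖ ≤ C * ρ ^ j * ‖y‖) :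
    ‖z‖ ≤ ρ := by
  obtain ⟨i, hi⟩ : ∃ i, 0 < ‖(⟨x i, y i⟩ : ℂ)‖ := by
    by_contra hne
    push Not at hne
    have h0 : ∀ i, (⟨x i, y i⟩ : ℂ) = 0 := fun i => norm_le_zero_iff.1 (hne i)
    rcases h.ne_zero with hx0 | hy0
    · exact hx0 (funext fun i => congrArg Complex.re (h0 i))
    · exact hy0 (funext fun i => congrArg Complex.im (h0 i))
  have key (j : ℕ) : ‖z‖ ^ j * ‖(⟨x i, y i⟩ : ℂ)‖ ≤ C * (‖x‖ + ‖y‖) * ρ ^ j := by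
    rw [← norm_pow, ← norm_mul]
    refine (Complex.norm_le_abs_re_add_abs_im _).trans ?_
    have h1 : (z ^ j * ⟨x i, y i⟩ : ℂ).re = (T ^ j) x i := by
      rw [(h.pow j).1]; simp [Complex.mul_re]
    have h2 : (z ^ j * ⟨x i, y i⟩ : ℂ).im = (T ^ j) y i := by
      rw [(h.pow j).2]; simp [Complex.mul_im]; ring
    rw [h1, h2]
    have h3 := (norm_le_pi_norm ((T ^ j) x) i).trans (hx j)
    have h4 := (norm_le_pi_norm ((T ^ j) y) i).trans (hy j)
    rw [Real.norm_eq_abs] at h3 h4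
    nlinarith
  by_contra hz
  push Not at hz
  have hz0 : 0 < ‖z‖ := hρ.trans_lt hz
  have := one_le_of_forall_le_mul_pow (C := C * (‖x‖ + ‖y‖)) hi (div_nonneg hρ hz0.le) fun j => by
    rw [div_pow, ← mul_div_assoc, le_div_iff₀ (by positivity), mul_comm]
    exact key j
  rw [le_div_iff₀ hz0] at this
  linarith

/-- Decay is required on all real combinations of `x` and `y`, since `T ^ j` maps `x` and `y` to
such combinations, which `Ti ^ j` carries back. -/
theorem IsComplexEigenvector.one_le {T Ti : (Fin s → ℝ) →L[ℝ] (Fin s → ℝ)} {z : ℂ}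
    {x y : Fin s → ℝ} (h : IsComplexEigenvector T z x y) (hT : Ti * T = 1) {C ρ : ℝ} (hC : 0 ≤ C)
    (hρ : 0 ≤ ρ) (hd : ∀ (a b : ℝ) (j : ℕ), ‖(Ti ^ j) (a • x + b • y)‖ ≤ C * ρ ^ j * ‖a • x + b • y‖) :
    1 ≤ ρ * ‖z‖ := by
  have h0 : 0 < ‖x‖ + ‖y‖ := by
    rcases h.ne_zero with hx0 | hy0
    · have := norm_pos_iff.2 hx0; positivity
    · have := norm_pos_iff.2 hy0; positivity
  have hTi (j : ℕ) (v : Fin s → ℝ) : (Ti ^ j) ((T ^ j) v) = v := by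
    induction j with
    | zero => simp
    | succ j ih =>
      rw [pow_succ, pow_succ', mul_apply_eq_comp, mul_apply_eq_comp, ← mul_apply_eq_comp Ti, hT,
        one_apply_eq_self, ih]
  have hr (j : ℕ) : |(z ^ j).re| ≤ ‖z‖ ^ j := by
    rw [← norm_pow]; exact Complex.abs_re_le_norm _
  have hm (j : ℕ) : |(z ^ j).im| ≤ ‖z‖ ^ j := by
    rw [← norm_pow]; exact Complex.abs_im_le_norm _
  have hcomb (a b : ℝ) (j : ℕ) (ha : |a| ≤ ‖z‖ ^ j) (hb : |b| ≤ ‖z‖ ^ j) :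
      ‖a • x + b • y‖ ≤ ‖z‖ ^ j * (‖x‖ + ‖y‖) := by
    refine (norm_add_le _ _).trans ?_
    rw [norm_smul, norm_smul, mul_add, Real.norm_eq_abs, Real.norm_eq_abs]
    gcongr
  refine one_le_of_forall_le_mul_pow (C := 2 * C * (‖x‖ + ‖y‖)) h0 (by positivity) fun j => ?_
  have h1 : ‖x‖ ≤ C * ρ ^ j * (‖z‖ ^ j * (‖x‖ + ‖y‖)) := by
    have := hd (z ^ j).re (-(z ^ j).im) j
    rw [neg_smul, ← sub_eq_add_neg, ← (h.pow j).1, hTi, (h.pow j).1, sub_eq_add_neg,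
      ← neg_smul] at this
    exact this.trans (mul_le_mul_of_nonneg_left
      (hcomb _ _ j (hr j) (by rw [abs_neg]; exact hm j)) (by positivity))
  have h2 : ‖y‖ ≤ C * ρ ^ j * (‖z‖ ^ j * (‖x‖ + ‖y‖)) := by
    have := hd (z ^ j).im (z ^ j).re j
    rw [← (h.pow j).2, hTi, (h.pow j).2] at this
    exact this.trans (mul_le_mul_of_nonneg_left (hcomb _ _ j (hm j) (hr j)) (by positivity))
  rw [mul_pow]
  linarith

/-- An eigenvector of `B` is one of `1 + e B`. -/
theorem IsComplexEigenvector.one_add_smul {B : (Fin s → ℝ) →L[ℝ] (Fin s → ℝ)} {z : ℂ}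
    {x y : Fin s → ℝ} (h : IsComplexEigenvector B z x y) (e : ℝ) :
    IsComplexEigenvector (1 + e • B) (1 + e * z) x y := by
  refine ⟨h.ne_zero, ?_, ?_⟩
  · simp [h.re]; module
  · simp [h.im]; module

/-- The constant depends on the adapted norm and thus, later, on `ε`; only the rate `a` will be
used. -/
theorem AdaptedSplitting.decay {Λ P : (Fin s → ℝ) →L[ℝ] (Fin s → ℝ)} {a b : ℝ}
    (h : AdaptedSplitting Λ P a b) (ha : 0 ≤ a) :
    ∃ C, 0 ≤ C ∧ ∀ v, P v = v → ∀ j : ℕ, ‖(Λ ^ j) v‖ ≤ C * a ^ j * ‖v‖ := by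
  obtain ⟨_, h2, ⟨N, hN0, hN⟩, _⟩ := h
  obtain ⟨C, hC, hd⟩ := exists_decay (T := Λ) (V := LinearMap.ker (P - 1).toLinearMap)
    (N := N) ha
    (fun v hv => by
      have hv' : P v = v := by simpa [sub_eq_zero] using hv
      have := DFunLike.congr_fun h2 v
      simp only [ContinuousLinearMap.comp_apply, hv'] at this
      simp [this])
    (fun v hv => hN0 v (by simpa [sub_eq_zero] using hv))
    (fun v hv => hN v (by simpa [sub_eq_zero] using hv))
  exact ⟨C, hC, fun v hv => hd v (by simp [hv])⟩

theorem AdaptedSplitting.decay_inverse {Λ Λi P : (Fin s → ℝ) →L[ℝ] (Fin s → ℝ)} {a b : ℝ}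
    (h : AdaptedSplitting Λ P a b) (hb : 0 ≤ b) (h1 : Λ * Λi = 1) (h2 : Λi * Λ = 1) :
    ∃ C, 0 ≤ C ∧ ∀ v, P v = 0 → ∀ j : ℕ, ‖(Λi ^ j) v‖ ≤ C * b ^ j * ‖v‖ := by
  obtain ⟨_, hc, _, ⟨N, hN0, hN⟩⟩ := h
  have hPi : ∀ v, P v = 0 → P (Λi v) = 0 := fun v hv => by
    have h3 := DFunLike.congr_fun hc (Λi v)
    simp only [ContinuousLinearMap.comp_apply, ← mul_apply_eq_comp Λ Λi, h1, one_apply_eq_self,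
      hv] at h3
    have h4 := congrArg Λi h3
    rwa [map_zero, ← mul_apply_eq_comp, h2, one_apply_eq_self, eq_comm] at h4
  obtain ⟨C, hC, hd⟩ := exists_decay (T := Λi) (V := LinearMap.ker P.toLinearMap) (N := N) hb
    (fun v hv => hPi v hv) (fun v hv => hN0 v hv)
    (fun v hv => by
      have := hN (Λi v) (hPi v hv)
      rwa [← mul_apply_eq_comp Λ, h1, one_apply_eq_self] at this)
  exact ⟨C, hC, fun v hv => hd v hv⟩

/-- Eigenvalues of `B` stay away from the imaginary axis if `1 + e B` has an adapted splitting with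
rates of order `e`. -/
theorem AdaptedSplitting.le_abs_re {B Λi P : (Fin s → ℝ) →L[ℝ] (Fin s → ℝ)} {e a b : ℝ}
    (h : AdaptedSplitting (1 + e • B) P (1 - a * e) (1 - b * e)) (he : 0 < e)
    (hb : 0 < b) (hae : a * e ≤ 1) (hbe : b * e ≤ 1) (h1 : (1 + e • B) * Λi = 1)
    (h2 : Λi * (1 + e • B) = 1) (hB : e * ‖B‖ ^ 2 ≤ b) {z : ℂ}
    (hz : z ∈ spectrum ℂ (complexMatrix B)) : min a (b / 2) ≤ |z.re| := by
  obtain ⟨x, y, hxy⟩ := exists_isComplexEigenvector hz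
  have hpow (v : Fin s → ℝ) (j : ℕ) : ‖(B ^ j) v‖ ≤ 1 * ‖B‖ ^ j * ‖v‖ := by
    rcases Nat.eq_zero_or_pos j with rfl | hj
    · simp
    · rw [one_mul]
      exact ((B ^ j).le_opNorm v).trans (by gcongr; exact norm_pow_le' B hj)
  have hzB : ‖z‖ ≤ ‖B‖ := hxy.norm_le (norm_nonneg _) (hpow x) (hpow y)
  have hΛ := hxy.one_add_smul e
  have hre : (1 + e * z : ℂ).re = 1 + e * z.re := by simp
  have him : (1 + e * z : ℂ).im = e * z.im := by simp
  -- Either the eigenvector lies in the unstable space, or its nonzero projection is an eigenvector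
  -- in the stable space.
  by_cases hP : P x = 0 ∧ P y = 0
  · obtain ⟨C, hC, hd⟩ := h.decay_inverse (by linarith) h1 h2
    have := hΛ.one_le h2 hC (by linarith) fun α β j =>
      hd (α • x + β • y) (by simp [hP.1, hP.2]) j
    refine (min_le_right _ _).trans (le_trans ?_ (le_abs_self _))
    have h3 : 1 + b * e ≤ ‖(1 + e * z : ℂ)‖ := by
      nlinarith [norm_nonneg (1 + e * z : ℂ), mul_pos hb he]
    have h4 : (1 + b * e) ^ 2 ≤ ‖(1 + e * z : ℂ)‖ ^ 2 := by gcongr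
    rw [← Complex.normSq_eq_norm_sq, Complex.normSq_apply, hre, him] at h4
    have h5 : z.re * z.re + z.im * z.im ≤ ‖B‖ ^ 2 := by
      rw [← Complex.normSq_apply, Complex.normSq_eq_norm_sq]
      gcongr
    have h6 : e * (e * (z.re * z.re + z.im * z.im)) ≤ e * b := by
      gcongr
      exact (mul_le_mul_of_nonneg_left h5 he.le).trans hB
    -- `‖1 + e z‖² ≥ (1 + b e)²` gives `2 e Re z + e² ‖z‖² ≥ 2 b e`; the smallness of `e ‖B‖²` costs
    -- at most half of the right-hand side.
    have h7 : e * (b / 2) ≤ e * z.re := by nlinarith [sq_nonneg (b * e)]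
    exact le_of_mul_le_mul_left h7 he
  · obtain ⟨C, hC, hd⟩ := h.decay (by linarith)
    have hPP (v) : P (P v) = P v := DFunLike.congr_fun h.1 v
    have hPΛ (v) : (1 + e • B) (P v) = P ((1 + e • B) v) :=
      (DFunLike.congr_fun h.2.1 v).symm
    have hPxy : IsComplexEigenvector (1 + e • B) (1 + e * z) (P x) (P y) := by
      refine ⟨by tauto, ?_, ?_⟩
      · rw [hPΛ, hΛ.re, map_sub, map_smul, map_smul]
      · rw [hPΛ, hΛ.im, map_add, map_smul, map_smul]
    have := hPxy.norm_le (by linarith) (fun j => hd _ (hPP x) j) fun j => hd _ (hPP y) j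
    refine (min_le_left _ _).trans (le_trans ?_ (neg_le_abs _))
    have h3 := (Complex.re_le_norm (1 + e * z)).trans this
    rw [hre] at h3
    have h4 : e * a ≤ e * -z.re := by linarith
    exact le_of_mul_le_mul_left h4 he

/-- Over `ℂ` the characteristic polynomial is a product of `s` factors `t - z` with `z` in the
spectrum. -/
theorem le_norm_eval_charpoly {M : Matrix (Fin s) (Fin s) ℂ} {c : ℝ} (hc : 0 ≤ c) {t : ℂ}
    (h : ∀ z ∈ spectrum ℂ M, c ≤ ‖t - z‖) : c ^ s ≤ ‖M.charpoly.eval t‖ := by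
  rw [(IsAlgClosed.splits M.charpoly).eval_eq_prod_roots_of_monic M.charpoly_monic]
  have hcard : M.charpoly.roots.card = s := by
    rw [← (IsAlgClosed.splits M.charpoly).natDegree_eq_card_roots, M.charpoly_natDegree_eq_dim]
    simp
  have key : ∀ R : Multiset ℂ, (∀ z ∈ R, c ≤ ‖t - z‖) →
      c ^ R.card ≤ ‖(R.map fun z => t - z).prod‖ := fun R => by
    induction R using Multiset.induction with
    | empty => simp
    | cons a R ih =>
      intro hR
      simp only [Multiset.card_cons, Multiset.map_cons, Multiset.prod_cons, norm_mul, pow_succ']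
      exact mul_le_mul (hR a (by simp)) (ih fun z hz => hR z (by simp [hz])) (by positivity)
        (norm_nonneg _)
  have := key M.charpoly.roots fun z hz => h z (by
    rw [Matrix.mem_spectrum_iff_isRoot_charpoly]
    exact (Polynomial.mem_roots'.1 hz).2)
  rwa [hcard] at this

theorem continuous_complexMatrix :
    Continuous (complexMatrix : ((Fin s → ℝ) →L[ℝ] (Fin s → ℝ)) → _) := by
  refine continuous_matrix fun i j => ?_
  simp only [complexMatrix, Matrix.map_apply, LinearMap.toMatrix'_apply]
  exact Complex.continuous_ofReal.comp ((continuous_apply i).comp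
    (ContinuousLinearMap.apply ℝ (Fin s → ℝ) (Pi.single j 1)).continuous)

/-- A uniform spectral gap at the imaginary axis passes to limits. -/
theorem re_ne_zero_of_tendsto {ι : Type} {F : Filter ι} [F.NeBot]
    {B : ι → (Fin s → ℝ) →L[ℝ] (Fin s → ℝ)} {B₀ : (Fin s → ℝ) →L[ℝ] (Fin s → ℝ)}
    (hB : Tendsto B F (𝓝 B₀)) {c : ℝ} (hc : 0 < c)
    (h : ∀ᶠ i in F, ∀ z ∈ spectrum ℂ (complexMatrix (B i)), c ≤ |z.re|) :
    ∀ z ∈ spectrum ℂ (complexMatrix B₀), z.re ≠ 0 := by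
  intro z hz hre
  -- Determinants depend continuously on the matrix, which avoids following individual eigenvalues.
  have h1 : ∀ᶠ i in F, c ^ s ≤ ‖(scalar (Fin s) z - complexMatrix (B i)).det‖ := by
    filter_upwards [h] with i hi
    rw [← Matrix.eval_charpoly]
    refine le_norm_eval_charpoly hc.le fun w hw => (hi w hw).trans ?_
    have := Complex.abs_re_le_norm (z - w)
    rwa [Complex.sub_re, hre, zero_sub, abs_neg] at this
  have h2 : Tendsto (fun i => ‖(scalar (Fin s) z - complexMatrix (B i)).det‖) F
      (𝓝 ‖(scalar (Fin s) z - complexMatrix B₀).det‖) := by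
    have hcont : Continuous fun T : (Fin s → ℝ) →L[ℝ] (Fin s → ℝ) =>
        ‖(scalar (Fin s) z - complexMatrix T).det‖ :=
      (Continuous.matrix_det (continuous_const.sub continuous_complexMatrix)).norm
    exact (hcont.tendsto B₀).comp hB
  have h3 := ge_of_tendsto h2 h1
  rw [Matrix.mem_spectrum_iff_isRoot_charpoly, Polynomial.IsRoot, Matrix.eval_charpoly] at hz
  rw [hz, norm_zero] at h3
  have := pow_pos hc s
  linarith

end Spectrum

end PhaseLocking

end

noncomputable section

namespace PhaseLocking

/-! ### Dichotomy constants uniform in `ε`. -/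

section UniformDichotomy

variable {s : ℕ}

theorem eventually_mul_pow_le (K : ℝ) {c : ℝ} (hc : 0 < c) {n : ℕ} (hn : 1 ≤ n) :
    ∀ᶠ ε in 𝓝[>] (0 : ℝ), K * ε ^ n ≤ c := by
  have h : Tendsto (fun ε : ℝ => K * ε ^ n) (𝓝 0) (𝓝 (K * 0 ^ n)) :=
    (continuous_const.mul (continuous_id.pow n)).tendsto 0
  rw [zero_pow (by omega), mul_zero] at h
  exact nhdsWithin_le_nhds (h.eventually (ge_mem_nhds hc))

theorem exists_inverse_one_add {T : (Fin s → ℝ) →L[ℝ] (Fin s → ℝ)} (hT : ‖T‖ < 1) :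
    ∃ Ti, (1 + T) * Ti = 1 ∧ Ti * (1 + T) = 1 := by
  have h : ‖-T‖ < 1 := by rwa [norm_neg]
  refine ⟨((Units.oneSub (-T) h)⁻¹ : (_)ˣ), ?_, ?_⟩
  · have := (Units.oneSub (-T) h).mul_inv
    rwa [Units.val_oneSub, sub_neg_eq_add] at this
  · have := (Units.oneSub (-T) h).inv_mul
    rwa [Units.val_oneSub, sub_neg_eq_add] at this

theorem exists_bilinear_lyapunov {B₀ : (Fin s → ℝ) →L[ℝ] (Fin s → ℝ)}
    (hB : ∀ z ∈ spectrum ℂ (complexMatrix B₀), z.re ≠ 0) :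
    ∃ S : (Fin s → ℝ) →L[ℝ] (Fin s → ℝ) →L[ℝ] ℝ, (∀ v w, S v w = S w v) ∧
      ∃ a > 0, ∀ v, a * ‖v‖ ^ 2 ≤ S v (B₀ v) := by
  obtain ⟨S, hS, a, ha, h⟩ := exists_lyapunov _ hB
  have hval (v w) : (Matrix.toBilin' S).toContinuousBilinearMap v w = v ⬝ᵥ (S.mulVec w) := by
    rw [LinearMap.toContinuousBilinearMap_apply, Matrix.toBilin'_apply']
  refine ⟨(Matrix.toBilin' S).toContinuousBilinearMap, fun v w => ?_, a, ha, fun v => ?_⟩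
  · rw [hval, hval, Matrix.dotProduct_mulVec, ← Matrix.mulVec_transpose, hS.eq, dotProduct_comm]
  · rw [hval]
    have := h v
    rwa [LinearMap.toMatrix'_mulVec] at this

theorem AdaptedSplitting.tendsto {Λ Λi P : (Fin s → ℝ) →L[ℝ] (Fin s → ℝ)} {a b : ℝ}
    (h : AdaptedSplitting Λ P a b) (ha : 0 ≤ a) (ha1 : a < 1) (hb : 0 ≤ b) (hb1 : b < 1)
    (h1 : Λ * Λi = 1) (h2 : Λi * Λ = 1) (v : Fin s → ℝ) :
    Tendsto (fun j : ℕ => (Λ ^ j) (P v)) atTop (𝓝 0) ∧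
      Tendsto (fun j : ℕ => (Λi ^ j) ((1 - P) v)) atTop (𝓝 0) := by
  have hPP (v) : P (P v) = P v := DFunLike.congr_fun h.1 v
  have key {a C : ℝ} {u : ℕ → Fin s → ℝ} {v : Fin s → ℝ} (ha : 0 ≤ a) (ha1 : a < 1)
      (hu : ∀ j, ‖u j‖ ≤ C * a ^ j * ‖v‖) : Tendsto u atTop (𝓝 0) := by
    have ht := ((tendsto_pow_atTop_nhds_zero_of_lt_one ha ha1).const_mul C).mul_const ‖v‖
    rw [mul_zero, zero_mul] at ht
    exact squeeze_zero_norm hu ht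
  obtain ⟨C, _, hC⟩ := h.decay ha
  obtain ⟨C', _, hC'⟩ := h.decay_inverse hb h1 h2
  exact ⟨key ha ha1 (hC _ (hPP v)), key hb hb1 (hC' _ (by simp [hPP]))⟩

/-- Adapted splittings of `1 + εⁿ B(ε)` with rates of order `εⁿ` have dichotomy constants that are
uniform in `ε`. -/
theorem exists_uniform_hypDich {B : ℝ → (Fin s → ℝ) →L[ℝ] (Fin s → ℝ)}
    {B₀ : (Fin s → ℝ) →L[ℝ] (Fin s → ℝ)} (hB : Tendsto B (𝓝[>] 0) (𝓝 B₀)) {n : ℕ} (hn : 1 ≤ n)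
    {Cs Cu : ℝ} (hCs : 0 < Cs) (hCu : 0 < Cu)
    (h : ∀ᶠ ε in 𝓝[>] (0 : ℝ), ∃ P,
      AdaptedSplitting (1 + ε ^ n • B ε) P (1 - Cs * ε ^ n) (1 - Cu * ε ^ n)) :
    ∃ K' c, 0 < c ∧ ∀ᶠ ε in 𝓝[>] (0 : ℝ), ∀ P,
      AdaptedSplitting (1 + ε ^ n • B ε) P (1 - Cs * ε ^ n) (1 - Cu * ε ^ n) →
      ∃ Λi, HypDich (1 + ε ^ n • B ε) Λi P K' (c * ε ^ n) := by
  set b := ‖B₀‖ + 1 with hb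
  have hb0 : 0 < b := by positivity
  have hBb : ∀ᶠ ε in 𝓝[>] (0 : ℝ), ‖B ε‖ ≤ b :=
    hB.norm.eventually (ge_mem_nhds (by simp [hb]))
  have hpos : ∀ᶠ ε in 𝓝[>] (0 : ℝ), 0 < ε := eventually_mem_nhdsWithin
  have hinv : ∀ᶠ ε in 𝓝[>] (0 : ℝ), ∃ Λi, (1 + ε ^ n • B ε) * Λi = 1 ∧
      Λi * (1 + ε ^ n • B ε) = 1 := by
    filter_upwards [hBb, hpos, eventually_mul_pow_le b (by norm_num : (0:ℝ) < 1 / 2) hn]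
      with ε h1 h2 h3
    refine exists_inverse_one_add ?_
    rw [norm_smul, norm_pow, Real.norm_of_nonneg h2.le]
    have := mul_le_mul_of_nonneg_left h1 (pow_nonneg h2.le n)
    linarith
  -- The rates in `h` keep the eigenvalues of `B ε` at a distance from the imaginary axis that does
  -- not depend on `ε`.
  have hre : ∀ z ∈ spectrum ℂ (complexMatrix B₀), z.re ≠ 0 := by
    refine re_ne_zero_of_tendsto hB (c := min Cs (Cu / 2)) (by positivity) ?_
    filter_upwards [h, hBb, hpos, hinv, eventually_mul_pow_le Cs one_pos hn,
      eventually_mul_pow_le Cu one_pos hn, eventually_mul_pow_le (b ^ 2) hCu hn]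
      with ε ⟨P, hP⟩ h1 h2 ⟨Λi, h3, h4⟩ h5 h6 h7 z hz
    refine hP.le_abs_re (pow_pos h2 n) hCu h5 h6 h3 h4 ?_ hz
    refine le_trans ?_ h7
    rw [mul_comm]
    gcongr
  -- One form for the limit `B₀` serves every small `ε`, with `a / 2` in place of `a`; its constants
  -- do not see the adapted norms.
  obtain ⟨S, hS, a, ha, hSB⟩ := exists_bilinear_lyapunov hre
  set M := ‖S‖ + 1 with hMdef
  have hM : 0 < M := by positivity
  have hSM (v w) : |S v w| ≤ M * ‖v‖ * ‖w‖ := (S.le_opNorm₂ v w).trans (by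
    gcongr; exact (le_add_of_nonneg_right zero_le_one))
  have hclose : ∀ᶠ ε in 𝓝[>] (0 : ℝ), M * ‖B ε - B₀‖ ≤ a / 2 := by
    have ht := ((tendsto_sub_nhds_zero_iff.2 hB).norm).const_mul M
    rw [norm_zero, mul_zero] at ht
    exact ht.eventually (ge_mem_nhds (by positivity))
  set κ := a / 2 / (4 * b) with hκ
  have hκ0 : 0 < κ := by positivity
  -- `K₀ = 1 + M / κ` satisfies `M ≤ κ * K₀ ^ 2`, and `κ` was chosen so that `4 * κ * b = a / 2`.
  refine ⟨(1 + M / κ) * (2 * M / κ), a / 2 / (4 * M), by positivity, ?_⟩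
  filter_upwards [hBb, hpos, hinv, hclose, eventually_mul_pow_le (M * b ^ 2) (half_pos ha) hn,
    eventually_mul_pow_le b (by norm_num : (0:ℝ) < 1 / 2) hn, eventually_mul_pow_le (a / 2) hM hn,
    eventually_mul_pow_le Cs one_pos hn, eventually_mul_pow_le Cu one_pos hn]
    with ε h1 h2 ⟨Λi, h3, h4⟩ h5 h6 h7 h8 h9 h10 P hP
  have hpow : 0 < ε ^ n := pow_pos h2 n
  have htend := hP.tendsto (by linarith) (by nlinarith) (by linarith) (by nlinarith) h3 h4
  refine ⟨Λi, hypDich_of_lyapunov hS hM hb0.le hSM h1 (fun v => ?_) hpow h6 h7 h8 hκ0 ?_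
    (by positivity) ?_ h3 h4 hP.2.1 (fun v => (htend v).1) fun v => (htend v).2⟩
  · have h11 : S v (B ε v) = S v (B₀ v) + S v ((B ε - B₀) v) := by
      rw [← map_add]; simp
    have h12 := (abs_le.1 (hSM v ((B ε - B₀) v))).1
    have h13 : M * ‖v‖ * ‖(B ε - B₀) v‖ ≤ a / 2 * ‖v‖ ^ 2 :=
      calc _ ≤ M * ‖v‖ * (‖B ε - B₀‖ * ‖v‖) := by gcongr; exact (B ε - B₀).le_opNorm v
        _ = M * ‖B ε - B₀‖ * ‖v‖ ^ 2 := by ring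
        _ ≤ _ := by gcongr
    rw [h11]
    linarith [hSB v]
  · rw [hκ]
    exact le_of_eq (by field_simp)
  · have h11 : κ * (1 + M / κ) ^ 2 = κ + 2 * M + M ^ 2 / κ := by field_simp; ring
    rw [h11]
    have : 0 ≤ M ^ 2 / κ := by positivity
    linarith

end UniformDichotomy

end PhaseLocking

end

noncomputable section

namespace PhaseLocking

/-! ### Families polynomial in `ε` and their zeros. -/

section ParameterFamilies

variable {Y Z : Type} [NormedAddCommGroup Y] [NormedSpace ℝ Y]
  [NormedAddCommGroup Z] [NormedSpace ℝ Z]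

theorem exists_bc_polynomial {c : ℕ → Y → Z} {m j : ℕ} (hc : ∀ k < m, ∃ K, BC j K (c k)) :
    ∃ K, 0 ≤ K ∧ ∀ ε ∈ Icc (0:ℝ) 1, BC j K fun y => ∑ k ∈ Finset.range m, ε ^ k • c k y := by
  choose! K hK using hc
  refine ⟨∑ k ∈ Finset.range m, K k,
    Finset.sum_nonneg fun k hk => (hK k (Finset.mem_range.1 hk)).nonneg, fun ε hε => ?_⟩
  refine BC.sum _ fun k hk => ((hK k (Finset.mem_range.1 hk)).smul (ε ^ k)).mono ?_
  have h := (hK k (Finset.mem_range.1 hk)).nonneg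
  rw [abs_of_nonneg (pow_nonneg hε.1 k)]
  exact mul_le_of_le_one_left h (pow_le_one₀ hε.1 hε.2)

theorem contDiff_polynomial {c : ℕ → Y → Z} {m : ℕ} {j : WithTop ℕ∞}
    (hc : ∀ k < m, ContDiff ℝ j (c k)) :
    ContDiff ℝ j fun z : ℝ × Y => ∑ k ∈ Finset.range m, z.1 ^ k • c k z.2 :=
  ContDiff.sum fun k hk =>
    (contDiff_fst.pow k).smul ((hc k (Finset.mem_range.1 hk)).comp contDiff_snd)

theorem fderiv_slice {E : ℝ × Y → Z} (hE : ContDiff ℝ 1 E) (ε : ℝ) (y : Y) :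
    fderiv ℝ (fun y => E (ε, y)) y = (fderiv ℝ E (ε, y)).comp (ContinuousLinearMap.inr ℝ ℝ Y) := by
  have h1 : HasFDerivAt E (fderiv ℝ E (ε, y)) (ε, y) :=
    (hE.differentiable one_ne_zero _).hasFDerivAt
  exact (h1.comp y (hasFDerivAt_prodMk_right ε y)).fderiv

/-- A nondegenerate zero persists along a smooth family. -/
theorem exists_zero_family [CompleteSpace Y] {E : ℝ × Y → Y} (hE : ContDiff ℝ 1 E) {y₀ : Y}
    (h0 : E (0, y₀) = 0) (hu : IsUnit (fderiv ℝ (fun y => E (0, y)) y₀)) :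
    ∃ ψ : ℝ → Y, (∃ C, ∀ᶠ ε in 𝓝 0, ‖ψ ε - y₀‖ ≤ C * ‖ε‖) ∧ (∀ᶠ ε in 𝓝 0, E (ε, ψ ε) = 0) ∧
      Tendsto ψ (𝓝 0) (𝓝 y₀) ∧
      Tendsto (fun ε => fderiv ℝ (fun y => E (ε, y)) (ψ ε)) (𝓝 0)
        (𝓝 (fderiv ℝ (fun y => E (0, y)) y₀)) := by
  have hd : ContDiffAt ℝ 1 E (0, y₀) := hE.contDiffAt
  have hinv : (fderiv ℝ E (0, y₀) ∘L .inr ℝ ℝ Y).IsInvertible := by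
    rw [← fderiv_slice hE]
    obtain ⟨u, hu⟩ := hu
    exact ⟨ContinuousLinearEquiv.unitsEquiv ℝ Y u, by rw [← hu]; rfl⟩
  set ψ := hd.implicitFunction one_ne_zero hinv
  have hψ0 : ψ 0 = y₀ := hd.implicitFunction_apply_self one_ne_zero hinv
  have hψd := (hd.hasStrictFDerivAt_implicitFunction one_ne_zero hinv).hasFDerivAt
  have hψt : Tendsto ψ (𝓝 0) (𝓝 y₀) := hψ0 ▸ hψd.continuousAt.tendsto
  refine ⟨ψ, ?_, ?_, hψt, ?_⟩
  -- Differentiability of the implicit function at zero gives the linear bound on the displacement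
  -- of the zero.
  · obtain ⟨C, hC⟩ := hψd.isBigO_sub.bound
    refine ⟨C, hC.mono fun ε h => ?_⟩
    have h' : ‖ψ ε - ψ 0‖ ≤ C * ‖ε - 0‖ := h
    rwa [hψ0, sub_zero] at h'
  · simpa only [h0] using hd.eventually_apply_implicitFunction one_ne_zero hinv
  · simp only [fderiv_slice hE]
    have hc : Continuous fun z : ℝ × Y =>
        (fderiv ℝ E z).comp (ContinuousLinearMap.inr ℝ ℝ Y) :=
      (hE.continuous_fderiv one_ne_zero).clm_comp continuous_const
    exact (hc.tendsto (0, y₀)).comp (tendsto_id.prodMk_nhds hψt)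

/-- `ε = ε ^ (1 - α) * ε ^ α`, and the first factor tends to zero. -/
theorem eventually_mul_le_rpow (C : ℝ) {c α : ℝ} (hc : 0 < c) (hα : α < 1) :
    ∀ᶠ ε in 𝓝[>] (0 : ℝ), C * ε ≤ c * ε ^ α := by
  have h1 : Tendsto (fun ε : ℝ => C * ε ^ (1 - α)) (𝓝[>] 0) (𝓝 (C * 0 ^ (1 - α))) :=
    (tendsto_nhdsWithin_of_tendsto_nhds
      (Real.continuousAt_rpow_const 0 (1 - α) (Or.inr (by linarith))).tendsto).const_mul C
  rw [Real.zero_rpow (by linarith), mul_zero] at h1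
  filter_upwards [h1.eventually (ge_mem_nhds hc), self_mem_nhdsWithin] with ε h hε
  have hε0 : (0:ℝ) < ε := hε
  calc C * ε = C * ε ^ (1 - α) * ε ^ α := by
        rw [mul_assoc, ← Real.rpow_add hε0, sub_add_cancel, Real.rpow_one]
    _ ≤ c * ε ^ α := by gcongr

end ParameterFamilies

/-! ### Regularity of the averaged field. -/

section AveragedField

variable {r s k n m : ℕ} {f : ℝ → (Fin (r + s) → ℝ) → Fin (r + s) → ℝ} {Ω₀ : Fin (r + s) → ℝ}
  {A : Matrix.SpecialLinearGroup (Fin (r + s)) ℤ}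

/-- The coefficients of the averaged vector field. -/
def averagedCoefficient (f : ℝ → (Fin (r + s) → ℝ) → Fin (r + s) → ℝ) (Ω₀ : Fin (r + s) → ℝ)
    (A : Matrix.SpecialLinearGroup (Fin (r + s)) ℤ) (n i : ℕ) (x₂ : Fin s → ℝ) :
    Fin (r + s) → ℝ :=
  slAct A (averagedTerm f Ω₀ (n + i) (slAct A⁻¹ (Fin.append (0 : Fin r → ℝ) x₂)))

theorem exists_bc_averagedCoefficient (hn : 1 ≤ n)
    (hg : ∀ i < n + m - 1, ∀ a, WA k fun x => averagedTerm f Ω₀ (i + 1) x a) :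
    ∀ i < m, ∃ K, BC k K (averagedCoefficient f Ω₀ A n i) := fun i hi => by
  obtain ⟨K, hK⟩ := exists_bc_of_forall_wa (k := k) le_rfl (hg (n + i - 1) (by omega))
  rw [show n + i - 1 + 1 = n + i by omega] at hK
  exact ⟨_, BC.clm_comp (slActL A) (hK.comp (DB.clm (((slActL A⁻¹).comp
    (appendL (r := r) (s := s))).comp (ContinuousLinearMap.inr ℝ (Fin r → ℝ) (Fin s → ℝ)))))⟩

theorem exists_bc_averagedField (hn : 1 ≤ n)
    (hg : ∀ i < n + m - 1, ∀ a, WA k fun x => averagedTerm f Ω₀ (i + 1) x a) :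
    ∃ K, 0 ≤ K ∧ ∀ ε ∈ Icc (0:ℝ) 1, BC k K fun y => averagedField f Ω₀ A n m y ε :=
  exists_bc_polynomial (exists_bc_averagedCoefficient hn hg)

theorem contDiff_eta (hn : 1 ≤ n)
    (hg : ∀ i < n + m - 1, ∀ a, WA k fun x => averagedTerm f Ω₀ (i + 1) x a) :
    ContDiff ℝ k fun z : ℝ × (Fin s → ℝ) => eta f Ω₀ A n m z.2 z.1 :=
  (sndL (r := r) (s := s)).contDiff.comp (contDiff_polynomial fun i hi =>
    (exists_bc_averagedCoefficient hn hg i hi).choose_spec.contDiff)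

theorem exists_bc_theta_eta (hn : 1 ≤ n)
    (hg : ∀ i < n + m - 1, ∀ a, WA k fun x => averagedTerm f Ω₀ (i + 1) x a) :
    ∃ K, 0 ≤ K ∧ ∀ ε ∈ Icc (0:ℝ) 1, BC k K (fun y => theta f Ω₀ A n m y ε) ∧
      BC k K (fun y => eta f Ω₀ A n m y ε) := by
  obtain ⟨K, hK0, hK⟩ := exists_bc_averagedField (A := A) hn hg
  refine ⟨(‖fstL (r := r) (s := s)‖ + ‖sndL (r := r) (s := s)‖) * K, by positivity, fun ε hε =>
    ⟨((hK ε hε).clm_comp fstL).mono ?_, ((hK ε hε).clm_comp sndL).mono ?_⟩⟩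
  · gcongr; exact le_add_of_nonneg_right (norm_nonneg _)
  · gcongr; exact le_add_of_nonneg_left (norm_nonneg _)

end AveragedField

end PhaseLocking

end

noncomputable section

namespace PhaseLocking

/-! ### Invariant graphs near a zero of the averaged field. -/

section InvariantGraph

variable {X Y Z : Type} [NormedAddCommGroup X] [NormedSpace ℝ X] [NormedAddCommGroup Y]
  [NormedSpace ℝ Y] [NormedAddCommGroup Z] [NormedSpace ℝ Z] {k : ℕ} {K κ δ : ℝ}

theorem BC.comp_add_right {g : X → Z} (h : BC k K g) (a : X) : BC k K fun x => g (x + a) := by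
  refine ⟨h.contDiff.comp (contDiff_id.add contDiff_const), fun j hj x => ?_⟩
  rw [iteratedFDeriv_comp_add_right]
  exact h.bound j hj _

/-- The zero is moved to the origin and the linear part split off, so that the remaining
nonlinearity vanishes to second order. The bound `K + K` arises because its derivative is a
difference of two derivatives of `η`. -/
theorem graphData_of_bc {θ : Y → X} {η : Y → Y} {R₁ : X × Y → X} {R₂ : X × Y → Y}
    (hθ : BC (k + 2) K θ) (hη : BC (k + 2) K η) (hR₁ : BC (k + 1) κ R₁) (hR₂ : BC (k + 1) κ R₂)
    {y₀ : Y} (h0 : η y₀ = 0) :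
    GraphData k (K + K) κ (fun v => θ (v + y₀)) (fun v => η (v + y₀) - fderiv ℝ η y₀ v)
      (fun z => R₁ (z + (0, y₀))) (fun z => R₂ (z + (0, y₀))) := by
  have hK := hθ.nonneg
  obtain ⟨hd, hb⟩ := db_succ_iff.1 hη.db
  have hfd (v : Y) : HasFDerivAt (fun v => η (v + y₀) - fderiv ℝ η y₀ v)
      (fderiv ℝ η (v + y₀) - fderiv ℝ η y₀) v :=
    ((hasFDerivAt_comp_add_right y₀).2 (hd (v + y₀)).hasFDerivAt).sub (fderiv ℝ η y₀).hasFDerivAt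
  refine ⟨((hθ.comp_add_right y₀).db.of_le (by omega)).mono (by linarith),
    fun v => (hfd v).differentiableAt, by simp [h0], by rw [(hfd 0).fderiv]; simp, ?_,
    hR₁.comp_add_right _, hR₂.comp_add_right _⟩
  rw [funext fun v => (hfd v).fderiv]
  exact (hb.comp_add_right y₀).sub ((BC.const _).mono (hb.norm_le y₀))

/-- Normally hyperbolic invariant graph over the torus near a zero of `η`. -/
theorem exists_invariant_graph [FiniteDimensional ℝ X] [FiniteDimensional ℝ Y]
    {θ : Y → X} {η : Y → Y} {R₁ : X × Y → X} {R₂ : X × Y → Y}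
    (hθ : BC (k + 2) K θ) (hη : BC (k + 2) K η) (hR₁ : BC (k + 1) κ R₁) (hR₂ : BC (k + 1) κ R₂)
    {y₀ : Y} (h0 : η y₀ = 0) {Λi P : Y →L[ℝ] Y} {K' c e : ℝ} (hc : 0 < c) (he : 0 < e)
    (hce : c * e ≤ 1) (he1 : e ≤ 1) (hΛ : HypDich (1 + e • fderiv ℝ η y₀) Λi P K' (c * e))
    (hδ0 : 0 ≤ δ) (hδ : δ ≤ 1)
    (h1 : 2 ^ (k + 2) * ((1 + nearConst (k + 1)) * (graphConst k (K + K) * (δ + κ))) ≤ 1)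
    (h2 : nearConst (k + 1) * (2 * (1 + nearConst (k + 1)) * (graphConst k (K + K) * (δ + κ)))
      ≤ c / 2)
    (h3 : 8 * K' / c * (2 * graphConst k (K + K) * (δ ^ 2 + κ)) ≤ δ)
    (h4 : 2 * K' / c * ((K + K) * δ + κ + δ * ((K + K) + κ)) ≤ 1 / 2)
    (h5 : (K + K) * δ + 2 * κ < 1) (ω : X) :
    ∃ w : X → Y, ContDiff ℝ k w ∧ (∀ x, ‖w x - y₀‖ ≤ δ) ∧
      (∀ t : X, (∀ x v, R₁ (x + t, v) = R₁ (x, v)) → (∀ x v, R₂ (x + t, v) = R₂ (x, v)) →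
        ∀ x, w (x + t) = w x) ∧
      Function.Bijective (fun x => x + (ω + e • (θ (w x) + R₁ (x, w x)))) ∧
      ∀ x, w (x + (ω + e • (θ (w x) + R₁ (x, w x)))) =
        w x + e • (η (w x) + R₂ (x, w x)) := by
  obtain ⟨y, hy1, hy2, hy3, hy4, hy5⟩ := (graphData_of_bc hθ hη hR₁ hR₂ h0).exists_invariant hc he
    hce he1 hΛ hδ0 hδ h1 h2 h3 h4 h5 ω
  simp only [Prod.mk_add_mk, add_zero] at hy3 hy4 hy5
  refine ⟨fun x => y x + y₀, hy1.add contDiff_const, fun x => by simpa using hy2 x,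
    fun t ht1 ht2 x => by
      beta_reduce
      rw [hy3 t (fun x v => ht1 x _) (fun x v => ht2 x _)], hy4, fun x => ?_⟩
  beta_reduce
  rw [hy5]
  simp only [add_apply, one_apply_eq_self, smul_apply]
  module

/-- The smallness conditions of the graph transform hold for small parameters. -/
theorem eventually_small (k : ℕ) (K K' C' : ℝ) {c α : ℝ} (hc : 0 < c) (hα₀ : 0 < α)
    (hα₁ : α < 1) : ∀ᶠ ε in 𝓝[>] (0:ℝ),
    2 ^ (k + 2) * ((1 + nearConst (k + 1)) * (graphConst k K * (ε ^ α + C' * ε))) ≤ 1 ∧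
    nearConst (k + 1) * (2 * (1 + nearConst (k + 1)) * (graphConst k K * (ε ^ α + C' * ε)))
      ≤ c / 2 ∧
    8 * K' / c * (2 * graphConst k K * ((ε ^ α) ^ 2 + C' * ε)) ≤ ε ^ α ∧
    2 * K' / c * (K * ε ^ α + C' * ε + ε ^ α * (K + C' * ε)) ≤ 1 / 2 ∧
    K * ε ^ α + 2 * (C' * ε) < 1 := by
  have hid : Tendsto (fun ε : ℝ => ε) (𝓝[>] 0) (𝓝 0) := tendsto_nhdsWithin_of_tendsto_nhds tendsto_id
  have hpow : Tendsto (fun ε : ℝ => ε ^ α) (𝓝[>] 0) (𝓝 0) := by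
    have := (Real.continuousAt_rpow_const 0 α (Or.inr hα₀.le)).tendsto
    rw [Real.zero_rpow hα₀.ne'] at this
    exact tendsto_nhdsWithin_of_tendsto_nhds this
  have key (g : ℝ × ℝ → ℝ) (hg : Continuous g) (hg0 : g (0, 0) = 0) {a : ℝ} (ha : 0 < a) :
      ∀ᶠ ε in 𝓝[>] (0:ℝ), g (ε ^ α, ε) < a := by
    have := (hg.tendsto (0, 0)).comp (hpow.prodMk_nhds hid)
    rw [hg0] at this
    exact this.eventually_lt_const ha
  -- The third condition is the only one whose right-hand side tends to zero: `D ε^(2α)` is small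
  -- against `ε ^ α` as `α > 0`, and `D C' ε` is so as `α < 1`.
  set D := 8 * K' / c * (2 * graphConst k K)
  filter_upwards [
    key (fun z => 2 ^ (k + 2) * ((1 + nearConst (k + 1)) * (graphConst k K * (z.1 + C' * z.2))))
      (by fun_prop) (by simp) one_pos,
    key (fun z => nearConst (k + 1) * (2 * (1 + nearConst (k + 1)) *
      (graphConst k K * (z.1 + C' * z.2)))) (by fun_prop) (by simp) (half_pos hc),
    key (fun z => D * z.1) (by fun_prop) (by simp) one_half_pos,
    eventually_mul_le_rpow (D * C') one_half_pos hα₁,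
    key (fun z => 2 * K' / c * (K * z.1 + C' * z.2 + z.1 * (K + C' * z.2))) (by fun_prop) (by simp)
      one_half_pos,
    key (fun z => K * z.1 + 2 * (C' * z.2)) (by fun_prop) (by simp) one_pos,
    self_mem_nhdsWithin] with ε a1 a2 a3 a4 a5 a6 a7
  refine ⟨a1.le, a2.le, ?_, a5.le, a6⟩
  have hp : 0 ≤ ε ^ α := Real.rpow_nonneg (le_of_lt a7) α
  calc _ = D * ε ^ α * ε ^ α + D * C' * ε := by ring
    _ ≤ 1 / 2 * ε ^ α + 1 / 2 * ε ^ α := by gcongr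
    _ = _ := by ring

end InvariantGraph

end PhaseLocking

end

noncomputable section

namespace PhaseLocking

/-! ### From an invariant graph to an invariant torus. -/

section InvariantTorus

variable {r s k : ℕ} {Φ : (Fin (r + s) → ℝ) → Fin (r + s) → ℝ} {w : (Fin r → ℝ) → Fin s → ℝ}

/-- On an invariant graph `Φ₂(v, w(v)) = w(𝒫(v))`, so the stable component is `P w`; in the unstable
one the bracket reduces to `Λ w`, which `Λ⁻¹` undoes. -/
theorem graphTransform_eq_self {Λ Λi P : (Fin s → ℝ) →L[ℝ] (Fin s → ℝ)} (h1 : Λ * Λi = 1)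
    (h2 : Λi * Λ = 1) (hb : Function.Bijective (baseMap Φ w))
    (hw : ∀ x, w (baseMap Φ w x) = fibreMap Φ w x) : graphTransform Φ Λ P w = w := by
  have hinv (v : Fin s → ℝ) : Λ.inverse (Λ v) = v := by
    let u : ((Fin s → ℝ) →L[ℝ] (Fin s → ℝ))ˣ := ⟨Λ, Λi, h1, h2⟩
    have hu : Λ = (ContinuousLinearEquiv.unitsEquiv ℝ _ u : (Fin s → ℝ) ≃L[ℝ] (Fin s → ℝ)) := rfl
    rw [hu, ContinuousLinearMap.inverse_equiv]
    exact ContinuousLinearEquiv.symm_apply_apply _ v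
  ext1 x
  rw [graphTransform, ← hw, ← hw, Function.rightInverse_invFun hb.2, sub_sub_cancel, hinv]
  simp

variable {A : Matrix.SpecialLinearGroup (Fin (r + s)) ℤ} {l : Fin (r + s) → ℤ}
  {H F : (Fin (r + s) → ℝ) → Fin (r + s) → ℝ}

theorem slAct_inv_append_injective {m : Fin (r + s) → ℤ} {θ θ' : Fin r → ℝ} {v v' : Fin s → ℝ}
    (h : slAct A⁻¹ (Fin.append θ v) = slAct A⁻¹ (Fin.append θ' v') + intVec m) :
    ∃ a, θ = θ' + intVec a := by
  have h1 := congrArg (fun y => fstPart (slAct A y)) h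
  simp only [slAct_add, slAct_slAct_inv, slAct_intVec, fstPart_append] at h1
  refine ⟨fun i => ((A : Matrix (Fin (r + s)) (Fin (r + s)) ℤ).mulVec m) (Fin.castAdd s i), ?_⟩
  rw [h1]
  ext i
  simp [fstPart, intVec]

/-- The image of an invariant graph of the normal form is an invariant torus. -/
theorem isInvariantTorus_of_graph (hH : Function.Bijective H) (hHk : ContDiff ℝ k H)
    (hHi : Differentiable ℝ (Function.invFun H))
    (hHm : ∀ x m, H (x + intVec m) = H x + intVec m)
    (hF : ∀ x m, F (x + intVec m) = F x + intVec m) (hw : Periodic w) (hwk : ContDiff ℝ k w)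
    {p : (Fin r → ℝ) → Fin r → ℝ} (hp : Function.Surjective p)
    (hinv : ∀ x, slAct A (Function.invFun H (F (H (slAct A⁻¹ (Fin.append x (w x)))))) - intVec l =
      Fin.append (p x) (w (p x))) :
    IsInvariantTorus k F fun x => H (slAct A⁻¹ (Fin.append x (w x))) := by
  set κ : (Fin r → ℝ) → Fin (r + s) → ℝ := fun x => H (slAct A⁻¹ (Fin.append x (w x))) with hκ
  set j : (Fin r → ℝ) × (Fin s → ℝ) →L[ℝ] (Fin (r + s) → ℝ) := (slActL A⁻¹).comp appendL with hj
  have hκk : ContDiff ℝ k κ := hHk.comp (j.contDiff.comp (contDiff_id.prodMk hwk))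
  have hκp (x : Fin r → ℝ) (a : Fin r → ℤ) : ∃ m, κ (x + intVec a) = κ x + intVec m := by
    have h1 : Fin.append (x + intVec a) (w (x + intVec a)) =
        Fin.append x (w x) + intVec (Fin.append a 0) := by
      rw [hw x a, ← append_intVec, ← append_add, add_zero]
    exact ⟨_, by simp only [hκ]; rw [h1, slAct_add, slAct_intVec, hHm]⟩
  have hκF (x : Fin r → ℝ) : ∃ m, F (κ x) = κ (p x) + intVec m := by
    have h1 := hinv x
    rw [sub_eq_iff_eq_add] at h1
    have h2 := congrArg (fun y => H (slAct A⁻¹ y)) h1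
    simp only [slAct_inv_slAct, slAct_add, slAct_intVec, hHm] at h2
    rw [Function.rightInverse_invFun hH.2] at h2
    exact ⟨_, h2⟩
  refine ⟨hκk, fun θ θ' => ?_, fun hk θ => ?_, ?_⟩
  · rw [toTorus_eq_iff, toTorus_eq_iff]
    constructor
    · rintro ⟨m, hm⟩
      simp only [hκ] at hm
      rw [← hHm] at hm
      exact slAct_inv_append_injective (hH.1 hm)
    · rintro ⟨a, rfl⟩
      exact hκp θ' a
  -- `g` recovers the base point from a point of the torus; a differentiable left inverse makes `κ`
  -- an immersion.
  · set g : (Fin (r + s) → ℝ) → Fin r → ℝ :=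
      fun y => (fstL.comp (slActL A)) (Function.invFun H y) with hg
    have hgd : Differentiable ℝ g := ((fstL.comp (slActL A)).differentiable).comp hHi
    have hgκ : g ∘ κ = id := by
      ext1 x
      change fstPart (slAct A (Function.invFun H (H (slAct A⁻¹ (Fin.append x (w x)))))) = x
      rw [Function.leftInverse_invFun hH.1, slAct_slAct_inv, fstPart_append]
    have hκd : DifferentiableAt ℝ κ θ :=
      (hκk.differentiable (by exact_mod_cast (by omega : k ≠ 0))) θ
    have h1 := fderiv_comp θ (hgd (κ θ)) hκd
    rw [hgκ, fderiv_id] at h1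
    intro v v' hv
    have h2 := DFunLike.congr_fun h1 v
    have h3 := DFunLike.congr_fun h1 v'
    simp only [ContinuousLinearMap.comp_apply, ContinuousLinearMap.id_apply] at h2 h3
    rw [h2, h3, hv]
  · ext y
    constructor
    · rintro ⟨x, ⟨θ, hθ⟩, rfl⟩
      obtain ⟨m, hm⟩ := toTorus_eq_iff.1 hθ.symm
      obtain ⟨m', hm'⟩ := hκF θ
      refine ⟨p θ, (toTorus_eq_iff.2 ⟨m' + m, ?_⟩).symm⟩
      rw [hm, hF, hm', add_assoc]
      congr 1
      ext i
      simp [intVec]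
    · rintro ⟨θ, rfl⟩
      obtain ⟨θ', rfl⟩ := hp θ
      exact ⟨κ θ', ⟨θ', rfl⟩, toTorus_eq_iff.2 (hκF θ')⟩

end InvariantTorus

end PhaseLocking

end

noncomputable section

namespace PhaseLocking

/-! ### The total loss of regularity. -/

section Regularity

variable {r s n m q L : ℕ} {f : ℝ → (Fin (r + s) → ℝ) → Fin (r + s) → ℝ} {Ω₀ : Fin (r + s) → ℝ}
  {τ ε₁ : ℝ} {p : WithTop ℕ∞}

/-- This holds also for `p = ∞` and `p = ω`; the strict inequality in the regularity assumption thus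
provides one derivative beyond `L + 2 + q`. -/
theorem natCast_succ_le {a : ℕ} (h : (a : WithTop ℕ∞) < p) : ((a + 1 : ℕ) : WithTop ℕ∞) ≤ p := by
  induction p using WithTop.recTopCoe with
  | top => exact le_top
  | coe p =>
    have h' : ((a : ℕ∞) : WithTop ℕ∞) < p := h
    have h1 : (a : ℕ∞) < p := WithTop.coe_lt_coe.1 h'
    have h2 : ((a + 1 : ℕ) : ℕ∞) ≤ p := by
      push_cast
      exact Order.add_one_le_of_lt h1
    exact WithTop.coe_le_coe.2 h2

/-- The regularity of the averaging procedure. -/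
theorem averaging_regularity (hs : 0 < s) (hτ : 0 < τ) (hΩ₀ : SmallDivisors τ Ω₀)
    (hn : 1 ≤ n) (hm : 1 ≤ m) (hL : 1 ≤ L)
    (hq : ((n + m - 1 : ℕ) : ℝ) * (((r + s : ℕ) : ℝ) + τ) ≤ (q : ℝ))
    (hp : ((L + 2 + q : ℕ) : WithTop ℕ∞) < p) (hε₁ : 0 < ε₁)
    (hper : ∀ ε ∈ Ico (0 : ℝ) ε₁, Periodic (f ε)) (hf : MixedRegularity p (n + m) ε₁ f) :
    (∀ i < n + m - 1, ∀ a, WA (L + 2) fun x => averagedTerm f Ω₀ (i + 1) x a) ∧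
    (∀ i < n + m - 1, ∀ a, WA (L + 2) fun x => conjugacyTerm f Ω₀ i x a) ∧
    ∃ b > 0, ∃ K, 0 ≤ K ∧ ∀ ε ∈ Ico (0:ℝ) b,
      BC L (K * ε ^ (n + m - 1 + 1)) (averagingError f Ω₀ (n + m - 1) ε) := by
  set N := n + m - 1 with hN
  -- The family is `C^(L+3+q)`; the passage to Fourier coefficients costs more than `d`, for which
  -- `1 / 2` leaves room.
  set S : ℝ := ((L + 2 + q + 1 : ℕ) : ℝ) - ((r + s : ℕ) : ℝ) - 1 / 2 with hS
  have hN1 : (1:ℝ) ≤ N := by exact_mod_cast (by omega : 1 ≤ N)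
  have hd1 : (1:ℝ) ≤ ((r + s : ℕ) : ℝ) := by exact_mod_cast (by omega : 1 ≤ r + s)
  -- `N` steps cost `N (τ + 1)`. As `N ≥ 1` and `d ≥ 1`, the allowance `q ≥ N (d + τ)` covers this
  -- and all but one unit of the single loss of `d`.
  have hSN : (L:ℝ) + 3 / 2 ≤ S - N * (τ + 1) := by
    rw [hS]
    push_cast at hq hd1 ⊢
    nlinarith
  have hNτ : 0 ≤ N * (τ + 1) := by positivity
  have hmono : ∀ i ≤ N, (i : ℝ) * (τ + 1) ≤ N * (τ + 1) := fun i hi => by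
    have : (i : ℝ) ≤ N := by exact_mod_cast hi
    gcongr
  have hL0 : (0:ℝ) ≤ L := Nat.cast_nonneg L
  have hexp : ∀ i, Expands L S N fun ε x => f ε x i := fun i =>
    (expands_of_mixedRegularity hε₁ hper hf (natCast_succ_le hp) (by linarith)
      (by rw [hS]; linarith) (by omega) i).mono (by linarith) (by omega)
  have hstep := averagingStep hτ hΩ₀ hexp hL (by linarith) le_rfl
  refine ⟨fun i hi a => (hstep.averagedTerm i hi a).mono ?_,
    fun i hi a => (hstep.conjugacyTerm i hi a).mono ?_,
    bc_averagingError hτ hΩ₀ hexp hL (by linarith)⟩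
  · have := hmono (i + 1) hi
    push_cast at this
    linarith
  · have := hmono (i + 1) hi
    push_cast at this
    linarith

end Regularity

end PhaseLocking

end

/-! ### Assembly of normal form, dichotomy and invariant graph. -/

open PhaseLocking in
theorem theoremA2 (r s : ℕ) (hs : 0 < s)
    -- the resonant frequency and its Diophantine intrinsic frequency
    (Ω₀ : Fin (r + s) → ℝ) (A : Matrix.SpecialLinearGroup (Fin (r + s)) ℤ)
    (ω : Fin r → ℝ) (l : Fin (r + s) → ℤ)
    (hΩ₀ : slAct A Ω₀ = Fin.append ω (0 : Fin s → ℝ) + intVec l)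
    (ν τ : ℝ) (hν : 0 < ν) (hτ : 0 < τ) (hω : Diophantine ν τ ω)
    -- the family of torus maps and its regularity
    (n m q L : ℕ) (hm : 1 ≤ m) (hL : 1 ≤ L) (p : WithTop ℕ∞)
    (hq : ((n + m - 1 : ℕ) : ℝ) * (((r + s : ℕ) : ℝ) + τ) ≤ (q : ℝ))
    (hp : ((L + 2 + q : ℕ) : WithTop ℕ∞) < p)
    (f : ℝ → (Fin (r + s) → ℝ) → (Fin (r + s) → ℝ)) (ε₁ : ℝ) (hε₁ : 0 < ε₁)
    (hper : ∀ ε ∈ Set.Ico (0 : ℝ) ε₁, Periodic (f ε))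
    (hf : MixedRegularity p (n + m) ε₁ f)
    (hn : IsLeadingOrder f Ω₀ n)
    -- a nondegenerate zero of `η(·, 0)`
    (xstar : Fin s → ℝ) (hzero : eta f Ω₀ A n m xstar 0 = 0)
    (hnondeg : IsUnit (etaDeriv f Ω₀ A n m xstar 0))
    -- hyperbolicity at the zeros of `η(·, ε)` near `xstar`, for small `ε > 0`
    (Cs Cu : ℝ) (hCs : 0 < Cs) (hCu : 0 < Cu)
    (hhyp : ∃ ρ > 0, ∀ᶠ ε in 𝓝[>] (0 : ℝ), ∀ x₂ ∈ Metric.ball xstar ρ,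
      eta f Ω₀ A n m x₂ ε = 0 →
        SpectrumOffUnitCircle (1 + ε ^ n • etaDeriv f Ω₀ A n m x₂ ε) ∧
        ∃ P, AdaptedSplitting (1 + ε ^ n • etaDeriv f Ω₀ A n m x₂ ε) P
          (1 - Cs * ε ^ n) (1 - Cu * ε ^ n))
    (C : ℝ) (α : ℝ) (hα₀ : 0 < α) (hα₁ : α < 1) :
    ∃ ε₀ > 0, ε₀ ≤ ε₁ ∧ ∀ ε, 0 < ε → ε < ε₀ →
      Function.Bijective (conjugacy f Ω₀ (n + m - 1) ε) ∧
      ∃ xε : Fin s → ℝ, eta f Ω₀ A n m xε ε = 0 ∧ ‖xε - xstar‖ ≤ ε ^ α ∧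
      ∃ P, AdaptedSplitting (1 + ε ^ n • etaDeriv f Ω₀ A n m xε ε) P
          (1 - Cs * ε ^ n) (1 - Cu * ε ^ n) ∧
      ∀ Ω : Fin (r + s) → ℝ, ‖Ω - Ω₀‖ ≤ C * ε ^ (n + 1) →
        ∃ w : (Fin r → ℝ) → (Fin s → ℝ),
          Periodic w ∧ ContDiff ℝ ((L - 1 : ℕ) : WithTop ℕ∞) w ∧
          (∀ x₁, ‖w x₁ - xε‖ ≤ ε ^ α) ∧
          Function.Bijective (baseMap (normalFormMap f Ω₀ A l (n + m - 1) Ω ε) w) ∧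
          graphTransform (normalFormMap f Ω₀ A l (n + m - 1) Ω ε)
            (1 + ε ^ n • etaDeriv f Ω₀ A n m xε ε) P w = w ∧
          IsInvariantTorus (L - 1) (family f Ω ε)
            (fun x₁ => conjugacy f Ω₀ (n + m - 1) ε (slAct A⁻¹ (Fin.append x₁ (w x₁)))) := by
  -- The iteration runs in `C^(k+1) = C^L` and its limit is `C^k`.
  obtain ⟨k, rfl⟩ : ∃ k, L = k + 1 := ⟨L - 1, by omega⟩
  rw [Nat.add_sub_cancel]
  have hn1 := hn.1
  obtain ⟨hg, hh, herr⟩ := averaging_regularity hs hτ (smallDivisors_of_diophantine hΩ₀ hν hτ hω)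
    hn1 hm hL hq hp hε₁ hper hf
  obtain ⟨C', hC', hNF⟩ := exists_normalForm hΩ₀ hν hω hn hm hε₁ hper hg hh herr C
  have hg' : ∀ i < n + m - 1, ∀ a, WA ((k + 2 : ℕ) : ℝ) fun x => averagedTerm f Ω₀ (i + 1) x a :=
    fun i hi a => (hg i hi a).mono (by push_cast; linarith)
  obtain ⟨K, hK0, hK⟩ := exists_bc_theta_eta (A := A) hn1 hg'
  obtain ⟨ψ, ⟨Cψ, hψC⟩, hψ0, hψt, hψD⟩ := exists_zero_family
    (E := fun z : ℝ × (Fin s → ℝ) => eta f Ω₀ A n m z.2 z.1)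
    ((contDiff_eta hn1 hg').of_le (by exact_mod_cast (by omega : 1 ≤ k + 2))) hzero hnondeg
  have hsub : 𝓝[>] (0:ℝ) ≤ 𝓝 0 := nhdsWithin_le_nhds
  have hsplit : ∀ᶠ ε in 𝓝[>] (0:ℝ), ∃ P,
      AdaptedSplitting (1 + ε ^ n • etaDeriv f Ω₀ A n m (ψ ε) ε) P
        (1 - Cs * ε ^ n) (1 - Cu * ε ^ n) := by
    obtain ⟨ρ, hρ, h⟩ := hhyp
    filter_upwards [h, hsub hψ0, hsub (hψt (Metric.ball_mem_nhds xstar hρ))] with ε h1 h2 h3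
    exact (h1 (ψ ε) h3 h2).2
  -- `K'` and `c` have to be fixed before the smallness conditions of the iteration can be imposed.
  obtain ⟨K', c, hc, hdich⟩ := exists_uniform_hypDich (B := fun ε => etaDeriv f Ω₀ A n m (ψ ε) ε)
    (hψD.mono_left hsub) hn1 hCs hCu hsplit
  have hclose : ∀ᶠ ε in 𝓝[>] (0:ℝ), ‖ψ ε - xstar‖ ≤ ε ^ α := by
    filter_upwards [hsub hψC, eventually_mul_le_rpow Cψ one_pos hα₁, self_mem_nhdsWithin]
      with ε h1 h2 h3
    rw [Real.norm_of_nonneg (le_of_lt h3)] at h1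
    linarith
  -- All requirements hold for small `ε > 0` with constants independent of `Ω`, which allows `ε₀` to
  -- be chosen before `Ω`.
  have hall := (((hNF.and (hsub hψ0)).and (hsplit.and hdich)).and (hclose.and
    (eventually_small k (K + K) K' C' hc hα₀ hα₁))).and
    ((eventually_mul_pow_le c one_pos hn1).and (eventually_mem_Ioo one_pos))
  obtain ⟨u, hu, hsubset⟩ := mem_nhdsGT_iff_exists_Ioo_subset.1 hall
  refine ⟨min u ε₁, lt_min hu hε₁, min_le_right _ _, fun ε hε hεu => ?_⟩
  obtain ⟨⟨⟨⟨⟨hbij, -, hHi, hHk, hHm, hN⟩, hz⟩, ⟨P, hP⟩, hd⟩, hx, h1, h2, h3, h4, h5⟩, hce,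
    hε1⟩ :=
    hsubset ⟨hε, hεu.trans_le (min_le_left _ _)⟩
  have hεε₁ : ε < ε₁ := hεu.trans_le (min_le_right _ _)
  refine ⟨hbij, ψ ε, hz, hx, P, hP, fun Ω hΩ => ?_⟩
  obtain ⟨R₁, R₂, hR₁, hR₂, hR₁p, hR₂p, hΦ⟩ := hN Ω hΩ
  obtain ⟨Λi, hΛ⟩ := hd P hP
  obtain ⟨hθ, hη⟩ := hK ε ⟨hε.le, hε1.2.le⟩
  -- Here `e = ε ^ n`, `δ = ε ^ α` and `κ = C' * ε`.
  obtain ⟨w, hwk, hwδ, hwp, hwb, hwi⟩ := exists_invariant_graph hθ hη hR₁ hR₂ hz hc (pow_pos hε n)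
    hce (pow_le_one₀ hε.le hε1.2.le) hΛ (Real.rpow_nonneg hε.le α)
    (Real.rpow_le_one hε.le hε1.2.le hα₀.le) h1 h2 h3 h4 h5 ω
  have hw : Periodic w := fun x a => hwp (intVec a) (fun x v => hR₁p x v a)
    (fun x v => hR₂p x v a) x
  set Φ := normalFormMap f Ω₀ A l (n + m - 1) Ω ε with hΦdef
  have hbase : baseMap Φ w = fun x => x + (ω + ε ^ n • (theta f Ω₀ A n m (w x) ε + R₁ (x, w x))) :=
    funext fun x => by rw [baseMap, hΦ, fstPart_append]
  have hfib : ∀ x, fibreMap Φ w x = w x + ε ^ n • (eta f Ω₀ A n m (w x) ε + R₂ (x, w x)) :=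
    fun x => by rw [fibreMap, hΦ, sndPart_append]
  have hbb : Function.Bijective (baseMap Φ w) := by rw [hbase]; exact hwb
  have hinv : ∀ x, w (baseMap Φ w x) = fibreMap Φ w x := fun x => by rw [hbase, hfib]; exact hwi x
  refine ⟨w, hw, hwk, hwδ, hbb, graphTransform_eq_self hΛ.mul_inv hΛ.inv_mul hbb hinv,
    isInvariantTorus_of_graph (l := l) hbij (hHk.of_le (by exact_mod_cast Nat.le_succ k)) hHi hHm
      (family_add_intVec (hper ε ⟨hε.le, hεε₁⟩)) hw hwk hbb.2 fun x => ?_⟩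
  rw [hinv]
  exact (append_fstPart_sndPart (Φ (Fin.append x (w x)))).symm
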